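/- **Notation.** Let $k,M\ge 1$ be integers. $\sum^*_{d}$ denotes summation over positive fundamental discriminants $d$ (including $d=1$), $\chi_d=\left(\frac{d}{\cdot}\right)$ is the Kronecker symbol and $L(s,\chi_d)$ its (analytically continued) $L$-function, so that $L(s,\chi_1)=\zeta(s)$. For $\mathrm{Re}(s_j)>1$ and $\mathrm{Re}(w)>1$ put $$A_M(s_1,\dots,s_k;w)=\sideset{}{^*}\sum_{d\ge1}\frac{\chi_d(M)L(s_1,\chi_d)\cdots L(s_k,\chi_d)}{d^w},$$ an absolutely convergent series. For $J\subseteq\{1,\dots,k\}$ put $\sigma_J(w)=w+\sum_{j\in J}s_j-\frac{|J|}2$, and let $s_j^J=1-s_j$ if $j\in J$, $s_j^J=s_j$ if $j\notin J$. Let $\mathcal X(s)=\pi^{s-1/2}\,\Gamma\!\left(\frac{1-s}2\right)/\Gamma\!\left(\frac s2\right)$ and $a(n)=\prod_{p\mid n}\frac p{p+1}$. For $\mathrm{Re}(s_j)>1$ let $$T_M(s_1,\dots,s_k)=\frac1{2\zeta(2)}\sum_{\substack{n_1,\dots,n_k\ge1\\ Mn_1\cdots n_k=\square}}\frac{a(Mn_1\cdots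 n_k)}{n_1^{s_1}\cdots n_k^{s_k}}.$$ For a smooth compactly supported $g:\mathbb R\to\mathbb C$ let $\tilde g(s)=\int_0^\infty g(x)x^{s-1}\,dx$, and for $X>0$ let $$\mathcal S_k(X;s_1,\dots,s_k;M)=\sideset{}{^*}\sum_{d\ge1}g\!\left(\frac dX\right)\chi_d(M)L(s_1,\chi_d)\cdots L(s_k,\chi_d).$$ **Hypothesis (conjecture on the multiple Dirichlet series, for the given $k$ and $M$).** The function $$\Bigg(\prod_{J\subseteq\{1,\dots,k\}}(\sigma_J(w)-1)\Bigg)\Bigg(A_M(s_1,\dots,s_k;w)-\prod_{j=1}^k\zeta(s_j)\Bigg)$$ has a holomorphic continuation to a tube domain containing $(s_1,\dots,s_k,w)=(\frac12,\dots,\frac12,1)$, and the continuation is polynomially bounded in vertical strips. That is: there are an open connected set $V\subseteq\mathbb R^{k+1}$ containing $(\frac12,\dots,\frac12,1)$ and meeting $(1,\infty)^{k+1}$, and a holomorphic function $F$ on $V+i\mathbb R^{k+1}$ that equals the above function at all points of $V+i\mathbb R^{k+1}$ with $\mathrm{Re}(s_j)>1$ and $\mathrm{Re}(w)>1$, such that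 for all real $a_1,b_1,\dots,a_{k+1},b_{k+1}$ there is a real polynomial $P$ with $|F(\sigma+it)|\le|P(t)|$ for all $t\in\mathbb R^{k+1}$ and all $\sigma\in V$ with $a_j\le\sigma_j\le b_j$ for all $j$. **Proposition.** Under this hypothesis the recipe prediction holds with a power-saving error term: there are $\delta>0$ and $\eta>0$ such that 1. $T_M$ has a meromorphic continuation to $\{\mathrm{Re}(s_j)>\frac12-\eta \text{ for all } j\}$ of the form $G(s)/\prod_{1\le i\le j\le k}(s_i+s_j-1)$ with $G$ holomorphic; 2. for every smooth compactly supported $g:\mathbb R\to\mathbb C$ and every $X>0$ the sum $$\mathcal R(X;s_1,\dots,s_k)=\sum_{J\subseteq\{1,\dots,k\}}\ \prod_{j\in J}\mathcal X(s_j)\cdot X^{1+\frac{|J|}2-\sum_{j\in J}s_j}\,\tilde g\Big(1+\frac{|J|}2-\sum_{j\in J}s_j\Big)\,T_M(s_1^J,\dots,s_k^J),$$ in which $T_M$ denotes the continuation from 1, extends from the set where none of its terms has a pole (that is, where $s_i^J+s_j^J\neq1$ for all $J$ and all $i\le j$) to a holomorphic function of $(s_1,\dots,s_k)$ in $\{|\mathrm{Re}(s_j)-\frac12|<\eta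 \text{ for all } j\}$; 3. for every such $g$ and all real $B,C$ there are $K$ and $X_0$ such that, with $\mathcal R$ denoting the extended function from 2, $$\big|\mathcal S_k(X;s_1,\dots,s_k;M)-\mathcal R(X;s_1,\dots,s_k)\big|\le K\,X^{1-\delta}$$ for all $X\ge X_0$ and all $s_1,\dots,s_k\in\mathbb C$ with $|\mathrm{Re}(s_j)-\frac12|\le C/\log X$ and $|\mathrm{Im}(s_j)|\le B$ for all $j$. -/

import Mathlib

open scoped ContDiff

namespace QuadraticMoments

/-- Positive fundamental discriminants: squarefree `d ≡ 1 (mod 4)` (in particular `d = 1`), or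
`d = 4 m` with `m` squarefree and `m ≡ 2, 3 (mod 4)`. -/
def fundDisc : Set ℕ+ :=
  {d | ((d : ℕ) % 4 = 1 ∧ Squarefree (d : ℕ)) ∨
    ∃ m : ℕ, (d : ℕ) = 4 * m ∧ (m % 4 = 2 ∨ m % 4 = 3) ∧ Squarefree m}

/-- The Kronecker symbol `(d | n)` for natural numbers `d`, `n`: the Jacobi symbol at the odd part
of `n`, times the power of `(d | 2) = χ₈(d)` belonging to the exponent of `2` in `n`; and
`(d | 0) = 1` for `d = 1`, `(d | 0) = 0` otherwise. -/
def kronecker (d n : ℕ) : ℤ :=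
  if n = 0 then (if d = 1 then 1 else 0)
  else ZMod.χ₈ (d : ZMod 8) ^ padicValNat 2 n * jacobiSym (d : ℤ) (n / 2 ^ padicValNat 2 n)

/-- `L(s, χ_d)`, with its analytic continuation. For a fundamental discriminant `d > 0` the
Kronecker symbol `(d | ·)` has period `d`, so it is given by its values at `0, …, d - 1`. -/
noncomputable def Lquad (d : ℕ+) (s : ℂ) : ℂ :=
  ZMod.LFunction (N := (d : ℕ)) (fun a => ((kronecker d a.val : ℤ) : ℂ)) s

/-- `𝒳(s) = π^{s - 1/2} Γ((1 - s)/2) / Γ(s/2)`. -/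
noncomputable def gammaRatio (s : ℂ) : ℂ :=
  (Real.pi : ℂ) ^ (s - 1 / 2) * Complex.Gamma ((1 - s) / 2) / Complex.Gamma (s / 2)

/-- The twisted shifted moment
`𝒮_k(X; S; M) = ∑*_{d ≥ 1} g(d/X) χ_d(M) L(s_1, χ_d) ⋯ L(s_k, χ_d)`. -/
noncomputable def moment {k : ℕ} (M : ℕ) (g : ℝ → ℂ) (X : ℝ) (s : Fin k → ℂ) : ℂ :=
  ∑' d : fundDisc, g (((d : ℕ+) : ℝ) / X) * ((kronecker (d : ℕ+) M : ℤ) : ℂ) *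
    ∏ j, Lquad d (s j)

/-- The multiple Dirichlet series
`A_M(s_1, …, s_k; w) = ∑*_{d ≥ 1} χ_d(M) L(s_1, χ_d) ⋯ L(s_k, χ_d) d^{-w}`. -/
noncomputable def multiSeries {k : ℕ} (M : ℕ) (s : Fin k → ℂ) (w : ℂ) : ℂ :=
  ∑' d : fundDisc, ((kronecker (d : ℕ+) M : ℤ) : ℂ) * (∏ j, Lquad d (s j)) /
    (((d : ℕ+) : ℕ) : ℂ) ^ w

/-- `σ_J(w) = w + ∑_{j ∈ J} s_j - |J|/2`. -/
noncomputable def sigmaJ {k : ℕ} (s : Fin k → ℂ) (J : Finset (Fin k)) (w : ℂ) : ℂ :=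
  w + ∑ j ∈ J, s j - (J.card : ℂ) / 2

/-- The tube domain `V + i ℝⁿ` over `V ⊆ ℝⁿ`. -/
def tube {n : ℕ} (V : Set (Fin n → ℝ)) : Set (Fin n → ℂ) :=
  {z | (fun j => (z j).re) ∈ V}

/-- Polynomial boundedness in vertical strips of a function on the tube over `V`. -/
def PolyBoundedOnTube {n : ℕ} (V : Set (Fin n → ℝ)) (F : (Fin n → ℂ) → ℂ) : Prop :=
  ∀ a b : Fin n → ℝ, ∃ P : MvPolynomial (Fin n) ℝ, ∀ z ∈ tube V,
    (∀ j, a j ≤ (z j).re ∧ (z j).re ≤ b j) →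
      ‖F z‖ ≤ |MvPolynomial.eval (fun j => (z j).im) P|

/-- `(∏_J (σ_J(w) - 1)) (A_M(s; w) - ∏_j ζ(s_j))` as a function of
`z = (s_1, …, s_k, w)`. -/
noncomputable def clearedSeries (k M : ℕ) (z : Fin (k + 1) → ℂ) : ℂ :=
  (∏ J : Finset (Fin k), (sigmaJ (fun j => z j.castSucc) J (z (Fin.last k)) - 1)) *
    (multiSeries M (fun j : Fin k => z j.castSucc) (z (Fin.last k)) -
      ∏ j : Fin k, riemannZeta (z j.castSucc))

/-- The set `Re s_j > 1`, `Re w > 1`, where the multiple Dirichlet series converges absolutely. -/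
def convRegion (k : ℕ) : Set (Fin (k + 1) → ℂ) :=
  {z | ∀ i, 1 < (z i).re}

/-- The conjecture on the multiple Dirichlet series: the cleared function, given by the series on
`convRegion`, continues holomorphically to a tube domain through `(1/2, …, 1/2, 1)`, with
polynomial bounds in vertical strips. (A continuation to a connected domain starts from a part of
that domain where the series defines the function.) -/
def MDSConjecture (k M : ℕ) : Prop :=
  ∃ V : Set (Fin (k + 1) → ℝ), IsOpen V ∧ IsConnected V ∧
    Fin.snoc (α := fun _ => ℝ) (fun _ : Fin k => (1 / 2 : ℝ)) 1 ∈ V ∧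
    (tube V ∩ convRegion k).Nonempty ∧
    ∃ F : (Fin (k + 1) → ℂ) → ℂ, DifferentiableOn ℂ F (tube V) ∧
      (∀ z ∈ tube V ∩ convRegion k, F z = clearedSeries k M z) ∧
      PolyBoundedOnTube V F

/-- `a(n) = ∏_{p ∣ n} p/(p+1)`. -/
noncomputable def aCoeff (n : ℕ) : ℂ := ∏ p ∈ n.primeFactors, (p : ℂ) / ((p : ℂ) + 1)

open Classical in
/-- The series `T_M(S) = (1/(2ζ(2))) ∑_{M n_1 ⋯ n_k = □} a(M n_1 ⋯ n_k) / (n_1^{s_1} ⋯ n_k^{s_k})`. -/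
noncomputable def diagSeries {k : ℕ} (M : ℕ) (s : Fin k → ℂ) : ℂ :=
  1 / (2 * riemannZeta 2) * ∑' n : Fin k → ℕ+,
    if IsSquare (M * ∏ j, (n j : ℕ)) then
      aCoeff (M * ∏ j, (n j : ℕ)) / ∏ j, ((n j : ℕ) : ℂ) ^ (s j)
    else 0

/-- `∏_{i ≤ j} (s_i + s_j - 1)`, the equation of the polar hyperplanes of the continued `T_M`. -/
noncomputable def polarFactor {k : ℕ} (s : Fin k → ℂ) : ℂ :=
  ∏ i, ∏ j ∈ Finset.Ici i, (s i + s j - 1)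

/-- `T` is the meromorphic continuation of the series `T_M` to `Re s_j > 1/2 - η`, holomorphic
there outside the hyperplanes `s_i + s_j = 1` (`i ≤ j`), along which it has at most simple
poles. The values of `T` on these hyperplanes carry no information. -/
def IsContinuationOfDiag {k : ℕ} (M : ℕ) (η : ℝ) (T : (Fin k → ℂ) → ℂ) : Prop :=
  (∀ s : Fin k → ℂ, (∀ j, 1 < (s j).re) → T s = diagSeries M s) ∧
  ∃ G : (Fin k → ℂ) → ℂ, DifferentiableOn ℂ G {s | ∀ j, 1 / 2 - η < (s j).re} ∧
    ∀ s : Fin k → ℂ, (∀ j, 1 / 2 - η < (s j).re) → polarFactor s ≠ 0 →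
      T s = G s / polarFactor s

/-- The tuple `s^J`, i.e. the multiset `S ∖ S_J ∪ S_J⁻`: `1 - s_j` for `j ∈ J`, else `s_j`. -/
def reflect {k : ℕ} (s : Fin k → ℂ) (J : Finset (Fin k)) : Fin k → ℂ :=
  fun j => if j ∈ J then 1 - s j else s j

/-- The recipe expression
`∑_J ∏_{j ∈ J} 𝒳(s_j) X^{1 + |J|/2 - ∑_J s_j} g̃(1 + |J|/2 - ∑_J s_j) T(S ∖ S_J ∪ S_J⁻)`. -/
noncomputable def recipeSum {k : ℕ} (T : (Fin k → ℂ) → ℂ) (g : ℝ → ℂ) (X : ℝ)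
    (s : Fin k → ℂ) : ℂ :=
  ∑ J : Finset (Fin k), (∏ j ∈ J, gammaRatio (s j)) *
    (X : ℂ) ^ (1 + (J.card : ℂ) / 2 - ∑ j ∈ J, s j) *
    mellin g (1 + (J.card : ℂ) / 2 - ∑ j ∈ J, s j) * T (reflect s J)

/-- The recipe prediction with a power-saving error term. The single terms of the recipe
expression have poles, but their sum is holomorphic in `|Re s_j - 1/2| < η`; `R X` is this
holomorphic function, equal to the expression wherever no term has a pole. -/
def RecipeWithPowerSaving (k M : ℕ) : Prop :=
  ∃ δ > (0 : ℝ), ∃ η > (0 : ℝ), ∃ T : (Fin k → ℂ) → ℂ, IsContinuationOfDiag M η T ∧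
    ∀ g : ℝ → ℂ, ContDiff ℝ ∞ g → HasCompactSupport g →
      ∃ R : ℝ → (Fin k → ℂ) → ℂ,
        (∀ X : ℝ, 0 < X →
          DifferentiableOn ℂ (R X) {s | ∀ j, |(s j).re - 1 / 2| < η} ∧
          ∀ s : Fin k → ℂ, (∀ j, |(s j).re - 1 / 2| < η) →
            (∀ J : Finset (Fin k), polarFactor (reflect s J) ≠ 0) →
            R X s = recipeSum T g X s) ∧
        ∀ C B : ℝ, ∃ K X₀ : ℝ, ∀ X : ℝ, X₀ ≤ X → ∀ s : Fin k → ℂ,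
          (∀ j, |(s j).re - 1 / 2| ≤ C / Real.log X ∧ |(s j).im| ≤ B) →
          ‖moment M g X s - R X s‖ ≤ K * X ^ (1 - δ)

end QuadraticMoments

/-! By Mellin inversion the moment is the integral of `A_M(s; w) g̃(w) X^w / (2πi)` over `Re w = k +
2`. There the series over `d ≠ 1` converges absolutely even for `s_j` near `1/2`, by the crude bound
`|L(s, χ_d)| ≤ 4 d |s|`. Moving the line to `Re w = 1 - η/2` crosses the poles `w_J = 1 + |J|/2 -
∑_J s_j`. Their residues are the terms of the recipe, and the new line contributes `O(X^{1 - η/2})`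
since `g̃` decays faster than any power. The discriminant `d = 1` is kept apart because `ζ` has a
pole; its term `g(1/X) ∏ ζ(s_j)` is bounded near `s_j = 1/2`.

The hypothesis gives a continuation only to a tube over some connected open `V` through the central
point, which need not reach the line `Re w = k + 2`. The tube over the union of `V` with the orthant
of absolute convergence is connected, and Bochner's tube theorem, in a form that keeps polynomial
growth (`exists_extension_convexHull_tube`), extends the function to the tube over the convex hull.
This hull contains a full wedge `Re s_j > 1/2 - η`, `Re w > 1 - η`
(`MDSConjecture.exists_continuation`).

The residue at `w_∅ = 1` is `T_M(s)`: for `Re s_j > 1` the series is a sum over `N` of `D_{MN}(w) =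
∑*_d (d | MN) d^{-w}`, whose residue at `1` is `a(MN) / (2 ζ(2))` if `MN` is a square and `0`
otherwise (`tendsto_discSum`). The other residues follow from the functional equation
(`IsClearedContinuation.reflect`), which sends `s` to `s^J` and `w` to `σ_J(w)`, hence `w_J` to `1`.
It rests on `L(s, χ_d)` having root number `1`, that is, on the sign of the quadratic Gauss sum. The
continuation of `T_M` itself is independent of the hypothesis: its Euler product is compared with
`∏_{i ≤ j} ζ(s_i + s_j)` (`exists_diag_continuation`).

Single terms of the recipe have poles where points `w_J` collide. Their sum is a difference of two
line integrals (`recipeFun`), which is holomorphic in `s` throughout. It equals the sum of residues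
when the `w_J` are distinct, and the remaining `s` outside the polar hyperplanes follow by
continuity. -/

namespace QuadraticMoments

open MeasureTheory Filter Topology

/-! ### Holomorphic functions of several variables: Cauchy estimate, series, identity theorem. -/

section SeveralVariables

variable {E : Type*} [NormedAddCommGroup E] [NormedSpace ℂ E]

/-- Cauchy's estimate for the Fréchet derivative of a bounded holomorphic function. -/
theorem norm_fderiv_le_of_norm_le_on_ball {f : E → ℂ} {z₀ : E} {r C : ℝ}
    (hf : DifferentiableOn ℂ f (Metric.ball z₀ (2 * r)))
    (hC : ∀ z ∈ Metric.ball z₀ (2 * r), ‖f z‖ ≤ C) {x : E} (hx : x ∈ Metric.ball z₀ r) :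
    ‖fderiv ℂ f x‖ ≤ 2 * C / r := by
  have hr : 0 < r := (dist_nonneg.trans_lt hx)
  have hx2 : x ∈ Metric.ball z₀ (2 * r) := Metric.ball_subset_ball (by linarith) hx
  have hC0 : 0 ≤ C := (norm_nonneg _).trans (hC x hx2)
  refine ContinuousLinearMap.opNorm_le_bound _ (by positivity) fun v => ?_
  rcases eq_or_ne v 0 with rfl | hv
  · simp
  have hv' : 0 < ‖v‖ := norm_pos_iff.2 hv
  -- A disc of this radius in the direction `v` moves `x` by at most `r/2`, so it stays in the ball
  -- of radius `2r`; the one-variable Cauchy estimate is applied on it.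
  set R : ℝ := r / (2 * ‖v‖) with hR
  have hRpos : 0 < R := by positivity
  have hmem : ∀ l : ℂ, ‖l‖ ≤ R → x + l • v ∈ Metric.ball z₀ (2 * r) := by
    intro l hl
    have h1 : ‖l • v‖ ≤ r / 2 := by
      rw [norm_smul]
      calc ‖l‖ * ‖v‖ ≤ R * ‖v‖ := by gcongr
        _ = r / 2 := by rw [hR]; field_simp
    have h2 : dist x z₀ < r := hx
    rw [Metric.mem_ball, dist_eq_norm] at *
    calc ‖x + l • v - z₀‖ = ‖(x - z₀) + l • v‖ := by congr 1; abel
      _ ≤ ‖x - z₀‖ + ‖l • v‖ := norm_add_le _ _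
      _ < 2 * r := by linarith
  have hlin : ∀ l : ℂ, HasDerivAt (fun l : ℂ => x + l • v) v l := fun l => by
    simpa using ((hasDerivAt_id l).smul_const v).const_add x
  have hfd : ∀ z ∈ Metric.ball z₀ (2 * r), DifferentiableAt ℂ f z := fun z hz =>
    hf.differentiableAt (Metric.isOpen_ball.mem_nhds hz)
  have hdiff : ∀ l : ℂ, ‖l‖ ≤ R →
      HasDerivAt (fun l : ℂ => f (x + l • v)) (fderiv ℂ f (x + l • v) v) l := fun l hl =>
    (hfd _ (hmem l hl)).hasFDerivAt.comp_hasDerivAt l (hlin l)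
  have hmain : ‖deriv (fun l : ℂ => f (x + l • v)) 0‖ ≤ C / R := by
    refine Complex.norm_deriv_le_of_forall_mem_sphere_norm_le hRpos ?_ ?_
    · refine DifferentiableOn.diffContOnCl fun l hl => ?_
      rw [closure_ball _ hRpos.ne'] at hl
      exact (hdiff l (by simpa using hl)).differentiableAt.differentiableWithinAt
    · intro l hl
      exact hC _ (hmem l (by simpa using (le_of_eq (by simpa using hl))))
  have h0 := (hdiff 0 (by simpa using hRpos.le)).deriv
  rw [h0] at hmain
  simp only [zero_smul, add_zero] at hmain
  calc ‖fderiv ℂ f x v‖ ≤ C / R := hmain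
    _ = 2 * C / r * ‖v‖ := by rw [hR]; field_simp

/-- A locally dominated series of holomorphic functions is holomorphic. -/
theorem differentiableOn_tsum_of_locally_dominated {ι : Type*} {U : Set E}
    {f : ι → E → ℂ} (hU : IsOpen U) (hf : ∀ i, DifferentiableOn ℂ (f i) U)
    (hb : ∀ z₀ ∈ U, ∃ r > 0, ∃ u : ι → ℝ, Summable u ∧
      ∀ z ∈ Metric.ball z₀ r, z ∈ U → ∀ i, ‖f i z‖ ≤ u i) :
    DifferentiableOn ℂ (fun z => ∑' i, f i z) U := by
  intro z₀ hz₀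
  obtain ⟨r, hr, u, hu, hle⟩ := hb z₀ hz₀
  obtain ⟨r', hr', hsub⟩ := Metric.isOpen_iff.1 hU z₀ hz₀
  set ρ := min r r' / 2 with hρ
  have hρpos : 0 < ρ := by positivity
  have h2 : 2 * ρ = min r r' := by rw [hρ]; ring
  have hb1 : Metric.ball z₀ (2 * ρ) ⊆ Metric.ball z₀ r :=
    Metric.ball_subset_ball (by rw [h2]; exact min_le_left _ _)
  have hb2 : Metric.ball z₀ (2 * ρ) ⊆ U :=
    (Metric.ball_subset_ball (by rw [h2]; exact min_le_right _ _)).trans hsub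
  have hb3 : Metric.ball z₀ ρ ⊆ U := (Metric.ball_subset_ball (by linarith)).trans hb2
  have hz : z₀ ∈ Metric.ball z₀ ρ := Metric.mem_ball_self hρpos
  -- Cauchy's estimate turns the bound `u` on the larger ball into the summable bound `2u/ρ` for the
  -- derivatives on the smaller one, which permits termwise differentiation.
  refine (hasFDerivAt_tsum_of_isPreconnected (f' := fun i x => fderiv ℂ (f i) x)
    (u := fun i => 2 * u i / ρ) ?_ Metric.isOpen_ball
    (Metric.isPreconnected_ball (x := z₀) (r := ρ)) ?_ ?_ hz ?_ hz
    ).differentiableAt.differentiableWithinAt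
  · exact (hu.mul_left 2).div_const ρ
  · intro i x hx
    exact ((hf i).differentiableAt (hU.mem_nhds (hb3 hx))).hasFDerivAt
  · intro i x hx
    exact norm_fderiv_le_of_norm_le_on_ball ((hf i).mono hb2)
      (fun z hz => hle z (hb1 hz) (hb2 hz) i) hx
  · exact Summable.of_norm_bounded hu fun i => hle z₀ (Metric.mem_ball_self hr) hz₀ i

/-- The identity theorem on a convex open set, by restriction to complex lines. -/
theorem eqOn_of_convex_of_eventuallyEq {U : Set E} {f g : E → ℂ}
    (hU : IsOpen U) (hc : Convex ℝ U) (hf : DifferentiableOn ℂ f U) (hg : DifferentiableOn ℂ g U)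
    {z₀ : E} (hz₀ : z₀ ∈ U) (h : f =ᶠ[𝓝 z₀] g) : Set.EqOn f g U := by
  intro z hz
  -- The parameters `l` with `ℓ l ∈ U` form a convex, hence connected, open subset of `ℂ`, so the
  -- one-variable identity theorem carries the equality from `l = 0` to `l = 1`.
  set ℓ : ℂ → E := fun l => z₀ + l • (z - z₀) with hℓ
  have hℓc : Continuous ℓ := by fun_prop
  have hℓd : Differentiable ℂ ℓ := by
    intro l
    exact ((differentiableAt_id).smul_const _).const_add _
  set W : Set ℂ := ℓ ⁻¹' U with hW
  have hWo : IsOpen W := hU.preimage hℓc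
  have hWc : Convex ℝ W := by
    intro a ha b hb x y hx hy hxy
    have hx' : (x : ℂ) + y = 1 := by exact_mod_cast hxy
    have : ℓ (x • a + y • b) = x • ℓ a + y • ℓ b := by
      have h1 : (x • z₀ : E) + y • z₀ = z₀ := by rw [← add_smul, hxy, one_smul]
      simp only [hℓ, smul_add, add_smul]
      rw [smul_assoc, smul_assoc]
      nth_rw 1 [← h1]
      abel
    simp only [hW, Set.mem_preimage, this]
    exact hc ha hb hx hy hxy
  have hfW : AnalyticOnNhd ℂ (f ∘ ℓ) W :=
    (hf.comp hℓd.differentiableOn (fun _ h => h)).analyticOnNhd hWo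
  have hgW : AnalyticOnNhd ℂ (g ∘ ℓ) W :=
    (hg.comp hℓd.differentiableOn (fun _ h => h)).analyticOnNhd hWo
  have h0 : (0 : ℂ) ∈ W := by simpa [hW, hℓ] using hz₀
  have h1 : (1 : ℂ) ∈ W := by simpa [hW, hℓ] using hz
  have hev : f ∘ ℓ =ᶠ[𝓝 0] g ∘ ℓ := by
    have : Tendsto ℓ (𝓝 0) (𝓝 z₀) := by
      have := hℓc.tendsto 0
      simpa [hℓ] using this
    exact this.eventually h
  have := hfW.eqOn_of_preconnected_of_eventuallyEq hgW hWc.isPreconnected h0 hev h1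
  simpa [hℓ] using this

end SeveralVariables

/-! ### Holomorphic dependence of integrals on parameters. -/

section Parametric

variable {α : Type*} [MeasurableSpace α] {μ : Measure α} {ι : Type*} [Fintype ι]

/-- The integral of a locally dominated family of holomorphic functions is holomorphic. -/
theorem differentiableOn_integral_of_locally_dominated {U : Set (ι → ℂ)} (hU : IsOpen U)
    {F : (ι → ℂ) → α → ℂ} (hmeas : ∀ z ∈ U, AEStronglyMeasurable (F z) μ)
    (hd : ∀ a, DifferentiableOn ℂ (fun z => F z a) U)
    (hb : ∀ z₀ ∈ U, ∃ r > 0, ∃ b : α → ℝ, Integrable b μ ∧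
      ∀ z ∈ Metric.ball z₀ r, z ∈ U → ∀ a, ‖F z a‖ ≤ b a) :
    DifferentiableOn ℂ (fun z => ∫ a, F z a ∂μ) U := by
  classical
  intro z₀ hz₀
  obtain ⟨r, hr, u, hu, hle⟩ := hb z₀ hz₀
  obtain ⟨r', hr', hsub⟩ := Metric.isOpen_iff.1 hU z₀ hz₀
  set ρ := min r r' / 2 with hρ
  have hρpos : 0 < ρ := by positivity
  have h2 : 2 * ρ = min r r' := by rw [hρ]; ring
  have hb1 : Metric.ball z₀ (2 * ρ) ⊆ Metric.ball z₀ r :=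
    Metric.ball_subset_ball (by rw [h2]; exact min_le_left _ _)
  have hb2 : Metric.ball z₀ (2 * ρ) ⊆ U :=
    (Metric.ball_subset_ball (by rw [h2]; exact min_le_right _ _)).trans hsub
  have hb3 : Metric.ball z₀ ρ ⊆ U := (Metric.ball_subset_ball (by linarith)).trans hb2
  have hder : ∀ a, ∀ x ∈ Metric.ball z₀ ρ,
      HasFDerivAt (fun z => F z a) (fderiv ℂ (fun z => F z a) x) x := fun a x hx =>
    ((hd a).differentiableAt (hU.mem_nhds (hb3 hx))).hasFDerivAt
  have hz : z₀ ∈ Metric.ball z₀ ρ := Metric.mem_ball_self hρpos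
  refine (hasFDerivAt_integral_of_dominated_of_fderiv_le
    (F' := fun x a => fderiv ℂ (fun z => F z a) x) (bound := fun a => 2 * u a / ρ)
    (Metric.ball_mem_nhds z₀ hρpos) ?_ ?_ ?_ ?_ ?_ ?_).differentiableAt.differentiableWithinAt
  · filter_upwards [hU.mem_nhds hz₀] with z hz using hmeas z hz
  · exact hu.mono' (hmeas z₀ hz₀) (ae_of_all _ (hle z₀ (Metric.mem_ball_self hr) hz₀))
  -- Measurability of the derivative in `a`: each partial derivative is a limit of difference
  -- quotients with steps `1/(n + N)`, where `N > 1/ρ` keeps the displaced points in the ball; the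
  -- full derivative is a finite combination of coordinate projections.
  · have key : ∀ j : ι, AEStronglyMeasurable
        (fun a => fderiv ℂ (fun z => F z a) z₀ (Pi.single j 1)) μ := by
      intro j
      obtain ⟨N, hN⟩ := exists_nat_gt (1 / ρ)
      have hNpos : (0 : ℝ) < N := lt_trans (by positivity) hN
      set x : ℕ → (ι → ℂ) := fun n => z₀ + ((1 : ℂ) / ((n : ℂ) + N)) • Pi.single j 1 with hx
      have hnorm : ∀ n : ℕ, ‖(1 : ℂ) / ((n : ℂ) + N)‖ = 1 / ((n : ℝ) + N) := by
        intro n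
        rw [norm_div, norm_one]
        congr 1
        rw [show ((n : ℂ) + N) = ((n + N : ℕ) : ℂ) by push_cast; ring, Complex.norm_natCast]
        push_cast; ring
      have hxU : ∀ n, x n ∈ U := by
        intro n
        apply hb3
        rw [Metric.mem_ball, dist_eq_norm, hx]
        simp only [add_sub_cancel_left, norm_smul, hnorm]
        have : ‖(Pi.single j (1 : ℂ) : ι → ℂ)‖ ≤ 1 := by
          refine (pi_norm_le_iff_of_nonneg zero_le_one).2 fun i => ?_
          by_cases h : i = j
          · subst h; simp
          · simp [h]
        calc 1 / ((n : ℝ) + N) * ‖(Pi.single j (1 : ℂ) : ι → ℂ)‖ ≤ 1 / ((n : ℝ) + N) * 1 := by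
              gcongr
          _ ≤ 1 / N := by
              rw [mul_one]
              exact one_div_le_one_div_of_le hNpos (by linarith [Nat.cast_nonneg (α := ℝ) n])
          _ < ρ := by rw [div_lt_comm₀ hNpos hρpos]; exact hN
      refine aestronglyMeasurable_of_tendsto_ae atTop
        (f := fun (n : ℕ) a => ((n : ℂ) + N) • (F (x n) a - F z₀ a)) ?_ (ae_of_all _ fun a => ?_)
      · intro n
        exact ((hmeas _ (hxU n)).sub (hmeas _ hz₀)).const_smul ((n : ℂ) + N)
      · have h := (hder a z₀ hz).hasFDerivWithinAt (s := Set.univ)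
        have := h.lim (α := ℕ) (l := atTop) (c := fun n : ℕ => ((n : ℂ) + N))
          (d := fun n : ℕ => ((1 : ℂ) / ((n : ℂ) + N)) • (Pi.single j 1 : ι → ℂ))
          (v := Pi.single j 1) ?_ (Eventually.of_forall fun _ => Set.mem_univ _) ?_
        · simpa [hx] using this
        · have h3 : Tendsto (fun n : ℕ => ((1 : ℂ) / ((n : ℂ) + N))) atTop (𝓝 0) := by
            rw [tendsto_zero_iff_norm_tendsto_zero]
            simp only [hnorm]
            exact tendsto_const_nhds.div_atTop
              (tendsto_atTop_add_const_right _ _ tendsto_natCast_atTop_atTop)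
          simpa using h3.smul_const (Pi.single j 1 : ι → ℂ)
        · refine tendsto_const_nhds.congr' ?_
          filter_upwards with n
          have : ((n : ℂ) + N) ≠ 0 := by
            rw [show ((n : ℂ) + N) = ((n + N : ℕ) : ℂ) by push_cast; ring]
            have : 0 < N := by exact_mod_cast hNpos
            exact_mod_cast (by omega : n + N ≠ 0)
          rw [smul_smul, mul_one_div_cancel this, one_smul]
    have hrepr : (fun a => fderiv ℂ (fun z => F z a) z₀) = fun a => ∑ j : ι,
        (fderiv ℂ (fun z => F z a) z₀ (Pi.single j 1)) •
          (ContinuousLinearMap.proj (R := ℂ) (φ := fun _ : ι => ℂ) j) := by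
      funext a
      ext v
      conv_lhs => rw [← Finset.univ_sum_single v]
      rw [map_sum]
      simp only [sum_apply, smul_apply,
        ContinuousLinearMap.proj_apply, smul_eq_mul]
      refine Finset.sum_congr rfl fun j _ => ?_
      rw [show (Pi.single j (v j) : ι → ℂ) = v j • Pi.single j (1 : ℂ) by
        rw [← Pi.single_smul]; simp, map_smul, smul_eq_mul, mul_comm]
    rw [hrepr]
    exact Finset.aestronglyMeasurable_fun_sum _ fun j _ => (key j).smul_const _
  · exact ae_of_all _ fun a x hx => norm_fderiv_le_of_norm_le_on_ball ((hd a).mono hb2)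
      (fun z hz => hle z (hb1 hz) (hb2 hz) a) hx
  · exact (hu.const_mul 2).div_const ρ
  · exact ae_of_all _ fun a x hx => hder a x hx

end Parametric

/-! ### Tube domains and the shift of integration in them. -/

section Tubes

variable {n : ℕ}

theorem isOpen_tube {V : Set (Fin n → ℝ)} (hV : IsOpen V) : IsOpen (tube V) :=
  hV.preimage (f := fun z : Fin n → ℂ => fun j => (z j).re)
    (continuous_pi fun j => Complex.continuous_re.comp (continuous_apply j))

/-- The point `σ + i t`. -/
def vert (σ t : Fin n → ℝ) : Fin n → ℂ := fun j => (σ j : ℂ) + (t j : ℂ) * Complex.I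

@[simp] theorem vert_re (σ t : Fin n → ℝ) (j : Fin n) : (vert σ t j).re = σ j := by simp [vert]
@[simp] theorem vert_im (σ t : Fin n → ℝ) (j : Fin n) : (vert σ t j).im = t j := by simp [vert]

theorem vert_mem_tube {V : Set (Fin n → ℝ)} {σ t : Fin n → ℝ} : vert σ t ∈ tube V ↔ σ ∈ V := by
  simp [tube]

theorem vert_re_im (z : Fin n → ℂ) : vert (fun j => (z j).re) (fun j => (z j).im) = z := by
  funext j; simp [vert]

theorem continuous_vert : Continuous fun p : (Fin n → ℝ) × (Fin n → ℝ) => vert p.1 p.2 := by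
  unfold vert; fun_prop

theorem isPreconnected_tube {V : Set (Fin n → ℝ)} (hV : IsPreconnected V) :
    IsPreconnected (tube V) := by
  have h := (hV.prod (isPreconnected_univ (α := Fin n → ℝ))).image _ continuous_vert.continuousOn
  convert h using 1
  ext z
  constructor
  · intro hz
    exact ⟨(fun j => (z j).re, fun j => (z j).im), ⟨hz, trivial⟩, vert_re_im z⟩
  · rintro ⟨⟨σ, t⟩, ⟨hσ, -⟩, rfl⟩
    exact vert_mem_tube.2 hσ

theorem convex_tube {V : Set (Fin n → ℝ)} (hV : Convex ℝ V) : Convex ℝ (tube V) := by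
  intro z hz w hw a b ha hb hab
  have := hV hz hw ha hb hab
  simp only [tube, Set.mem_ofPred_eq] at this ⊢
  convert this using 1
  funext j
  simp

theorem integrable_prod_inv_one_add_sq :
    Integrable (fun t : Fin n → ℝ => ∏ j, (1 + t j ^ 2)⁻¹) := by
  exact Integrable.fintype_prod (f := fun (_ : Fin n) (x : ℝ) => (1 + x ^ 2)⁻¹)
    fun _ => integrable_inv_one_add_sq

/-- Peetre's inequality, from `t = (t + y) - y`: quadratic decay survives a bounded shift in the
imaginary direction. -/
theorem inv_one_add_sq_add_le {t y Y : ℝ} (hy : |y| ≤ Y) :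
    (1 + (t + y) ^ 2)⁻¹ ≤ 2 * (1 + Y ^ 2) * (1 + t ^ 2)⁻¹ := by
  have h1 : y ^ 2 ≤ Y ^ 2 := by
    rw [← sq_abs y]; gcongr
  rw [← div_eq_mul_inv, le_div_iff₀ (by positivity), inv_mul_le_iff₀ (by positivity)]
  nlinarith [sq_nonneg (t + 2 * y), sq_nonneg (t + y), mul_nonneg (sq_nonneg Y) (sq_nonneg (t + y))]

/-- Cauchy's theorem in a tube: the integral over the fibre `σ + i ℝⁿ` does not depend on `σ`. -/
theorem integral_vert_eq_of_decay {V : Set (Fin n → ℝ)} (hV : IsOpen V) (hVc : IsPreconnected V)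
    {Φ : (Fin n → ℂ) → ℂ} (hΦ : DifferentiableOn ℂ Φ (tube V))
    (hb : ∀ σ₀ ∈ V, ∃ r > 0, ∃ C : ℝ, ∀ σ ∈ Metric.ball σ₀ r, σ ∈ V → ∀ t : Fin n → ℝ,
      ‖Φ (vert σ t)‖ ≤ C * ∏ j, (1 + t j ^ 2)⁻¹)
    {σ₁ σ₂ : Fin n → ℝ} (h₁ : σ₁ ∈ V) (h₂ : σ₂ ∈ V) :
    ∫ t : Fin n → ℝ, Φ (vert σ₁ t) = ∫ t : Fin n → ℝ, Φ (vert σ₂ t) := by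
  -- The fibre integral as a function of a complex point. It is holomorphic, and translation
  -- invariance of Lebesgue measure makes it constant in imaginary directions. By complex linearity
  -- its derivative then vanishes in all directions, so it is constant on the connected tube.
  set K : (Fin n → ℂ) → ℂ := fun z => ∫ t : Fin n → ℝ, Φ (z + vert 0 t) with hK
  have hmem : ∀ z ∈ tube V, ∀ t : Fin n → ℝ, z + vert 0 t ∈ tube V := by
    intro z hz t
    simpa [tube] using hz
  have hcont : ∀ z, Continuous fun t : Fin n → ℝ => z + vert 0 t := fun z => by
    unfold vert; fun_prop
  have hKd : DifferentiableOn ℂ K (tube V) := by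
    refine differentiableOn_integral_of_locally_dominated (isOpen_tube hV) ?_ ?_ ?_
    · intro z hz
      exact (hΦ.continuousOn.comp_continuous (hcont z) (hmem z hz)).aestronglyMeasurable
    · intro t
      exact hΦ.comp (by fun_prop) fun z hz => hmem z hz t
    · intro z₀ hz₀
      obtain ⟨r, hr, C, hC⟩ := hb _ hz₀
      set Y := ‖z₀‖ + r with hY
      refine ⟨r, hr, fun t => C * ∏ j, (2 * (1 + Y ^ 2) * (1 + t j ^ 2)⁻¹), ?_, ?_⟩
      · simp_rw [Finset.prod_mul_distrib]
        exact (integrable_prod_inv_one_add_sq.const_mul _).const_mul _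
      · intro z hz hzV t
        have hz' : ∀ j, ‖z j - z₀ j‖ < r := fun j =>
          lt_of_le_of_lt (norm_le_pi_norm (z - z₀) j) (by simpa [dist_eq_norm] using hz)
        have hσ : (fun j => (z j).re) ∈ Metric.ball (fun j => (z₀ j).re) r := by
          rw [Metric.mem_ball, dist_pi_lt_iff hr]
          intro j
          rw [Real.dist_eq, ← Complex.sub_re]
          exact (Complex.abs_re_le_norm _).trans_lt (hz' j)
        have hy : ∀ j, |(z j).im| ≤ Y := by
          intro j
          calc |(z j).im| ≤ ‖z j‖ := Complex.abs_im_le_norm _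
            _ ≤ ‖z₀ j‖ + ‖z j - z₀ j‖ := norm_le_norm_add_norm_sub' _ _
            _ ≤ ‖z₀‖ + r := add_le_add (norm_le_pi_norm z₀ j) (hz' j).le
        have heq : z + vert 0 t = vert (fun j => (z j).re) (fun j => t j + (z j).im) := by
          funext j
          apply Complex.ext <;> simp [add_comm]
        have hC0 : 0 ≤ C := by
          have h := (norm_nonneg _).trans (hC _ hσ hzV 0)
          simpa using h
        rw [heq]
        refine (hC _ hσ hzV _).trans (mul_le_mul_of_nonneg_left ?_ hC0)
        exact Finset.prod_le_prod (fun j _ => by positivity) fun j _ =>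
          inv_one_add_sq_add_le (hy j)
  have htrans : ∀ z (v : Fin n → ℝ), K (z + vert 0 v) = K z := by
    intro z v
    simp only [hK]
    rw [← integral_add_right_eq_self (fun t : Fin n → ℝ => Φ (z + vert 0 t)) v]
    congr 1
    funext t
    congr 1
    funext j
    simp [vert]
    ring
  have hfd : Set.EqOn (fderiv ℂ K) 0 (tube V) := by
    intro z hz
    have hKz := (hKd.differentiableAt ((isOpen_tube hV).mem_nhds hz)).hasFDerivAt
    have hre : ∀ v : Fin n → ℝ, fderiv ℂ K z (vert 0 v) = 0 := by
      intro v
      have h1 : HasDerivAt (fun l : ℝ => z + (l : ℂ) • vert 0 v) (vert 0 v) 0 := by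
        have := ((Complex.ofRealCLM.hasDerivAt (x := (0 : ℝ))).smul_const (vert 0 v)).const_add z
        simpa using this
      have h2 : HasDerivAt (fun l : ℝ => K (z + (l : ℂ) • vert 0 v)) (fderiv ℂ K z (vert 0 v)) 0 := by
        have h3 : HasFDerivAt K ((fderiv ℂ K z).restrictScalars ℝ) (z + ((0 : ℝ) : ℂ) • vert 0 v) := by
          simpa using hKz.restrictScalars ℝ
        exact h3.comp_hasDerivAt (0 : ℝ) h1
      have h4 : (fun l : ℝ => K (z + (l : ℂ) • vert 0 v)) = fun _ => K z := by
        funext l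
        rw [← htrans z (l • v)]
        congr 2
        funext j
        simp [vert]
        ring
      rw [h4] at h2
      exact h2.unique (hasDerivAt_const _ _)
    ext v
    have hv : v = (-Complex.I) • vert 0 (fun j => (v j).re) + vert 0 (fun j => (v j).im) := by
      funext j
      apply Complex.ext <;> simp [vert]
    rw [hv, map_add, map_smul, hre, hre]
    simp
  have hc := (isOpen_tube hV).is_const_of_fderiv_eq_zero (isPreconnected_tube hVc) hKd hfd
    (vert_mem_tube (t := 0).2 h₁) (vert_mem_tube (t := 0).2 h₂)
  have hs : ∀ σ, K (vert σ 0) = ∫ t : Fin n → ℝ, Φ (vert σ t) := by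
    intro σ
    simp only [hK]
    congr 1
    funext t
    congr 1
    funext j
    simp [vert]
  rw [hs, hs] at hc
  exact hc

end Tubes

end QuadraticMoments

namespace QuadraticMoments

open MeasureTheory Filter Topology

/-! ### Bochner's tube theorem with polynomial growth, by the Fourier–Laplace transform. -/

section TubeTheorem

variable {n : ℕ}

/-- Fourier inversion on `ℝⁿ` in coordinates. -/
theorem fourier_inversion_pi {f : (Fin n → ℝ) → ℂ} (hf : Continuous f) (hfi : Integrable f)
    (hfh : Integrable fun ξ : Fin n → ℝ => ∫ t : Fin n → ℝ,
      f t * Complex.exp (-(2 * Real.pi * Complex.I) * ∑ j, (t j : ℂ) * ξ j)) (t : Fin n → ℝ) :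
    ∫ ξ : Fin n → ℝ, (∫ u : Fin n → ℝ,
      f u * Complex.exp (-(2 * Real.pi * Complex.I) * ∑ j, (u j : ℂ) * ξ j)) *
        Complex.exp ((2 * Real.pi * Complex.I) * ∑ j, (t j : ℂ) * ξ j) = f t := by
  have hmp := PiLp.volume_preserving_ofLp (Fin n)
  have hme : MeasurableEmbedding (WithLp.ofLp : EuclideanSpace ℝ (Fin n) → (Fin n → ℝ)) :=
    (MeasurableEquiv.toLp 2 (Fin n → ℝ)).symm.measurableEmbedding
  set f' : EuclideanSpace ℝ (Fin n) → ℂ := fun x => f x.ofLp with hf'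
  have h1 : ∀ w : EuclideanSpace ℝ (Fin n), FourierTransform.fourier f' w = ∫ u : Fin n → ℝ,
      f u * Complex.exp (-(2 * Real.pi * Complex.I) * ∑ j, (u j : ℂ) * w.ofLp j) := by
    intro w
    rw [Real.fourier_eq', ← hmp.integral_comp hme]
    congr 1
    funext v
    simp only [hf', smul_eq_mul]
    rw [mul_comm]
    congr 2
    simp only [PiLp.inner_apply, RCLike.inner_apply, conj_trivial]
    push_cast
    rw [show ∑ j, (v.ofLp j : ℂ) * (w.ofLp j : ℂ) = ∑ j, (w.ofLp j : ℂ) * (v.ofLp j : ℂ) from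
      Finset.sum_congr rfl fun _ _ => mul_comm _ _]
    ring
  have hc' : Continuous f' := hf.comp (PiLp.continuous_ofLp 2 _)
  have hi' : Integrable f' := (hmp.integrable_comp_emb hme).2 hfi
  have hh' : Integrable (FourierTransform.fourier f') := by
    have : FourierTransform.fourier f' = (fun ξ : Fin n → ℝ => ∫ t : Fin n → ℝ,
      f t * Complex.exp (-(2 * Real.pi * Complex.I) * ∑ j, (t j : ℂ) * ξ j)) ∘ WithLp.ofLp :=
      funext h1
    rw [this]
    exact (hmp.integrable_comp_emb hme).2 hfh
  have h2 := congrFun (hc'.fourierInv_fourier_eq hi' hh') (WithLp.toLp 2 t)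
  rw [Real.fourierInv_eq'] at h2
  simp only [hf'] at h2
  rw [← h2, ← hmp.integral_comp hme]
  congr 1
  funext v
  rw [smul_eq_mul, mul_comm, ← h1 v]
  congr 2
  simp only [PiLp.inner_apply, RCLike.inner_apply, conj_trivial]
  push_cast
  ring

/-- Locally uniform polynomial growth in the imaginary directions on the tube over `V`. -/
def TubeGrowth (V : Set (Fin n → ℝ)) (F : (Fin n → ℂ) → ℂ) : Prop :=
  ∀ σ₀ ∈ V, ∃ r > 0, ∃ C : ℝ, ∃ A : ℕ, ∀ σ ∈ Metric.ball σ₀ r, σ ∈ V → ∀ t : Fin n → ℝ,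
    ‖F (vert σ t)‖ ≤ C * (1 + ‖t‖) ^ A

/-- The entire function `exp (∑ (z_j - i τ_j)²)`, a Gaussian centred at height `τ`. -/
noncomputable def gaussAt (τ : Fin n → ℝ) (z : Fin n → ℂ) : ℂ :=
  Complex.exp (∑ j, (z j - τ j * Complex.I) ^ 2)

theorem norm_gaussAt_vert (τ σ t : Fin n → ℝ) :
    ‖gaussAt τ (vert σ t)‖ = Real.exp (∑ j, σ j ^ 2) * Real.exp (-∑ j, (t j - τ j) ^ 2) := by
  rw [gaussAt, Complex.norm_exp, ← Real.exp_add, ← Finset.sum_neg_distrib,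
    ← Finset.sum_add_distrib, Complex.re_sum]
  congr 1
  refine Finset.sum_congr rfl fun j _ => ?_
  simp [pow_two, vert, Complex.mul_re, Complex.sub_re, Complex.sub_im]
  ring

theorem differentiable_gaussAt (τ : Fin n → ℝ) : Differentiable ℂ (gaussAt τ) := by
  unfold gaussAt; fun_prop

theorem gaussAt_ne_zero (τ : Fin n → ℝ) (z : Fin n → ℂ) : gaussAt τ z ≠ 0 := Complex.exp_ne_zero _

/-- Polynomial factors are absorbed by the Gaussian. -/
theorem exists_pow_mul_exp_neg_sq_le (n A : ℕ) : ∃ B : ℝ, 0 ≤ B ∧ ∀ u : Fin n → ℝ,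
    (1 + ‖u‖) ^ A * Real.exp (-∑ j, u j ^ 2) ≤ B * ∏ j, (1 + u j ^ 2)⁻¹ := by
  -- From `y^(A+2) ≤ (A+2)! e^y` at `y = 1 + |x|`, together with `1 + |x| - x² ≤ 2`; two of the
  -- powers pay for the factor `1 + x²`.
  set b : ℝ := (A + 2).factorial * Real.exp 2 with hb
  have h1 : ∀ x : ℝ, (1 + |x|) ^ A * Real.exp (-x ^ 2) ≤ b * (1 + x ^ 2)⁻¹ := by
    intro x
    rw [← div_eq_mul_inv, le_div_iff₀ (by positivity)]
    have h2 : 1 + x ^ 2 ≤ (1 + |x|) ^ 2 := by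
      nlinarith [abs_nonneg x, sq_abs x]
    have h3 : (1 + |x|) ^ (A + 2) ≤ (A + 2).factorial * Real.exp (1 + |x|) := by
      have := Real.pow_div_factorial_le_exp (1 + |x|) (by positivity) (A + 2)
      rwa [div_le_iff₀' (by positivity)] at this
    calc (1 + |x|) ^ A * Real.exp (-x ^ 2) * (1 + x ^ 2)
        ≤ (1 + |x|) ^ A * Real.exp (-x ^ 2) * (1 + |x|) ^ 2 := by gcongr
      _ = (1 + |x|) ^ (A + 2) * Real.exp (-x ^ 2) := by ring
      _ ≤ (A + 2).factorial * Real.exp (1 + |x|) * Real.exp (-x ^ 2) := by gcongr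
      _ = (A + 2).factorial * Real.exp (1 + |x| - x ^ 2) := by
          rw [mul_assoc, ← Real.exp_add]; ring_nf
      _ ≤ b := by
          rw [hb]
          gcongr
          nlinarith [sq_nonneg (|x| - 1 / 2), sq_abs x]
  refine ⟨b ^ n, by positivity, fun u => ?_⟩
  have h4 : 1 + ‖u‖ ≤ ∏ j, (1 + |u j|) := by
    have hone : (1 : ℝ) ≤ ∏ j, (1 + |u j|) :=
      Finset.one_le_prod fun j => by simp
    have : ‖u‖ ≤ ∏ j, (1 + |u j|) - 1 := by
      refine (pi_norm_le_iff_of_nonneg (by linarith)).2 fun i => ?_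
      have h5 : (1 + |u i|) ≤ ∏ j, (1 + |u j|) := by
        rw [← Finset.mul_prod_erase _ _ (Finset.mem_univ i)]
        refine le_mul_of_one_le_right (by positivity) ?_
        exact Finset.prod_induction (fun j => 1 + |u j|) (fun x => 1 ≤ x)
          (fun a b ha hb => one_le_mul_of_one_le_of_one_le ha hb) le_rfl (fun j _ => by simp)
      rw [Real.norm_eq_abs]; linarith
    linarith
  calc (1 + ‖u‖) ^ A * Real.exp (-∑ j, u j ^ 2)
      ≤ (∏ j, (1 + |u j|)) ^ A * Real.exp (-∑ j, u j ^ 2) := by gcongr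
    _ = ∏ j, ((1 + |u j|) ^ A * Real.exp (-u j ^ 2)) := by
        rw [Finset.prod_mul_distrib, Finset.prod_pow, ← Real.exp_sum, Finset.sum_neg_distrib]
    _ ≤ ∏ j, (b * (1 + u j ^ 2)⁻¹) := Finset.prod_le_prod (fun j _ => by positivity) fun j _ => h1 _
    _ = b ^ n * ∏ j, (1 + u j ^ 2)⁻¹ := by simp [Finset.prod_mul_distrib]

/-- The Fourier–Laplace transform of `F · gaussAt τ` along the fibre over `σ`. -/
noncomputable def laplaceAt (F : (Fin n → ℂ) → ℂ) (σ τ ξ : Fin n → ℝ) : ℂ :=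
  ∫ t : Fin n → ℝ, F (vert σ t) * gaussAt τ (vert σ t) *
    Complex.exp (-(2 * Real.pi) * ∑ j, vert σ t j * ξ j)

theorem norm_exp_pairing (c : ℝ) (z : Fin n → ℂ) (ξ : Fin n → ℝ) :
    ‖Complex.exp (c * ∑ j, z j * ξ j)‖ = Real.exp (c * ∑ j, (z j).re * ξ j) := by
  rw [Complex.norm_exp]
  congr 1
  simp [Complex.re_sum]

/-- Growth in `t` is traded for growth in the centre `τ`: `1 + ‖t‖ ≤ (1 + ‖τ‖)(1 + ‖t - τ‖)`, and
the Gaussian absorbs the powers of `‖t - τ‖`. Keeping `τ` explicit is what later gives polynomial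
growth of the extension, through the choice `τ = t`. -/
theorem TubeGrowth.gauss_bound {V : Set (Fin n → ℝ)} {F : (Fin n → ℂ) → ℂ} (hg : TubeGrowth V F)
    {σ₀ : Fin n → ℝ} (hσ₀ : σ₀ ∈ V) : ∃ r > 0, ∃ C : ℝ, 0 ≤ C ∧ ∃ A : ℕ,
      ∀ σ ∈ Metric.ball σ₀ r, σ ∈ V → ∀ τ t : Fin n → ℝ,
        ‖F (vert σ t) * gaussAt τ (vert σ t)‖ ≤
          C * (1 + ‖τ‖) ^ A * ∏ j, (1 + (t j - τ j) ^ 2)⁻¹ := by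
  obtain ⟨r, hr, C, A, hC⟩ := hg σ₀ hσ₀
  obtain ⟨B, hB, hBle⟩ := exists_pow_mul_exp_neg_sq_le n A
  have hC0 : 0 ≤ C := by
    have := (norm_nonneg _).trans (hC σ₀ (Metric.mem_ball_self hr) hσ₀ 0)
    simpa using this
  set Q := Real.exp (∑ _j : Fin n, (‖σ₀‖ + r) ^ 2) with hQ
  refine ⟨r, hr, C * Q * B, by positivity, A, fun σ hσ hσV τ t => ?_⟩
  have h1 : Real.exp (∑ j, σ j ^ 2) ≤ Q := by
    refine Real.exp_le_exp.2 (Finset.sum_le_sum fun j _ => ?_)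
    have : |σ j| ≤ ‖σ₀‖ + r := by
      have h2 : ‖σ‖ ≤ ‖σ₀‖ + ‖σ - σ₀‖ := norm_le_norm_add_norm_sub' _ _
      have h3 : ‖σ - σ₀‖ < r := by simpa [dist_eq_norm] using hσ
      have h4 := norm_le_pi_norm σ j
      rw [Real.norm_eq_abs] at h4
      linarith
    rw [← sq_abs]
    gcongr
  have h2 : (1 + ‖t‖) ≤ (1 + ‖τ‖) * (1 + ‖t - τ‖) := by
    have : ‖t‖ ≤ ‖τ‖ + ‖t - τ‖ := norm_le_norm_add_norm_sub' _ _
    nlinarith [norm_nonneg τ, norm_nonneg (t - τ)]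
  have h3 := hBle (t - τ)
  simp only [Pi.sub_apply] at h3
  rw [norm_mul, norm_gaussAt_vert]
  calc ‖F (vert σ t)‖ * (Real.exp (∑ j, σ j ^ 2) * Real.exp (-∑ j, (t j - τ j) ^ 2))
      ≤ (C * ((1 + ‖τ‖) * (1 + ‖t - τ‖)) ^ A) * (Q * Real.exp (-∑ j, (t j - τ j) ^ 2)) := by
        gcongr
        exact (hC σ hσ hσV t).trans (by gcongr)
    _ = C * (1 + ‖τ‖) ^ A * Q * ((1 + ‖t - τ‖) ^ A * Real.exp (-∑ j, (t j - τ j) ^ 2)) := by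
        rw [mul_pow]; ring
    _ ≤ C * (1 + ‖τ‖) ^ A * Q * (B * ∏ j, (1 + (t j - τ j) ^ 2)⁻¹) := by gcongr
    _ = _ := by ring

variable {V : Set (Fin n → ℝ)} {F : (Fin n → ℂ) → ℂ}

/-- The integrand is the restriction of a holomorphic function of `z` with quadratic decay on the
fibres, so Cauchy's theorem in the tube applies. One transform therefore serves all abscissae in
`V`. -/
theorem laplaceAt_eq (hV : IsOpen V) (hVc : IsPreconnected V) (hF : DifferentiableOn ℂ F (tube V))
    (hg : TubeGrowth V F) (τ ξ : Fin n → ℝ) {σ₁ σ₂ : Fin n → ℝ} (h₁ : σ₁ ∈ V) (h₂ : σ₂ ∈ V) :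
    laplaceAt F σ₁ τ ξ = laplaceAt F σ₂ τ ξ := by
  refine integral_vert_eq_of_decay hV hVc
    (Φ := fun z => F z * gaussAt τ z * Complex.exp (-(2 * Real.pi) * ∑ j, z j * ξ j)) ?_ ?_ h₁ h₂
  · refine (hF.mul (differentiable_gaussAt τ).differentiableOn).mul ?_
    fun_prop
  · intro σ₀ hσ₀
    obtain ⟨r, hr, C, hC0, A, hC⟩ := hg.gauss_bound hσ₀
    set S := Real.exp (2 * Real.pi * ∑ j, (‖σ₀‖ + r) * |ξ j|) with hS
    refine ⟨r, hr, C * (1 + ‖τ‖) ^ A * (∏ _j : Fin n, (2 * (1 + ‖τ‖ ^ 2))) * S,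
      fun σ hσ hσV t => ?_⟩
    have h1 : ∏ j, (1 + (t j - τ j) ^ 2)⁻¹ ≤
        (∏ _j : Fin n, (2 * (1 + ‖τ‖ ^ 2))) * ∏ j, (1 + t j ^ 2)⁻¹ := by
      rw [← Finset.prod_mul_distrib]
      refine Finset.prod_le_prod (fun j _ => by positivity) fun j _ => ?_
      rw [sub_eq_add_neg]
      refine inv_one_add_sq_add_le ?_
      rw [abs_neg]
      exact norm_le_pi_norm τ j
    have h2 : ‖Complex.exp (-(2 * Real.pi) * ∑ j, vert σ t j * ξ j)‖ ≤ S := by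
      have := norm_exp_pairing (-(2 * Real.pi)) (vert σ t) ξ
      push_cast at this
      rw [this, hS]
      refine Real.exp_le_exp.2 ?_
      rw [neg_mul, ← mul_neg, ← Finset.sum_neg_distrib]
      refine mul_le_mul_of_nonneg_left (Finset.sum_le_sum fun j _ => ?_) (by positivity)
      have : |σ j| ≤ ‖σ₀‖ + r := by
        have h2 : ‖σ‖ ≤ ‖σ₀‖ + ‖σ - σ₀‖ := norm_le_norm_add_norm_sub' _ _
        have h3 : ‖σ - σ₀‖ < r := by simpa [dist_eq_norm] using hσ
        have h4 := norm_le_pi_norm σ j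
        rw [Real.norm_eq_abs] at h4
        linarith
      calc -((vert σ t j).re * ξ j) ≤ |σ j * ξ j| := by rw [vert_re]; exact neg_le_abs _
        _ ≤ (‖σ₀‖ + r) * |ξ j| := by rw [abs_mul]; gcongr
    rw [norm_mul]
    calc _ ≤ (C * (1 + ‖τ‖) ^ A * ((∏ _j : Fin n, (2 * (1 + ‖τ‖ ^ 2))) * ∏ j, (1 + t j ^ 2)⁻¹)) * S := by
          gcongr
          exact (hC σ hσ hσV τ t).trans (by gcongr)
      _ = _ := by ring

theorem integrable_prod_inv_one_add_sub_sq (τ : Fin n → ℝ) :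
    Integrable fun t : Fin n → ℝ => ∏ j, (1 + (t j - τ j) ^ 2)⁻¹ :=
  integrable_prod_inv_one_add_sq.comp_sub_right τ

/-- Exponential decay of the Fourier–Laplace transform at the abscissa `σ`. -/
def LaplaceDecay (h : (Fin n → ℝ) → (Fin n → ℝ) → ℂ) (σ : Fin n → ℝ) : Prop :=
  ∃ ρ > 0, ∃ C : ℝ, 0 ≤ C ∧ ∃ A : ℕ, ∀ τ ξ : Fin n → ℝ,
    ‖h τ ξ‖ ≤ C * (1 + ‖τ‖) ^ A * Real.exp (-(2 * Real.pi * ∑ j, σ j * ξ j + ρ * ∑ j, |ξ j|))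

/-- The abscissa may be moved from `σ` by `ε` in each coordinate, in the direction of the sign of
`ξ_j`. This does not change the integral and gains the factor `exp(-2π ε ∑ |ξ_j|)`. -/
theorem laplaceDecay_of_mem (hV : IsOpen V) (hVc : IsPreconnected V)
    (hF : DifferentiableOn ℂ F (tube V)) (hg : TubeGrowth V F) {σ₁ : Fin n → ℝ} (h₁ : σ₁ ∈ V)
    {σ : Fin n → ℝ} (hσ : σ ∈ V) : LaplaceDecay (laplaceAt F σ₁) σ := by
  obtain ⟨r, hr, C, hC0, A, hC⟩ := hg.gauss_bound hσ
  obtain ⟨r', hr', hsub⟩ := Metric.isOpen_iff.1 hV σ hσ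
  obtain ⟨ε, hεpos, hεr, hεr'⟩ : ∃ ε > 0, ε < r ∧ ε < r' :=
    ⟨min r r' / 2, by positivity,
      (half_lt_self (by positivity)).trans_le (min_le_left _ _),
      (half_lt_self (by positivity)).trans_le (min_le_right _ _)⟩
  obtain ⟨I, hI⟩ : ∃ I : ℝ, I = ∫ t : Fin n → ℝ, ∏ j, (1 + t j ^ 2)⁻¹ := ⟨_, rfl⟩
  have hI0 : 0 ≤ I := by
    rw [hI]
    exact integral_nonneg fun t => Finset.prod_nonneg fun j _ => by positivity
  refine ⟨2 * Real.pi * ε, by positivity, C * I, by positivity, A, fun τ ξ => ?_⟩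
  obtain ⟨σ', hdist, hσ'⟩ : ∃ σ' : Fin n → ℝ, dist σ' σ ≤ ε ∧
      ∀ j, σ' j * ξ j = σ j * ξ j + ε * |ξ j| := by
    refine ⟨fun j => σ j + ε * SignType.sign (ξ j), ?_, fun j => ?_⟩
    · refine (dist_pi_le_iff hεpos.le).2 fun j => ?_
      rw [Real.dist_eq]
      simp only [add_sub_cancel_left, abs_mul, abs_of_pos hεpos]
      refine mul_le_of_le_one_right hεpos.le ?_
      rcases lt_trichotomy (ξ j) 0 with h | h | h <;> simp [h]
    · have hs := sign_mul_self (ξ j)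
      linear_combination ε * hs
  have hσ'V : σ' ∈ V := hsub (Metric.mem_ball.2 (hdist.trans_lt hεr'))
  have hσ'b : σ' ∈ Metric.ball σ r := Metric.mem_ball.2 (hdist.trans_lt hεr)
  rw [laplaceAt_eq hV hVc hF hg τ ξ h₁ hσ'V, laplaceAt]
  obtain ⟨Ex, hEx⟩ : ∃ Ex, Ex = Real.exp (-(2 * Real.pi * ∑ j, σ j * ξ j +
    2 * Real.pi * ε * ∑ j, |ξ j|)) := ⟨_, rfl⟩
  rw [← hEx]
  have hnorm : ∀ t, ‖Complex.exp (-(2 * Real.pi) * ∑ j, vert σ' t j * ξ j)‖ = Ex := by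
    intro t
    have := norm_exp_pairing (-(2 * Real.pi)) (vert σ' t) ξ
    push_cast at this
    rw [this, hEx]
    congr 1
    rw [mul_assoc (2 * Real.pi) ε, ← mul_add, neg_mul, Finset.mul_sum (a := ε),
      ← Finset.sum_add_distrib]
    congr 2
    refine Finset.sum_congr rfl fun j _ => ?_
    rw [vert_re, hσ']
  have hEx0 : 0 ≤ Ex := by rw [hEx]; exact (Real.exp_pos _).le
  have hInt : Integrable fun t : Fin n → ℝ => C * (1 + ‖τ‖) ^ A * Ex *
      ∏ j, (1 + (t j - τ j) ^ 2)⁻¹ := (integrable_prod_inv_one_add_sub_sq τ).const_mul _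
  have hle : ∀ t : Fin n → ℝ, ‖F (vert σ' t) * gaussAt τ (vert σ' t) *
      Complex.exp (-(2 * Real.pi) * ∑ j, vert σ' t j * ξ j)‖ ≤ C * (1 + ‖τ‖) ^ A * Ex *
      ∏ j, (1 + (t j - τ j) ^ 2)⁻¹ := by
    intro t
    rw [norm_mul, hnorm]
    exact (mul_le_mul_of_nonneg_right (hC σ' hσ'b hσ'V τ t) hEx0).trans_eq (mul_right_comm _ _ _)
  have hval : ∫ t : Fin n → ℝ, C * (1 + ‖τ‖) ^ A * Ex * ∏ j, (1 + (t j - τ j) ^ 2)⁻¹ =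
      C * I * (1 + ‖τ‖) ^ A * Ex := by
    rw [integral_const_mul, hI, ← integral_sub_right_eq_self
      (fun t : Fin n → ℝ => ∏ j, (1 + t j ^ 2)⁻¹) τ]
    simp only [Pi.sub_apply]
    ring
  rw [← hval]
  exact norm_integral_le_of_norm_le hInt (ae_of_all _ hle)

/-- The heart of the tube theorem. Two bounds hold simultaneously for each `ξ`, so the better one
does; and the linear form `σ ↦ σ·ξ` at a convex combination never exceeds the larger of its two
values. Decay thus spreads to the convex hull although nothing is known to be holomorphic there. -/
theorem convex_laplaceDecay (h : (Fin n → ℝ) → (Fin n → ℝ) → ℂ) :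
    Convex ℝ {σ | LaplaceDecay h σ} := by
  rintro σ ⟨ρ, hρ, C, hC, A, hle⟩ σ' ⟨ρ', hρ', C', hC', A', hle'⟩ a b ha hb hab
  refine ⟨min ρ ρ', lt_min hρ hρ', max C C', le_max_of_le_left hC, max A A', fun τ ξ => ?_⟩
  set K := max C C' * (1 + ‖τ‖) ^ (max A A') with hK
  have hτ : (1 : ℝ) ≤ 1 + ‖τ‖ := by linarith [norm_nonneg τ]
  have hK0 : 0 ≤ K := by positivity
  set S := ∑ j, |ξ j| with hS
  have hS0 : 0 ≤ S := Finset.sum_nonneg fun j _ => abs_nonneg _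
  set x := 2 * Real.pi * ∑ j, σ j * ξ j with hx
  set y := 2 * Real.pi * ∑ j, σ' j * ξ j with hy
  have h1 : ‖h τ ξ‖ ≤ K * Real.exp (-(x + min ρ ρ' * S)) := by
    refine (hle τ ξ).trans ?_
    rw [hK]
    gcongr
    · exact le_max_left _ _
    · exact le_max_left _ _
    · exact min_le_left _ _
  have h2 : ‖h τ ξ‖ ≤ K * Real.exp (-(y + min ρ ρ' * S)) := by
    refine (hle' τ ξ).trans ?_
    rw [hK]
    gcongr
    · exact le_max_right _ _
    · exact le_max_right _ _
    · exact min_le_right _ _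
  have h3 : 2 * Real.pi * ∑ j, (a • σ + b • σ') j * ξ j = a * x + b * y := by
    rw [hx, hy, mul_left_comm a, mul_left_comm b, ← mul_add, Finset.mul_sum (a := a),
      Finset.mul_sum (a := b), ← Finset.sum_add_distrib]
    congr 1
    refine Finset.sum_congr rfl fun j _ => ?_
    simp only [Pi.add_apply, Pi.smul_apply, smul_eq_mul]
    ring
  rw [h3]
  have hb' : b = 1 - a := by linarith
  rcases le_total x y with hxy | hxy
  · refine h2.trans ?_
    gcongr
    rw [hb']
    nlinarith
  · refine h1.trans ?_
    gcongr
    rw [hb']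
    nlinarith

theorem exp_neg_mul_abs_le {ρ : ℝ} (hρ : 0 < ρ) (x : ℝ) :
    Real.exp (-(ρ * |x|)) ≤ (1 + 2 / ρ ^ 2) * (1 + x ^ 2)⁻¹ := by
  have h1 := Real.quadratic_le_exp_of_nonneg (x := ρ * |x|) (by positivity)
  have h2 : 1 ≤ Real.exp (ρ * |x|) := Real.one_le_exp (by positivity)
  have h3 : x ^ 2 ≤ 2 / ρ ^ 2 * Real.exp (ρ * |x|) := by
    rw [div_mul_eq_mul_div, le_div_iff₀ (by positivity)]
    have : (ρ * |x|) ^ 2 = x ^ 2 * ρ ^ 2 := by rw [mul_pow, sq_abs]; ring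
    nlinarith [mul_nonneg hρ.le (abs_nonneg x)]
  rw [Real.exp_neg, ← div_eq_mul_inv, inv_eq_one_div, div_le_div_iff₀ (by positivity) (by positivity)]
  nlinarith

theorem integrable_exp_neg_sum_abs {ρ : ℝ} (hρ : 0 < ρ) :
    Integrable fun ξ : Fin n → ℝ => Real.exp (-(ρ * ∑ j, |ξ j|)) := by
  have : (fun ξ : Fin n → ℝ => Real.exp (-(ρ * ∑ j, |ξ j|))) =
      fun ξ => ∏ j, Real.exp (-(ρ * |ξ j|)) := by
    funext ξ
    rw [← Real.exp_sum, Finset.sum_neg_distrib, Finset.mul_sum]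
  rw [this]
  refine Integrable.fintype_prod (f := fun (_ : Fin n) (x : ℝ) => Real.exp (-(ρ * |x|))) fun _ => ?_
  refine (integrable_inv_one_add_sq.const_mul (1 + 2 / ρ ^ 2)).mono'
    (by fun_prop) (ae_of_all _ fun x => ?_)
  rw [Real.norm_eq_abs, abs_of_pos (Real.exp_pos _)]
  exact exp_neg_mul_abs_le hρ x

/-- The inverse Fourier–Laplace transform, with the Gaussian removed. -/
noncomputable def laplaceInv (h : (Fin n → ℝ) → ℂ) (τ : Fin n → ℝ) (z : Fin n → ℂ) : ℂ :=
  (gaussAt τ z)⁻¹ * ∫ ξ : Fin n → ℝ, h ξ * Complex.exp ((2 * Real.pi) * ∑ j, z j * ξ j)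

/-- A deviation of `ρ/(4π)` in each real part costs at most half of the exponential decay `ρ`; the
other half keeps the inverse transform convergent. -/
theorem laplace_term_bound {h : (Fin n → ℝ) → (Fin n → ℝ) → ℂ} {σ₀ τ : Fin n → ℝ} {ρ C : ℝ} {A : ℕ}
    (hρ : 0 < ρ) (hC : 0 ≤ C) (hle : ∀ τ ξ : Fin n → ℝ, ‖h τ ξ‖ ≤ C * (1 + ‖τ‖) ^ A *
      Real.exp (-(2 * Real.pi * ∑ j, σ₀ j * ξ j + ρ * ∑ j, |ξ j|)))
    {z : Fin n → ℂ} (hz : ∀ j, |(z j).re - σ₀ j| ≤ ρ / (4 * Real.pi)) (ξ : Fin n → ℝ) :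
    ‖h τ ξ * Complex.exp ((2 * Real.pi) * ∑ j, z j * ξ j)‖ ≤
      C * (1 + ‖τ‖) ^ A * Real.exp (-(ρ / 2 * ∑ j, |ξ j|)) := by
  have h1 := norm_exp_pairing (2 * Real.pi) z ξ
  push_cast at h1
  rw [norm_mul, h1]
  calc _ ≤ C * (1 + ‖τ‖) ^ A * Real.exp (-(2 * Real.pi * ∑ j, σ₀ j * ξ j + ρ * ∑ j, |ξ j|)) *
        Real.exp (2 * Real.pi * ∑ j, (z j).re * ξ j) := by
          gcongr
          exact hle τ ξ
    _ = C * (1 + ‖τ‖) ^ A * Real.exp (-(2 * Real.pi * ∑ j, σ₀ j * ξ j + ρ * ∑ j, |ξ j|) +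
        2 * Real.pi * ∑ j, (z j).re * ξ j) := by rw [mul_assoc, ← Real.exp_add]
    _ ≤ _ := by
      gcongr
      have h2 : 2 * Real.pi * ∑ j, ((z j).re - σ₀ j) * ξ j ≤ ρ / 2 * ∑ j, |ξ j| := by
        rw [Finset.mul_sum, Finset.mul_sum]
        refine Finset.sum_le_sum fun j _ => ?_
        calc 2 * Real.pi * (((z j).re - σ₀ j) * ξ j) ≤ 2 * Real.pi * (ρ / (4 * Real.pi) * |ξ j|) := by
              refine mul_le_mul_of_nonneg_left ((le_abs_self _).trans ?_) (by positivity)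
              rw [abs_mul]
              exact mul_le_mul_of_nonneg_right (hz j) (abs_nonneg _)
          _ = ρ / 2 * |ξ j| := by
              have := Real.pi_pos.ne'
              field_simp
              ring
      simp only [sub_mul, Finset.sum_sub_distrib, mul_sub] at h2
      linarith

theorem differentiableOn_laplaceInv {h : (Fin n → ℝ) → (Fin n → ℝ) → ℂ} {W : Set (Fin n → ℝ)}
    (hW : IsOpen W) (hd : ∀ σ ∈ W, LaplaceDecay h σ) (τ : Fin n → ℝ)
    (hm : AEStronglyMeasurable (h τ) volume) :
    DifferentiableOn ℂ (laplaceInv (h τ) τ) (tube W) := by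
  unfold laplaceInv
  refine DifferentiableOn.mul ?_ ?_
  · exact ((differentiable_gaussAt τ).inv (gaussAt_ne_zero τ)).differentiableOn
  · refine differentiableOn_integral_of_locally_dominated (isOpen_tube hW) ?_ ?_ ?_
    · intro z _
      exact hm.mul (Continuous.aestronglyMeasurable (by fun_prop))
    · intro ξ
      fun_prop
    · intro z₀ hz₀
      obtain ⟨ρ, hρ, C, hC, A, hle⟩ := hd _ hz₀
      refine ⟨ρ / (4 * Real.pi), by positivity, fun ξ => C * (1 + ‖τ‖) ^ A *
        Real.exp (-(ρ / 2 * ∑ j, |ξ j|)), (integrable_exp_neg_sum_abs (by positivity)).const_mul _, ?_⟩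
      intro z hz _ ξ
      refine laplace_term_bound hρ hC hle (fun j => ?_) ξ
      rw [← Complex.sub_re]
      refine (Complex.abs_re_le_norm _).trans ((norm_le_pi_norm (z - z₀) j).trans ?_)
      rw [Metric.mem_ball, dist_eq_norm] at hz
      exact hz.le

/-- The Gaussian is centred at the height of the point itself, where its modulus is `exp(∑ σ_j²) ≥
1`, so dividing by it costs nothing. -/
theorem norm_laplaceInv_le {h : (Fin n → ℝ) → (Fin n → ℝ) → ℂ} {σ₀ : Fin n → ℝ}
    (hd : LaplaceDecay h σ₀) : ∃ r > 0, ∃ C : ℝ, ∃ A : ℕ, ∀ σ ∈ Metric.ball σ₀ r, ∀ t,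
      ‖laplaceInv (h t) t (vert σ t)‖ ≤ C * (1 + ‖t‖) ^ A := by
  obtain ⟨ρ, hρ, C, hC, A, hle⟩ := hd
  refine ⟨ρ / (4 * Real.pi), by positivity,
    C * ∫ ξ : Fin n → ℝ, Real.exp (-(ρ / 2 * ∑ j, |ξ j|)), A, fun σ hσ t => ?_⟩
  rw [laplaceInv, norm_mul, norm_inv, norm_gaussAt_vert]
  have h1 : (Real.exp (∑ j, σ j ^ 2) * Real.exp (-∑ j, (t j - t j) ^ 2))⁻¹ ≤ 1 := by
    refine inv_le_one_of_one_le₀ ?_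
    simp only [sub_self, ne_eq, OfNat.ofNat_ne_zero, not_false_eq_true, zero_pow,
      Finset.sum_const_zero, neg_zero, Real.exp_zero, mul_one]
    exact Real.one_le_exp (Finset.sum_nonneg fun j _ => sq_nonneg _)
  have h2 : ‖∫ ξ : Fin n → ℝ, h t ξ * Complex.exp ((2 * Real.pi) * ∑ j, vert σ t j * ξ j)‖ ≤
      ∫ ξ : Fin n → ℝ, C * (1 + ‖t‖) ^ A * Real.exp (-(ρ / 2 * ∑ j, |ξ j|)) := by
    refine norm_integral_le_of_norm_le
      ((integrable_exp_neg_sum_abs (by positivity)).const_mul _) (ae_of_all _ fun ξ => ?_)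
    refine laplace_term_bound hρ hC hle (fun j => ?_) ξ
    rw [vert_re]
    have := norm_le_pi_norm (σ - σ₀) j
    rw [Metric.mem_ball, dist_eq_norm] at hσ
    exact this.trans hσ.le
  calc _ ≤ 1 * ∫ ξ : Fin n → ℝ, C * (1 + ‖t‖) ^ A * Real.exp (-(ρ / 2 * ∑ j, |ξ j|)) := by
        gcongr
    _ = _ := by rw [one_mul, integral_const_mul]; ring

theorem aestronglyMeasurable_laplaceAt (hF : DifferentiableOn ℂ F (tube V)) {σ : Fin n → ℝ}
    (hσ : σ ∈ V) (τ : Fin n → ℝ) : AEStronglyMeasurable (laplaceAt F σ τ) volume := by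
  refine StronglyMeasurable.aestronglyMeasurable (StronglyMeasurable.integral_prod_right ?_)
  refine Continuous.stronglyMeasurable ?_
  have hv : Continuous fun p : (Fin n → ℝ) × (Fin n → ℝ) => vert σ p.2 := by unfold vert; fun_prop
  have h1 : Continuous fun p : (Fin n → ℝ) × (Fin n → ℝ) => F (vert σ p.2) :=
    hF.continuousOn.comp_continuous hv fun p => vert_mem_tube.2 hσ
  have h2 : Continuous fun p : (Fin n → ℝ) × (Fin n → ℝ) => gaussAt τ (vert σ p.2) :=
    (differentiable_gaussAt τ).continuous.comp hv
  have h3 : Continuous fun p : (Fin n → ℝ) × (Fin n → ℝ) =>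
      Complex.exp (-(2 * Real.pi) * ∑ j, vert σ p.2 j * p.1 j) := by unfold vert; fun_prop
  exact (h1.mul h2).mul h3

/-- Along the fibre over `σ`, the transform times `exp(2π σ·ξ)` is the ordinary Fourier transform of
`F` times the Gaussian, and Fourier inversion recovers that product. -/
theorem laplaceInv_laplaceAt (hV : IsOpen V) (hVc : IsPreconnected V)
    (hF : DifferentiableOn ℂ F (tube V)) (hg : TubeGrowth V F) {σ₁ : Fin n → ℝ} (h₁ : σ₁ ∈ V)
    (τ : Fin n → ℝ) {z : Fin n → ℂ} (hz : z ∈ tube V) :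
    laplaceInv (laplaceAt F σ₁ τ) τ z = F z := by
  set σ : Fin n → ℝ := fun j => (z j).re with hσ
  set t : Fin n → ℝ := fun j => (z j).im with ht
  have hzv : z = vert σ t := (vert_re_im z).symm
  have hσV : σ ∈ V := hz
  set f : (Fin n → ℝ) → ℂ := fun u => F (vert σ u) * gaussAt τ (vert σ u) with hf
  have hv : Continuous fun u : Fin n → ℝ => vert σ u := by unfold vert; fun_prop
  have hfc : Continuous f :=
    (hF.continuousOn.comp_continuous hv fun p => vert_mem_tube.2 hσV).mul
      ((differentiable_gaussAt τ).continuous.comp hv)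
  have hfi : Integrable f := by
    obtain ⟨r, hr, C, hC0, A, hC⟩ := hg.gauss_bound hσV
    exact ((integrable_prod_inv_one_add_sub_sq τ).const_mul _).mono' hfc.aestronglyMeasurable
      (ae_of_all _ fun u => hC σ (Metric.mem_ball_self hr) hσV τ u)
  have hsplit : ∀ u ξ : Fin n → ℝ, ∑ j, vert σ u j * (ξ j : ℂ) =
      ∑ j, (σ j : ℂ) * ξ j + Complex.I * ∑ j, (u j : ℂ) * ξ j := by
    intro u ξ
    rw [Finset.mul_sum, ← Finset.sum_add_distrib]
    refine Finset.sum_congr rfl fun j _ => ?_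
    simp only [vert]; ring
  have hlap : ∀ ξ : Fin n → ℝ, laplaceAt F σ₁ τ ξ * Complex.exp ((2 * Real.pi) * ∑ j, (σ j : ℂ) * ξ j) =
      ∫ u : Fin n → ℝ, f u * Complex.exp (-(2 * Real.pi * Complex.I) * ∑ j, (u j : ℂ) * ξ j) := by
    intro ξ
    rw [laplaceAt_eq hV hVc hF hg τ ξ h₁ hσV, laplaceAt, ← integral_mul_const]
    congr 1
    funext u
    rw [mul_assoc, ← Complex.exp_add, hsplit]
    congr 2
    ring
  have hfh : Integrable fun ξ : Fin n → ℝ => ∫ u : Fin n → ℝ,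
      f u * Complex.exp (-(2 * Real.pi * Complex.I) * ∑ j, (u j : ℂ) * ξ j) := by
    simp_rw [← hlap]
    obtain ⟨ρ, hρ, C, hC, A, hle⟩ := laplaceDecay_of_mem hV hVc hF hg h₁ hσV
    refine ((integrable_exp_neg_sum_abs (half_pos hρ)).const_mul (C * (1 + ‖τ‖) ^ A)).mono'
      ((aestronglyMeasurable_laplaceAt hF h₁ τ).mul (Continuous.aestronglyMeasurable (by fun_prop))) (ae_of_all _ fun ξ => ?_)
    exact laplace_term_bound hρ hC hle (z := fun j => (σ j : ℂ))
      (fun j => by simp; positivity) ξ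
  have hinv := fourier_inversion_pi hfc hfi hfh t
  have hgn := gaussAt_ne_zero τ z
  rw [laplaceInv, inv_mul_eq_iff_eq_mul₀ hgn, mul_comm (gaussAt τ z)]
  have : f t = F z * gaussAt τ z := by simp only [hf, ← hzv]
  rw [← this, ← hinv]
  congr 1
  funext ξ
  rw [← hlap, mul_assoc (laplaceAt F σ₁ τ ξ), ← Complex.exp_add, hzv, hsplit]
  congr 2
  ring

/-- Bochner's tube theorem for functions of polynomial growth: a holomorphic function on a
connected tube extends to the convex hull of the tube, with polynomial growth. -/
theorem exists_extension_convexHull_tube (hV : IsOpen V) (hVc : IsConnected V)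
    (hF : DifferentiableOn ℂ F (tube V)) (hg : TubeGrowth V F) :
    ∃ G : (Fin n → ℂ) → ℂ, DifferentiableOn ℂ G (tube (convexHull ℝ V)) ∧
      Set.EqOn G F (tube V) ∧ TubeGrowth (convexHull ℝ V) G := by
  obtain ⟨σ₁, h₁⟩ := hVc.nonempty
  have hVp := hVc.isPreconnected
  have hW : IsOpen (convexHull ℝ V) := hV.convexHull
  have hdec : ∀ σ ∈ convexHull ℝ V, LaplaceDecay (laplaceAt F σ₁) σ := fun σ hσ =>
    convexHull_min (fun v hv => laplaceDecay_of_mem hV hVp hF hg h₁ hv)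
      (convex_laplaceDecay _) hσ
  have hdiff : ∀ τ, DifferentiableOn ℂ (laplaceInv (laplaceAt F σ₁ τ) τ) (tube (convexHull ℝ V)) :=
    fun τ => differentiableOn_laplaceInv hW hdec τ (aestronglyMeasurable_laplaceAt hF h₁ τ)
  have hsub : tube V ⊆ tube (convexHull ℝ V) := fun z hz => subset_convexHull ℝ V hz
  have hEq : ∀ τ, Set.EqOn (laplaceInv (laplaceAt F σ₁ τ) τ) F (tube V) := fun τ z hz =>
    laplaceInv_laplaceAt hV hVp hF hg h₁ τ hz
  have hz₁ : vert σ₁ 0 ∈ tube V := vert_mem_tube.2 h₁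
  -- All centres `τ` give the same extension, by the identity theorem starting from the tube over
  -- `V`. So `τ = 0` can serve to define it and `τ = t` to bound it at height `t`.
  have hind : ∀ τ, Set.EqOn (laplaceInv (laplaceAt F σ₁ 0) 0) (laplaceInv (laplaceAt F σ₁ τ) τ)
      (tube (convexHull ℝ V)) := fun τ =>
    eqOn_of_convex_of_eventuallyEq (isOpen_tube hW) (convex_tube (convex_convexHull ℝ V)) (hdiff 0)
      (hdiff τ) (hsub hz₁) (by
        filter_upwards [(isOpen_tube hV).mem_nhds hz₁] with z hz
        rw [hEq 0 hz, hEq τ hz])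
  refine ⟨laplaceInv (laplaceAt F σ₁ 0) 0, hdiff 0, hEq 0, fun σ₀ hσ₀ => ?_⟩
  obtain ⟨r, hr, C, A, hle⟩ := norm_laplaceInv_le (hdec σ₀ hσ₀)
  refine ⟨r, hr, C, A, fun σ hσ hσV t => ?_⟩
  rw [hind t (vert_mem_tube.2 hσV)]
  exact hle σ hσ t

end TubeTheorem

end QuadraticMoments

namespace QuadraticMoments

open Filter Topology

/-! ### Evaluation of the quadratic Gauss sum, sign included, by theta functions. -/

section QuadraticGaussSum

open Complex

theorem summable_exp_neg_pi_sq : Summable fun n : ℤ => Real.exp (-Real.pi * (n : ℝ) ^ 2) := by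
  have := summable_pow_mul_jacobiTheta₂_term_bound 0 one_pos 0
  simpa using this

theorem norm_exp_theta_term (c : ℂ) (x : ℝ) (n : ℤ) :
    ‖exp (-Real.pi * c * n ^ 2 + 2 * Real.pi * (-I * x) * n)‖ =
      Real.exp (-Real.pi * c.re * (n : ℝ) ^ 2) := by
  rw [Complex.norm_exp]
  congr 1
  have h1 : (2 * (Real.pi : ℂ) * (-I * x) * n) = ((-(2 * Real.pi * x * n) : ℝ) : ℂ) * I := by
    push_cast; ring
  have h2 : (-(Real.pi : ℂ) * c * n ^ 2) = ((-Real.pi * (n : ℝ) ^ 2 : ℝ) : ℂ) * c := by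
    push_cast; ring
  rw [h1, h2, add_re, re_ofReal_mul, re_ofReal_mul, I_re]
  ring

theorem exp_theta_le {y : ℝ} (hy : 1 ≤ y) (n : ℤ) (hn : n ≠ 0) :
    Real.exp (-Real.pi * y * (n : ℝ) ^ 2) ≤
      Real.exp (-Real.pi * (y - 1)) * Real.exp (-Real.pi * (n : ℝ) ^ 2) := by
  rw [← Real.exp_add]
  refine Real.exp_le_exp.2 ?_
  have h1 : (1 : ℝ) ≤ (n : ℝ) ^ 2 := by
    have : (1 : ℤ) ≤ n ^ 2 := by
      have := sq_pos_of_ne_zero hn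
      omega
    exact_mod_cast this
  nlinarith [mul_nonneg Real.pi_pos.le (mul_nonneg (sub_nonneg.2 hy) (sub_nonneg.2 h1))]

theorem summable_theta_term {c : ℂ} (hc : 1 ≤ c.re) (x : ℝ) :
    Summable fun n : ℤ => exp (-Real.pi * c * n ^ 2 + 2 * Real.pi * (-I * x) * n) := by
  refine Summable.of_norm_bounded summable_exp_neg_pi_sq fun n => ?_
  rw [norm_exp_theta_term]
  refine Real.exp_le_exp.2 ?_
  nlinarith [mul_nonneg Real.pi_pos.le (mul_nonneg (sub_nonneg.2 hc) (sq_nonneg (n : ℝ)))]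

/-- The dual theta series tends to its constant term as `Re c → ∞`. -/
theorem tendsto_theta_one {α : Type*} {l : Filter α} {c : α → ℂ}
    (hc : Tendsto (fun a => (c a).re) l atTop) (x : ℝ) :
    Tendsto (fun a => ∑' n : ℤ, exp (-Real.pi * c a * n ^ 2 + 2 * Real.pi * (-I * x) * n))
      l (𝓝 1) := by
  set S := ∑' n : ℤ, Real.exp (-Real.pi * (n : ℝ) ^ 2) with hS
  rw [tendsto_iff_norm_sub_tendsto_zero]
  have hlim : Tendsto (fun a => Real.exp (-Real.pi * ((c a).re - 1)) * S) l (𝓝 0) := by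
    rw [← zero_mul S]
    refine Tendsto.mul_const _ (Real.tendsto_exp_atBot.comp ?_)
    have : Tendsto (fun a => (c a).re - 1) l atTop := tendsto_atTop_add_const_right _ _ hc
    exact this.const_mul_atTop_of_neg (neg_lt_zero.2 Real.pi_pos)
  refine squeeze_zero' (Eventually.of_forall fun _ => norm_nonneg _) ?_ hlim
  filter_upwards [hc.eventually_ge_atTop 1] with a ha
  have h1 : (1 : ℂ) = ∑' n : ℤ, if n = 0 then 1 else 0 := by rw [tsum_ite_eq]
  have hs1 : Summable fun n : ℤ => if n = 0 then (1 : ℂ) else 0 :=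
    summable_of_ne_finset_zero (s := {0}) (by simp)
  rw [h1, ← (summable_theta_term ha x).tsum_sub hs1, hS, ← tsum_mul_left]
  refine tsum_of_norm_bounded (summable_exp_neg_pi_sq.mul_left _).hasSum fun n => ?_
  rcases eq_or_ne n 0 with rfl | hn
  · simp; positivity
  · simp only [hn, if_false, sub_zero]
    rw [norm_exp_theta_term]
    exact exp_theta_le ha n hn

/-- Poisson summation: the shift `x` becomes a phase in the dual sum. It is used as `Re c → ∞`,
where the dual sum tends to `1` and `c^(1/2)` is the leading behaviour. -/
theorem tsum_shifted_gaussian {c : ℂ} (hc : 0 < c.re) (x : ℝ) :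
    ∑' m : ℤ, exp (-Real.pi / c * (m + x) ^ 2) = c ^ (1 / 2 : ℂ) *
      ∑' n : ℤ, exp (-Real.pi * c * n ^ 2 + 2 * Real.pi * (-I * x) * n) := by
  have hc0 : c ≠ 0 := fun h => by simp [h] at hc
  rw [Complex.tsum_exp_neg_quadratic hc (-I * x)]
  rw [← mul_assoc, mul_one_div_cancel (by simp [cpow_eq_zero_iff, hc0]), one_mul]
  congr 1
  funext m
  congr 3
  rw [← mul_assoc, mul_neg, I_mul_I, neg_neg, one_mul]

/-- A sum over `ℤ` split by residue classes. -/
theorem tsum_int_eq_sum_range (N : ℕ) [NeZero N] {f : ℤ → ℂ} (hf : Summable f) :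
    ∑' n, f n = ∑ r ∈ Finset.range N, ∑' m : ℤ, f (N * m + r) := by
  have h1 := (Int.divModEquiv N).symm.tsum_eq f
  have hs : Summable fun p : ℤ × Fin N => f ((Int.divModEquiv N).symm p) :=
    (Int.divModEquiv N).symm.summable_iff.2 hf
  have hs' : Summable fun p : Fin N × ℤ => f ((Int.divModEquiv N).symm p.swap) :=
    (Equiv.prodComm _ _).summable_iff.2 hs
  rw [← h1, ← (Equiv.prodComm (Fin N) ℤ).tsum_eq]
  simp only [Equiv.prodComm_apply]
  rw [hs'.tsum_prod, tsum_fintype, Finset.sum_range]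
  refine Finset.sum_congr rfl fun r _ => ?_
  congr 1
  funext m
  congr 1
  simp [Int.divModEquiv]
  ring

/-- Gauss sum reciprocity: the evaluation of `∑ e(r²/N)`, by comparing the behaviour of the
theta function at the cusps `2/N` and `-N/2`. -/
theorem gauss_sum_mul_eq (N : ℕ) [NeZero N] :
    (∑ r ∈ Finset.range N, exp (2 * Real.pi * I * r ^ 2 / N)) * (1 / (I * N / 2)) ^ (1 / 2 : ℂ) =
      1 + exp (-Real.pi * I * N / 2) := by
  have hN0 : (N : ℂ) ≠ 0 := NeZero.ne _
  have hNpos : (0 : ℝ) < N := by exact_mod_cast Nat.pos_of_ne_zero (NeZero.ne N)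
  -- The theta transformation is used at `a = 1/(u + iN/2)` as `u → 0+`. On one side `a` approaches
  -- `-2i/N`; splitting modulo `N` leaves Gaussians with `N²(a + 2i/N) = 1/c`. On the other side
  -- `1/a = u + iN/2`; splitting modulo `2` leaves Gaussians with `4u = 1/c'`.
  set a : ℝ → ℂ := fun u => 1 / (u + I * N / 2) with ha
  set c : ℝ → ℂ := fun u => 1 / (4 * u) - I / (2 * N) with hc
  set c' : ℝ → ℂ := fun u => 1 / (4 * u) with hc'
  have hcre : ∀ u, (c u).re = 1 / (4 * u) := by
    intro u
    have h : c u = ((1 / (4 * u) : ℝ) : ℂ) + ((-(1 / (2 * N)) : ℝ) : ℂ) * I := by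
      simp only [hc]; push_cast; ring
    rw [h, add_re, ofReal_re, re_ofReal_mul, I_re]; ring
  have hcre' : ∀ u, (c' u).re = 1 / (4 * u) := by
    intro u
    have h : c' u = ((1 / (4 * u) : ℝ) : ℂ) := by simp only [hc']; push_cast; ring
    rw [h, ofReal_re]
  have hden : ∀ u : ℝ, 0 < u → (u + I * N / 2 : ℂ) ≠ 0 := by
    intro u hu h
    have := congrArg re h
    simp at this
    linarith
  have hare : ∀ u : ℝ, 0 < u → 0 < (a u).re := by
    intro u hu
    simp only [ha, one_div, inv_re]
    have h1 : (u + I * N / 2 : ℂ).re = u := by simp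
    rw [h1]
    exact div_pos hu (normSq_pos.2 (hden u hu))
  have hid : ∀ u : ℝ, 0 < u →
      (∑ r ∈ Finset.range N, exp (2 * Real.pi * I * r ^ 2 / N) *
        ∑' n : ℤ, exp (-Real.pi * c u * n ^ 2 + 2 * Real.pi * (-I * ((r / N : ℝ))) * n)) *
        ((1 - 2 * I * u / N) ^ (1 / 2 : ℂ) * (a u) ^ (1 / 2 : ℂ)) =
      ∑ r ∈ Finset.range 2, exp (-Real.pi * I * N * r ^ 2 / 2) *
        ∑' n : ℤ, exp (-Real.pi * c' u * n ^ 2 + 2 * Real.pi * (-I * ((r / 2 : ℝ))) * n) := by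
    intro u hu
    have hu0 : (u : ℂ) ≠ 0 := ofReal_ne_zero.2 hu.ne'
    have h4u : (0 : ℝ) < 1 / (4 * u) := by positivity
    have hcpos : 0 < (c u).re := by rw [hcre]; exact h4u
    have hcpos' : 0 < (c' u).re := by rw [hcre']; exact h4u
    have ha0 : a u ≠ 0 := fun h => by have := hare u hu; simp [h] at this
    have hc0 : c u ≠ 0 := fun h => by simp [h] at hcpos
    have hc0' : c' u ≠ 0 := fun h => by simp [h] at hcpos'
    have hainv : 1 / a u = u + I * N / 2 := by simp [ha]
    have key := Complex.tsum_exp_neg_quadratic (hare u hu) 0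
    simp only [mul_zero, zero_mul, add_zero] at key
    have hsum : ∀ {b : ℂ}, 0 < b.re → Summable fun n : ℤ => exp (-Real.pi * b * n ^ 2) := by
      intro b hb
      have := summable_pow_mul_jacobiTheta₂_term_bound 0 hb 0
      refine Summable.of_norm_bounded this fun n => ?_
      have h := norm_exp_theta_term b 0 n
      simp only [ofReal_zero, mul_zero, zero_mul, add_zero] at h
      rw [h]
      simp only [pow_zero, one_mul, mul_zero, zero_mul, sub_zero]
      exact le_of_eq (by ring_nf)
    have hbre : 0 < (1 / a u).re := by rw [hainv]; simpa using hu
    have hL : ∑' n : ℤ, exp (-Real.pi * a u * n ^ 2) = (c u) ^ (1 / 2 : ℂ) *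
        ∑ r ∈ Finset.range N, exp (2 * Real.pi * I * r ^ 2 / N) *
        ∑' n : ℤ, exp (-Real.pi * c u * n ^ 2 + 2 * Real.pi * (-I * ((r / N : ℝ))) * n) := by
      rw [tsum_int_eq_sum_range N (hsum (hare u hu)), Finset.mul_sum]
      refine Finset.sum_congr rfl fun r _ => ?_
      rw [mul_left_comm, ← tsum_shifted_gaussian hcpos, ← tsum_mul_left]
      congr 1
      funext m
      rw [← exp_add, exp_eq_exp_iff_exists_int]
      -- `(Nm + r)²/N` differs from `r²/N` by the integer `N m² + 2 m r`, so the phase depends only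
      -- on the residue class.
      refine ⟨N * m ^ 2 + 2 * m * r, ?_⟩
      have hcinv : (N : ℂ) ^ 2 * (a u + 2 * I / N) = 1 / c u := by
        have h1 : c u = (N - 2 * I * u) / (4 * u * N) := by
          simp only [hc]; field_simp; ring
        have h2 : (N - 2 * I * u : ℂ) ≠ 0 := by
          intro h
          rw [h1, h, zero_div] at hc0
          exact hc0 rfl
        have h3 : (2 * u + I * N : ℂ) ≠ 0 := by
          intro h
          apply hden u hu
          linear_combination h / 2
        have h4 : a u = 2 / (2 * u + I * N) := by
          simp only [ha]
          rw [div_eq_div_iff (hden u hu) h3]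
          ring
        rw [h1, one_div_div, h4]
        have hI : I ^ 2 = -1 := I_sq
        rw [div_add_div _ _ h3 hN0, mul_div_assoc', div_eq_div_iff (mul_ne_zero h3 hN0) h2]
        linear_combination (2 * (N : ℂ) ^ 3 * (N - 2 * I * u) - 8 * u ^ 2 * N ^ 2) * hI
      have h5 : -(Real.pi : ℂ) / c u * (m + ((r / N : ℝ) : ℂ)) ^ 2 =
          -Real.pi * (1 / c u) * (m + ((r / N : ℝ) : ℂ)) ^ 2 := by ring
      rw [h5, ← hcinv]
      push_cast
      field_simp
      ring
    have hR : ∑' n : ℤ, exp (-Real.pi / a u * n ^ 2) = (c' u) ^ (1 / 2 : ℂ) *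
        ∑ r ∈ Finset.range 2, exp (-Real.pi * I * N * r ^ 2 / 2) *
        ∑' n : ℤ, exp (-Real.pi * c' u * n ^ 2 + 2 * Real.pi * (-I * ((r / 2 : ℝ))) * n) := by
      have e1 : (fun n : ℤ => exp (-Real.pi / a u * n ^ 2)) =
          fun n : ℤ => exp (-Real.pi * (1 / a u) * n ^ 2) := by
        funext n; congr 1; ring
      rw [e1, tsum_int_eq_sum_range 2 (hsum hbre), Finset.mul_sum]
      refine Finset.sum_congr rfl fun r _ => ?_
      rw [mul_left_comm, ← tsum_shifted_gaussian hcpos', ← tsum_mul_left]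
      congr 1
      funext m
      rw [← exp_add, exp_eq_exp_iff_exists_int]
      refine ⟨-(N * (m ^ 2 + m * r)), ?_⟩
      rw [hainv]
      simp only [hc']
      push_cast
      field_simp
      ring
    -- No branch problem: `c = c' (1 - 2iu/N)` with `c'` positive, so the principal roots multiply.
    have hcc : (c u) ^ (1 / 2 : ℂ) = (c' u) ^ (1 / 2 : ℂ) * (1 - 2 * I * u / N) ^ (1 / 2 : ℂ) := by
      have h1 : c u = ((1 / (4 * u) : ℝ) : ℂ) * (1 - 2 * I * u / N) := by
        simp only [hc]; push_cast; field_simp; ring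
      have h2 : (1 - 2 * I * u / N : ℂ) ≠ 0 := by
        intro h
        rw [h1, h, mul_zero] at hc0
        exact hc0 rfl
      have h3 : c' u = ((1 / (4 * u) : ℝ) : ℂ) := by simp only [hc']; push_cast; ring
      rw [cpow_def_of_ne_zero hc0, cpow_def_of_ne_zero hc0', cpow_def_of_ne_zero h2, ← exp_add,
        h1, log_ofReal_mul h4u h2, h3, ofReal_log h4u.le]
      congr 1
      ring
    rw [hL, hR, hcc] at key
    have hp : (c' u) ^ (1 / 2 : ℂ) ≠ 0 := by simp [cpow_eq_zero_iff, hc0']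
    have hp' : (a u) ^ (1 / 2 : ℂ) ≠ 0 := by simp [cpow_eq_zero_iff, ha0]
    apply mul_left_cancel₀ hp
    rw [one_div_mul_eq_div, eq_div_iff hp'] at key
    linear_combination key
  have hcl : Tendsto (fun u : ℝ => 1 / (4 * u)) (𝓝[>] 0) atTop := by
    have : (fun u : ℝ => 1 / (4 * u)) = fun u => (1 / 4) * u⁻¹ := by
      funext u; rw [one_div, mul_inv]; ring
    rw [this]
    exact tendsto_inv_nhdsGT_zero.const_mul_atTop (by norm_num)
  have hLlim : Tendsto (fun u : ℝ => (∑ r ∈ Finset.range N, exp (2 * Real.pi * I * r ^ 2 / N) *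
        ∑' n : ℤ, exp (-Real.pi * c u * n ^ 2 + 2 * Real.pi * (-I * ((r / N : ℝ))) * n)) *
        ((1 - 2 * I * u / N) ^ (1 / 2 : ℂ) * (a u) ^ (1 / 2 : ℂ))) (𝓝[>] 0)
      (𝓝 ((∑ r ∈ Finset.range N, exp (2 * Real.pi * I * r ^ 2 / N) * 1) *
        (1 * (1 / (I * N / 2)) ^ (1 / 2 : ℂ)))) := by
    refine Tendsto.mul ?_ (Tendsto.mul ?_ ?_)
    · refine tendsto_finsetSum _ fun r _ => tendsto_const_nhds.mul (tendsto_theta_one ?_ _)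
      simp_rw [hcre]
      exact hcl
    · have : ContinuousAt (fun u : ℝ => (1 - 2 * I * u / N : ℂ) ^ (1 / 2 : ℂ)) 0 := by
        refine ContinuousAt.cpow (by fun_prop) continuousAt_const ?_
        simp
      have h := this.tendsto
      simp only [ofReal_zero, mul_zero, zero_div, sub_zero, one_cpow] at h
      exact h.mono_left nhdsWithin_le_nhds
    · have hne : (I * N / 2 : ℂ) ≠ 0 := by simp [hN0]
      have : ContinuousAt (fun u : ℝ => (a u) ^ (1 / 2 : ℂ)) 0 := by
        refine ContinuousAt.cpow ?_ continuousAt_const ?_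
        · simp only [ha]
          exact continuousAt_const.div (by fun_prop) (by simpa using hN0)
        · simp only [ha, ofReal_zero, zero_add, mem_slitPlane_iff]
          right
          have : (1 / (I * N / 2) : ℂ) = ((-(2 / N) : ℝ) : ℂ) * I := by
            push_cast
            field_simp
            rw [I_sq]
            ring
          rw [this, im_ofReal_mul, I_im]
          have : (0 : ℝ) < 2 / N := by positivity
          linarith
      have h := this.tendsto
      simp only [ha, ofReal_zero, zero_add] at h
      exact h.mono_left nhdsWithin_le_nhds
  have hRlim : Tendsto (fun u : ℝ => ∑ r ∈ Finset.range 2, exp (-Real.pi * I * N * r ^ 2 / 2) *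
        ∑' n : ℤ, exp (-Real.pi * c' u * n ^ 2 + 2 * Real.pi * (-I * ((r / 2 : ℝ))) * n)) (𝓝[>] 0)
      (𝓝 (∑ r ∈ Finset.range 2, exp (-Real.pi * I * N * r ^ 2 / 2) * 1)) := by
    refine tendsto_finsetSum _ fun r _ => tendsto_const_nhds.mul (tendsto_theta_one ?_ _)
    simp_rw [hcre']
    exact hcl
  -- As `u → 0+` the real parts `1/(4u)` tend to infinity, every dual theta series tends to `1`, and
  -- only the finite exponential sums remain.
  have hEq := tendsto_nhds_unique (hLlim.congr' (by
    filter_upwards [self_mem_nhdsWithin] with u hu using hid u hu)) hRlim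
  simp only [mul_one, one_mul, Finset.sum_range_succ, Finset.sum_range_zero, zero_add,
    Nat.cast_zero, Nat.cast_one, one_pow] at hEq
  rw [hEq]
  simp

/-- In the reciprocity the root equals `(1 - i)/√N` and the exponential equals `(-i)^N`, so the sum
is `√N (1 + (-i)^N)/(1 - i)`, which for odd `N` is decided by `N` modulo `4`. -/
theorem gauss_sum_eq {N : ℕ} (hN : N % 2 = 1) :
    ∑ r ∈ Finset.range N, exp (2 * Real.pi * I * r ^ 2 / N) =
      (Real.sqrt N : ℂ) * if N % 4 = 1 then 1 else I := by
  have hN0 : N ≠ 0 := by rintro rfl; simp at hN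
  have : NeZero N := ⟨hN0⟩
  have hNC : (N : ℂ) ≠ 0 := NeZero.ne _
  have hNpos : (0 : ℝ) < N := by exact_mod_cast Nat.pos_of_ne_zero hN0
  have hroot : (1 / (I * N / 2)) ^ (1 / 2 : ℂ) = (1 - I) / (Real.sqrt N : ℂ) := by
    have h1 : (1 / (I * N / 2) : ℂ) = ((2 / N : ℝ) : ℂ) * (-I) := by
      push_cast
      field_simp
      rw [I_sq]
      ring
    have h2 : (1 / (I * N / 2) : ℂ) ≠ 0 := by simp [hNC]
    rw [cpow_def_of_ne_zero h2, h1, log_ofReal_mul (by positivity) (by simp), log_neg_I]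
    have h3 : (((Real.log (2 / N) : ℝ) : ℂ) + -(Real.pi / 2) * I) * (1 / 2) =
        ((Real.log (2 / N) / 2 : ℝ) : ℂ) + ((-(Real.pi / 4) : ℝ) : ℂ) * I := by
      push_cast; ring
    rw [h3, exp_add, ← ofReal_exp, exp_mul_I, ← ofReal_cos, ← ofReal_sin, Real.cos_neg, Real.sin_neg,
      Real.cos_pi_div_four, Real.sin_pi_div_four]
    have h4 : Real.exp (Real.log (2 / N) / 2) = Real.sqrt 2 / Real.sqrt N := by
      rw [← Real.sqrt_div (by norm_num), Real.sqrt_eq_rpow, Real.rpow_def_of_pos (by positivity)]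
      congr 1; ring
    rw [h4]
    have h5 : ((Real.sqrt 2 : ℝ) : ℂ) ^ 2 = 2 := by
      rw [← ofReal_pow, Real.sq_sqrt (by norm_num)]; norm_num
    have h6 : ((Real.sqrt N : ℝ) : ℂ) ≠ 0 := ofReal_ne_zero.2 (Real.sqrt_pos.2 hNpos).ne'
    push_cast
    field_simp
    linear_combination (1 - I) * h5
  have h := gauss_sum_mul_eq N
  rw [hroot] at h
  have hs : ((Real.sqrt N : ℝ) : ℂ) ≠ 0 := ofReal_ne_zero.2 (Real.sqrt_pos.2 hNpos).ne'
  have hI1 : (1 - I : ℂ) ≠ 0 := by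
    intro h
    have := congrArg re h
    simp at this
  have hexp : exp (-Real.pi * I * N / 2) = (-I) ^ N := by
    rw [← exp_neg_pi_div_two_mul_I, ← exp_nat_mul]
    congr 1
    ring
  rw [hexp] at h
  have h4 : (-I : ℂ) ^ 4 = 1 := by
    rw [neg_pow, I_pow_four]; norm_num
  have hsum : (∑ r ∈ Finset.range N, exp (2 * Real.pi * I * r ^ 2 / N)) * (1 - I) =
      (Real.sqrt N : ℂ) * (1 + (-I) ^ N) := by
    rw [← h]; field_simp
  apply mul_right_cancel₀ hI1
  rw [hsum]
  have hN4 : N % 4 = 1 ∨ N % 4 = 3 := by omega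
  have hp : (-I : ℂ) ^ N = (-I) ^ (N % 4) := by
    conv_lhs => rw [← Nat.div_add_mod N 4, pow_add, pow_mul, h4, one_pow, one_mul]
  rw [hp]
  rcases hN4 with h1 | h1
  · simp only [h1, if_true]; ring
  · have h3 : (-I : ℂ) ^ 3 = I := by
      rw [neg_pow, I_pow_three]; norm_num
    simp only [h1, Nat.reduceEqDiff, if_false, h3]
    rw [mul_assoc, mul_sub, I_mul_I]
    ring

end QuadraticGaussSum

end QuadraticMoments

namespace QuadraticMoments

open Filter Topology

/-! ### Quadratic characters as eigenfunctions of the discrete Fourier transform. -/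

section FourierEigen

open Complex

/-- A completely multiplicative `m`-periodic function that is an eigenfunction of the discrete
Fourier transform on `ℤ/m` with eigenvalue `c`. -/
structure DFTEigen (m : ℕ) (c : ℂ) (f : ℤ → ℂ) : Prop where
  map_mul : ∀ a b, f (a * b) = f a * f b
  periodic : ∀ a b : ℤ, a ≡ b [ZMOD m] → f a = f b
  eigen : ∀ k : ℤ, ∑ j ∈ Finset.range m, f j * exp (-(2 * Real.pi * I * j * k / m)) = c * f k

theorem sum_range_eq_sum_zmod {N : ℕ} [NeZero N] (h : ℕ → ℂ) :
    ∑ j ∈ Finset.range N, h j = ∑ x : ZMod N, h x.val := by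
  obtain ⟨n, rfl⟩ := Nat.exists_eq_succ_of_ne_zero (NeZero.ne N)
  rw [Finset.sum_range]
  rfl

theorem exp_periodic_aux {N : ℕ} (hN : N ≠ 0) {a b : ℤ} (h : a ≡ b [ZMOD N]) :
    exp (-(2 * Real.pi * I * a / N)) = exp (-(2 * Real.pi * I * b / N)) := by
  obtain ⟨t, ht⟩ := h.dvd
  rw [exp_eq_exp_iff_exists_int]
  refine ⟨t, ?_⟩
  have hN' : (N : ℂ) ≠ 0 := by exact_mod_cast hN
  have : (b : ℂ) = a + N * t := by
    have : b = a + N * t := by linarith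
    rw [this]; push_cast; ring
  rw [this]
  field_simp
  ring

/-- The Chinese remainder theorem for sums of periodic functions. -/
theorem sum_range_mul_coprime {m n : ℕ} (hm : m ≠ 0) (hn : n ≠ 0) (hmn : m.Coprime n) {F : ℤ → ℂ}
    (hF : ∀ a b : ℤ, a ≡ b [ZMOD (m * n : ℕ)] → F a = F b) :
    ∑ x ∈ Finset.range (m * n), F x =
      ∑ y ∈ Finset.range m, ∑ z ∈ Finset.range n, F (n * y + m * z) := by
  rw [← Finset.sum_product']
  symm
  have hmaps : Set.MapsTo (fun p : ℕ × ℕ => (n * p.1 + m * p.2) % (m * n))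
      (Finset.range m ×ˢ Finset.range n : Finset (ℕ × ℕ)) (Finset.range (m * n)) := by
    intro p _
    simpa using Nat.mod_lt _ (Nat.mul_pos (Nat.pos_of_ne_zero hm) (Nat.pos_of_ne_zero hn))
  have hinj : Set.InjOn (fun p : ℕ × ℕ => (n * p.1 + m * p.2) % (m * n))
      (Finset.range m ×ˢ Finset.range n : Finset (ℕ × ℕ)) := by
    rintro ⟨y, z⟩ hp ⟨y', z'⟩ hp' h
    simp only [Finset.coe_product, Finset.coe_range, Set.mem_prod, Set.mem_Iio] at hp hp'
    have h' : n * y + m * z ≡ n * y' + m * z' [MOD m * n] := h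
    have h1 : n * y ≡ n * y' [MOD m] := by
      have := h'.of_mul_right n
      simpa [Nat.ModEq, Nat.add_mul_mod_self_left] using this
    have h2 : m * z ≡ m * z' [MOD n] := by
      have := h'.of_mul_left m
      simpa [Nat.ModEq, Nat.add_comm (n * _), Nat.add_mul_mod_self_left] using this
    have h3 : y = y' := (Nat.ModEq.cancel_left_of_coprime hmn h1).eq_of_lt_of_lt hp.1 hp'.1
    have h4 : z = z' := (Nat.ModEq.cancel_left_of_coprime hmn.symm h2).eq_of_lt_of_lt hp.2 hp'.2
    rw [h3, h4]
  refine Finset.sum_nbij (fun p : ℕ × ℕ => (n * p.1 + m * p.2) % (m * n)) hmaps hinj ?_ ?_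
  · exact Finset.surjOn_of_injOn_of_card_le _ hmaps hinj (by simp)
  · intro p _
    apply hF
    push_cast
    exact (Int.mod_modEq _ _).symm

/-- Writing residues as `n y + m z`, the exponential splits into its parts modulo `m` and modulo
`n`, while `f` sees only `n y` and `g` only `m z`. This is the origin of the factor `f n * g m` in
the eigenvalue. -/
theorem DFTEigen.mul {m n : ℕ} (hm : m ≠ 0) (hn : n ≠ 0) (hmn : m.Coprime n) {c c' : ℂ}
    {f g : ℤ → ℂ} (hf : DFTEigen m c f) (hg : DFTEigen n c' g) :
    DFTEigen (m * n) (f n * g m * c * c') (fun a => f a * g a) where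
  map_mul a b := by rw [hf.map_mul, hg.map_mul]; ring
  periodic a b h := by
    push_cast at h
    rw [hf.periodic a b (h.of_mul_right _), hg.periodic a b (h.of_mul_left _)]
  eigen k := by
    have hper : ∀ a b : ℤ, a ≡ b [ZMOD (m * n : ℕ)] →
        f a * g a * exp (-(2 * Real.pi * I * a * k / (m * n : ℕ))) =
        f b * g b * exp (-(2 * Real.pi * I * b * k / (m * n : ℕ))) := by
      intro a b h
      have h1 := exp_periodic_aux (Nat.mul_ne_zero hm hn) (h.mul_right k)
      push_cast at h
      rw [hf.periodic a b (h.of_mul_right _), hg.periodic a b (h.of_mul_left _)]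
      congr 1
      convert h1 using 3 <;> push_cast <;> ring
    have h1 := sum_range_mul_coprime hm hn hmn hper
    simp only [Int.cast_natCast] at h1
    rw [h1]
    have hm' : (m : ℂ) ≠ 0 := by exact_mod_cast hm
    have hn' : (n : ℂ) ≠ 0 := by exact_mod_cast hn
    have h2 : ∀ y z : ℕ, f (n * y + m * z) * g (n * y + m * z) *
        exp (-(2 * Real.pi * I * ((n * y + m * z : ℤ) : ℂ) * k / (m * n : ℕ))) =
        (f n * g m) * ((f y * exp (-(2 * Real.pi * I * y * k / m))) *
          (g z * exp (-(2 * Real.pi * I * z * k / n)))) := by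
      intro y z
      have e1 : f (n * y + m * z) = f n * f y := by
        rw [← hf.map_mul]
        exact hf.periodic _ _ (by simp [Int.ModEq])
      have e2 : g (n * y + m * z) = g m * g z := by
        rw [← hg.map_mul]
        exact hg.periodic _ _ (by simp [Int.ModEq])
      have e3 : exp (-(2 * Real.pi * I * ((n * y + m * z : ℤ) : ℂ) * k / (m * n : ℕ))) =
          exp (-(2 * Real.pi * I * y * k / m)) * exp (-(2 * Real.pi * I * z * k / n)) := by
        rw [← exp_add]
        congr 1
        push_cast
        field_simp
        ring
      rw [e1, e2, e3]
      ring
    simp_rw [h2, ← Finset.mul_sum, ← Finset.sum_mul]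
    rw [hf.eigen, hg.eigen]
    ring

/-- The equation `x² = a` has `1 + χ(a)` solutions, and the sum of the additive character over all
`a` vanishes. -/
theorem sum_stdAddChar_sq {p : ℕ} [Fact p.Prime] (hp : p % 2 = 1) :
    ∑ x : ZMod p, ((quadraticChar (ZMod p) x : ℤ) : ℂ) * ZMod.stdAddChar x =
      ∑ x : ZMod p, ZMod.stdAddChar (x ^ 2) := by
  have hp2 : ringChar (ZMod p) ≠ 2 := by
    rw [ZMod.ringChar_zmod_n]; rintro rfl; simp at hp
  have hprim := ZMod.isPrimitive_stdAddChar p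
  have h0 : ∑ a : ZMod p, ZMod.stdAddChar a = (0 : ℂ) := by
    have := AddChar.sum_mulShift (1 : ZMod p) hprim
    simpa using this
  rw [← Finset.sum_fiberwise (Finset.univ : Finset (ZMod p)) (fun x => x ^ 2)
    (fun x => (ZMod.stdAddChar (x ^ 2) : ℂ))]
  have h1 : ∀ a : ZMod p, ∑ x : ZMod p with x ^ 2 = a, (ZMod.stdAddChar (x ^ 2) : ℂ) =
      (((quadraticChar (ZMod p) a : ℤ) : ℂ) + 1) * ZMod.stdAddChar a := by
    intro a
    rw [Finset.sum_congr rfl (g := fun _ => (ZMod.stdAddChar a : ℂ))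
      (fun x hx => by rw [(Finset.mem_filter.1 hx).2]), Finset.sum_const, nsmul_eq_mul]
    congr 1
    have := quadraticChar_card_sqrts hp2 a
    have h2 : ({x : ZMod p | x ^ 2 = a}.toFinset) = Finset.univ.filter fun x : ZMod p => x ^ 2 = a := by
      ext x; simp
    rw [h2] at this
    exact_mod_cast congrArg (Int.cast : ℤ → ℂ) this
  simp_rw [h1, add_mul, one_mul, Finset.sum_add_distrib, h0, add_zero]

theorem sum_quadraticChar_stdAddChar {p : ℕ} [Fact p.Prime] (hp : p % 2 = 1) :
    ∑ x : ZMod p, ((quadraticChar (ZMod p) x : ℤ) : ℂ) * ZMod.stdAddChar x =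
      (Real.sqrt p : ℂ) * if p % 4 = 1 then 1 else I := by
  rw [sum_stdAddChar_sq hp, ← gauss_sum_eq hp, sum_range_eq_sum_zmod]
  refine Finset.sum_congr rfl fun x _ => ?_
  have : (x ^ 2 : ZMod p) = (((x.val : ℤ) ^ 2 : ℤ) : ZMod p) := by
    push_cast
    rw [ZMod.natCast_zmod_val]
  rw [this, ZMod.stdAddChar_coe]
  push_cast
  rfl

/-- The sign `1` or `-i` in the eigenvalue of the Jacobi symbol modulo `m`. -/
noncomputable def epsBar (m : ℕ) : ℂ := if m % 4 = 1 then 1 else -I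

theorem jacobi_periodic (m : ℕ) {a b : ℤ} (h : a ≡ b [ZMOD m]) : jacobiSym a m = jacobiSym b m :=
  jacobiSym.mod_left' h

/-- For `k ≠ 0` the substitution `x ↦ -k x` reduces to the Gauss sum and produces `χ(-k) = χ₄(p)
χ(k)`; the sign `χ₄(p)` turns `1, i` into `1, -i`, which is `epsBar`. For `k = 0` both sides vanish.
-/
theorem dftEigen_prime {p : ℕ} (hp : p.Prime) (hp2 : p % 2 = 1) :
    DFTEigen p (epsBar p * Real.sqrt p) (fun a => ((jacobiSym a p : ℤ) : ℂ)) where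
  map_mul a b := by rw [jacobiSym.mul_left]; push_cast; rfl
  periodic a b h := by rw [jacobi_periodic p h]
  eigen k := by
    have : Fact p.Prime := ⟨hp⟩
    have hring : ringChar (ZMod p) ≠ 2 := by
      rw [ZMod.ringChar_zmod_n]; rintro rfl; simp at hp2
    have hJ : ∀ a : ℤ, jacobiSym a p = quadraticChar (ZMod p) (a : ZMod p) := by
      intro a
      rw [← jacobiSym.legendreSym.to_jacobiSym]; rfl
    rw [sum_range_eq_sum_zmod]
    have h1 : ∀ x : ZMod p, ((jacobiSym (x.val : ℕ) p : ℤ) : ℂ) *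
        exp (-(2 * Real.pi * I * (x.val : ℕ) * k / p)) =
        ((quadraticChar (ZMod p) x : ℤ) : ℂ) * ZMod.stdAddChar (-(x * (k : ZMod p))) := by
      intro x
      rw [hJ]
      have e1 : (((x.val : ℕ) : ℤ) : ZMod p) = x := by
        push_cast; exact ZMod.natCast_zmod_val x
      have e2 : -(x * (k : ZMod p)) = ((-((x.val : ℕ) * k) : ℤ) : ZMod p) := by
        push_cast; rw [ZMod.natCast_zmod_val]
      rw [e1, e2, ZMod.stdAddChar_coe]
      congr 2
      push_cast
      ring
    simp_rw [h1]
    rw [hJ]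
    rcases eq_or_ne (k : ZMod p) 0 with hk | hk
    · rw [hk]
      have := quadraticChar_sum_zero hring
      simp only [mul_zero, neg_zero, AddChar.map_zero_eq_one, mul_one, MulChar.map_zero,
        Int.cast_zero]
      exact_mod_cast congrArg (Int.cast : ℤ → ℂ) this
    · have hk' : -(k : ZMod p) ≠ 0 := neg_ne_zero.2 hk
      have hχ : ∀ x : ZMod p, ((quadraticChar (ZMod p) x : ℤ) : ℂ) =
          ((quadraticChar (ZMod p) (-(k : ZMod p)) : ℤ) : ℂ) * ((quadraticChar (ZMod p) (-(k : ZMod p) * x) : ℤ) : ℂ) := by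
        intro x
        have h := quadraticChar_sq_one hk'
        rw [map_mul, ← Int.cast_mul, ← mul_assoc, ← pow_two, h, one_mul]
      have h2 : ∀ x : ZMod p, ((quadraticChar (ZMod p) x : ℤ) : ℂ) * ZMod.stdAddChar (-(x * (k : ZMod p))) =
          ((quadraticChar (ZMod p) (-(k : ZMod p)) : ℤ) : ℂ) *
          (((quadraticChar (ZMod p) (-(k : ZMod p) * x) : ℤ) : ℂ) * ZMod.stdAddChar (-(k : ZMod p) * x)) := by
        intro x
        conv_lhs => rw [hχ x]
        rw [mul_assoc]
        congr 3
        ring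
      simp_rw [h2, ← Finset.mul_sum]
      rw [Fintype.sum_bijective (fun x : ZMod p => -(k : ZMod p) * x) (mulLeft_bijective₀ _ hk')
        (fun x => ((quadraticChar (ZMod p) (-(k : ZMod p) * x) : ℤ) : ℂ) * ZMod.stdAddChar (-(k : ZMod p) * x))
        (fun x => ((quadraticChar (ZMod p) x : ℤ) : ℂ) * ZMod.stdAddChar x) (fun _ => rfl),
        sum_quadraticChar_stdAddChar hp2]
      have h3 : quadraticChar (ZMod p) (-(k : ZMod p)) =
          ZMod.χ₄ p * quadraticChar (ZMod p) (k : ZMod p) := by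
        rw [← neg_one_mul, map_mul, quadraticChar_neg_one hring, ZMod.card]
      rw [h3, epsBar]
      rcases (by omega : p % 4 = 1 ∨ p % 4 = 3) with h4 | h4
      · rw [ZMod.χ₄_nat_one_mod_four h4]
        simp [h4]
        ring
      · rw [ZMod.χ₄_nat_three_mod_four h4]
        simp [h4]
        ring

/-- Induction over the primes of `m`. The product `(a | p)(p | a)` contributed by `DFTEigen.mul` is
the sign of quadratic reciprocity, and it is exactly the ratio of `epsBar (p * a)` to `epsBar p *
epsBar a`. -/
theorem dftEigen_jacobi {m : ℕ} (hm : Squarefree m) (hodd : m % 2 = 1) :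
    DFTEigen m (epsBar m * Real.sqrt m) (fun a => ((jacobiSym a m : ℤ) : ℂ)) := by
  induction m using induction_on_primes with
  | zero => simp at hodd
  | one =>
    constructor
    · intro a b; simp
    · intro a b _; simp
    · intro k; simp [epsBar]
  | prime_mul p a hp ih =>
    have hpo : p % 2 = 1 := by
      rcases Nat.mod_two_eq_zero_or_one p with h | h
      · simp [Nat.mul_mod, h] at hodd
      · exact h
    have hao : a % 2 = 1 := by
      rcases Nat.mod_two_eq_zero_or_one a with h | h
      · simp [Nat.mul_mod, h] at hodd
      · exact h
    have hcop : p.Coprime a := Nat.coprime_of_squarefree_mul hm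
    have hsa : Squarefree a := hm.squarefree_of_dvd (dvd_mul_left a p)
    have ha0 : a ≠ 0 := hsa.ne_zero
    have h := (dftEigen_prime hp hpo).mul hp.ne_zero ha0 hcop (ih hsa hao)
    have hne : NeZero a := ⟨ha0⟩
    have hne' : NeZero p := ⟨hp.ne_zero⟩
    have hfun : (fun x : ℤ => ((jacobiSym x (p * a) : ℤ) : ℂ)) =
        fun x => ((jacobiSym x p : ℤ) : ℂ) * ((jacobiSym x a : ℤ) : ℂ) := by
      funext x
      rw [jacobiSym.mul_right]; push_cast; rfl
    rw [hfun]
    convert h using 1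
    have hrec := jacobiSym.quadratic_reciprocity_if hpo hao
    have hsq : (jacobiSym (a : ℤ) p) * (jacobiSym (a : ℤ) p) = 1 := by
      rw [← pow_two]
      exact jacobiSym.sq_one (by simpa [Int.gcd] using hcop.symm)
    have hsq' : ((jacobiSym (a : ℤ) p : ℤ) : ℂ) * ((jacobiSym (a : ℤ) p : ℤ) : ℂ) = 1 := by
      exact_mod_cast hsq
    rw [← hrec, Nat.cast_mul, Real.sqrt_mul (Nat.cast_nonneg _)]
    have key : epsBar (p * a) = (if p % 4 = 3 ∧ a % 4 = 3 then (-1 : ℂ) else 1) *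
        epsBar p * epsBar a := by
      unfold epsBar
      rcases (by omega : p % 4 = 1 ∨ p % 4 = 3) with h1 | h1 <;>
      rcases (by omega : a % 4 = 1 ∨ a % 4 = 3) with h2 | h2 <;>
      simp [Nat.mul_mod, h1, h2]
    rw [key]
    split_ifs with hc
    · push_cast
      linear_combination (-(-1 * epsBar p * epsBar a * Real.sqrt p * Real.sqrt a)) * hsq'
    · push_cast
      linear_combination (-(epsBar p * epsBar a * Real.sqrt p * Real.sqrt a)) * hsq'

/-- For explicit small moduli: periodicity leaves finitely many `k`, and the eigenvalue equation
becomes an identity between powers of one root of unity. -/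
theorem DFTEigen.of_forall_lt {m : ℕ} (hm : m ≠ 0) {c : ℂ} {f : ℤ → ℂ}
    (hmul : ∀ a b, f (a * b) = f a * f b) (hper : ∀ a b : ℤ, a ≡ b [ZMOD m] → f a = f b)
    (h : ∀ k < m, ∑ j ∈ Finset.range m, f j * exp (-(2 * Real.pi * I / m)) ^ (j * k) = c * f k) :
    DFTEigen m c f where
  map_mul := hmul
  periodic := hper
  eigen k := by
    have hm' : (m : ℤ) ≠ 0 := by exact_mod_cast hm
    obtain ⟨k', hk'⟩ : ∃ k' : ℕ, (k' : ℤ) = k % m :=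
      ⟨(k % m).toNat, Int.toNat_of_nonneg (Int.emod_nonneg _ hm')⟩
    have hmod : k ≡ k' [ZMOD m] := by rw [hk']; exact (Int.mod_modEq _ _).symm
    have hlt : k' < m := by
      have := Int.emod_lt_of_pos k (by omega : (0 : ℤ) < m)
      omega
    rw [hper k k' hmod, ← h k' hlt]
    refine Finset.sum_congr rfl fun j _ => ?_
    congr 1
    have h1 := exp_periodic_aux hm (hmod.mul_left j)
    rw [← exp_nat_mul]
    convert h1 using 2 <;> push_cast <;> ring

theorem mulChar_intCast_periodic {N : ℕ} (χ : MulChar (ZMod N) ℤ) (a b : ℤ) (h : a ≡ b [ZMOD N]) :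
    ((χ (a : ZMod N) : ℤ) : ℂ) = ((χ (b : ZMod N) : ℤ) : ℂ) := by
  rw [(ZMod.intCast_eq_intCast_iff a b N).2 h]

theorem exp_neg_pi_div_four : exp (-(2 * Real.pi * I / (8 : ℕ))) = (1 - I) / (Real.sqrt 2 : ℂ) := by
  have h3 : -(2 * (Real.pi : ℂ) * I / (8 : ℕ)) = ((-(Real.pi / 4) : ℝ) : ℂ) * I := by
    push_cast; ring
  have h5 : ((Real.sqrt 2 : ℝ) : ℂ) ^ 2 = 2 := by
    rw [← ofReal_pow, Real.sq_sqrt (by norm_num)]; norm_num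
  have h6 : ((Real.sqrt 2 : ℝ) : ℂ) ≠ 0 := ofReal_ne_zero.2 (by positivity)
  rw [h3, exp_mul_I, ← ofReal_cos, ← ofReal_sin, Real.cos_neg, Real.sin_neg,
    Real.cos_pi_div_four, Real.sin_pi_div_four]
  push_cast
  field_simp
  linear_combination (1 - I) * h5

theorem dftEigen_chi4 : DFTEigen 4 (-2 * I) (fun a => ((ZMod.χ₄ (a : ZMod 4) : ℤ) : ℂ)) := by
  refine DFTEigen.of_forall_lt (by norm_num) ?_ (mulChar_intCast_periodic ZMod.χ₄) ?_
  · intro a b; push_cast; rw [map_mul]; push_cast; rfl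
  · have hz : exp (-(2 * Real.pi * I / (4 : ℕ))) = -I := by
      rw [← exp_neg_pi_div_two_mul_I]
      congr 1; push_cast; ring
    have h0 : ZMod.χ₄ 0 = 0 := by decide
    have h1 : ZMod.χ₄ 1 = 1 := by decide
    have h2 : ZMod.χ₄ 2 = 0 := by decide
    have h3 : ZMod.χ₄ 3 = -1 := by decide
    have hI2 : I ^ 2 = -1 := I_sq
    intro k hk
    rw [hz]
    interval_cases k <;>
      simp only [Finset.sum_range_succ, Finset.sum_range_zero, Nat.cast_zero, Nat.cast_one,
        Nat.cast_ofNat, Int.cast_zero, Int.cast_one, Int.cast_ofNat, h0, h1, h2, h3] <;>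
      push_cast
    · ring
    · linear_combination I * hI2
    · linear_combination (I ^ 2 - I ^ 4) * hI2
    · linear_combination (I ^ 7 - I ^ 5 + I ^ 3 - 2 * I) * hI2

theorem zeta8_pow {z : ℂ} (h2 : z ^ 2 = -I) (j : ℕ) : z ^ (j % 8) = z ^ j := by
  have h8 : z ^ 8 = 1 := by
    calc z ^ 8 = (z ^ 2) ^ 4 := by ring
      _ = 1 := by rw [h2, neg_pow, I_pow_four]; norm_num
  conv_rhs => rw [← Nat.div_add_mod j 8, pow_add, pow_mul, h8, one_pow, one_mul]

theorem dftEigen_chi8_aux {z : ℂ} (hz : z = (1 - I) / (Real.sqrt 2 : ℂ)) :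
    z ^ 2 = -I ∧ z ^ 3 = -I * z ∧ z ^ 4 = -1 ∧ z ^ 5 = -z ∧ z ^ 6 = I ∧ z ^ 7 = I * z ∧
      z + I * z = Real.sqrt 2 ∧ z - I * z = - I * Real.sqrt 2 := by
  have h5 : ((Real.sqrt 2 : ℝ) : ℂ) ^ 2 = 2 := by
    rw [← ofReal_pow, Real.sq_sqrt (by norm_num)]; norm_num
  have h6 : ((Real.sqrt 2 : ℝ) : ℂ) ≠ 0 := ofReal_ne_zero.2 (by positivity)
  have hI2 : I ^ 2 = -1 := I_sq
  have h2 : z ^ 2 = -I := by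
    rw [hz, div_pow, h5]; linear_combination hI2 / 2
  refine ⟨h2, ?_, ?_, ?_, ?_, ?_, ?_, ?_⟩
  · linear_combination z * h2
  · linear_combination (z ^ 2 - I) * h2 + hI2
  · linear_combination z * ((z ^ 2 - I) * h2 + hI2)
  · linear_combination (z ^ 4 - I * z ^ 2 + I ^ 2) * h2 - I * hI2
  · linear_combination z * ((z ^ 4 - I * z ^ 2 + I ^ 2) * h2 - I * hI2)
  · rw [hz]; field_simp; linear_combination -hI2 - h5
  · rw [hz]; field_simp; linear_combination hI2 + I * h5

theorem dftEigen_chi8 : DFTEigen 8 (Real.sqrt 8) (fun a => ((ZMod.χ₈ (a : ZMod 8) : ℤ) : ℂ)) := by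
  refine DFTEigen.of_forall_lt (by norm_num) ?_ (mulChar_intCast_periodic ZMod.χ₈) ?_
  · intro a b; push_cast; rw [map_mul]; push_cast; rfl
  · have h8 : Real.sqrt 8 = 2 * Real.sqrt 2 := by
      rw [show (8 : ℝ) = 2 ^ 2 * 2 by norm_num, Real.sqrt_mul (by norm_num), Real.sqrt_sq (by norm_num)]
    set z := exp (-(2 * Real.pi * I / (8 : ℕ))) with hz
    obtain ⟨e2, e3, e4, e5, e6, e7, es, ed⟩ := dftEigen_chi8_aux exp_neg_pi_div_four
    rw [← hz] at e2 e3 e4 e5 e6 e7 es ed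
    have h0 : ZMod.χ₈ 0 = 0 := by decide
    have h1 : ZMod.χ₈ 1 = 1 := by decide
    have h2 : ZMod.χ₈ 2 = 0 := by decide
    have h3 : ZMod.χ₈ 3 = -1 := by decide
    have h4 : ZMod.χ₈ 4 = 0 := by decide
    have h5 : ZMod.χ₈ 5 = -1 := by decide
    have h6 : ZMod.χ₈ 6 = 0 := by decide
    have h7 : ZMod.χ₈ 7 = 1 := by decide
    rw [h8]
    intro k hk
    interval_cases k <;>
      simp only [Finset.sum_range_succ, Finset.sum_range_zero, Nat.cast_zero, Nat.cast_one,
        Nat.cast_ofNat, Int.cast_zero, Int.cast_one, Int.cast_ofNat, h0, h1, h2, h3, h4, h5, h6,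
        h7] <;>
      simp only [← zeta8_pow e2 (_ * _)] <;> norm_num <;>
      simp only [e3, e5, e7] <;> first | ring1 | linear_combination 2 * es | linear_combination (-2) * es

theorem dftEigen_chi8' :
    DFTEigen 8 (-I * Real.sqrt 8) (fun a => ((ZMod.χ₈' (a : ZMod 8) : ℤ) : ℂ)) := by
  refine DFTEigen.of_forall_lt (by norm_num) ?_ (mulChar_intCast_periodic ZMod.χ₈') ?_
  · intro a b; push_cast; rw [map_mul]; push_cast; rfl
  · have h8 : Real.sqrt 8 = 2 * Real.sqrt 2 := by
      rw [show (8 : ℝ) = 2 ^ 2 * 2 by norm_num, Real.sqrt_mul (by norm_num), Real.sqrt_sq (by norm_num)]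
    set z := exp (-(2 * Real.pi * I / (8 : ℕ))) with hz
    obtain ⟨e2, e3, e4, e5, e6, e7, es, ed⟩ := dftEigen_chi8_aux exp_neg_pi_div_four
    rw [← hz] at e2 e3 e4 e5 e6 e7 es ed
    have h0 : ZMod.χ₈' 0 = 0 := by decide
    have h1 : ZMod.χ₈' 1 = 1 := by decide
    have h2 : ZMod.χ₈' 2 = 0 := by decide
    have h3 : ZMod.χ₈' 3 = 1 := by decide
    have h4 : ZMod.χ₈' 4 = 0 := by decide
    have h5 : ZMod.χ₈' 5 = -1 := by decide
    have h6 : ZMod.χ₈' 6 = 0 := by decide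
    have h7 : ZMod.χ₈' 7 = -1 := by decide
    rw [h8]
    intro k hk
    interval_cases k <;>
      simp only [Finset.sum_range_succ, Finset.sum_range_zero, Nat.cast_zero, Nat.cast_one,
        Nat.cast_ofNat, Int.cast_zero, Int.cast_one, Int.cast_ofNat, h0, h1, h2, h3, h4, h5, h6,
        h7] <;>
      simp only [← zeta8_pow e2 (_ * _)] <;> norm_num <;>
      simp only [e3, e5, e7] <;> first | ring1 | linear_combination 2 * ed | linear_combination (-2) * ed

end FourierEigen

end QuadraticMoments

namespace QuadraticMoments

open Filter Topology

/-! ### The Kronecker symbol of a fundamental discriminant and the functional equation of its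
L-function. -/

section Kronecker

theorem kronecker_one_left (n : ℕ) : kronecker 1 n = 1 := by
  by_cases h : n = 0 <;> simp [kronecker, h]

theorem kronecker_zero_right {d : ℕ} (hd : d ≠ 1) : kronecker d 0 = 0 := by simp [kronecker, hd]

theorem odd_div_two_pow_padicVal {n : ℕ} (hn : n ≠ 0) : Odd (n / 2 ^ padicValNat 2 n) := by
  have h := Nat.not_dvd_ordCompl Nat.prime_two hn
  rw [Nat.factorization_def n Nat.prime_two] at h
  exact Nat.odd_iff.2 (Nat.two_dvd_ne_zero.1 h)

theorem two_pow_padicVal_mul {n : ℕ} : 2 ^ padicValNat 2 n * (n / 2 ^ padicValNat 2 n) = n :=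
  Nat.mul_div_cancel' pow_padicValNat_dvd

theorem chi8_abs_le (x : ZMod 8) : |ZMod.χ₈ x| ≤ 1 := by revert x; decide

theorem abs_kronecker_le (d n : ℕ) : |kronecker d n| ≤ 1 := by
  unfold kronecker
  split_ifs
  · simp
  · simp
  · rw [abs_mul, abs_pow]
    refine mul_le_one₀ (pow_le_one₀ (abs_nonneg _) (chi8_abs_le _)) (abs_nonneg _) ?_
    rcases jacobiSym.trichotomy (d : ℤ) (n / 2 ^ padicValNat 2 n) with h | h | h <;> simp [h]

theorem norm_kronecker_le (d n : ℕ) : ‖((kronecker d n : ℤ) : ℂ)‖ ≤ 1 := by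
  rw [Complex.norm_intCast]
  exact_mod_cast abs_kronecker_le d n

/-- A completely multiplicative function with the values of the Kronecker symbol at `2` and at odd
numbers is the Kronecker symbol. -/
theorem kronecker_eq_of_mul {d : ℕ} (hd : d ≠ 1) {f : ℤ → ℂ} (hmul : ∀ a b, f (a * b) = f a * f b)
    (h0 : f 0 = 0) (h2 : f 2 = ((ZMod.χ₈ (d : ZMod 8) : ℤ) : ℂ))
    (hodd : ∀ n : ℕ, Odd n → f n = ((jacobiSym (d : ℤ) n : ℤ) : ℂ)) (n : ℕ) :
    ((kronecker d n : ℤ) : ℂ) = f n := by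
  rcases eq_or_ne n 0 with rfl | hn
  · rw [kronecker_zero_right hd]; simpa using h0.symm
  have h1 : f 1 = 1 := by simpa using hodd 1 odd_one
  have hpow : ∀ v : ℕ, f (2 ^ v) = f 2 ^ v := by
    intro v
    induction v with
    | zero => simpa using h1
    | succ v ih => rw [pow_succ, hmul, ih, pow_succ]
  have hn' : (n : ℤ) = 2 ^ padicValNat 2 n * ((n / 2 ^ padicValNat 2 n : ℕ) : ℤ) := by
    exact_mod_cast two_pow_padicVal_mul.symm
  rw [hn', hmul, hpow, h2, hodd _ (odd_div_two_pow_padicVal hn)]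
  simp only [kronecker, hn, if_false]
  push_cast
  rfl

theorem jacobi_eight {n : ℕ} (hn : Odd n) : jacobiSym 8 n = ZMod.χ₈ n := by
  rw [show (8 : ℤ) = 4 * 2 by norm_num, jacobiSym.mul_left, jacobiSym.at_four hn,
    jacobiSym.at_two hn, one_mul]

theorem jacobi_reciprocity_three {q n : ℕ} (hq : q % 4 = 3) (hn : Odd n) :
    jacobiSym (q : ℤ) n = ZMod.χ₄ n * jacobiSym (n : ℤ) q := by
  have hn2 := Nat.odd_iff.1 hn
  have := jacobiSym.quadratic_reciprocity_if (a := q) (b := n) (by omega) hn2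
  rw [← this]
  rcases (by omega : n % 4 = 1 ∨ n % 4 = 3) with h | h
  · rw [ZMod.χ₄_nat_one_mod_four h]; simp [h]
  · rw [ZMod.χ₄_nat_three_mod_four h]; simp [h, hq]

theorem exists_dftEigen_of_values {d N : ℕ} (hd : d ≠ 1) {c : ℂ} {f : ℤ → ℂ}
    (h : DFTEigen N c f) (hN : d = N) (hc : (Real.sqrt N : ℂ) = c) (h0 : f 0 = 0)
    (h2 : f 2 = ((ZMod.χ₈ (d : ZMod 8) : ℤ) : ℂ))
    (hodd : ∀ n : ℕ, Odd n → f n = ((jacobiSym (d : ℤ) n : ℤ) : ℂ)) :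
    ∃ f : ℤ → ℂ, DFTEigen d (Real.sqrt d : ℂ) f ∧ f 0 = 0 ∧
      ∀ n : ℕ, ((kronecker d n : ℤ) : ℂ) = f n := by
  subst hN
  subst hc
  exact ⟨f, h, h0, kronecker_eq_of_mul hd h.map_mul h0 h2 hodd⟩

/-- The symbol is a Jacobi symbol modulo the odd part of `d`, times `1`, `χ₄`, `χ₈` or `χ₈'`;
reciprocity identifies the two descriptions at odd arguments. In every case the signs from `epsBar`,
from the 2-adic character and from the mixed values cancel, so that the eigenvalue is `+√d`: this is
the statement that the root number is `1`. -/
theorem exists_dftEigen_kronecker {d : ℕ+} (hd : d ∈ fundDisc) (hd1 : d ≠ 1) :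
    ∃ f : ℤ → ℂ, DFTEigen d (Real.sqrt (d : ℕ) : ℂ) f ∧ f 0 = 0 ∧
      ∀ n : ℕ, ((kronecker d n : ℤ) : ℂ) = f n := by
  have hd1' : (d : ℕ) ≠ 1 := fun h => hd1 (PNat.coe_eq_one_iff.1 h)
  rcases hd with ⟨h4, hsq⟩ | ⟨m, hm, hm4, hsq⟩
  · have hodd : Odd (d : ℕ) := Nat.odd_iff.2 (by omega)
    have h := dftEigen_jacobi hsq (by omega)
    have h0 : ((jacobiSym 0 (d : ℕ) : ℤ) : ℂ) = 0 := by
      rw [jacobiSym.zero_left (by have := d.pos; omega)]; simp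
    refine exists_dftEigen_of_values hd1' h rfl (by simp [epsBar, h4]) h0 ?_ ?_
    · rw [jacobiSym.at_two hodd]
    · intro n hn
      rw [jacobiSym.quadratic_reciprocity_one_mod_four h4 hn]
  · have hm0 : m ≠ 0 := hsq.ne_zero
    have hchi : ZMod.χ₈ ((d : ℕ) : ZMod 8) = 0 := by
      rw [hm]
      push_cast
      have : ∀ x : ZMod 8, ZMod.χ₈ (4 * x) = 0 := by decide
      exact this _
    rcases hm4 with hm4 | hm4
    · obtain ⟨q, rfl⟩ : ∃ q, m = 2 * q := ⟨m / 2, by omega⟩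
      have hqo : q % 2 = 1 := by omega
      have hqodd : Odd q := Nat.odd_iff.2 hqo
      have hqs : Squarefree q := hsq.squarefree_of_dvd (dvd_mul_left q 2)
      have hq0 : q ≠ 0 := hqs.ne_zero
      have hcop : Nat.Coprime 8 q := by
        rw [show 8 = 2 ^ 3 by norm_num]
        exact Nat.Coprime.pow_left 3 (Nat.coprime_two_left.2 hqodd)
      have hd8 : (d : ℕ) = 8 * q := by omega
      have hsq8 : Real.sqrt ((8 * q : ℕ) : ℝ) = Real.sqrt 8 * Real.sqrt q := by
        push_cast
        rw [Real.sqrt_mul (by norm_num)]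
      have hJ : ∀ n : ℕ, Odd n → jacobiSym ((d : ℕ) : ℤ) n = ZMod.χ₈ n * jacobiSym (q : ℤ) n := by
        intro n hn
        rw [hd8]
        push_cast
        rw [jacobiSym.mul_left, jacobi_eight hn]
      have hunit : ZMod.χ₈ (q : ZMod 8) * ZMod.χ₈ (q : ZMod 8) = 1 := by
        rw [← jacobi_eight hqodd, ← pow_two]
        exact jacobiSym.sq_one (by simpa [Int.gcd] using hcop)
      rcases (by omega : q % 4 = 1 ∨ q % 4 = 3) with hq4 | hq4
      · have h := dftEigen_chi8.mul (by norm_num) hq0 hcop (dftEigen_jacobi hqs hqo)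
        refine exists_dftEigen_of_values hd1' h hd8 ?_ ?_ ?_ ?_
        · rw [hsq8]
          simp only [epsBar, hq4, if_true, one_mul, Int.cast_natCast, Nat.cast_ofNat]
          rw [jacobi_eight hqodd]
          have : ((ZMod.χ₈ (q : ZMod 8) : ℤ) : ℂ) * ((ZMod.χ₈ (q : ZMod 8) : ℤ) : ℂ) = 1 := by
            exact_mod_cast hunit
          rw [this]
          push_cast
          ring
        · simp
        · rw [hchi]
          have : ZMod.χ₈ ((2 : ℤ) : ZMod 8) = 0 := by decide
          rw [this]; simp
        · intro n hn
          rw [hJ n hn, jacobiSym.quadratic_reciprocity_one_mod_four hq4 hn]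
          simp
      -- Here `χ₈'` and the Jacobi symbol modulo `q` each contribute `-i`; the resulting `-1` is
      -- cancelled by `χ₄(q) = -1`, which comes from `χ₈'(q) (8 | q)`.
      · have h := dftEigen_chi8'.mul (by norm_num) hq0 hcop (dftEigen_jacobi hqs hqo)
        have hchi' : ∀ n : ℕ, ZMod.χ₈' (n : ZMod 8) = ZMod.χ₄ (n : ZMod 4) * ZMod.χ₈ (n : ZMod 8) := by
          intro n
          rw [ZMod.χ₈'_nat_eq_if_mod_eight, ZMod.χ₄_nat_eq_if_mod_four, ZMod.χ₈_nat_eq_if_mod_eight]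
          split_ifs <;> first | rfl | omega
        refine exists_dftEigen_of_values hd1' h hd8 ?_ ?_ ?_ ?_
        · rw [hsq8]
          simp only [epsBar, hq4, Int.cast_natCast, Nat.cast_ofNat, Nat.reduceEqDiff, if_false]
          rw [jacobi_eight hqodd, hchi', ZMod.χ₄_nat_three_mod_four hq4]
          have : ((ZMod.χ₈ (q : ZMod 8) : ℤ) : ℂ) * ((ZMod.χ₈ (q : ZMod 8) : ℤ) : ℂ) = 1 := by
            exact_mod_cast hunit
          have hI : Complex.I * Complex.I = -1 := Complex.I_mul_I
          push_cast
          linear_combination (Real.sqrt 8 * Real.sqrt q * Complex.I * Complex.I : ℂ) * this +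
            (Real.sqrt 8 * Real.sqrt q : ℂ) * hI
        · simp
        · rw [hchi]
          have : ZMod.χ₈' ((2 : ℤ) : ZMod 8) = 0 := by decide
          rw [this]; simp
        · intro n hn
          rw [hJ n hn, jacobi_reciprocity_three hq4 hn]
          simp only [Int.cast_natCast]
          rw [hchi']
          push_cast
          ring
    · have hmo : m % 2 = 1 := by omega
      have hmodd : Odd m := Nat.odd_iff.2 hmo
      have hcop : Nat.Coprime 4 m := by
        rw [show 4 = 2 ^ 2 by norm_num]
        exact Nat.Coprime.pow_left 2 (Nat.coprime_two_left.2 hmodd)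
      have h := dftEigen_chi4.mul (by norm_num) hm0 hcop (dftEigen_jacobi hsq hmo)
      refine exists_dftEigen_of_values hd1' h hm ?_ ?_ ?_ ?_
      · simp only [epsBar, hm4, Int.cast_natCast, Nat.cast_ofNat]
        rw [jacobiSym.at_four hmodd, ZMod.χ₄_nat_three_mod_four hm4]
        have hI : Complex.I * Complex.I = -1 := Complex.I_mul_I
        have h4 : Real.sqrt ((4 * m : ℕ) : ℝ) = 2 * Real.sqrt m := by
          push_cast
          rw [Real.sqrt_mul (by norm_num), show (4 : ℝ) = 2 ^ 2 by norm_num,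
            Real.sqrt_sq (by norm_num)]
        rw [h4]
        simp only [Nat.reduceEqDiff, if_false]
        push_cast
        linear_combination (2 * Real.sqrt m : ℂ) * hI
      · simp
      · rw [hchi]
        have : ZMod.χ₄ ((2 : ℤ) : ZMod 4) = 0 := by decide
        rw [this]; simp
      · intro n hn
        rw [hm]
        push_cast
        rw [jacobiSym.mul_left, jacobiSym.at_four hn, one_mul, jacobi_reciprocity_three hm4 hn]
        push_cast
        rfl

/-- The Kronecker symbol of a fundamental discriminant as a function on `ℤ/d`. -/
noncomputable def kroneckerMod (d : ℕ+) : ZMod (d : ℕ) → ℂ :=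
  fun a => ((kronecker d a.val : ℤ) : ℂ)

theorem Lquad_eq (d : ℕ+) (s : ℂ) : Lquad d s = ZMod.LFunction (kroneckerMod d) s := rfl

theorem kroneckerMod_natCast {d : ℕ+} (hd : d ∈ fundDisc) (n : ℕ) :
    kroneckerMod d (n : ZMod (d : ℕ)) = ((kronecker d n : ℤ) : ℂ) := by
  rcases eq_or_ne d 1 with rfl | hd1
  · simp [kroneckerMod, kronecker_one_left]
  · obtain ⟨f, hf, -, hk⟩ := exists_dftEigen_kronecker hd hd1
    rw [kroneckerMod, hk, hk]
    apply hf.periodic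
    rw [ZMod.val_natCast]
    push_cast
    exact Int.mod_modEq _ _

theorem dft_kroneckerMod {d : ℕ+} (hd : d ∈ fundDisc) (hd1 : d ≠ 1) :
    ZMod.dft (kroneckerMod d) = (Real.sqrt (d : ℕ) : ℂ) • kroneckerMod d := by
  obtain ⟨f, hf, -, hk⟩ := exists_dftEigen_kronecker hd hd1
  funext k
  have h := hf.eigen (k.val : ℕ)
  rw [sum_range_eq_sum_zmod] at h
  rw [ZMod.dft_apply, Pi.smul_apply, smul_eq_mul, kroneckerMod, hk, ← h]
  refine Finset.sum_congr rfl fun j _ => ?_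
  have e2 : -(j * k) = ((-((j.val : ℕ) * (k.val : ℕ)) : ℤ) : ZMod (d : ℕ)) := by
    push_cast; rw [ZMod.natCast_zmod_val, ZMod.natCast_zmod_val]
  rw [e2, ZMod.stdAddChar_coe, smul_eq_mul, kroneckerMod, hk, mul_comm]
  congr 2
  push_cast
  ring

/-- Two Fourier transforms give `d f(-k)` by inversion and `d f(k)` by the eigenvalue `√d`. -/
theorem even_kroneckerMod {d : ℕ+} (hd : d ∈ fundDisc) (hd1 : d ≠ 1) :
    Function.Even (kroneckerMod d) := by
  intro k
  have h := congrFun (ZMod.dft_dft (kroneckerMod d)) k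
  rw [dft_kroneckerMod hd hd1, map_smul, dft_kroneckerMod hd hd1, smul_smul, ← Complex.ofReal_mul,
    Real.mul_self_sqrt (Nat.cast_nonneg _)] at h
  have hd0 : (((d : ℕ) : ℝ) : ℂ) ≠ 0 := by
    exact_mod_cast d.ne_zero
  simp only [Pi.smul_apply, smul_eq_mul] at h
  apply mul_left_cancel₀ hd0
  rw [h]
  simp

theorem kroneckerMod_zero {d : ℕ+} (hd1 : d ≠ 1) : kroneckerMod d 0 = 0 := by
  have hd1' : (d : ℕ) ≠ 1 := fun h => hd1 (PNat.coe_eq_one_iff.1 h)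
  simp [kroneckerMod, kronecker_zero_right hd1']

/-- The eigenvalue equation at frequency `0`, where the symbol vanishes because `d ≠ 1`; it makes
`L(s, χ_d)` entire. -/
theorem sum_kroneckerMod {d : ℕ+} (hd : d ∈ fundDisc) (hd1 : d ≠ 1) :
    ∑ a, kroneckerMod d a = 0 := by
  have h := congrFun (dft_kroneckerMod hd hd1) 0
  rw [ZMod.dft_apply] at h
  simpa [kroneckerMod_zero hd1] using h

/-- The functional equation of `L(s, χ_d)`: the root number of `χ_d` is `1`. -/
theorem Lquad_functional_equation {d : ℕ+} (hd : d ∈ fundDisc) (hd1 : d ≠ 1) {s : ℂ}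
    (hs0 : 0 < s.re) (hs1 : s.re < 1) :
    Lquad d s = gammaRatio s * ((d : ℕ) : ℂ) ^ (1 / 2 - s) * Lquad d (1 - s) := by
  have hd0 : ((d : ℕ) : ℂ) ≠ 0 := by exact_mod_cast d.ne_zero
  have he := even_kroneckerMod hd hd1
  have h0 := kroneckerMod_zero hd1
  -- The general functional equation relates a periodic function to its Fourier transform; the
  -- eigenvalue equation returns the same function with the factor `√d`.
  have hfe := ZMod.completedLFunction_one_sub_even he s (Or.inr (sum_kroneckerMod hd hd1)) (Or.inr h0)
  rw [dft_kroneckerMod hd hd1] at hfe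
  have hconst := ZMod.completedLFunction_const_mul (Real.sqrt (d : ℕ) : ℂ) (kroneckerMod d) s
  have hsm : ((Real.sqrt (d : ℕ) : ℂ) • kroneckerMod d) =
      fun j => (Real.sqrt (d : ℕ) : ℂ) * kroneckerMod d j := rfl
  rw [hsm, hconst] at hfe
  rw [Lquad_eq, Lquad_eq, ZMod.LFunction_eq_completed_div_gammaFactor_even he s (Or.inr h0),
    ZMod.LFunction_eq_completed_div_gammaFactor_even he (1 - s) (Or.inr h0), hfe]
  have hG : Complex.Gamma (s / 2) ≠ 0 := Complex.Gamma_ne_zero_of_re_pos (by simpa using hs0)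
  have hG' : Complex.Gamma ((1 - s) / 2) ≠ 0 :=
    Complex.Gamma_ne_zero_of_re_pos (by simpa using hs1)
  have hpi : (Real.pi : ℂ) ≠ 0 := Complex.ofReal_ne_zero.2 Real.pi_pos.ne'
  have hsqrt : (Real.sqrt (d : ℕ) : ℂ) = ((d : ℕ) : ℂ) ^ (1 / 2 : ℂ) := by
    rw [Real.sqrt_eq_rpow, Complex.ofReal_cpow (Nat.cast_nonneg _)]
    push_cast
    rfl
  have hdpow : ((d : ℕ) : ℂ) ^ (1 / 2 - s) * (((d : ℕ) : ℂ) ^ (s - 1) *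
      ((d : ℕ) : ℂ) ^ (1 / 2 : ℂ)) = 1 := by
    rw [← Complex.cpow_add _ _ hd0, ← Complex.cpow_add _ _ hd0]
    rw [show (1 / 2 - s + (s - 1 + 1 / 2) : ℂ) = 0 by ring, Complex.cpow_zero]
  have hratio : gammaRatio s * (Complex.Gammaℝ s / Complex.Gammaℝ (1 - s)) = 1 := by
    rw [gammaRatio, Complex.Gammaℝ_def, Complex.Gammaℝ_def]
    have e1 : (Real.pi : ℂ) ^ (-(1 - s) / 2) ≠ 0 := by simp [Complex.cpow_eq_zero_iff, hpi]
    have e2 : (Real.pi : ℂ) ^ (-s / 2) ≠ 0 := by simp [Complex.cpow_eq_zero_iff, hpi]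
    have e3 : (Real.pi : ℂ) ^ (s - 1 / 2) * (Real.pi : ℂ) ^ (-s / 2) = (Real.pi : ℂ) ^ (-(1 - s) / 2) := by
      rw [← Complex.cpow_add _ _ hpi]; congr 1; ring
    rw [← e3]
    have e4 : (Real.pi : ℂ) ^ (s - 1 / 2) ≠ 0 := by simp [Complex.cpow_eq_zero_iff, hpi]
    field_simp
  have hR : Complex.Gammaℝ s ≠ 0 := Complex.Gammaℝ_ne_zero_of_re_pos hs0
  have hR' : Complex.Gammaℝ (1 - s) ≠ 0 := Complex.Gammaℝ_ne_zero_of_re_pos (by simpa using hs1)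
  rw [hsqrt]
  rw [div_eq_iff hR]
  have : gammaRatio s * Complex.Gammaℝ s = Complex.Gammaℝ (1 - s) := by
    rw [← mul_div_assoc, div_eq_one_iff_eq hR'] at hratio
    exact hratio
  set Λ := ZMod.completedLFunction (kroneckerMod d) s
  calc Λ = (((d : ℕ) : ℂ) ^ (1 / 2 - s) * (((d : ℕ) : ℂ) ^ (s - 1) * ((d : ℕ) : ℂ) ^ (1 / 2 : ℂ))) *
        (Complex.Gammaℝ (1 - s) / Complex.Gammaℝ (1 - s)) * Λ := by
          rw [hdpow, div_self hR']; ring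
    _ = _ := by rw [← this]; ring

end Kronecker

end QuadraticMoments

namespace QuadraticMoments

open Filter Topology MeasureTheory

/-! ### Bounds for `L(s, χ_d)` in terms of the conductor. -/

section LBounds

/-- One-variable form of `differentiableOn_integral_of_locally_dominated`. -/
theorem differentiableOn_integral_of_locally_dominated_complex {α : Type*} [MeasurableSpace α]
    {μ : Measure α} {U : Set ℂ} (hU : IsOpen U) {F : ℂ → α → ℂ}
    (hmeas : ∀ z ∈ U, AEStronglyMeasurable (F z) μ)
    (hd : ∀ a, DifferentiableOn ℂ (fun z => F z a) U)
    (hb : ∀ z₀ ∈ U, ∃ r > 0, ∃ b : α → ℝ, Integrable b μ ∧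
      ∀ z ∈ Metric.ball z₀ r, z ∈ U → ∀ a, ‖F z a‖ ≤ b a) :
    DifferentiableOn ℂ (fun z => ∫ a, F z a ∂μ) U := by
  have hproj : Differentiable ℂ fun z : Fin 1 → ℂ => z 0 := by fun_prop
  have h := differentiableOn_integral_of_locally_dominated (μ := μ)
    (U := (fun z : Fin 1 → ℂ => z 0) ⁻¹' U) (hU.preimage hproj.continuous)
    (F := fun z a => F (z 0) a) (fun z hz => hmeas _ hz)
    (fun a => (hd a).comp hproj.differentiableOn fun z hz => hz) ?_
  · exact h.comp (f := fun z : ℂ => fun _ : Fin 1 => z) (by fun_prop) fun z hz => hz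
  · intro z₀ hz₀
    obtain ⟨r, hr, b, hbi, hle⟩ := hb _ hz₀
    refine ⟨r, hr, b, hbi, fun z hz hzU a => hle _ ?_ hzU a⟩
    exact lt_of_le_of_lt (dist_le_pi_dist z z₀ 0) hz

theorem differentiableAt_prod {E ι : Type*} [NormedAddCommGroup E] [NormedSpace ℂ E]
    {f : ι → E → ℂ} {x : E} (u : Finset ι) (h : ∀ i ∈ u, DifferentiableAt ℂ (f i) x) :
    DifferentiableAt ℂ (fun y => ∏ i ∈ u, f i y) x := by
  classical
  induction u using Finset.induction_on with
  | empty => simp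
  | insert a u ha ih =>
    simp only [Finset.prod_insert ha]
    exact (h a (Finset.mem_insert_self _ _)).mul
      (ih fun i hi => h i (Finset.mem_insert_of_mem hi))

theorem sum_range_mul_add_of_periodic {N : ℕ} {g : ℕ → ℂ} (hper : ∀ n, g (n + N) = g n)
    (h0 : ∑ j ∈ Finset.range N, g j = 0) (q r : ℕ) :
    ∑ j ∈ Finset.range (N * q + r), g j = ∑ j ∈ Finset.range r, g j := by
  induction q with
  | zero => simp
  | succ q ih =>
    rw [show N * (q + 1) + r = N + (N * q + r) by ring, Finset.sum_range_add, h0, zero_add, ← ih]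
    refine Finset.sum_congr rfl fun j _ => ?_
    rw [add_comm, hper]

theorem norm_sum_Icc_le_of_sum_zero {N : ℕ} [NeZero N] {Φ : ZMod N → ℂ} (h0 : Φ 0 = 0)
    (hsum : ∑ a, Φ a = 0) (hle : ∀ a, ‖Φ a‖ ≤ 1) (n : ℕ) :
    ‖∑ j ∈ Finset.Icc 1 n, Φ j‖ ≤ N := by
  have h1 : ∑ j ∈ Finset.Icc 1 n, Φ j = ∑ j ∈ Finset.range (n + 1), Φ j := by
    clear hsum hle
    induction n with
    | zero => simp [h0]
    | succ n ih => rw [Finset.sum_Icc_succ_top (by omega), ih, Finset.sum_range_succ _ (n + 1)]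
  have hz : ∑ j ∈ Finset.range N, Φ (j : ZMod N) = 0 := by
    rw [sum_range_eq_sum_zmod (fun j => Φ (j : ZMod N)), ← hsum]
    exact Finset.sum_congr rfl fun a _ => by rw [ZMod.natCast_zmod_val]
  rw [h1, ← Nat.div_add_mod (n + 1) N,
    sum_range_mul_add_of_periodic (g := fun j => Φ (j : ZMod N)) (fun m => by simp) hz]
  refine (norm_sum_le _ _).trans ((Finset.sum_le_sum fun j _ => hle _).trans ?_)
  simp only [Finset.sum_const, Finset.card_range, nsmul_eq_mul, mul_one]
  exact_mod_cast (Nat.mod_lt _ (Nat.pos_of_ne_zero (NeZero.ne N))).le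

/-- A convexity-free bound for `L(s, Φ)` in `Re s > 0` by partial summation. -/
theorem norm_LFunction_le_of_sum_zero {N : ℕ} [NeZero N] {Φ : ZMod N → ℂ} (h0 : Φ 0 = 0)
    (hsum : ∑ a, Φ a = 0) (hle : ∀ a, ‖Φ a‖ ≤ 1) {s : ℂ} (hs : 0 < s.re) :
    ‖ZMod.LFunction Φ s‖ ≤ ‖s‖ * (N / s.re) := by
  set S : ℝ → ℂ := fun t => ∑ j ∈ Finset.Icc 1 ⌊t⌋₊, Φ j with hS
  have hSle : ∀ t, ‖S t‖ ≤ N := fun t => norm_sum_Icc_le_of_sum_zero h0 hsum hle _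
  have hSm : Measurable S := by
    have : S = (fun n : ℕ => ∑ j ∈ Finset.Icc 1 n, Φ j) ∘ (Nat.floor : ℝ → ℕ) := rfl
    rw [this]
    exact (measurable_of_countable _).comp Nat.measurable_floor
  have hnorm : ∀ t ∈ Set.Ioi (1 : ℝ), ∀ z : ℂ, ‖S t * (t : ℂ) ^ (-(z + 1))‖ ≤ N * t ^ (-(z.re + 1)) := by
    intro t ht z
    have ht0 : (0 : ℝ) < t := lt_trans one_pos ht
    rw [norm_mul, Complex.norm_cpow_eq_rpow_re_of_pos ht0]
    simp only [Complex.neg_re, Complex.add_re, Complex.one_re]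
    gcongr
    exact hSle t
  have hU : IsOpen {z : ℂ | 0 < z.re} := isOpen_lt continuous_const Complex.continuous_re
  have hmeas : ∀ z : ℂ, AEStronglyMeasurable (fun t : ℝ => S t * (t : ℂ) ^ (-(z + 1)))
      (volume.restrict (Set.Ioi 1)) := by
    intro z
    refine hSm.aestronglyMeasurable.mul ?_
    refine ContinuousOn.aestronglyMeasurable (fun t ht => ?_) measurableSet_Ioi
    have ht0 : (0 : ℝ) < t := lt_trans one_pos ht
    exact (Complex.continuousAt_ofReal_cpow_const _ _ (Or.inr ht0.ne')).continuousWithinAt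
  -- The indicator makes holomorphy and the bound true for every real `t`, as the lemma on integrals
  -- demands, and not only for `t > 1`.
  set I : ℂ → ℂ := fun z => ∫ t in Set.Ioi (1 : ℝ), Set.indicator (Set.Ioi (1 : ℝ))
    (fun t => S t * (t : ℂ) ^ (-(z + 1))) t with hI
  have hId : DifferentiableOn ℂ I {z : ℂ | 0 < z.re} := by
    refine differentiableOn_integral_of_locally_dominated_complex hU ?_ ?_ ?_
    · intro z _
      exact (hmeas z).indicator measurableSet_Ioi
    · intro t
      by_cases ht : t ∈ Set.Ioi (1 : ℝ)
      · simp only [Set.indicator_of_mem ht]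
        have ht0 : (t : ℂ) ≠ 0 := Complex.ofReal_ne_zero.2 (lt_trans one_pos ht).ne'
        refine DifferentiableOn.const_mul (fun z _ => ?_) _
        exact (DifferentiableAt.const_cpow (by fun_prop) (Or.inl ht0)).differentiableWithinAt
      · simp only [Set.indicator_of_notMem ht]
        exact differentiableOn_const _
    · intro z₀ hz₀
      have hz₀' : 0 < z₀.re := hz₀
      refine ⟨z₀.re / 2, by positivity, fun t => Set.indicator (Set.Ioi (1 : ℝ))
        (fun t => N * t ^ (-(z₀.re / 2 + 1))) t, ?_, ?_⟩
      · refine Integrable.indicator ?_ measurableSet_Ioi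
        exact ((integrableOn_Ioi_rpow_of_lt (by linarith) one_pos).const_mul _)
      · intro z hz _ t
        by_cases ht : t ∈ Set.Ioi (1 : ℝ)
        · simp only [Set.indicator_of_mem ht]
          refine (hnorm t ht z).trans ?_
          have h1 : |(z - z₀).re| ≤ ‖z - z₀‖ := Complex.abs_re_le_norm _
          rw [Metric.mem_ball, dist_eq_norm] at hz
          rw [Complex.sub_re] at h1
          have h2 := (abs_le.1 h1).1
          gcongr 2
          · exact le_of_lt ht
          · linarith
        · simp only [Set.indicator_of_notMem ht, norm_zero, le_refl]
  have hIeq : ∀ z, I z = ∫ t in Set.Ioi (1 : ℝ), S t * (t : ℂ) ^ (-(z + 1)) := by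
    intro z
    simp only [hI]
    exact setIntegral_congr_fun measurableSet_Ioi fun t ht => by simp only [Set.indicator_of_mem ht]
  -- Abel summation gives the equality for `Re z > 1`; both sides are holomorphic for `Re z > 0`,
  -- the partial sums being bounded.
  have hEq : Set.EqOn (ZMod.LFunction Φ) (fun z => z * I z) {z : ℂ | 0 < z.re} := by
    refine eqOn_of_convex_of_eventuallyEq hU (convex_halfSpace_re_gt 0)
      (ZMod.differentiable_LFunction_of_sum_zero hsum).differentiableOn
      (differentiableOn_id.mul hId) (z₀ := 2) (by simp) ?_
    have h1 : IsOpen {z : ℂ | 1 < z.re} := isOpen_lt continuous_const Complex.continuous_re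
    filter_upwards [h1.mem_nhds (by simp : (2 : ℂ) ∈ {z : ℂ | 1 < z.re})] with z hz
    have hz' : 1 < z.re := hz
    rw [ZMod.LFunction_eq_LSeries Φ hz', hIeq]
    refine LSeries_eq_mul_integral _ le_rfl (by linarith) (ZMod.LSeriesSummable_of_one_lt_re Φ hz') ?_
    simp only [Real.rpow_zero]
    exact Asymptotics.isBigO_of_le' (c := N) _ fun n => by
      simpa using norm_sum_Icc_le_of_sum_zero h0 hsum hle n
  rw [hEq hs, norm_mul, hIeq]
  gcongr
  refine (norm_integral_le_of_norm_le (g := fun t => N * t ^ (-(s.re + 1)))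
    ((integrableOn_Ioi_rpow_of_lt (by linarith) one_pos).const_mul _) ?_).trans ?_
  · filter_upwards [ae_restrict_mem measurableSet_Ioi] with t ht using hnorm t ht s
  · rw [integral_const_mul, integral_Ioi_rpow_of_lt (by linarith) one_pos]
    simp only [neg_add_rev, Real.one_rpow]
    rw [show (-1 + -s.re + 1) = -s.re by ring, neg_div_neg_eq, mul_one_div]

theorem norm_kroneckerMod_le (d : ℕ+) (a : ZMod (d : ℕ)) : ‖kroneckerMod d a‖ ≤ 1 :=
  norm_kronecker_le _ _

theorem differentiable_Lquad {d : ℕ+} (hd : d ∈ fundDisc) (hd1 : d ≠ 1) :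
    Differentiable ℂ (Lquad d) :=
  ZMod.differentiable_LFunction_of_sum_zero (sum_kroneckerMod hd hd1)

/-- A bound far from sharp, but linear in `d`: `k` such factors are absorbed by taking `Re w > k +
1`. -/
theorem norm_Lquad_le {d : ℕ+} (hd : d ∈ fundDisc) (hd1 : d ≠ 1) {s : ℂ} (hs : 1 / 4 ≤ s.re) :
    ‖Lquad d s‖ ≤ 4 * (d : ℕ) * ‖s‖ := by
  have h := norm_LFunction_le_of_sum_zero (kroneckerMod_zero hd1) (sum_kroneckerMod hd hd1)
    (norm_kroneckerMod_le d) (s := s) (by linarith)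
  refine h.trans ?_
  rw [mul_comm]
  gcongr
  rw [div_le_iff₀ (by linarith)]
  nlinarith [Nat.cast_nonneg (α := ℝ) (d : ℕ)]

theorem LSeries_kronecker {d : ℕ+} (hd : d ∈ fundDisc) {s : ℂ} (hs : 1 < s.re) :
    Lquad d s = LSeries (fun n => ((kronecker d n : ℤ) : ℂ)) s := by
  rw [Lquad_eq, ZMod.LFunction_eq_LSeries _ hs]
  congr 1
  funext n
  exact kroneckerMod_natCast hd n

theorem norm_term_kronecker_le (d : ℕ) {a : ℝ} {s : ℂ} (hs : a ≤ s.re) (n : ℕ) :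
    ‖LSeries.term (fun n => ((kronecker d n : ℤ) : ℂ)) s n‖ ≤ 1 / (n : ℝ) ^ a := by
  rcases eq_or_ne n 0 with rfl | hn
  · simp [LSeries.term]; positivity
  · rw [LSeries.term_of_ne_zero hn, norm_div, Complex.norm_natCast_cpow_of_pos (Nat.pos_of_ne_zero hn)]
    have h1 : (1 : ℝ) ≤ n := by exact_mod_cast Nat.pos_of_ne_zero hn
    gcongr
    · exact norm_kronecker_le _ _

theorem norm_Lquad_le_of_one_lt {d : ℕ+} (hd : d ∈ fundDisc) {a : ℝ} (ha : 1 < a) {s : ℂ}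
    (hs : a ≤ s.re) : ‖Lquad d s‖ ≤ ∑' n : ℕ, 1 / (n : ℝ) ^ a := by
  rw [LSeries_kronecker hd (by linarith), LSeries]
  exact tsum_of_norm_bounded (Real.summable_one_div_nat_rpow.2 ha).hasSum
    fun n => norm_term_kronecker_le d hs n

theorem Lquad_one (s : ℂ) : Lquad 1 s = riemannZeta s := by
  have h := ZMod.LFunction_modOne_eq (fun a => ((kronecker 1 a.val : ℤ) : ℂ)) s
  have h1 : ∀ n, kronecker 1 n = 1 := fun n => kronecker_one_left n
  simp only [h1, Int.cast_one, one_mul] at h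
  refine Eq.trans ?_ h
  unfold Lquad
  simp only [PNat.one_coe, h1, Int.cast_one]

theorem one_mem_fundDisc : (1 : ℕ+) ∈ fundDisc := Or.inl ⟨rfl, squarefree_one⟩

end LBounds

/-! ### The multiple Dirichlet series without `d = 1`: convergence, holomorphy, functional equation.
-/

section StarSeries

variable {k : ℕ}

open Classical in
/-- The term of `A_M(s; w)` belonging to `d`, with the term of `d = 1` removed. -/
noncomputable def starTerm (M : ℕ) (s : Fin k → ℂ) (w : ℂ) (d : fundDisc) : ℂ :=
  if (d : ℕ+) = 1 then 0 else ((kronecker (d : ℕ+) M : ℤ) : ℂ) * (∏ j, Lquad d (s j)) /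
    (((d : ℕ+) : ℕ) : ℂ) ^ w

/-- `A_M(s; w)` without the term of `d = 1`. -/
noncomputable def starSeries (M : ℕ) (s : Fin k → ℂ) (w : ℂ) : ℂ := ∑' d, starTerm M s w d

theorem summable_fundDisc_rpow {b : ℝ} (hb : 1 < b) :
    Summable fun d : fundDisc => 1 / (((d : ℕ+) : ℕ) : ℝ) ^ b := by
  refine (Real.summable_one_div_nat_rpow.2 hb).comp_injective
    (i := fun d : fundDisc => ((d : ℕ+) : ℕ)) ?_
  intro a b h
  exact Subtype.ext (PNat.coe_injective h)

theorem norm_fullTerm_le (M : ℕ) {a b : ℝ} (ha : 1 < a) {s : Fin k → ℂ} {w : ℂ}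
    (hs : ∀ j, a ≤ (s j).re) (hw : b ≤ w.re) (d : fundDisc) :
    ‖((kronecker (d : ℕ+) M : ℤ) : ℂ) * (∏ j, Lquad d (s j)) / (((d : ℕ+) : ℕ) : ℂ) ^ w‖ ≤
      (∑' n : ℕ, 1 / (n : ℝ) ^ a) ^ k * (1 / (((d : ℕ+) : ℕ) : ℝ) ^ b) := by
  have hd1 : (1 : ℝ) ≤ ((d : ℕ+) : ℕ) := by exact_mod_cast (d : ℕ+).pos
  rw [norm_div, norm_mul, Complex.norm_natCast_cpow_of_pos (d : ℕ+).pos, ← mul_one_div]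
  have h1 : ‖∏ j, Lquad d (s j)‖ ≤ (∑' n : ℕ, 1 / (n : ℝ) ^ a) ^ k := by
    rw [norm_prod]
    calc _ ≤ ∏ _j : Fin k, ∑' n : ℕ, 1 / (n : ℝ) ^ a :=
          Finset.prod_le_prod (fun _ _ => norm_nonneg _) fun j _ =>
            norm_Lquad_le_of_one_lt d.2 ha (hs j)
      _ = _ := by simp
  have h2 : 1 / (((d : ℕ+) : ℕ) : ℝ) ^ w.re ≤ 1 / (((d : ℕ+) : ℕ) : ℝ) ^ b := by
    gcongr
  calc _ ≤ (1 * (∑' n : ℕ, 1 / (n : ℝ) ^ a) ^ k) * (1 / (((d : ℕ+) : ℕ) : ℝ) ^ b) := by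
        gcongr
        exact norm_kronecker_le _ _
    _ = _ := by ring

theorem norm_starTerm_le_conv (M : ℕ) {a b : ℝ} (ha : 1 < a) {s : Fin k → ℂ} {w : ℂ}
    (hs : ∀ j, a ≤ (s j).re) (hw : b ≤ w.re) (d : fundDisc) :
    ‖starTerm M s w d‖ ≤ (∑' n : ℕ, 1 / (n : ℝ) ^ a) ^ k * (1 / (((d : ℕ+) : ℕ) : ℝ) ^ b) := by
  unfold starTerm
  split_ifs
  · rw [norm_zero]
    have : 0 ≤ ∑' n : ℕ, 1 / (n : ℝ) ^ a := tsum_nonneg fun n => by positivity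
    positivity
  · exact norm_fullTerm_le M ha hs hw d

/-- The `k` linear bounds cost `d^k`. The resulting region of convergence contains both `s` and `1 -
s` near the critical line, where the functional equation can be applied term by term. -/
theorem norm_starTerm_le_strip (M : ℕ) {b : ℝ} {s : Fin k → ℂ} {w : ℂ}
    (hs : ∀ j, 1 / 4 ≤ (s j).re) (hw : b ≤ w.re) (d : fundDisc) :
    ‖starTerm M s w d‖ ≤ (∏ j, 4 * ‖s j‖) * (1 / (((d : ℕ+) : ℕ) : ℝ) ^ (b - k)) := by
  have hpos : (0 : ℝ) < ((d : ℕ+) : ℕ) := by exact_mod_cast (d : ℕ+).pos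
  have hd1 : (1 : ℝ) ≤ ((d : ℕ+) : ℕ) := by exact_mod_cast (d : ℕ+).pos
  unfold starTerm
  split_ifs with h
  · rw [norm_zero]
    have : 0 ≤ ∏ j, 4 * ‖s j‖ := Finset.prod_nonneg fun j _ => by positivity
    positivity
  · rw [norm_div, norm_mul, Complex.norm_natCast_cpow_of_pos (d : ℕ+).pos, ← mul_one_div]
    have h1 : ‖∏ j, Lquad d (s j)‖ ≤ (∏ j, 4 * ‖s j‖) * (((d : ℕ+) : ℕ) : ℝ) ^ k := by
      rw [norm_prod]
      calc _ ≤ ∏ j : Fin k, (4 * ‖s j‖ * (((d : ℕ+) : ℕ) : ℝ)) :=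
            Finset.prod_le_prod (fun _ _ => norm_nonneg _) fun j _ =>
              (norm_Lquad_le d.2 h (hs j)).trans_eq (by ring)
        _ = _ := by simp [Finset.prod_mul_distrib]
    have h2 : 1 / (((d : ℕ+) : ℕ) : ℝ) ^ w.re ≤ 1 / (((d : ℕ+) : ℕ) : ℝ) ^ b := by
      gcongr
    calc _ ≤ (1 * ((∏ j, 4 * ‖s j‖) * (((d : ℕ+) : ℕ) : ℝ) ^ k)) *
          (1 / (((d : ℕ+) : ℕ) : ℝ) ^ b) := by
          gcongr
          exact norm_kronecker_le _ _
      _ = _ := by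
          rw [Real.rpow_sub hpos, Real.rpow_natCast]
          field_simp

theorem multiSeries_sub_eq_starSeries (M : ℕ) {s : Fin k → ℂ} {w : ℂ}
    (hs : ∀ j, 1 < (s j).re) (hw : 1 < w.re) :
    multiSeries M s w - ∏ j, riemannZeta (s j) = starSeries M s w := by
  obtain ⟨a, ha1, ha⟩ : ∃ a : ℝ, 1 < a ∧ ∀ j, a ≤ (s j).re := by
    rcases isEmpty_or_nonempty (Fin k) with h | h
    · exact ⟨2, by norm_num, fun j => h.elim j⟩
    · obtain ⟨j₀, hj₀⟩ := Finite.exists_min fun j => (s j).re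
      exact ⟨(s j₀).re, hs j₀, hj₀⟩
  have hsum : Summable fun d : fundDisc => ((kronecker (d : ℕ+) M : ℤ) : ℂ) *
      (∏ j, Lquad d (s j)) / (((d : ℕ+) : ℕ) : ℂ) ^ w :=
    Summable.of_norm_bounded ((summable_fundDisc_rpow hw).mul_left _)
      fun d => norm_fullTerm_le M ha1 ha le_rfl d
  classical
  rw [multiSeries, hsum.tsum_eq_add_tsum_ite ⟨1, one_mem_fundDisc⟩]
  have h1 : ((kronecker ((1 : ℕ+) : ℕ) M : ℤ) : ℂ) * (∏ j, Lquad 1 (s j)) /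
      (((1 : ℕ+) : ℕ) : ℂ) ^ w = ∏ j, riemannZeta (s j) := by
    simp only [Lquad_one, PNat.one_coe, kronecker_one_left]
    simp
  simp only at h1 ⊢
  rw [h1, add_sub_cancel_left]
  unfold starSeries starTerm
  congr 1
  funext d
  simp only [Subtype.ext_iff]

theorem differentiable_starTerm (M : ℕ) (d : fundDisc) :
    Differentiable ℂ fun z : Fin (k + 1) → ℂ =>
      starTerm M (fun j => z j.castSucc) (z (Fin.last k)) d := by
  unfold starTerm
  split_ifs with h
  · exact differentiable_const _
  · have hd0 : (((d : ℕ+) : ℕ) : ℂ) ≠ 0 := by exact_mod_cast (d : ℕ+).ne_zero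
    intro z
    simp only [div_eq_mul_inv, ← Complex.cpow_neg]
    refine DifferentiableAt.mul (DifferentiableAt.const_mul ?_ _) ?_
    · refine differentiableAt_prod _ fun j _ => ?_
      exact (differentiable_Lquad d.2 h _).comp z (by fun_prop)
    · exact DifferentiableAt.const_cpow (by fun_prop) (Or.inl hd0)

/-- The region `Re s_j > 1/4`, `Re w > k + 1`. -/
def stripRegion (k : ℕ) : Set (Fin (k + 1) → ℂ) :=
  {z | (∀ j : Fin k, 1 / 4 < (z j.castSucc).re) ∧ (k : ℝ) + 1 < (z (Fin.last k)).re}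

theorem isOpen_convRegion (k : ℕ) : IsOpen (convRegion k) := by
  have : convRegion k = ⋂ i, {z : Fin (k + 1) → ℂ | 1 < (z i).re} := by
    ext z; simp [convRegion]
  rw [this]
  exact isOpen_iInter_of_finite fun i =>
    isOpen_lt continuous_const (Complex.continuous_re.comp (continuous_apply i))

theorem isOpen_stripRegion (k : ℕ) : IsOpen (stripRegion k) := by
  have : stripRegion k = (⋂ j : Fin k, {z : Fin (k + 1) → ℂ | 1 / 4 < (z j.castSucc).re}) ∩
      {z | (k : ℝ) + 1 < (z (Fin.last k)).re} := by
    ext z; simp [stripRegion]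
  rw [this]
  refine (isOpen_iInter_of_finite fun i => ?_).inter ?_
  · exact isOpen_lt continuous_const (Complex.continuous_re.comp (continuous_apply _))
  · exact isOpen_lt continuous_const (Complex.continuous_re.comp (continuous_apply _))

theorem re_sub_le_of_mem_ball {n : ℕ} {z z₀ : Fin n → ℂ} {r : ℝ} (hz : z ∈ Metric.ball z₀ r)
    (i : Fin n) : (z₀ i).re - r ≤ (z i).re := by
  have h1 : |(z i - z₀ i).re| ≤ ‖z i - z₀ i‖ := Complex.abs_re_le_norm _
  have h2 : ‖z i - z₀ i‖ ≤ ‖z - z₀‖ := norm_le_pi_norm (z - z₀) i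
  rw [Metric.mem_ball, dist_eq_norm] at hz
  rw [Complex.sub_re] at h1
  linarith [(abs_le.1 h1).1]

theorem differentiableOn_starSeries_conv (k M : ℕ) :
    DifferentiableOn ℂ (fun z : Fin (k + 1) → ℂ =>
      starSeries M (fun j => z j.castSucc) (z (Fin.last k))) (convRegion k) := by
  refine differentiableOn_tsum_of_locally_dominated (isOpen_convRegion k)
    (fun d => (differentiable_starTerm M d).differentiableOn) fun z₀ hz₀ => ?_
  obtain ⟨i₀, hi₀⟩ := Finite.exists_min fun i => (z₀ i).re
  have h1 : 1 < (z₀ i₀).re := hz₀ i₀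
  set r := ((z₀ i₀).re - 1) / 2 with hr
  have hle : ∀ z ∈ Metric.ball z₀ r, ∀ i, 1 + r ≤ (z i).re := by
    intro z hz i
    have := re_sub_le_of_mem_ball hz i
    have := hi₀ i
    linarith
  refine ⟨r, by linarith, fun d => (∑' n : ℕ, 1 / (n : ℝ) ^ (1 + r)) ^ k *
    (1 / (((d : ℕ+) : ℕ) : ℝ) ^ (1 + r)), (summable_fundDisc_rpow (by linarith)).mul_left _,
    fun z hz _ d => ?_⟩
  exact norm_starTerm_le_conv (a := 1 + r) M (by linarith) (fun j => hle z hz _) (hle z hz _) d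

theorem differentiableOn_starSeries_strip (k M : ℕ) :
    DifferentiableOn ℂ (fun z : Fin (k + 1) → ℂ =>
      starSeries M (fun j => z j.castSucc) (z (Fin.last k))) (stripRegion k) := by
  refine differentiableOn_tsum_of_locally_dominated (isOpen_stripRegion k)
    (fun d => (differentiable_starTerm M d).differentiableOn) fun z₀ hz₀ => ?_
  have h1 : (k : ℝ) + 1 < (z₀ (Fin.last k)).re := hz₀.2
  set r := ((z₀ (Fin.last k)).re - (k + 1)) / 2 with hr
  refine ⟨r, by linarith, fun d => (∏ _j : Fin k, 4 * (‖z₀‖ + r)) *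
    (1 / (((d : ℕ+) : ℕ) : ℝ) ^ ((k : ℝ) + 1 + r - k)),
    (summable_fundDisc_rpow (by linarith)).mul_left _, fun z hz hzU d => ?_⟩
  have h2 := re_sub_le_of_mem_ball hz (Fin.last k)
  refine (norm_starTerm_le_strip (b := k + 1 + r) M (fun j => (hzU.1 j).le) (by linarith) d).trans ?_
  refine mul_le_mul_of_nonneg_right ?_ (by positivity)
  refine Finset.prod_le_prod (fun j _ => by positivity) fun j _ => ?_
  have h3 := norm_le_pi_norm z j.castSucc
  have h4 : ‖z‖ ≤ ‖z₀‖ + ‖z - z₀‖ := norm_le_norm_add_norm_sub' _ _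
  rw [Metric.mem_ball, dist_eq_norm] at hz
  linarith

theorem norm_starSeries_le_conv (M : ℕ) {a b : ℝ} (ha : 1 < a) (hb : 1 < b) : ∃ C : ℝ,
    ∀ (s : Fin k → ℂ) (w : ℂ), (∀ j, a ≤ (s j).re) → b ≤ w.re → ‖starSeries M s w‖ ≤ C :=
  ⟨_, fun _ _ hs hw => tsum_of_norm_bounded ((summable_fundDisc_rpow hb).mul_left _).hasSum
    fun d => norm_starTerm_le_conv M ha hs hw d⟩

theorem sigmaJ_eq (s : Fin k → ℂ) (J : Finset (Fin k)) (w : ℂ) :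
    sigmaJ s J w = w + ∑ j ∈ J, (s j - 1 / 2) := by
  rw [sigmaJ, Finset.sum_sub_distrib, Finset.sum_const, nsmul_eq_mul]
  ring

/-- The functional equation of the multiple Dirichlet series under `s_j ↦ 1 - s_j`, `j ∈ J`. -/
theorem starSeries_reflect (M : ℕ) {s : Fin k → ℂ} (hs : ∀ j, 0 < (s j).re ∧ (s j).re < 1)
    (J : Finset (Fin k)) (w : ℂ) :
    starSeries M s w = (∏ j ∈ J, gammaRatio (s j)) * starSeries M (reflect s J) (sigmaJ s J w) := by
  unfold starSeries
  rw [← tsum_mul_left]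
  congr 1
  funext d
  unfold starTerm
  split_ifs with h
  · simp
  · have hd0 : (((d : ℕ+) : ℕ) : ℂ) ≠ 0 := by exact_mod_cast (d : ℕ+).ne_zero
    have h1 : ∏ j, Lquad d (s j) = (∏ j ∈ J, (gammaRatio (s j) * (((d : ℕ+) : ℕ) : ℂ) ^ (1 / 2 - s j))) *
        ∏ j, Lquad d (reflect s J j) := by
      rw [← Finset.prod_mul_prod_compl J, ← Finset.prod_mul_prod_compl J (fun j => Lquad d (reflect s J j)),
        ← mul_assoc, ← Finset.prod_mul_distrib]
      congr 1
      · refine Finset.prod_congr rfl fun j hj => ?_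
        rw [Lquad_functional_equation d.2 h (hs j).1 (hs j).2]
        simp [reflect, hj]
      · refine Finset.prod_congr rfl fun j hj => ?_
        simp [reflect, Finset.mem_compl.1 hj]
    have h2 : ∏ j ∈ J, (((d : ℕ+) : ℕ) : ℂ) ^ (1 / 2 - s j) =
        (((d : ℕ+) : ℕ) : ℂ) ^ (∑ j ∈ J, (1 / 2 - s j)) := by
      clear h1
      induction J using Finset.induction_on with
      | empty => simp
      | insert a J ha ih => rw [Finset.prod_insert ha, Finset.sum_insert ha, ih, Complex.cpow_add _ _ hd0]
    -- The conductor powers produced by the functional equations of the single L-functions turn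
    -- `d^{-w}` into `d^{-σ_J(w)}`.
    have h3 : (((d : ℕ+) : ℕ) : ℂ) ^ sigmaJ s J w = (((d : ℕ+) : ℕ) : ℂ) ^ w /
        (((d : ℕ+) : ℕ) : ℂ) ^ (∑ j ∈ J, (1 / 2 - s j)) := by
      rw [← Complex.cpow_sub _ _ hd0, sigmaJ_eq]
      congr 1
      rw [sub_eq_add_neg, ← Finset.sum_neg_distrib]
      congr 1
      exact Finset.sum_congr rfl fun j _ => by ring
    rw [h1, Finset.prod_mul_distrib, h2, h3]
    have h4 : (((d : ℕ+) : ℕ) : ℂ) ^ (∑ j ∈ J, (1 / 2 - s j)) ≠ 0 := by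
      simp [Complex.cpow_eq_zero_iff, hd0]
    have h5 : (((d : ℕ+) : ℕ) : ℂ) ^ w ≠ 0 := by simp [Complex.cpow_eq_zero_iff, hd0]
    field_simp

end StarSeries

end QuadraticMoments

namespace QuadraticMoments

open Filter Topology

/-! ### Sums over tuples `(n_1, …, n_k)` grouped by their product. -/

section TupleConvolution

/-- Summation over pairs, grouped by the value of the product. -/
theorem hasSum_divisorsAntidiagonal {E : Type*} [NormedAddCommGroup E] [CompleteSpace E] {F : ℕ × ℕ → E}
    (h0 : ∀ p : ℕ × ℕ, p.1 * p.2 = 0 → F p = 0) {a : E} (ha : HasSum F a) :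
    HasSum (fun N : ℕ => ∑ p ∈ N.divisorsAntidiagonal, F p) a := by
  convert ha.tsum_fiberwise (fun p : ℕ × ℕ => p.1 * p.2) using 1
  funext n
  rcases eq_or_ne n 0 with rfl | hn
  · rw [Nat.divisorsAntidiagonal_zero, Finset.sum_empty]
    symm
    exact (tsum_congr fun p => h0 _ p.2).trans tsum_zero
  · rw [show (fun p : ℕ × ℕ ↦ p.1 * p.2) ⁻¹' {n} = n.divisorsAntidiagonal by ext; simp [hn],
      Finset.tsum_subtype' n.divisorsAntidiagonal F]

/-- The weight depends on the product only, so it passes through the convolution. In the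
applications it is a Kronecker symbol, or the coefficient `a(MN)` restricted to square `MN`. -/
theorem hasSum_convolution {a b : ArithmeticFunction ℂ} (ha : Summable fun n => ‖a n‖)
    (hb : Summable fun n => ‖b n‖) {φ : ℕ → ℂ} (hφ : ∀ n, ‖φ n‖ ≤ 1) :
    Summable (fun p : ℕ × ℕ => φ (p.1 * p.2) * (a p.1 * b p.2)) ∧
    HasSum (fun N => φ N * (a * b) N) (∑' p : ℕ × ℕ, φ (p.1 * p.2) * (a p.1 * b p.2)) := by
  have hs : Summable (fun p : ℕ × ℕ => φ (p.1 * p.2) * (a p.1 * b p.2)) := by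
    refine Summable.of_norm_bounded (summable_mul_of_summable_norm ha hb).norm fun p => ?_
    rw [norm_mul]
    exact mul_le_of_le_one_left (norm_nonneg _) (hφ _)
  refine ⟨hs, ?_⟩
  have h : (fun N => φ N * (a * b) N) =
      fun N => ∑ p ∈ N.divisorsAntidiagonal, φ (p.1 * p.2) * (a p.1 * b p.2) := by
    funext N
    rw [ArithmeticFunction.mul_apply, Finset.mul_sum]
    refine Finset.sum_congr rfl fun p hp => ?_
    rw [(Nat.mem_divisorsAntidiagonal.1 hp).1]
  rw [h]
  refine hasSum_divisorsAntidiagonal (fun p hp => ?_) hs.hasSum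
  · rcases Nat.mul_eq_zero.1 hp with h | h <;> simp [h]

theorem summable_norm_convolution {a b : ArithmeticFunction ℂ} (ha : Summable fun n => ‖a n‖)
    (hb : Summable fun n => ‖b n‖) : Summable fun n => ‖(a * b) n‖ := by
  have h : Summable fun p : ℕ × ℕ => ‖a p.1 * b p.2‖ := (summable_mul_of_summable_norm ha hb).norm
  refine Summable.of_nonneg_of_le (fun _ => norm_nonneg _) (fun N => ?_)
    (hasSum_divisorsAntidiagonal ?_ h.hasSum).summable
  · rw [ArithmeticFunction.mul_apply]
    exact norm_sum_le _ _
  · intro p hp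
    rcases Nat.mul_eq_zero.1 hp with h | h <;> simp [h]

/-- The arithmetic function `n ↦ n^{-s}`. -/
noncomputable def cpowFun (s : ℂ) : ArithmeticFunction ℂ :=
  ⟨fun n => if n = 0 then 0 else (n : ℂ) ^ (-s), by simp⟩

theorem cpowFun_apply (s : ℂ) {n : ℕ} (hn : n ≠ 0) : cpowFun s n = (n : ℂ) ^ (-s) := if_neg hn

/-- The arithmetic function `n ↦ n^{-a}`, for real `a`. -/
noncomputable def rpowFun (a : ℝ) : ArithmeticFunction ℝ :=
  ⟨fun n => if n = 0 then 0 else (n : ℝ) ^ (-a), by simp⟩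

theorem rpowFun_apply (a : ℝ) {n : ℕ} (hn : n ≠ 0) : rpowFun a n = (n : ℝ) ^ (-a) := if_neg hn

/-- `N ↦ ∑_{n_1 ⋯ n_k = N} n_1^{-s_1} ⋯ n_k^{-s_k}`. -/
noncomputable def tupleFun {k : ℕ} (s : Fin k → ℂ) : ArithmeticFunction ℂ := ∏ j, cpowFun (s j)

theorem tupleFun_zero (s : Fin 0 → ℂ) : tupleFun s = 1 := by simp [tupleFun]

theorem tupleFun_succ {k : ℕ} (s : Fin (k + 1) → ℂ) :
    tupleFun s = cpowFun (s 0) * tupleFun (fun j : Fin k => s j.succ) := by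
  rw [tupleFun, Fin.prod_univ_succ]; rfl

theorem isMultiplicative_cpowFun (s : ℂ) : (cpowFun s).IsMultiplicative := by
  refine ArithmeticFunction.IsMultiplicative.iff_ne_zero.2 ⟨by simp [cpowFun_apply], ?_⟩
  intro m n hm hn _
  rw [cpowFun_apply _ hm, cpowFun_apply _ hn, cpowFun_apply _ (mul_ne_zero hm hn), Nat.cast_mul,
    Complex.natCast_mul_natCast_cpow]

theorem isMultiplicative_tupleFun {k : ℕ} (s : Fin k → ℂ) : (tupleFun s).IsMultiplicative := by
  induction k with
  | zero => rw [tupleFun_zero]; exact ArithmeticFunction.isMultiplicative_one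
  | succ k ih => rw [tupleFun_succ]; exact (isMultiplicative_cpowFun _).mul (ih _)

theorem norm_cpowFun {s : ℂ} {n : ℕ} : ‖cpowFun s n‖ = rpowFun s.re n := by
  rcases eq_or_ne n 0 with rfl | hn
  · simp
  · rw [cpowFun_apply _ hn, rpowFun_apply _ hn, Complex.norm_natCast_cpow_of_pos
      (Nat.pos_of_ne_zero hn), Complex.neg_re]

theorem rpowFun_nonneg (a : ℝ) (n : ℕ) : 0 ≤ rpowFun a n := by
  rcases eq_or_ne n 0 with rfl | hn
  · simp
  · rw [rpowFun_apply _ hn]; positivity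

theorem rpowFun_anti {a b : ℝ} (hab : a ≤ b) (n : ℕ) : rpowFun b n ≤ rpowFun a n := by
  rcases eq_or_ne n 0 with rfl | hn
  · simp
  · rw [rpowFun_apply _ hn, rpowFun_apply _ hn]
    have : (1 : ℝ) ≤ n := by exact_mod_cast Nat.one_le_iff_ne_zero.2 hn
    gcongr

theorem rpowFun_pow_nonneg (a : ℝ) (k n : ℕ) : 0 ≤ (rpowFun a ^ k) n := by
  induction k generalizing n with
  | zero => rw [pow_zero, ArithmeticFunction.one_apply]; split_ifs <;> norm_num
  | succ k ih =>
    rw [pow_succ', ArithmeticFunction.mul_apply]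
    exact Finset.sum_nonneg fun p _ => mul_nonneg (rpowFun_nonneg _ _) (ih _)

theorem norm_tupleFun_le {k : ℕ} {a : ℝ} {s : Fin k → ℂ} (hs : ∀ j, a ≤ (s j).re) (n : ℕ) :
    ‖tupleFun s n‖ ≤ (rpowFun a ^ k) n := by
  induction k generalizing n with
  | zero =>
    rw [tupleFun_zero, pow_zero, ArithmeticFunction.one_apply, ArithmeticFunction.one_apply]
    split_ifs <;> simp
  | succ k ih =>
    rw [tupleFun_succ, pow_succ', ArithmeticFunction.mul_apply, ArithmeticFunction.mul_apply]
    refine (norm_sum_le _ _).trans (Finset.sum_le_sum fun p _ => ?_)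
    rw [norm_mul, norm_cpowFun]
    exact mul_le_mul (rpowFun_anti (hs 0) _) (ih (fun j => hs j.succ) _) (norm_nonneg _)
      (rpowFun_nonneg _ _)

theorem summable_norm_cpowFun {s : ℂ} (hs : 1 < s.re) : Summable fun n => ‖cpowFun s n‖ := by
  refine Summable.of_nonneg_of_le (fun _ => norm_nonneg _) (fun n => ?_)
    (Real.summable_one_div_nat_rpow.2 hs)
  rw [norm_cpowFun]
  rcases eq_or_ne n 0 with rfl | hn
  · simp; positivity
  · rw [rpowFun_apply _ hn, Real.rpow_neg (by positivity), one_div]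

theorem summable_norm_tupleFun {k : ℕ} {s : Fin k → ℂ} (hs : ∀ j, 1 < (s j).re) :
    Summable fun n => ‖tupleFun s n‖ := by
  induction k with
  | zero =>
    rw [tupleFun_zero]
    refine summable_of_ne_finset_zero (s := {1}) fun n hn => ?_
    rw [ArithmeticFunction.one_apply_ne (by simpa using hn), norm_zero]
  | succ k ih =>
    rw [tupleFun_succ]
    exact summable_norm_convolution (summable_norm_cpowFun (hs 0)) (ih fun j => hs j.succ)

theorem differentiable_tupleFun (k n : ℕ) :
    Differentiable ℂ fun s : Fin k → ℂ => tupleFun s n := by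
  induction k generalizing n with
  | zero => simp only [tupleFun_zero]; exact differentiable_const _
  | succ k ih =>
    simp only [tupleFun_succ, ArithmeticFunction.mul_apply]
    refine Differentiable.fun_sum fun p hp => ?_
    refine Differentiable.mul ?_ ?_
    · have hp1 : p.1 ≠ 0 := (Nat.ne_zero_of_mem_divisorsAntidiagonal hp).1
      simp only [cpowFun_apply _ hp1]
      intro s
      exact DifferentiableAt.const_cpow (by fun_prop) (Or.inl (by exact_mod_cast hp1))
    · exact (ih p.2).comp (by fun_prop : Differentiable ℂ fun s : Fin (k + 1) → ℂ =>
        fun j : Fin k => s j.succ)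

/-- Induction on `k` with `φ` generalized: once `n_1 = m` is fixed, the remaining weight is `n ↦ φ
(m * n)`, again bounded by `1`. -/
theorem hasSum_tuples {k : ℕ} {s : Fin k → ℂ} (hs : ∀ j, 1 < (s j).re) {φ : ℕ → ℂ}
    (hφ : ∀ n, ‖φ n‖ ≤ 1) :
    HasSum (fun n : Fin k → ℕ+ => φ (∏ j, (n j : ℕ)) * ∏ j, ((n j : ℕ) : ℂ) ^ (-s j))
      (∑' N, φ N * tupleFun s N) := by
  induction k generalizing φ with
  | zero =>
    have h1 : ∑' N, φ N * tupleFun s N = φ 1 := by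
      rw [tsum_eq_single 1 fun n hn => ?_]
      · simp [tupleFun_zero]
      · rw [tupleFun_zero, ArithmeticFunction.one_apply_ne hn, mul_zero]
    rw [h1]
    simp
  | succ k ih =>
    rw [← (Fin.consEquiv fun _ : Fin (k + 1) => ℕ+).hasSum_iff]
    have hs' : ∀ j : Fin k, 1 < (s j.succ).re := fun j => hs j.succ
    have hfun : ((fun n : Fin (k + 1) → ℕ+ => φ (∏ j, (n j : ℕ)) * ∏ j, ((n j : ℕ) : ℂ) ^ (-s j)) ∘
        (Fin.consEquiv fun _ : Fin (k + 1) => ℕ+)) = fun p : ℕ+ × (Fin k → ℕ+) =>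
          φ ((p.1 : ℕ) * ∏ j, (p.2 j : ℕ)) * (cpowFun (s 0) p.1 *
            ∏ j : Fin k, ((p.2 j : ℕ) : ℂ) ^ (-s j.succ)) := by
      funext p
      simp [Fin.consEquiv, Fin.prod_univ_succ, cpowFun_apply]
    rw [hfun]
    have hsum1 : Summable fun n : ℕ+ => ‖cpowFun (s 0) n‖ :=
      (summable_norm_cpowFun (hs 0)).comp_injective PNat.coe_injective
    have hsum2 : Summable fun n : Fin k → ℕ+ => ‖∏ j, ((n j : ℕ) : ℂ) ^ (-s j.succ)‖ := by
      have := (ih hs' (φ := fun _ => 1) (by simp)).summable.norm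
      simpa using this
    have hsum : Summable fun p : ℕ+ × (Fin k → ℕ+) =>
          φ ((p.1 : ℕ) * ∏ j, (p.2 j : ℕ)) * (cpowFun (s 0) p.1 *
            ∏ j : Fin k, ((p.2 j : ℕ) : ℂ) ^ (-s j.succ)) := by
      refine Summable.of_norm_bounded (summable_mul_of_summable_norm hsum1 hsum2).norm fun p => ?_
      rw [norm_mul]
      exact mul_le_of_le_one_left (norm_nonneg _) (hφ _)
    convert hsum.hasSum using 1
    obtain ⟨hc1, hc2⟩ := hasSum_convolution (summable_norm_cpowFun (hs 0))
      (summable_norm_tupleFun hs') hφ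
    rw [tupleFun_succ, hc2.tsum_eq, hc1.tsum_prod, hsum.tsum_prod]
    have h3 : ∀ m : ℕ, ∑' n, φ (m * n) * (cpowFun (s 0) m * tupleFun (fun j : Fin k => s j.succ) n) =
        cpowFun (s 0) m * ∑' n, φ (m * n) * tupleFun (fun j : Fin k => s j.succ) n := by
      intro m
      rw [← tsum_mul_left]
      exact tsum_congr fun n => by ring
    simp only [h3]
    rw [← PNat.coe_injective.tsum_eq (f := fun m : ℕ => cpowFun (s 0) m *
      ∑' n, φ (m * n) * tupleFun (fun j : Fin k => s j.succ) n)]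
    · refine tsum_congr fun m => ?_
      rw [← (ih hs' (φ := fun n => φ (m * n)) fun n => hφ _).tsum_eq, ← tsum_mul_left]
      exact tsum_congr fun n => by ring
    · intro m hm
      rcases eq_or_ne m 0 with rfl | h
      · simp at hm
      · exact ⟨⟨m, Nat.pos_of_ne_zero h⟩, rfl⟩

/-- Multiplicativity is asked only at nonzero arguments, which is what the Kronecker symbol
satisfies; `cpowFun` vanishes at `0`, so nothing is lost. -/
theorem prod_tsum_mul_cpowFun {k : ℕ} {s : Fin k → ℂ} (hs : ∀ j, 1 < (s j).re) {χ : ℕ → ℂ}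
    (hχ : ∀ n, ‖χ n‖ ≤ 1) (h1 : χ 1 = 1)
    (hmul : ∀ m n, m ≠ 0 → n ≠ 0 → χ (m * n) = χ m * χ n) :
    ∏ j, (∑' N, χ N * cpowFun (s j) N) = ∑' N, χ N * tupleFun s N := by
  induction k with
  | zero =>
    rw [tsum_eq_single 1 fun n hn => ?_]
    · simp [tupleFun_zero, h1]
    · rw [tupleFun_zero, ArithmeticFunction.one_apply_ne hn, mul_zero]
  | succ k ih =>
    have hs' : ∀ j : Fin k, 1 < (s j.succ).re := fun j => hs j.succ
    have hle : ∀ f : ArithmeticFunction ℂ, Summable (fun n => ‖f n‖) →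
        Summable fun n => ‖χ n * f n‖ := by
      intro f hf
      refine Summable.of_nonneg_of_le (fun _ => norm_nonneg _) (fun n => ?_) hf
      rw [norm_mul]
      exact mul_le_of_le_one_left (norm_nonneg _) (hχ _)
    rw [Fin.prod_univ_succ, ih hs', tupleFun_succ, (hasSum_convolution
      (summable_norm_cpowFun (hs 0)) (summable_norm_tupleFun hs') hχ).2.tsum_eq,
      tsum_mul_tsum_of_summable_norm (hle _ (summable_norm_cpowFun (hs 0)))
        (hle _ (summable_norm_tupleFun hs'))]
    refine tsum_congr fun p => ?_
    rcases eq_or_ne p.1 0 with h | h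
    · simp [h]
    rcases eq_or_ne p.2 0 with h' | h'
    · simp [h']
    rw [hmul _ _ h h']
    ring

theorem convolution_prime_pow {R : Type*} [CommSemiring R] (f g : ArithmeticFunction R) {p : ℕ}
    (hp : p.Prime) (e : ℕ) :
    (f * g) (p ^ e) = ∑ i ∈ Finset.range (e + 1), f (p ^ i) * g (p ^ (e - i)) := by
  rw [ArithmeticFunction.mul_apply, Nat.sum_divisorsAntidiagonal (fun a b => f a * g b),
    Nat.divisors_prime_pow hp, Finset.sum_map]
  refine Finset.sum_congr rfl fun i hi => ?_
  simp only [Function.Embedding.coeFn_mk]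
  rw [Nat.pow_div (by simpa [Nat.lt_succ_iff] using hi) hp.pos]

theorem rpowFun_prime_pow (a : ℝ) {p : ℕ} (hp : p.Prime) (e : ℕ) :
    rpowFun a (p ^ e) = ((p : ℝ) ^ (-a)) ^ e := by
  rw [rpowFun_apply _ (pow_ne_zero _ hp.ne_zero), Nat.cast_pow, ← Real.rpow_natCast,
    ← Real.rpow_mul (by positivity), ← Real.rpow_natCast, ← Real.rpow_mul (by positivity), mul_comm]

theorem cpowFun_prime_pow (s : ℂ) {p : ℕ} (hp : p.Prime) (e : ℕ) :
    cpowFun s (p ^ e) = ((p : ℂ) ^ (-s)) ^ e := by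
  rw [cpowFun_apply _ (pow_ne_zero _ hp.ne_zero)]
  induction e with
  | zero => simp
  | succ e ih => rw [pow_succ, pow_succ, Nat.cast_mul, Complex.natCast_mul_natCast_cpow, ih]

/-- The value counts, with weight, the ways to distribute the exponent `e` over `k` factors, and `(e
+ 1)^k` bounds their number. -/
theorem rpowFun_pow_prime_pow_le (a : ℝ) (k : ℕ) {p : ℕ} (hp : p.Prime) (e : ℕ) :
    (rpowFun a ^ k) (p ^ e) ≤ ((e : ℝ) + 1) ^ k * ((p : ℝ) ^ (-a)) ^ e := by
  induction k generalizing e with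
  | zero =>
    rw [pow_zero, ArithmeticFunction.one_apply]
    split_ifs with h
    · have : e = 0 := by
        rcases eq_or_ne e 0 with h0 | h0
        · exact h0
        · exact absurd h (Nat.one_lt_pow h0 hp.one_lt).ne'
      simp [this]
    · positivity
  | succ k ih =>
    rw [pow_succ', convolution_prime_pow _ _ hp]
    have : ∀ i ∈ Finset.range (e + 1), rpowFun a (p ^ i) * (rpowFun a ^ k) (p ^ (e - i)) ≤
        ((e : ℝ) + 1) ^ k * ((p : ℝ) ^ (-a)) ^ e := by
      intro i hi
      have hi' : i ≤ e := by simpa [Nat.lt_succ_iff] using hi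
      rw [rpowFun_prime_pow _ hp]
      have h1 := ih (e - i)
      have h2 : (((e - i : ℕ) : ℝ) + 1) ^ k ≤ ((e : ℝ) + 1) ^ k := by
        gcongr
        exact Nat.sub_le _ _
      have hx : (0 : ℝ) ≤ (p : ℝ) ^ (-a) := by positivity
      calc ((p : ℝ) ^ (-a)) ^ i * (rpowFun a ^ k) (p ^ (e - i))
          ≤ ((p : ℝ) ^ (-a)) ^ i * (((e : ℝ) + 1) ^ k * ((p : ℝ) ^ (-a)) ^ (e - i)) := by
            refine mul_le_mul_of_nonneg_left (h1.trans ?_) (pow_nonneg hx _)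
            exact mul_le_mul_of_nonneg_right h2 (pow_nonneg hx _)
        _ = ((e : ℝ) + 1) ^ k * (((p : ℝ) ^ (-a)) ^ i * ((p : ℝ) ^ (-a)) ^ (e - i)) := by ring
        _ = _ := by rw [← pow_add, Nat.add_sub_cancel' hi']
    refine (Finset.sum_le_sum this).trans (le_of_eq ?_)
    rw [Finset.sum_const, Finset.card_range, nsmul_eq_mul]
    push_cast
    ring

theorem tupleFun_prime {k : ℕ} (s : Fin k → ℂ) {p : ℕ} (hp : p.Prime) :
    tupleFun s p = ∑ j, (p : ℂ) ^ (-s j) := by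
  induction k with
  | zero => rw [tupleFun_zero, ArithmeticFunction.one_apply_ne hp.ne_one]; simp
  | succ k ih =>
    rw [tupleFun_succ, Fin.sum_univ_succ]
    have h := convolution_prime_pow (cpowFun (s 0)) (tupleFun fun j : Fin k => s j.succ) hp 1
    rw [pow_one] at h
    rw [h]
    have h1 : tupleFun (fun j : Fin k => s j.succ) 1 = 1 := (isMultiplicative_tupleFun _).1
    simp [Finset.sum_range_succ, ih, h1, cpowFun_apply, hp.ne_zero]
    ring

/-- The complete homogeneous symmetric polynomial of degree two in the `p^{-s_j}`. -/
theorem tupleFun_prime_sq {k : ℕ} (s : Fin k → ℂ) {p : ℕ} (hp : p.Prime) :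
    tupleFun s (p ^ 2) = ((∑ j, (p : ℂ) ^ (-s j)) ^ 2 + ∑ j, ((p : ℂ) ^ (-s j)) ^ 2) / 2 := by
  induction k with
  | zero =>
    rw [tupleFun_zero, ArithmeticFunction.one_apply_ne (Nat.one_lt_pow two_ne_zero hp.one_lt).ne']
    simp
  | succ k ih =>
    rw [tupleFun_succ, Fin.sum_univ_succ, Fin.sum_univ_succ, convolution_prime_pow _ _ hp]
    have h1 : tupleFun (fun j : Fin k => s j.succ) 1 = 1 := (isMultiplicative_tupleFun _).1
    simp only [Finset.sum_range_succ, Finset.range_zero, Finset.sum_empty, cpowFun_prime_pow _ hp,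
      Nat.sub_zero, Nat.reduceSub, pow_zero, pow_one, h1, ih, tupleFun_prime _ hp]
    ring

/-- By symmetry the pairs `i ≤ j` and `i ≥ j` contribute equally, and together they cover all pairs
with the diagonal counted twice. The pairs `i ≤ j` are those that index the polar hyperplanes. -/
theorem sum_Ici_mul_self {k : ℕ} (x : Fin k → ℂ) :
    ∑ i, ∑ j ∈ Finset.Ici i, x i * x j = ((∑ j, x j) ^ 2 + ∑ j, x j ^ 2) / 2 := by
  have h1 : ∑ i, ∑ j ∈ Finset.Ici i, x i * x j = ∑ j, ∑ i ∈ Finset.Iic j, x i * x j :=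
    Finset.sum_comm' (by simp)
  have h2 : ∀ i, ∑ j ∈ Finset.Iic i, x i * x j + ∑ j ∈ Finset.Ici i, x i * x j =
      ∑ j, x i * x j + x i ^ 2 := by
    intro i
    rw [← Finset.sum_union_inter]
    congr 1
    · refine Finset.sum_congr ?_ fun _ _ => rfl
      ext j; simp [le_total]
    · have : Finset.Iic i ∩ Finset.Ici i = {i} := by
        ext j; simp [le_antisymm_iff]
      rw [this, Finset.sum_singleton, sq]
  have h3 : ∑ i, ∑ j ∈ Finset.Iic i, x i * x j = ∑ i, ∑ j ∈ Finset.Ici i, x i * x j := by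
    rw [h1]
    exact Finset.sum_congr rfl fun i _ => Finset.sum_congr rfl fun j _ => mul_comm _ _
  have h4 := Finset.sum_congr (rfl : (Finset.univ : Finset (Fin k)) = _) fun i _ => h2 i
  rw [Finset.sum_add_distrib, Finset.sum_add_distrib, h3, ← Finset.sum_mul_sum, ← sq] at h4
  rw [← h4]
  ring

end TupleConvolution

end QuadraticMoments

namespace QuadraticMoments

open Filter Topology

/-! ### Arithmetic of the Kronecker symbol in both arguments. -/

section KroneckerArithmetic

theorem kronecker_of_ne_zero (d : ℕ) {n : ℕ} (hn : n ≠ 0) : kronecker d n =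
    ZMod.χ₈ (d : ZMod 8) ^ padicValNat 2 n * jacobiSym (d : ℤ) (n / 2 ^ padicValNat 2 n) :=
  if_neg hn

theorem kronecker_mul_right (d : ℕ) {m n : ℕ} (hm : m ≠ 0) (hn : n ≠ 0) :
    kronecker d (m * n) = kronecker d m * kronecker d n := by
  have hm' : m / 2 ^ padicValNat 2 m ≠ 0 := (odd_div_two_pow_padicVal hm).pos.ne'
  have hn' : n / 2 ^ padicValNat 2 n ≠ 0 := (odd_div_two_pow_padicVal hn).pos.ne'
  rw [kronecker_of_ne_zero d hm, kronecker_of_ne_zero d hn,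
    kronecker_of_ne_zero d (mul_ne_zero hm hn), padicValNat.mul hm hn, pow_add, pow_add,
    ← Nat.div_mul_div_comm pow_padicValNat_dvd pow_padicValNat_dvd,
    jacobiSym.mul_right' _ hm' hn']
  ring

theorem kronecker_mul_left (a b : ℕ) {n : ℕ} (hn : n ≠ 0) :
    kronecker (a * b) n = kronecker a n * kronecker b n := by
  rw [kronecker_of_ne_zero _ hn, kronecker_of_ne_zero _ hn, kronecker_of_ne_zero _ hn,
    Nat.cast_mul, Nat.cast_mul, map_mul, mul_pow, jacobiSym.mul_left]
  ring

theorem kronecker_one_right (d : ℕ) : kronecker d 1 = 1 := by simp [kronecker]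

theorem kronecker_congr {m m' N : ℕ} (hN : N ≠ 0) (h : m ≡ m' [MOD 8 * N]) :
    kronecker m N = kronecker m' N := by
  rw [kronecker_of_ne_zero _ hN, kronecker_of_ne_zero _ hN]
  have h1 : (m : ZMod 8) = m' := (ZMod.natCast_eq_natCast_iff _ _ _).2 (h.of_mul_right _)
  have h2 : m ≡ m' [MOD N / 2 ^ padicValNat 2 N] :=
    (h.of_mul_left _).of_dvd (Nat.div_dvd_of_dvd pow_padicValNat_dvd)
  rw [h1, jacobiSym.mod_left' (a₁ := (m : ℤ)) (a₂ := (m' : ℤ)) (by exact_mod_cast h2)]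

theorem kronecker_of_odd (d : ℕ) {n : ℕ} (hn : Odd n) : kronecker d n = jacobiSym d n := by
  have h : padicValNat 2 n = 0 := padicValNat.eq_zero_of_not_dvd hn.not_two_dvd_nat
  rw [kronecker_of_ne_zero _ hn.pos.ne', h]
  simp

theorem kronecker_two (d : ℕ) : kronecker d 2 = ZMod.χ₈ (d : ZMod 8) := by
  rw [kronecker_of_ne_zero _ two_ne_zero, padicValNat_self]
  simp

theorem chi8_eq_zero_of_even {m : ℕ} (h : Even m) : ZMod.χ₈ (m : ZMod 8) = 0 := by
  rw [ZMod.χ₈_nat_mod_eight]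
  have : m % 8 < 8 := Nat.mod_lt _ (by norm_num)
  have h2 : m % 8 % 2 = 0 := by have := Nat.even_iff.1 h; omega
  interval_cases m % 8 <;> first | rfl | omega

theorem chi8_sq_of_odd {m : ℕ} (h : Odd m) : ZMod.χ₈ (m : ZMod 8) ^ 2 = 1 := by
  rw [ZMod.χ₈_nat_mod_eight]
  have : m % 8 < 8 := Nat.mod_lt _ (by norm_num)
  have h2 : m % 8 % 2 = 1 := by have := Nat.odd_iff.1 h; omega
  interval_cases m % 8 <;> first | rfl | omega

theorem kronecker_eq_zero {m N : ℕ} (hN : N ≠ 0) (h : ¬ m.Coprime N) : kronecker m N = 0 := by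
  obtain ⟨p, hp, hpm, hpN⟩ := Nat.Prime.not_coprime_iff_dvd.1 h
  obtain ⟨c, rfl⟩ := hpN
  have hc : c ≠ 0 := right_ne_zero_of_mul hN
  rw [kronecker_mul_right m hp.ne_zero hc]
  have : kronecker m p = 0 := by
    rcases hp.eq_two_or_odd' with rfl | hodd
    · rw [kronecker_two]
      exact chi8_eq_zero_of_even (even_iff_two_dvd.2 hpm)
    · rw [kronecker_of_odd _ hodd]
      have : NeZero p := ⟨hp.ne_zero⟩
      rw [jacobiSym.eq_zero_iff_not_coprime, Int.gcd_natCast_natCast]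
      rw [Nat.gcd_eq_right hpm]
      exact hp.ne_one
  rw [this, zero_mul]

theorem kronecker_sq {m N : ℕ} (hN : N ≠ 0) (h : m.Coprime N) : kronecker m N ^ 2 = 1 := by
  rw [kronecker_of_ne_zero _ hN]
  have h1 : jacobiSym (m : ℤ) (N / 2 ^ padicValNat 2 N) ^ 2 = 1 := by
    refine jacobiSym.sq_one ?_
    rw [Int.gcd_natCast_natCast]
    exact Nat.Coprime.coprime_dvd_right (Nat.div_dvd_of_dvd pow_padicValNat_dvd) h
  rw [mul_pow, h1, mul_one, ← pow_mul]
  rcases Nat.eq_zero_or_pos (padicValNat 2 N) with h0 | h0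
  · rw [h0]; simp
  · have h2 : 2 ∣ N := dvd_of_one_le_padicValNat h0
    have hm : Odd m := by
      rcases Nat.even_or_odd m with he | ho
      · exact absurd h (Nat.not_coprime_of_dvd_of_dvd (by norm_num) (even_iff_two_dvd.1 he) h2)
      · exact ho
    rw [mul_comm, pow_mul, chi8_sq_of_odd hm, one_pow]

/-- A non-square modulus admits a class `m ≡ 1 (mod 4)` with `(m | N) = -1`. -/
theorem exists_kronecker_eq_neg_one {N : ℕ} (hN : N ≠ 0) (hsq : ¬ IsSquare N) :
    ∃ m : ℕ, m % 4 = 1 ∧ m.Coprime N ∧ kronecker m N = -1 := by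
  -- A nonsquare `N` has a prime `p` in its squarefree part. By the Chinese remainder theorem `m` is
  -- made a nonresidue modulo `p` (or `5` modulo `8` if `p = 2`) and `1` modulo the rest, so that
  -- the only sign comes from `p`.
  obtain ⟨a, b, hab, ha⟩ := Nat.sq_mul_squarefree N
  have hb0 : b ≠ 0 := by rintro rfl; simp at hab; exact hN hab.symm
  have ha0 : a ≠ 0 := ha.ne_zero
  have ha1 : a ≠ 1 := by
    rintro rfl
    exact hsq ⟨b, by rw [← hab]; ring⟩
  obtain ⟨p, hp, hpa⟩ : ∃ p : ℕ, p.Prime ∧ p ∣ a := Nat.exists_prime_and_dvd ha1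
  obtain ⟨c, rfl⟩ := hpa
  have hc0 : c ≠ 0 := right_ne_zero_of_mul ha0
  have hpc : p.Coprime c := (Nat.squarefree_mul_iff.1 ha).1
  have hkey : ∀ m : ℕ, m.Coprime N → kronecker m N = kronecker m p * kronecker m c := by
    intro m hm
    have hmb : m.Coprime b := hm.coprime_dvd_right ⟨b * (p * c), by rw [← hab]; ring⟩
    rw [← hab, kronecker_mul_right _ (pow_ne_zero _ hb0) ha0, sq, kronecker_mul_right _ hb0 hb0,
      ← sq, kronecker_sq hb0 hmb, one_mul, kronecker_mul_right _ hp.ne_zero hc0]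
  set R := N / p ^ N.factorization p with hR
  have hRN : p ^ N.factorization p * R = N := Nat.ordProj_mul_ordCompl_eq_self N p
  have hpR : p.Coprime R := Nat.coprime_ordCompl hp hN
  have hcR : c ∣ R := by
    have : c ∣ p ^ N.factorization p * R := by rw [hRN, ← hab]; exact ⟨b ^ 2 * p, by ring⟩
    exact (Nat.Coprime.pow_right _ hpc.symm).dvd_of_dvd_mul_left this
  have hcop : ∀ m : ℕ, m.Coprime p → m ≡ 1 [MOD R] → m.Coprime N := by
    intro m h1 h2
    rw [← hRN]
    refine Nat.Coprime.mul_right (Nat.Coprime.pow_right _ h1) ?_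
    rw [Nat.Coprime, h2.gcd_eq]
    simp
  rcases hp.eq_two_or_odd' with rfl | hodd
  · have h8 : Nat.Coprime 8 R := by
      rw [show 8 = 2 ^ 3 by norm_num]; exact Nat.Coprime.pow_left _ hpR
    obtain ⟨m, hm1, hm2⟩ := Nat.chineseRemainder h8 5 1
    have hm1' : m % 8 = 5 := hm1
    have hmN := hcop m (Nat.coprime_two_right.2 (Nat.odd_iff.2 (by omega))) hm2
    refine ⟨m, by omega, hmN, ?_⟩
    have hco : Odd c := Nat.coprime_two_left.1 hpc
    rw [hkey m hmN, kronecker_two, kronecker_of_odd _ hco, ZMod.χ₈_nat_mod_eight, hm1',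
      jacobiSym.mod_left' (a₁ := (m : ℤ)) (a₂ := 1) (by exact_mod_cast hm2.of_dvd hcR),
      jacobiSym.one_left]
    rfl
  · have h8 : Nat.Coprime (8 * R) p := by
      refine Nat.Coprime.mul_left ?_ hpR.symm
      rw [show 8 = 2 ^ 3 by norm_num]; exact Nat.Coprime.pow_left _ (Nat.coprime_two_left.2 hodd)
    have : Fact p.Prime := ⟨hp⟩
    obtain ⟨x, hx⟩ := FiniteField.exists_nonsquare (F := ZMod p) (by
      rw [ZMod.ringChar_zmod_n]; rintro rfl; exact absurd hodd (by decide))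
    obtain ⟨m, hm1, hm2⟩ := Nat.chineseRemainder h8 1 x.val
    have hmx : (m : ZMod p) = x := by
      rw [(ZMod.natCast_eq_natCast_iff _ _ _).2 hm2, ZMod.natCast_zmod_val]
    have hx0 : x ≠ 0 := by rintro rfl; exact hx ⟨0, by simp⟩
    have hmp : m.Coprime p := by
      refine Nat.Coprime.symm ((Nat.Prime.coprime_iff_not_dvd hp).2 fun h => hx0 ?_)
      rw [← hmx]; exact (ZMod.natCast_eq_zero_iff _ _).2 h
    have hmN := hcop m hmp (hm1.of_mul_left _)
    refine ⟨m, ?_, hmN, ?_⟩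
    · have : m ≡ 1 [MOD 4] := (hm1.of_mul_right R).of_dvd (by norm_num)
      exact this
    · rw [hkey m hmN, kronecker_of_odd _ hodd, ← jacobiSym.legendreSym.to_jacobiSym]
      have h1 : legendreSym p (m : ℤ) = -1 := by
        rw [legendreSym.eq_neg_one_iff']
        rwa [hmx]
      have h2 : kronecker m c = kronecker 1 c :=
        kronecker_congr hc0 (hm1.of_dvd (Nat.mul_dvd_mul_left _ hcR))
      rw [h1, h2, kronecker_one_left]
      norm_num

end KroneckerArithmetic

/-! ### Character sums over squarefree numbers through Dirichlet L-functions. -/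

section SquarefreeSums

/-- A completely multiplicative periodic function as a Dirichlet character. -/
noncomputable def charOfPeriodic (q : ℕ) [NeZero q] (f : ℕ → ℂ) (hper : ∀ n, f (n % q) = f n)
    (h1 : f 1 = 1) (hmul : ∀ m n, f (m * n) = f m * f n) (h0 : ∀ n, ¬ n.Coprime q → f n = 0) :
    DirichletCharacter ℂ q where
  toFun a := f a.val
  map_one' := by rw [← Nat.cast_one, ZMod.val_natCast, hper, h1]
  map_mul' a b := by rw [ZMod.val_mul, hper, hmul]
  map_nonunit' a ha := by
    refine h0 _ fun h => ha ?_
    rw [← ZMod.natCast_zmod_val a]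
    exact (ZMod.isUnit_iff_coprime _ _).2 h

theorem charOfPeriodic_natCast (q : ℕ) [NeZero q] {f : ℕ → ℂ} (hper : ∀ n, f (n % q) = f n)
    (h1 : f 1 = 1) (hmul : ∀ m n, f (m * n) = f m * f n) (h0 : ∀ n, ¬ n.Coprime q → f n = 0)
    (n : ℕ) : charOfPeriodic q f hper h1 hmul h0 n = f n := by
  change f ((n : ZMod q).val) = f n
  rw [ZMod.val_natCast, hper]

/-- `m ↦ χ₄(m)^e (m | N)`. -/
noncomputable def twistedSymbol (e N m : ℕ) : ℂ :=
  ((ZMod.χ₄ (m : ZMod 4) ^ e * kronecker m N : ℤ) : ℂ)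

theorem chi4_eq_zero_of_even {m : ℕ} (h : Even m) : ZMod.χ₄ (m : ZMod 4) = 0 := by
  rw [ZMod.χ₄_nat_mod_four]
  have : m % 4 < 4 := Nat.mod_lt _ (by norm_num)
  have h2 : m % 4 % 2 = 0 := by have := Nat.even_iff.1 h; omega
  interval_cases m % 4 <;> first | rfl | omega

theorem chi4_sq_of_odd {m : ℕ} (h : Odd m) : ZMod.χ₄ (m : ZMod 4) ^ 2 = 1 := by
  rw [ZMod.χ₄_nat_mod_four]
  have : m % 4 < 4 := Nat.mod_lt _ (by norm_num)
  have h2 : m % 4 % 2 = 1 := by have := Nat.odd_iff.1 h; omega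
  interval_cases m % 4 <;> first | rfl | omega

theorem twistedSymbol_mul (e : ℕ) {N : ℕ} (hN : N ≠ 0) (m n : ℕ) :
    twistedSymbol e N (m * n) = twistedSymbol e N m * twistedSymbol e N n := by
  unfold twistedSymbol
  rw [kronecker_mul_left _ _ hN, Nat.cast_mul, map_mul, mul_pow]
  push_cast
  ring

theorem twistedSymbol_mod (e : ℕ) {N : ℕ} (hN : N ≠ 0) (m : ℕ) :
    twistedSymbol e N (m % (8 * N)) = twistedSymbol e N m := by
  unfold twistedSymbol
  have h : m % (8 * N) ≡ m [MOD 8 * N] := Nat.mod_modEq _ _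
  have h4 : ((m % (8 * N) : ℕ) : ZMod 4) = m :=
    (ZMod.natCast_eq_natCast_iff _ _ _).2 ((h.of_mul_right N).of_dvd (by norm_num))
  rw [kronecker_congr hN h, h4]

theorem twistedSymbol_one (e N : ℕ) : twistedSymbol e N 1 = 1 := by
  simp [twistedSymbol, kronecker_one_left]

/-- A positive exponent of `χ₄` is what excludes even `m`: `e = 1` twists by `χ₄`, while `e = 2`
only imposes that `m` be odd. -/
theorem twistedSymbol_eq_zero {e : ℕ} (he : e ≠ 0) {N : ℕ} (hN : N ≠ 0) (m : ℕ)
    (h : ¬ m.Coprime (8 * N)) : twistedSymbol e N m = 0 := by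
  unfold twistedSymbol
  rcases Nat.even_or_odd m with hm | hm
  · rw [chi4_eq_zero_of_even hm, zero_pow he]; simp
  · rw [kronecker_eq_zero hN fun h' => h ?_]
    · simp
    · refine Nat.Coprime.mul_right ?_ h'
      rw [show 8 = 2 ^ 3 by norm_num]
      exact Nat.Coprime.pow_right _ (Nat.coprime_two_right.2 hm)

theorem twistedSymbol_sq {e : ℕ} {N : ℕ} (hN : N ≠ 0) (m : ℕ)
    (h : m.Coprime (8 * N)) : twistedSymbol e N m ^ 2 = 1 := by
  unfold twistedSymbol
  have hm : Odd m := Nat.coprime_two_right.1 (h.coprime_dvd_right ⟨4 * N, by ring⟩)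
  have hmN : m.Coprime N := h.coprime_dvd_right ⟨8, by ring⟩
  have : (ZMod.χ₄ (m : ZMod 4) ^ e * kronecker m N) ^ 2 = 1 := by
    rw [mul_pow, kronecker_sq hN hmN, ← pow_mul, mul_comm e, pow_mul, chi4_sq_of_odd hm]
    simp
  exact_mod_cast this

theorem norm_twistedSymbol_le {e : ℕ} (he : e ≠ 0) {N : ℕ} (hN : N ≠ 0) (m : ℕ) :
    ‖twistedSymbol e N m‖ ≤ 1 := by
  by_cases h : m.Coprime (8 * N)
  · have := congrArg norm (twistedSymbol_sq (e := e) hN m h)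
    rw [norm_pow, norm_one] at this
    exact (pow_le_one_iff_of_nonneg (norm_nonneg _) two_ne_zero).1 this.le
  · rw [twistedSymbol_eq_zero he hN m h]; simp

theorem eq_of_sq_mul_squarefree {a b a' b' : ℕ} (hb : b ≠ 0) (hb' : b' ≠ 0) (ha : Squarefree a)
    (ha' : Squarefree a') (h : b ^ 2 * a = b' ^ 2 * a') : b = b' ∧ a = a' := by
  have key : ∀ {a b a' b' : ℕ}, b ≠ 0 → Squarefree a' → b ^ 2 * a = b' ^ 2 * a' → b ∣ b' := by
    intro a b a' b' hb ha' h
    obtain ⟨g, u, v, hg, hcop, hu, hv⟩ :=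
      Nat.exists_coprime' (m := b) (n := b') (Nat.gcd_pos_of_pos_left _ (Nat.pos_of_ne_zero hb))
    have h1 : u ^ 2 * a = v ^ 2 * a' := by
      refine Nat.eq_of_mul_eq_mul_left (pow_pos hg 2) ?_
      rw [hu, hv] at h
      linarith
    have h2 : u * u ∣ a' := by
      rw [← sq]
      exact (Nat.Coprime.pow 2 2 hcop).dvd_of_dvd_mul_left ⟨a, h1.symm⟩
    have hu1 : u = 1 := Nat.isUnit_iff.1 (ha' u h2)
    exact ⟨v, by rw [hv, hu, hu1]; ring⟩
  have hbb : b = b' := Nat.dvd_antisymm (key hb ha' h) (key hb' ha h.symm)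
  subst hbb
  exact ⟨rfl, Nat.eq_of_mul_eq_mul_left (pow_pos (Nat.pos_of_ne_zero hb) 2) h⟩

open Classical in
/-- A completely multiplicative sum is the product of its parts over squares and over squarefree
numbers. -/
theorem tsum_eq_tsum_sq_mul_tsum_squarefree {g : ℕ → ℂ} (hg : Summable fun n => ‖g n‖)
    (h0 : g 0 = 0) (hmul : ∀ m n, g (m * n) = g m * g n) :
    ∑' n, g n = (∑' b, g b ^ 2) * ∑' a, if Squarefree a then g a else 0 := by
  have hs1 : Summable fun b => ‖g b ^ 2‖ := by
    have : (fun b => ‖g b ^ 2‖) = fun b => ‖g (b * b)‖ := by funext b; rw [hmul, sq]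
    rw [this]
    exact hg.comp_injective fun a b h => by simpa using Nat.mul_self_inj.1 h
  have hs2 : Summable fun a => ‖if Squarefree a then g a else 0‖ := by
    refine Summable.of_nonneg_of_le (fun _ => norm_nonneg _) (fun n => ?_) hg
    split_ifs <;> simp
  rw [tsum_mul_tsum_of_summable_norm hs1 hs2]
  set S : Set (ℕ × ℕ) := {p | p.1 ≠ 0 ∧ Squarefree p.2} with hS
  rw [← tsum_subtype_eq_of_support_subset (s := S)]
  · have hinj : Function.Injective fun p : S => p.1.1 ^ 2 * p.1.2 := by
      intro p q h
      obtain ⟨h1, h2⟩ := eq_of_sq_mul_squarefree p.2.1 q.2.1 p.2.2 q.2.2 h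
      exact Subtype.ext (Prod.ext h1 h2)
    rw [← hinj.tsum_eq (f := g)]
    · refine tsum_congr fun p => ?_
      rw [if_pos p.2.2, hmul, sq, hmul, sq]
    · intro n hn
      have hn0 : n ≠ 0 := by rintro rfl; exact hn h0
      obtain ⟨a, b, -, hb, hab, ha⟩ := Nat.sq_mul_squarefree_of_pos (Nat.pos_of_ne_zero hn0)
      exact ⟨⟨(b, a), hb.ne', ha⟩, hab⟩
  · intro p hp
    refine ⟨?_, ?_⟩
    · intro h
      apply hp
      simp [h, h0]
    · by_contra h
      apply hp
      simp [h]

open Classical in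
/-- `∑ χ₄(a)^e (a | N) a^{-w}` over squarefree `a`. -/
noncomputable def sqfreeSum (e N : ℕ) (w : ℂ) : ℂ :=
  ∑' a : ℕ, if Squarefree a then twistedSymbol e N a * cpowFun w a else 0

theorem cpowFun_mul (w : ℂ) (m n : ℕ) : cpowFun w (m * n) = cpowFun w m * cpowFun w n := by
  rcases eq_or_ne m 0 with rfl | hm
  · simp
  rcases eq_or_ne n 0 with rfl | hn
  · simp
  rw [cpowFun_apply _ hm, cpowFun_apply _ hn, cpowFun_apply _ (mul_ne_zero hm hn), Nat.cast_mul,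
    Complex.natCast_mul_natCast_cpow]

theorem LFunction_eq_tsum_cpowFun {q : ℕ} [NeZero q] (χ : DirichletCharacter ℂ q) {w : ℂ}
    (hw : 1 < w.re) : χ.LFunction w = ∑' n : ℕ, χ n * cpowFun w n := by
  rw [DirichletCharacter.LFunction_eq_LSeries χ hw, LSeries]
  refine tsum_congr fun n => ?_
  rcases eq_or_ne n 0 with rfl | hn
  · simp
  · rw [LSeries.term_of_ne_zero hn, cpowFun_apply _ hn, Complex.cpow_neg, div_eq_mul_inv]

/-- The character `m ↦ χ₄(m)^e (m | N)` modulo `8 N`. -/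
noncomputable def twistedChar {e : ℕ} (he : e ≠ 0) (N : ℕ) [NeZero N] :
    DirichletCharacter ℂ (8 * N) :=
  charOfPeriodic (8 * N) (twistedSymbol e N) (twistedSymbol_mod e (NeZero.ne N))
    (twistedSymbol_one e N) (twistedSymbol_mul e (NeZero.ne N))
    (twistedSymbol_eq_zero he (NeZero.ne N))

theorem twistedChar_natCast {e : ℕ} (he : e ≠ 0) (N : ℕ) [NeZero N] (n : ℕ) :
    twistedChar he N n = twistedSymbol e N n := charOfPeriodic_natCast ..

/-- Write `n = b² a` with `a` squarefree. On squares the real character is the trivial one modulo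
`8N`, so the sum over `b` is its L-function at `2w`. -/
theorem LFunction_twistedChar {e : ℕ} (he : e ≠ 0) (N : ℕ) [NeZero N] {w : ℂ} (hw : 1 < w.re) :
    (twistedChar he N).LFunction w =
      DirichletCharacter.LFunctionTrivChar (8 * N) (2 * w) * sqfreeSum e N w := by
  have hN : N ≠ 0 := NeZero.ne N
  have hw2 : 1 < (2 * w).re := by simp; linarith
  rw [LFunction_eq_tsum_cpowFun _ hw, DirichletCharacter.LFunctionTrivChar,
    LFunction_eq_tsum_cpowFun _ hw2]
  simp only [twistedChar_natCast]
  rw [tsum_eq_tsum_sq_mul_tsum_squarefree]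
  · congr 1
    refine tsum_congr fun b => ?_
    by_cases h : b.Coprime (8 * N)
    · rw [mul_pow, twistedSymbol_sq hN b h, MulChar.one_apply ((ZMod.isUnit_iff_coprime _ _).2 h)]
      have hb : b ≠ 0 := by rintro rfl; simp at h
      rw [cpowFun_apply _ hb, cpowFun_apply _ hb, ← Complex.cpow_nat_mul]
      congr 2
      push_cast; ring
    · rw [twistedSymbol_eq_zero he hN b h, MulChar.map_nonunit]
      · simp
      · rwa [ZMod.isUnit_iff_coprime]
  · refine Summable.of_nonneg_of_le (fun _ => norm_nonneg _) (fun n => ?_) (summable_norm_cpowFun hw)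
    rw [norm_mul]
    exact mul_le_of_le_one_left (norm_nonneg _) (norm_twistedSymbol_le he hN n)
  · simp
  · intro m n
    rw [twistedSymbol_mul e hN, cpowFun_mul]
    ring

end SquarefreeSums

end QuadraticMoments

namespace QuadraticMoments

open Filter Topology

/-! ### The sum over fundamental discriminants, its residue, and the residue of the multiple
Dirichlet series. -/

section DiscriminantSum

/-- `D_N(w) = ∑*_d (d | N) d^{-w}`. -/
noncomputable def discSum (N : ℕ) (w : ℂ) : ℂ :=
  ∑' d : fundDisc, ((kronecker (d : ℕ+) N : ℤ) : ℂ) * cpowFun w ((d : ℕ+) : ℕ)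

theorem summable_norm_kronecker_mul_cpowFun (N : ℕ) {w : ℂ} (hw : 1 < w.re) :
    Summable fun d : ℕ => ‖((kronecker d N : ℤ) : ℂ) * cpowFun w d‖ := by
  refine Summable.of_nonneg_of_le (fun _ => norm_nonneg _) (fun n => ?_) (summable_norm_cpowFun hw)
  rw [norm_mul]
  exact mul_le_of_le_one_left (norm_nonneg _) (norm_kronecker_le _ _)

theorem two_mul_squarefree_iff {m : ℕ} (hm : m % 2 = 1) : Squarefree (2 * m) ↔ Squarefree m := by
  rw [Nat.squarefree_mul (Nat.coprime_two_left.2 (Nat.odd_iff.2 hm))]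
  simp [Nat.prime_two.squarefree]

-- Positive fundamental discriminants are the squarefree `d ≡ 1 (mod 4)`, the `4m` with `m ≡ 3 (mod
-- 4)` and the `8m` with `m` odd, `m` squarefree. The classes modulo `4` are detected by `(χ₄² ±
-- χ₄)/2`, which accounts for the half sums and half differences.
open Classical in
theorem discSum_eq {N : ℕ} (hN : N ≠ 0) {w : ℂ} (hw : 1 < w.re) :
    discSum N w = (sqfreeSum 2 N w + sqfreeSum 1 N w) / 2 +
      ((kronecker 4 N : ℤ) : ℂ) * cpowFun w 4 * ((sqfreeSum 2 N w - sqfreeSum 1 N w) / 2) +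
      ((kronecker 8 N : ℤ) : ℂ) * cpowFun w 8 * sqfreeSum 2 N w := by
  obtain ⟨H, hH⟩ : ∃ H : ℕ → ℂ, H = fun d => ((kronecker d N : ℤ) : ℂ) * cpowFun w d := ⟨_, rfl⟩
  have hHs : Summable fun d => ‖H d‖ := by rw [hH]; exact summable_norm_kronecker_mul_cpowFun N hw
  have hHmul : ∀ m n, H (m * n) = H m * H n := by
    intro m n
    simp only [hH]
    rw [kronecker_mul_left _ _ hN, cpowFun_mul]
    push_cast; ring
  have hite : ∀ (P : ℕ → Prop) [DecidablePred P], Summable fun d => if P d then H d else 0 := by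
    intro P _
    refine Summable.of_norm_bounded hHs fun d => ?_
    split_ifs <;> simp
  have hts : ∀ e, e ≠ 0 → Summable fun a => if Squarefree a then twistedSymbol e N a * cpowFun w a else 0 := by
    intro e he
    refine Summable.of_norm_bounded (summable_norm_cpowFun hw) fun d => ?_
    split_ifs
    · rw [norm_mul]
      exact mul_le_of_le_one_left (norm_nonneg _) (norm_twistedSymbol_le he hN d)
    · simp
  -- For squarefree `m`, the numbers `4m` with `m ≡ 3 (mod 4)` lie in the class `12` modulo `16` and
  -- those with `m ≡ 2 (mod 4)` in the class `8`, so the three families are separated by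
  -- congruences.
  have hsplit : discSum N w = (∑' d, if d % 4 = 1 ∧ Squarefree d then H d else 0) +
      (∑' d, if d % 16 = 12 ∧ Squarefree (d / 4) then H d else 0) +
      ∑' d, if d % 16 = 8 ∧ Squarefree (d / 8) then H d else 0 := by
    have s1 := hite fun d => d % 4 = 1 ∧ Squarefree d
    have s2 := hite fun d => d % 16 = 12 ∧ Squarefree (d / 4)
    have s3 := hite fun d => d % 16 = 8 ∧ Squarefree (d / 8)
    rw [← s1.tsum_add s2, ← (s1.add s2).tsum_add s3]
    have hinj : Function.Injective fun d : fundDisc => ((d : ℕ+) : ℕ) :=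
      fun a b h => Subtype.ext (PNat.coe_injective h)
    rw [← hinj.tsum_eq]
    · rw [discSum]
      refine tsum_congr fun d => ?_
      have hHd : ((kronecker (d : ℕ+) N : ℤ) : ℂ) * cpowFun w ((d : ℕ+) : ℕ) = H ((d : ℕ+) : ℕ) := by
        rw [hH]
      rw [hHd]
      rcases d.2 with ⟨h1, h2⟩ | ⟨m, hm, hm4, hsq⟩
      · rw [if_pos ⟨h1, h2⟩, if_neg (by omega), if_neg (by omega)]
        ring
      · rcases hm4 with h2 | h3
        · rw [if_neg (by omega), if_neg (by omega), if_pos]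
          · ring
          · refine ⟨by omega, ?_⟩
            have : m = 2 * (((d : ℕ+) : ℕ) / 8) := by omega
            rw [this] at hsq
            exact (two_mul_squarefree_iff (by omega)).1 hsq
        · rw [if_neg (by omega), if_pos, if_neg (by omega)]
          · ring
          · refine ⟨by omega, ?_⟩
            rw [hm, Nat.mul_div_cancel_left _ (by norm_num)]
            exact hsq
    · intro d hd
      have hd0 : d ≠ 0 := by rintro rfl; simp at hd
      refine ⟨⟨⟨d, Nat.pos_of_ne_zero hd0⟩, ?_⟩, rfl⟩
      by_contra hnot
      apply hd
      have n1 : ¬ (d % 4 = 1 ∧ Squarefree d) := fun h => hnot (Or.inl h)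
      have n2 : ¬ (d % 16 = 12 ∧ Squarefree (d / 4)) := by
        rintro ⟨h1, h2⟩
        refine hnot (Or.inr ⟨d / 4, ?_, Or.inr (by omega), h2⟩)
        change d = _; omega
      have n3 : ¬ (d % 16 = 8 ∧ Squarefree (d / 8)) := by
        rintro ⟨h1, h2⟩
        refine hnot (Or.inr ⟨2 * (d / 8), ?_, Or.inl (by omega), ?_⟩)
        · change d = _; omega
        · exact (two_mul_squarefree_iff (by omega)).2 h2
      simp only [if_neg n1, if_neg n2, if_neg n3, add_zero]
  have hscale : ∀ c : ℕ, c ≠ 0 → ∀ (P : ℕ → Prop) [DecidablePred P], (∀ d, P d → c ∣ d) →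
      (∑' d, if P d then H d else 0) = H c * ∑' m, if P (c * m) then H m else 0 := by
    intro c hc P _ hP
    rw [← (mul_right_injective₀ hc).tsum_eq, ← tsum_mul_left]
    · refine tsum_congr fun m => ?_
      simp only [hHmul]
      split_ifs <;> simp
    · intro d hd
      have : P d := by
        by_contra h
        apply hd; simp [h]
      obtain ⟨m, rfl⟩ := hP d this
      exact ⟨m, rfl⟩
  have h4 : (∑' d, if d % 16 = 12 ∧ Squarefree (d / 4) then H d else 0) =
      H 4 * ∑' m, if m % 4 = 3 ∧ Squarefree m then H m else 0 := by
    rw [hscale 4 (by norm_num) (fun d => d % 16 = 12 ∧ Squarefree (d / 4)) fun d hd => by omega]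
    congr 1
    refine tsum_congr fun m => ?_
    rw [Nat.mul_div_cancel_left _ (by norm_num)]
    refine if_congr (and_congr_left fun _ => ?_) rfl rfl
    omega
  have h8 : (∑' d, if d % 16 = 8 ∧ Squarefree (d / 8) then H d else 0) =
      H 8 * ∑' m, if m % 2 = 1 ∧ Squarefree m then H m else 0 := by
    rw [hscale 8 (by norm_num) (fun d => d % 16 = 8 ∧ Squarefree (d / 8)) fun d hd => by omega]
    congr 1
    refine tsum_congr fun m => ?_
    rw [Nat.mul_div_cancel_left _ (by norm_num)]
    refine if_congr (and_congr_left fun _ => ?_) rfl rfl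
    omega
  have hval : ∀ e m, twistedSymbol e N m * cpowFun w m = ((ZMod.χ₄ (m : ZMod 4) : ℤ) : ℂ) ^ e * H m := by
    intro e m
    simp only [hH, twistedSymbol]
    push_cast; ring
  have hchi : ∀ m : ℕ, (m % 4 = 1 ∧ ZMod.χ₄ (m : ZMod 4) = 1) ∨ (m % 4 = 3 ∧ ZMod.χ₄ (m : ZMod 4) = -1) ∨
      (m % 2 = 0 ∧ ZMod.χ₄ (m : ZMod 4) = 0) := by
    intro m
    have hlt : m % 4 < 4 := Nat.mod_lt _ (by norm_num)
    have h2 : m % 2 = m % 4 % 2 := by omega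
    rw [ZMod.χ₄_nat_mod_four, h2]
    interval_cases m % 4 <;> decide
  have e1 : (∑' d, if d % 4 = 1 ∧ Squarefree d then H d else 0) =
      (sqfreeSum 2 N w + sqfreeSum 1 N w) / 2 := by
    rw [sqfreeSum, sqfreeSum, ← (hts 2 (by norm_num)).tsum_add (hts 1 (by norm_num)), ← tsum_div_const]
    refine tsum_congr fun m => ?_
    simp only [hval]
    by_cases hsq : Squarefree m
    · rcases hchi m with ⟨h, hχ⟩ | ⟨h, hχ⟩ | ⟨h, hχ⟩
      · simp [h, hχ, hsq]
      · simp [h, hχ, hsq]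
      · rw [if_neg (by omega)]; simp [hχ]
    · simp [hsq]
  have e3 : (∑' d, if d % 4 = 3 ∧ Squarefree d then H d else 0) =
      (sqfreeSum 2 N w - sqfreeSum 1 N w) / 2 := by
    rw [sqfreeSum, sqfreeSum, ← (hts 2 (by norm_num)).tsum_sub (hts 1 (by norm_num)), ← tsum_div_const]
    refine tsum_congr fun m => ?_
    simp only [hval]
    by_cases hsq : Squarefree m
    · rcases hchi m with ⟨h, hχ⟩ | ⟨h, hχ⟩ | ⟨h, hχ⟩
      · simp [h, hχ, hsq]
      · simp [h, hχ, hsq]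
      · rw [if_neg (by omega)]; simp [hχ]
    · simp [hsq]
  have e2 : (∑' d, if d % 2 = 1 ∧ Squarefree d then H d else 0) = sqfreeSum 2 N w := by
    rw [sqfreeSum]
    refine tsum_congr fun m => ?_
    simp only [hval]
    by_cases hsq : Squarefree m
    · rcases hchi m with ⟨h, hχ⟩ | ⟨h, hχ⟩ | ⟨h, hχ⟩
      · rw [if_pos ⟨by omega, hsq⟩]; simp [hχ, hsq]
      · rw [if_pos ⟨by omega, hsq⟩]; simp [hχ, hsq]
      · rw [if_neg (by omega)]; simp [hχ]
    · simp [hsq]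
  rw [hsplit, h4, h8, e1, e2, e3]
  simp only [hH]

theorem twistedChar_eq_one {N : ℕ} [NeZero N] (hsq : IsSquare N) :
    twistedChar (e := 2) two_ne_zero N = 1 := by
  have hN : N ≠ 0 := NeZero.ne N
  ext a
  have ha : ((a : ZMod (8 * N)).val : ZMod (8 * N)) = a := ZMod.natCast_zmod_val _
  have hcop : (a : ZMod (8 * N)).val.Coprime (8 * N) := by
    rw [← ZMod.isUnit_iff_coprime, ha]; exact a.isUnit
  rw [MulChar.one_apply a.isUnit, ← ha, twistedChar_natCast]
  set m := (a : ZMod (8 * N)).val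
  obtain ⟨c, rfl⟩ := hsq
  have hc : c ≠ 0 := left_ne_zero_of_mul hN
  have hm : Odd m := Nat.coprime_two_right.1 (hcop.coprime_dvd_right ⟨4 * (c * c), by ring⟩)
  rw [twistedSymbol, kronecker_mul_right _ hc hc, ← sq, kronecker_sq hc, chi4_sq_of_odd hm]
  · simp
  · exact hcop.coprime_dvd_right ⟨8 * c, by ring⟩

theorem twistedChar_ne_one_of_not_isSquare {e : ℕ} (he : e ≠ 0) {N : ℕ} [NeZero N]
    (hsq : ¬ IsSquare N) : twistedChar he N ≠ 1 := by
  intro h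
  obtain ⟨m, hm4, hmN, hk⟩ := exists_kronecker_eq_neg_one (NeZero.ne N) hsq
  have hcop : m.Coprime (8 * N) := by
    refine Nat.Coprime.mul_right ?_ hmN
    rw [show 8 = 2 ^ 3 by norm_num]
    exact Nat.Coprime.pow_right _ (Nat.coprime_two_right.2 (Nat.odd_iff.2 (by omega)))
  have h1 := twistedChar_natCast he N m
  rw [h, MulChar.one_apply ((ZMod.isUnit_iff_coprime _ _).2 hcop), twistedSymbol, hk,
    ZMod.χ₄_nat_one_mod_four hm4] at h1
  norm_num at h1

/-- For square `N` the class of `8N - 1` is a witness: it is `3` modulo `4`, so `χ₄` gives `-1`,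
while its symbol over a square is `1`. -/
theorem twistedChar_one_ne_one {N : ℕ} [NeZero N] : twistedChar (e := 1) one_ne_zero N ≠ 1 := by
  by_cases hsq : IsSquare N
  · intro h
    have hN : N ≠ 0 := NeZero.ne N
    have hN1 : 1 ≤ N := Nat.one_le_iff_ne_zero.2 hN
    have hcop : (8 * N - 1).Coprime (8 * N) := by
      rw [Nat.coprime_self_sub_left (by omega)]
      exact Nat.coprime_one_left _
    have h1 := twistedChar_natCast (e := 1) one_ne_zero N (8 * N - 1)
    obtain ⟨c, rfl⟩ := hsq
    have hc : c ≠ 0 := left_ne_zero_of_mul hN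
    rw [h, MulChar.one_apply ((ZMod.isUnit_iff_coprime _ _).2 hcop), twistedSymbol,
      ZMod.χ₄_nat_three_mod_four (by omega), kronecker_mul_right _ hc hc, ← sq, kronecker_sq hc] at h1
    · norm_num at h1
    · exact hcop.coprime_dvd_right ⟨8 * c, by ring⟩
  · exact twistedChar_ne_one_of_not_isSquare _ hsq

theorem tendsto_ofReal_nhdsGT_one :
    Tendsto (fun w : ℝ => (w : ℂ)) (𝓝[>] 1) (𝓝[≠] 1) := by
  refine tendsto_nhdsWithin_iff.2 ⟨?_, ?_⟩
  · exact (Complex.continuous_ofReal.tendsto 1).mono_left nhdsWithin_le_nhds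
  · filter_upwards [self_mem_nhdsWithin] with w hw
    have : w ≠ 1 := (Set.mem_Ioi.1 hw).ne'
    simpa using this

theorem LFunctionTrivChar_two (q : ℕ) [NeZero q] :
    DirichletCharacter.LFunctionTrivChar q 2 =
      (∏ p ∈ q.primeFactors, (1 - ((p : ℂ) ^ 2)⁻¹)) * riemannZeta 2 := by
  rw [DirichletCharacter.LFunctionTrivChar_eq_mul_riemannZeta (by norm_num)]
  congr 1
  refine Finset.prod_congr rfl fun p _ => ?_
  rw [Complex.cpow_neg]
  norm_num

theorem one_sub_inv_sq_ne_zero {p : ℕ} (hp : p.Prime) : 1 - ((p : ℂ) ^ 2)⁻¹ ≠ 0 := by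
  intro h
  have h1 : (p : ℂ) ^ 2 = 1 := by
    rw [sub_eq_zero] at h
    exact inv_eq_one.1 h.symm
  have h2 : p ^ 2 = 1 := by exact_mod_cast h1
  have := Nat.one_lt_pow two_ne_zero hp.one_lt
  omega

theorem LFunctionTrivChar_two_ne_zero (q : ℕ) [NeZero q] :
    DirichletCharacter.LFunctionTrivChar q 2 ≠ 0 := by
  rw [LFunctionTrivChar_two]
  refine mul_ne_zero (Finset.prod_ne_zero_iff.2 fun p hp => ?_)
    (riemannZeta_ne_zero_of_one_le_re (by norm_num))
  exact one_sub_inv_sq_ne_zero (Nat.prime_of_mem_primeFactors hp)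

theorem tendsto_sqfreeSum {e : ℕ} (he : e ≠ 0) (N : ℕ) [NeZero N] {r : ℂ}
    (hr : Tendsto (fun s => (s - 1) * (twistedChar he N).LFunction s) (𝓝[≠] 1) (𝓝 r)) :
    Tendsto (fun w : ℝ => ((w : ℂ) - 1) * sqfreeSum e N w) (𝓝[>] 1)
      (𝓝 (r / DirichletCharacter.LFunctionTrivChar (8 * N) 2)) := by
  have h1 := hr.comp tendsto_ofReal_nhdsGT_one
  have hcont : ContinuousAt (DirichletCharacter.LFunctionTrivChar (8 * N)) 2 :=
    (DirichletCharacter.differentiableAt_LFunction _ _ (Or.inl (by norm_num))).continuousAt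
  have h2 : Tendsto (fun w : ℝ => DirichletCharacter.LFunctionTrivChar (8 * N) (2 * w)) (𝓝[>] 1)
      (𝓝 (DirichletCharacter.LFunctionTrivChar (8 * N) 2)) := by
    refine hcont.tendsto.comp ?_
    have : Tendsto (fun w : ℝ => (2 : ℂ) * w) (𝓝 1) (𝓝 (2 * ((1 : ℝ) : ℂ))) :=
      (by fun_prop : Continuous fun w : ℝ => (2 : ℂ) * w).tendsto 1
    simpa using this.mono_left nhdsWithin_le_nhds
  refine (h1.div h2 (LFunctionTrivChar_two_ne_zero _)).congr' ?_
  filter_upwards [self_mem_nhdsWithin,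
    h2.eventually_ne (LFunctionTrivChar_two_ne_zero _)] with w hw hne
  have hw' : 1 < (w : ℂ).re := by simpa using hw
  simp only [Function.comp_apply, Pi.div_apply]
  rw [LFunction_twistedChar he N hw', mul_left_comm, mul_div_cancel_left₀ _ hne]

theorem tendsto_sub_mul_LFunction {q : ℕ} [NeZero q] {χ : DirichletCharacter ℂ q} (hχ : χ ≠ 1) :
    Tendsto (fun s => (s - 1) * χ.LFunction s) (𝓝[≠] 1) (𝓝 0) := by
  have h : ContinuousAt (fun s => (s - 1) * χ.LFunction s) 1 :=
    ((by fun_prop : ContinuousAt (fun s : ℂ => s - 1) 1)).mul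
      (DirichletCharacter.differentiable_LFunction hχ).continuous.continuousAt
  have := h.tendsto
  simp only [sub_self, zero_mul] at this
  exact this.mono_left nhdsWithin_le_nhds

theorem tendsto_cpowFun_one {n : ℕ} (hn : n ≠ 0) :
    Tendsto (fun w : ℝ => cpowFun w n) (𝓝[>] 1) (𝓝 ((n : ℂ)⁻¹)) := by
  simp only [cpowFun_apply _ hn]
  have hn' : (n : ℂ) ≠ 0 := by exact_mod_cast hn
  have h : Continuous fun w : ℝ => (n : ℂ) ^ (-(w : ℂ)) :=
    Continuous.const_cpow (by fun_prop) (Or.inl hn')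
  have := (h.tendsto 1).mono_left (nhdsWithin_le_nhds (s := Set.Ioi 1))
  simpa [Complex.cpow_neg_one] using this

theorem primeFactors_eight_mul {N : ℕ} (hN : N ≠ 0) :
    (8 * N).primeFactors = insert 2 N.primeFactors := by
  rw [Nat.primeFactors_mul (by norm_num) hN, show 8 = 2 ^ 3 by norm_num,
    Nat.primeFactors_prime_pow (by norm_num) Nat.prime_two]
  rfl

/-- Factor by factor `(1 - 1/p)/(1 - 1/p²) = p/(p + 1)`: this is where the coefficient `a(n)` comes
from. -/
theorem residue_ratio {N : ℕ} [NeZero N] :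
    (∏ p ∈ (8 * N).primeFactors, (1 - (p : ℂ)⁻¹)) /
      DirichletCharacter.LFunctionTrivChar (8 * N) 2 =
      (∏ p ∈ (8 * N).primeFactors, (p : ℂ) / ((p : ℂ) + 1)) / riemannZeta 2 := by
  rw [LFunctionTrivChar_two, ← div_div, ← Finset.prod_div_distrib]
  congr 1
  refine Finset.prod_congr rfl fun p hp => ?_
  have hpp := Nat.prime_of_mem_primeFactors hp
  have h0 : (p : ℂ) ≠ 0 := by exact_mod_cast hpp.ne_zero
  have h1 : (p : ℂ) + 1 ≠ 0 := by exact_mod_cast Nat.succ_ne_zero p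
  rw [div_eq_div_iff (one_sub_inv_sq_ne_zero hpp) h1]
  field_simp
  ring

open Classical in
/-- The residue at `w = 1` of `D_N(w)`. -/
theorem tendsto_discSum {N : ℕ} (hN : N ≠ 0) :
    Tendsto (fun w : ℝ => ((w : ℂ) - 1) * discSum N w) (𝓝[>] 1)
      (𝓝 (if IsSquare N then aCoeff N / (2 * riemannZeta 2) else 0)) := by
  have : NeZero N := ⟨hN⟩
  have hlim : ∀ r : ℂ,
      Tendsto (fun s => (s - 1) * (twistedChar (e := 2) two_ne_zero N).LFunction s) (𝓝[≠] 1) (𝓝 r) →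
      Tendsto (fun w : ℝ => ((w : ℂ) - 1) * discSum N w) (𝓝[>] 1)
        (𝓝 ((r / DirichletCharacter.LFunctionTrivChar (8 * N) 2) *
          (1 / 2 + ((kronecker 4 N : ℤ) : ℂ) / 8 + ((kronecker 8 N : ℤ) : ℂ) / 8))) := by
    intro r hr
    have h2 := tendsto_sqfreeSum (e := 2) two_ne_zero N hr
    have h1 := tendsto_sqfreeSum (e := 1) one_ne_zero N
      (tendsto_sub_mul_LFunction (twistedChar_one_ne_one (N := N)))
    rw [zero_div] at h1
    have h4 := tendsto_cpowFun_one (n := 4) (by norm_num)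
    have h8 := tendsto_cpowFun_one (n := 8) (by norm_num)
    have := (((h2.add h1).div_const 2).add ((h4.const_mul ((kronecker 4 N : ℤ) : ℂ)).mul
      ((h2.sub h1).div_const 2))).add ((h8.const_mul ((kronecker 8 N : ℤ) : ℂ)).mul h2)
    convert this.congr' ?_ using 2
    · push_cast; ring
    · filter_upwards [self_mem_nhdsWithin] with w hw
      rw [discSum_eq hN (by simpa using hw)]
      ring
  split_ifs with hsq
  · have h1 := hlim _ (by
      rw [twistedChar_eq_one hsq]
      exact DirichletCharacter.LFunctionTrivChar_residue_one)
    convert h1 using 2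
    rw [residue_ratio, primeFactors_eight_mul hN, aCoeff]
    obtain ⟨c, hc⟩ := hsq
    have hc0 : c ≠ 0 := by rintro rfl; exact hN (by simpa using hc)
    have hz : riemannZeta 2 ≠ 0 := riemannZeta_ne_zero_of_one_le_re (by norm_num)
    -- The residue carries the weight `1/2 + (4 | N)/8 + (8 | N)/8`. For even `N` this is `1/2`. For
    -- odd `N` it is `3/4`, and the additional prime `2` of `8N` contributes `2/3`, which again
    -- gives `1/2`.
    by_cases h2 : 2 ∣ N
    · have k4 : kronecker 4 N = 0 := kronecker_eq_zero hN
        (Nat.not_coprime_of_dvd_of_dvd (by norm_num) (by norm_num : 2 ∣ 4) h2)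
      have k8 : kronecker 8 N = 0 := kronecker_eq_zero hN
        (Nat.not_coprime_of_dvd_of_dvd (by norm_num) (by norm_num : 2 ∣ 8) h2)
      rw [Finset.insert_eq_self.2 (Nat.mem_primeFactors.2 ⟨Nat.prime_two, h2, hN⟩), k4, k8]
      simp
      field_simp
    · have hodd : Odd c := by
        rcases Nat.even_or_odd c with h | h
        · exact absurd (hc ▸ (even_iff_two_dvd.1 h).mul_left c) h2
        · exact h
      have k4 : kronecker 4 N = 1 := by
        rw [hc, kronecker_mul_right _ hc0 hc0, ← sq, kronecker_sq hc0]
        rw [show 4 = 2 ^ 2 by norm_num]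
        exact Nat.Coprime.pow_left _ (Nat.coprime_two_left.2 hodd)
      have k8 : kronecker 8 N = 1 := by
        rw [hc, kronecker_mul_right _ hc0 hc0, ← sq, kronecker_sq hc0]
        rw [show 8 = 2 ^ 3 by norm_num]
        exact Nat.Coprime.pow_left _ (Nat.coprime_two_left.2 hodd)
      rw [Finset.prod_insert (by simp [h2]), k4, k8]
      push_cast
      field_simp
      ring
  · have h1 := hlim _ (tendsto_sub_mul_LFunction
      (twistedChar_ne_one_of_not_isSquare (e := 2) two_ne_zero hsq))
    simpa using h1

theorem norm_discSum_le (N : ℕ) {w : ℝ} (hw : 1 < w) :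
    ‖discSum N w‖ ≤ ∑' n : ℕ, 1 / (n : ℝ) ^ w := by
  have hinj : Function.Injective fun d : fundDisc => ((d : ℕ+) : ℕ) :=
    fun a b h => Subtype.ext (PNat.coe_injective h)
  have hs := Real.summable_one_div_nat_rpow.2 hw
  have h1 : ‖discSum N w‖ ≤ ∑' d : fundDisc, 1 / (((d : ℕ+) : ℕ) : ℝ) ^ w := by
    refine tsum_of_norm_bounded (hs.comp_injective hinj).hasSum fun d => ?_
    rw [norm_mul, norm_cpowFun, rpowFun_apply _ (d : ℕ+).ne_zero, Complex.ofReal_re,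
      Real.rpow_neg (by positivity)]
    simp only [Function.comp_apply, one_div]
    exact mul_le_of_le_one_left (by positivity) (norm_kronecker_le _ _)
  exact h1.trans (Summable.tsum_le_tsum_of_inj _ hinj (fun n _ => by positivity) (fun _ => le_rfl)
    (hs.comp_injective hinj) hs)

/-- In the region of absolute convergence the sums over `d` and `N` may be interchanged, and `(d |
M)(d | N) = (d | MN)`. -/
theorem multiSeries_eq_tsum_discSum {k M : ℕ} (hM : M ≠ 0) {s : Fin k → ℂ}
    (hs : ∀ j, 1 < (s j).re) {w : ℂ} (hw : 1 < w.re) :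
    multiSeries M s w = ∑' N, tupleFun s N * discSum (M * N) w := by
  have hinj : Function.Injective fun d : fundDisc => ((d : ℕ+) : ℕ) :=
    fun a b h => Subtype.ext (PNat.coe_injective h)
  have hL : ∀ d : fundDisc, ∏ j, Lquad d (s j) =
      ∑' N, ((kronecker (d : ℕ+) N : ℤ) : ℂ) * tupleFun s N := by
    intro d
    rw [← prod_tsum_mul_cpowFun hs (χ := fun n => ((kronecker (d : ℕ+) n : ℤ) : ℂ))
      (fun n => norm_kronecker_le _ _) (by simp [kronecker_one_right])
      (fun m n hm hn => by simp only [kronecker_mul_right _ hm hn]; push_cast; rfl)]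
    refine Finset.prod_congr rfl fun j _ => ?_
    rw [LSeries_kronecker d.2 (hs j), LSeries]
    refine tsum_congr fun n => ?_
    rcases eq_or_ne n 0 with rfl | hn
    · simp
    · rw [LSeries.term_of_ne_zero hn, cpowFun_apply _ hn, Complex.cpow_neg, div_eq_mul_inv]
  have hterm : ∀ d : fundDisc, ((kronecker (d : ℕ+) M : ℤ) : ℂ) * (∏ j, Lquad d (s j)) /
      (((d : ℕ+) : ℕ) : ℂ) ^ w = ∑' N, ((kronecker (d : ℕ+) (M * N) : ℤ) : ℂ) *
        cpowFun w ((d : ℕ+) : ℕ) * tupleFun s N := by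
    intro d
    rw [hL, div_eq_mul_inv, ← Complex.cpow_neg, ← cpowFun_apply _ (d : ℕ+).ne_zero,
      ← tsum_mul_left, ← tsum_mul_right]
    refine tsum_congr fun N => ?_
    rcases eq_or_ne N 0 with rfl | hN
    · simp
    · rw [kronecker_mul_right _ hM hN]
      push_cast
      ring
  have h1 : Summable fun d : fundDisc => ‖cpowFun w ((d : ℕ+) : ℕ)‖ :=
    (summable_norm_cpowFun hw).comp_injective hinj
  have h2 : Summable fun p : fundDisc × ℕ => ‖cpowFun w ((p.1 : ℕ+) : ℕ) * tupleFun s p.2‖ :=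
    (summable_mul_of_summable_norm h1 (summable_norm_tupleFun hs)).norm
  have h3 : Summable (Function.uncurry fun (d : fundDisc) (N : ℕ) =>
      ((kronecker (d : ℕ+) (M * N) : ℤ) : ℂ) * cpowFun w ((d : ℕ+) : ℕ) * tupleFun s N) := by
    refine Summable.of_norm_bounded h2 fun p => ?_
    simp only [Function.uncurry, norm_mul]
    refine mul_le_mul_of_nonneg_right ?_ (norm_nonneg _)
    exact mul_le_of_le_one_left (norm_nonneg _) (norm_kronecker_le _ _)
  rw [multiSeries, tsum_congr hterm, ← h3.tsum_comm]
  refine tsum_congr fun N => ?_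
  rw [discSum, ← tsum_mul_left]
  exact tsum_congr fun d => by ring

theorem norm_aCoeff_le (n : ℕ) : ‖aCoeff n‖ ≤ 1 := by
  rw [aCoeff, norm_prod]
  refine Finset.prod_le_one (fun _ _ => norm_nonneg _) fun p _ => ?_
  rw [norm_div]
  have h : ‖(p : ℂ) + 1‖ = (p : ℝ) + 1 := by
    rw [← Nat.cast_add_one, Complex.norm_natCast]; push_cast; rfl
  rw [h, Complex.norm_natCast]
  exact div_le_one_of_le₀ (by linarith) (by positivity)

open Classical in
theorem diagSeries_eq {k : ℕ} (M : ℕ) {s : Fin k → ℂ} (hs : ∀ j, 1 < (s j).re) :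
    diagSeries M s = 1 / (2 * riemannZeta 2) *
      ∑' N, (if IsSquare (M * N) then aCoeff (M * N) else 0) * tupleFun s N := by
  rw [diagSeries, ← (hasSum_tuples hs (φ := fun N => if IsSquare (M * N) then aCoeff (M * N) else 0)
    fun N => ?_).tsum_eq]
  · congr 1
    refine tsum_congr fun n => ?_
    split_ifs
    · rw [div_eq_mul_inv, ← Finset.prod_inv_distrib]
      simp only [Complex.cpow_neg]
    · simp
  · split_ifs
    · exact norm_aCoeff_le _
    · simp

/-- The residue of `A_M(s; w)` at `w = 1` is the diagonal series. -/
theorem tendsto_sub_mul_multiSeries {k M : ℕ} (hM : M ≠ 0) {s : Fin k → ℂ}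
    (hs : ∀ j, 1 < (s j).re) :
    Tendsto (fun w : ℝ => ((w : ℂ) - 1) * multiSeries M s w) (𝓝[>] 1) (𝓝 (diagSeries M s)) := by
  classical
  rw [diagSeries_eq M hs, ← tsum_mul_left]
  have h1 : Tendsto (fun w : ℝ => ∑' N, tupleFun s N * (((w : ℂ) - 1) * discSum (M * N) w)) (𝓝[>] 1)
      (𝓝 (∑' N, tupleFun s N *
        (if IsSquare (M * N) then aCoeff (M * N) / (2 * riemannZeta 2) else 0))) := by
    -- Uniformly in `N`, `(w - 1) D_{MN}(w)` is at most `(w - 1) ∑ n^{-w}`, which tends to `1`;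
    -- hence the constant `2` near `w = 1`.
    refine tendsto_tsum_of_dominated_convergence (bound := fun N => ‖tupleFun s N‖ * 2)
      ((summable_norm_tupleFun hs).mul_right 2) ?_ ?_
    · intro N
      rcases eq_or_ne N 0 with rfl | hN
      · simp
      · exact (tendsto_discSum (mul_ne_zero hM hN)).const_mul _
    · filter_upwards [self_mem_nhdsWithin,
        tendsto_sub_mul_tsum_nat_rpow.eventually_le_const (by norm_num : (1 : ℝ) < 2)] with w hw hw2 N
      have hw' : 1 < w := hw
      rw [norm_mul, norm_mul]
      refine mul_le_mul_of_nonneg_left (le_trans ?_ hw2) (norm_nonneg _)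
      have : ‖(w : ℂ) - 1‖ = w - 1 := by
        rw [← Complex.ofReal_one, ← Complex.ofReal_sub, Complex.norm_real, Real.norm_of_nonneg]
        linarith
      rw [this]
      exact mul_le_mul_of_nonneg_left (norm_discSum_le _ hw') (by linarith)
  have h2 : ∀ N, 1 / (2 * riemannZeta 2) *
      ((if IsSquare (M * N) then aCoeff (M * N) else 0) * tupleFun s N) = tupleFun s N *
        (if IsSquare (M * N) then aCoeff (M * N) / (2 * riemannZeta 2) else 0) := by
    intro N
    split_ifs
    · ring
    · simp
  rw [tsum_congr h2]
  refine h1.congr' ?_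
  filter_upwards [self_mem_nhdsWithin] with w hw
  rw [multiSeries_eq_tsum_discSum hM hs (by simpa using hw), ← tsum_mul_left]
  exact tsum_congr fun N => by ring

theorem tendsto_sub_mul_starSeries {k M : ℕ} (hM : M ≠ 0) {s : Fin k → ℂ}
    (hs : ∀ j, 1 < (s j).re) :
    Tendsto (fun w : ℝ => ((w : ℂ) - 1) * starSeries M s w) (𝓝[>] 1) (𝓝 (diagSeries M s)) := by
  have h0 : Tendsto (fun w : ℝ => ((w : ℂ) - 1) * ∏ j, riemannZeta (s j)) (𝓝[>] 1) (𝓝 0) := by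
    have h : Continuous fun w : ℝ => ((w : ℂ) - 1) * ∏ j, riemannZeta (s j) := by fun_prop
    have := h.tendsto 1
    simp only [Complex.ofReal_one, sub_self, zero_mul] at this
    exact this.mono_left nhdsWithin_le_nhds
  have := (tendsto_sub_mul_multiSeries hM hs).sub h0
  rw [sub_zero] at this
  refine this.congr' ?_
  filter_upwards [self_mem_nhdsWithin] with w hw
  rw [← multiSeries_sub_eq_starSeries M hs (by simpa using hw)]
  ring

end DiscriminantSum

end QuadraticMoments

namespace QuadraticMoments

open Filter Topology

/-! ### The diagonal series split at the primes dividing `M`. -/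

section DiagonalDecomposition

theorem isSquare_mul_iff_of_coprime {a b : ℕ} (h : a.Coprime b) :
    IsSquare (a * b) ↔ IsSquare a ∧ IsSquare b := by
  have key : ∀ {a b : ℕ}, a.Coprime b → IsSquare (a * b) → IsSquare a := by
    intro a b h ⟨c, hc⟩
    obtain ⟨d, hd⟩ := exists_eq_pow_of_mul_eq_pow (a := a) (b := b) (c := c) (k := 2)
      (by rw [show gcd a b = 1 from h]; exact isUnit_one) (by rw [hc, sq])
    exact ⟨d, by rw [hd, sq]⟩
  refine ⟨fun hs => ⟨key h hs, key h.symm (mul_comm a b ▸ hs)⟩, fun ⟨h1, h2⟩ => h1.mul h2⟩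

theorem aCoeff_mul_of_coprime {a b : ℕ} (h : a.Coprime b) :
    aCoeff (a * b) = aCoeff a * aCoeff b := by
  rw [aCoeff, h.primeFactors_mul, Finset.prod_union h.disjoint_primeFactors]
  rfl

theorem coprime_of_mem_factoredNumbers {M u v : ℕ} (hu : u ∈ Nat.factoredNumbers M.primeFactors)
    (hv : v.Coprime M) : u.Coprime v := by
  refine Nat.coprime_of_dvd fun p hp hpu hpv => ?_
  have h1 := Nat.mem_factoredNumbers'.1 hu p hp hpu
  exact Nat.not_coprime_of_dvd_of_dvd hp.one_lt hpv (Nat.dvd_of_mem_primeFactors h1) hv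

theorem exists_factored_mul_coprime {M : ℕ} (hM : M ≠ 0) {n : ℕ} (hn : n ≠ 0) :
    ∃ u ∈ Nat.factoredNumbers M.primeFactors, ∃ v : ℕ, v.Coprime M ∧ u * v = n := by
  induction n using Nat.strong_induction_on with
  | _ n ih =>
    by_cases h : n.Coprime M
    · exact ⟨1, Nat.mem_factoredNumbers'.2 fun p hp h1 => absurd (Nat.dvd_one.1 h1) hp.ne_one,
        n, h, one_mul n⟩
    · obtain ⟨p, hp, ⟨m, rfl⟩, hpM⟩ := Nat.Prime.not_coprime_iff_dvd.1 h
      have hm : m ≠ 0 := right_ne_zero_of_mul hn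
      obtain ⟨u, hu, v, hv, huv⟩ := ih m (by
        have := hp.one_lt
        have := Nat.pos_of_ne_zero hm
        nlinarith) hm
      refine ⟨p * u, Nat.mul_mem_factoredNumbers ?_ hu, v, hv, by rw [← huv]; ring⟩
      refine Nat.mem_factoredNumbers'.2 fun q hq hqp => ?_
      rw [(Nat.prime_dvd_prime_iff_eq hq hp).1 hqp]
      exact Nat.mem_primeFactors.2 ⟨hp, hpM, hM⟩

open Classical in
/-- The coefficients of the part of the diagonal series prime to `M`. -/
noncomputable def coprimeCoeff (M : ℕ) {k : ℕ} (s : Fin k → ℂ) (v : ℕ) : ℂ :=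
  if v.Coprime M ∧ IsSquare v then aCoeff v * tupleFun s v else 0

open Classical in
/-- The coefficients of the diagonal series. -/
noncomputable def diagCoeff (M : ℕ) {k : ℕ} (s : Fin k → ℂ) (N : ℕ) : ℂ :=
  (if IsSquare (M * N) then aCoeff (M * N) else 0) * tupleFun s N

theorem norm_diagCoeff_le (M : ℕ) {k : ℕ} (s : Fin k → ℂ) (N : ℕ) :
    ‖diagCoeff M s N‖ ≤ ‖tupleFun s N‖ := by
  rw [diagCoeff, norm_mul]
  refine mul_le_of_le_one_left (norm_nonneg _) ?_
  split_ifs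
  · exact norm_aCoeff_le _
  · simp

theorem norm_coprimeCoeff_le (M : ℕ) {k : ℕ} (s : Fin k → ℂ) (v : ℕ) :
    ‖coprimeCoeff M s v‖ ≤ ‖tupleFun s v‖ := by
  rw [coprimeCoeff]
  split_ifs
  · rw [norm_mul]
    exact mul_le_of_le_one_left (norm_nonneg _) (norm_aCoeff_le _)
  · simp

/-- `M u` and `v` are coprime, so `M u v` is a square only if both are. The coefficients are not
multiplicative in `N` because of `M`; splitting off the primes of `M` leaves a multiplicative part.
-/
theorem diagCoeff_mul {M : ℕ} {k : ℕ} (s : Fin k → ℂ) {u v : ℕ}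
    (hu : u ∈ Nat.factoredNumbers M.primeFactors) (hv : v.Coprime M) :
    diagCoeff M s (u * v) = diagCoeff M s u * coprimeCoeff M s v := by
  have huv := coprime_of_mem_factoredNumbers hu hv
  have h1 : (M * u).Coprime v := Nat.Coprime.mul_left hv.symm huv
  rw [diagCoeff, diagCoeff, coprimeCoeff, ← mul_assoc M, (isMultiplicative_tupleFun s).2 huv,
    aCoeff_mul_of_coprime h1]
  by_cases ha : IsSquare (M * u) <;> by_cases hb : IsSquare v
  · rw [if_pos ((isSquare_mul_iff_of_coprime h1).2 ⟨ha, hb⟩), if_pos ha, if_pos ⟨hv, hb⟩]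
    ring
  all_goals
    rw [if_neg fun h => ?_]
    · simp [ha, hb]
    · exact absurd ((isSquare_mul_iff_of_coprime h1).1 h) (by tauto)

theorem tsum_diagCoeff {M : ℕ} (hM : M ≠ 0) {k : ℕ} {s : Fin k → ℂ} (hs : ∀ j, 1 < (s j).re) :
    ∑' N, diagCoeff M s N = (∑' u : Nat.factoredNumbers M.primeFactors, diagCoeff M s u) *
      ∑' v, coprimeCoeff M s v := by
  have hsum := summable_norm_tupleFun hs
  have hs1 : Summable fun u : Nat.factoredNumbers M.primeFactors => ‖diagCoeff M s u‖ :=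
    Summable.of_nonneg_of_le (fun _ => norm_nonneg _) (fun u => norm_diagCoeff_le M s u)
      (hsum.comp_injective Subtype.val_injective)
  have hs2 : Summable fun v => ‖coprimeCoeff M s v‖ :=
    Summable.of_nonneg_of_le (fun _ => norm_nonneg _) (fun v => norm_coprimeCoeff_le M s v) hsum
  rw [tsum_mul_tsum_of_summable_norm hs1 hs2]
  obtain ⟨S, hS⟩ : ∃ S : Set (Nat.factoredNumbers M.primeFactors × ℕ), S = {p | p.2.Coprime M} :=
    ⟨_, rfl⟩
  have hmem : ∀ p : S, p.1.2.Coprime M := fun p => by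
    obtain ⟨p, hp⟩ := p
    rw [hS] at hp
    exact hp
  rw [← tsum_subtype_eq_of_support_subset (s := S)]
  · have hinj : Function.Injective fun p : S => (p.1.1 : ℕ) * p.1.2 := by
      intro p q h
      simp only at h
      have key : ∀ p q : S, (p.1.1 : ℕ) * p.1.2 = (q.1.1 : ℕ) * q.1.2 → (p.1.1 : ℕ) ∣ q.1.1 := by
        intro p q h
        exact (coprime_of_mem_factoredNumbers p.1.1.2 (hmem q)).dvd_of_dvd_mul_right ⟨_, h.symm⟩
      have h1 : (p.1.1 : ℕ) = q.1.1 := Nat.dvd_antisymm (key p q h) (key q p h.symm)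
      have h2 : p.1.2 = q.1.2 := by
        rw [h1] at h
        exact Nat.eq_of_mul_eq_mul_left
          (Nat.pos_of_ne_zero (Nat.ne_zero_of_mem_factoredNumbers q.1.1.2)) h
      exact Subtype.ext (Prod.ext (Subtype.ext h1) h2)
    rw [← hinj.tsum_eq (f := diagCoeff M s)]
    · exact tsum_congr fun p => diagCoeff_mul s p.1.1.2 (hmem p)
    · intro n hn
      have hn0 : n ≠ 0 := by
        rintro rfl
        simp [diagCoeff] at hn
      obtain ⟨u, hu, v, hv, huv⟩ := exists_factored_mul_coprime hM hn0
      exact ⟨⟨(⟨u, hu⟩, v), by rw [hS]; exact hv⟩, huv⟩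
  · intro p hp
    rw [hS]
    by_contra h
    apply hp
    have h' : ¬ p.2.Coprime M := h
    simp [coprimeCoeff, h']

/-- The region `Re s_j > 3/8`. -/
def diagRegion (k : ℕ) : Set (Fin k → ℂ) := {s | ∀ j, 3 / 8 < (s j).re}

theorem isOpen_diagRegion (k : ℕ) : IsOpen (diagRegion k) := by
  have : diagRegion k = ⋂ j, {s : Fin k → ℂ | 3 / 8 < (s j).re} := by
    ext s; simp [diagRegion]
  rw [this]
  exact isOpen_iInter_of_finite fun i =>
    isOpen_lt continuous_const (Complex.continuous_re.comp (continuous_apply i))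

theorem summable_succ_pow_mul_geometric (k : ℕ) {x : ℝ} (hx0 : 0 ≤ x) (hx1 : x < 1) :
    Summable fun e : ℕ => ((e : ℝ) + 1) ^ k * x ^ e := by
  rcases hx0.eq_or_lt with rfl | hx0
  · refine summable_of_ne_finset_zero (s := {0}) fun e he => ?_
    rw [zero_pow (by simpa using he), mul_zero]
  · have h := summable_pow_mul_geometric_of_norm_lt_one (R := ℝ) k (r := x)
      (by rwa [Real.norm_of_nonneg hx0.le])
    have h2 := ((summable_nat_add_iff 1).2 h).mul_right x⁻¹
    refine h2.congr fun e => ?_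
    push_cast
    rw [pow_succ]
    field_simp

theorem rpow_neg_lt_one {p : ℕ} (hp : p.Prime) {a : ℝ} (ha : 0 < a) : (p : ℝ) ^ (-a) < 1 :=
  Real.rpow_lt_one_of_one_lt_of_neg (by exact_mod_cast hp.one_lt) (by linarith)

theorem isMultiplicative_rpowFun (a : ℝ) : (rpowFun a).IsMultiplicative := by
  refine ArithmeticFunction.IsMultiplicative.iff_ne_zero.2 ⟨by simp [rpowFun_apply], ?_⟩
  intro m n hm hn _
  rw [rpowFun_apply _ hm, rpowFun_apply _ hn, rpowFun_apply _ (mul_ne_zero hm hn), Nat.cast_mul,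
    Real.mul_rpow (by positivity) (by positivity)]

theorem summable_rpowFun_pow_prime_pow {a : ℝ} (ha : 0 < a) (k : ℕ) {p : ℕ} (hp : p.Prime) :
    Summable fun e : ℕ => (rpowFun a ^ k) (p ^ e) :=
  Summable.of_nonneg_of_le (fun _ => rpowFun_pow_nonneg _ _ _)
    (fun e => rpowFun_pow_prime_pow_le a k hp e)
    (summable_succ_pow_mul_geometric k (by positivity) (rpow_neg_lt_one hp ha))

/-- Only finitely many primes occur, so this is a finite product of convergent local series for
every `a > 0`; the part of `T_M` at the primes of `M` has no poles in `diagRegion`. -/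
theorem summable_rpowFun_factored {a : ℝ} (ha : 0 < a) (k M : ℕ) :
    Summable fun u : Nat.factoredNumbers M.primeFactors => (rpowFun a ^ k) (u : ℕ) := by
  have hm : (rpowFun a ^ k).IsMultiplicative := (isMultiplicative_rpowFun a).pow
  have h := (EulerProduct.summable_and_hasSum_factoredNumbers_prod_filter_prime_tsum
    (f := fun n => (rpowFun a ^ k) n) hm.1 (fun h => hm.2 h)
    (fun hp => by
      simp only [Real.norm_of_nonneg (rpowFun_pow_nonneg _ _ _)]
      exact summable_rpowFun_pow_prime_pow ha k hp) M.primeFactors).1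
  simpa only [Real.norm_of_nonneg (rpowFun_pow_nonneg _ _ _)] using h

theorem differentiableOn_tsum_factored (k M : ℕ) : DifferentiableOn ℂ
    (fun s : Fin k → ℂ => ∑' u : Nat.factoredNumbers M.primeFactors, diagCoeff M s u)
    (diagRegion k) := by
  refine differentiableOn_tsum_of_locally_dominated (isOpen_diagRegion k) (fun u => ?_)
    fun z₀ _ => ⟨1, one_pos, fun u => (rpowFun (3 / 8) ^ k) (u : ℕ),
      summable_rpowFun_factored (by norm_num) k M, fun z _ hz u => ?_⟩
  · exact ((differentiable_tupleFun k _).const_mul _).differentiableOn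
  · exact (norm_diagCoeff_le M z u).trans (norm_tupleFun_le (fun j => (hz j).le) _)

end DiagonalDecomposition

/-! ### Euler factors of the diagonal series, to second order. -/

section EulerFactors

theorem norm_prod_one_sub_le {ι : Type*} (t : Finset ι) {y : ι → ℂ} {ρ : ℝ} (hρ1 : ρ ≤ 1)
    (hy : ∀ i ∈ t, ‖y i‖ ≤ ρ) : ‖∏ i ∈ t, (1 - y i)‖ ≤ 2 ^ t.card := by
  rw [norm_prod, ← Finset.prod_const]
  refine Finset.prod_le_prod (fun _ _ => norm_nonneg _) fun i hi => ?_
  calc ‖1 - y i‖ ≤ ‖(1 : ℂ)‖ + ‖y i‖ := norm_sub_le _ _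
    _ ≤ 1 + 1 := by rw [norm_one]; linarith [hy i hi]
    _ = 2 := by norm_num

theorem norm_prod_one_sub_sub_one_le {ι : Type*} (t : Finset ι) {y : ι → ℂ} {ρ : ℝ} (hρ0 : 0 ≤ ρ)
    (hρ1 : ρ ≤ 1) (hy : ∀ i ∈ t, ‖y i‖ ≤ ρ) : ‖∏ i ∈ t, (1 - y i) - 1‖ ≤ 2 ^ t.card * ρ := by
  classical
  induction t using Finset.induction_on with
  | empty => simpa using hρ0
  | insert a t ha ih =>
    have h1 := ih fun i hi => hy i (Finset.mem_insert_of_mem hi)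
    have h2 := norm_prod_one_sub_le t hρ1 fun i hi => hy i (Finset.mem_insert_of_mem hi)
    have h3 := hy a (Finset.mem_insert_self _ _)
    rw [Finset.prod_insert ha, Finset.card_insert_of_notMem ha]
    have : (1 - y a) * ∏ i ∈ t, (1 - y i) - 1 =
        (∏ i ∈ t, (1 - y i) - 1) - y a * ∏ i ∈ t, (1 - y i) := by ring
    rw [this]
    refine (norm_sub_le _ _).trans ?_
    rw [norm_mul, pow_succ]
    have := mul_le_mul h3 h2 (norm_nonneg _) hρ0
    linarith

theorem norm_prod_one_sub_sub_one_add_sum_le {ι : Type*} (t : Finset ι) {y : ι → ℂ} {ρ : ℝ}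
    (hρ0 : 0 ≤ ρ) (hρ1 : ρ ≤ 1) (hy : ∀ i ∈ t, ‖y i‖ ≤ ρ) :
    ‖∏ i ∈ t, (1 - y i) - 1 + ∑ i ∈ t, y i‖ ≤ 2 ^ t.card * ρ ^ 2 := by
  classical
  induction t using Finset.induction_on with
  | empty => simp; positivity
  | insert a t ha ih =>
    have h1 := ih fun i hi => hy i (Finset.mem_insert_of_mem hi)
    have h2 := norm_prod_one_sub_sub_one_le t hρ0 hρ1 fun i hi => hy i (Finset.mem_insert_of_mem hi)
    have h3 := hy a (Finset.mem_insert_self _ _)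
    rw [Finset.prod_insert ha, Finset.sum_insert ha, Finset.card_insert_of_notMem ha]
    have : (1 - y a) * ∏ i ∈ t, (1 - y i) - 1 + (y a + ∑ i ∈ t, y i) =
        (∏ i ∈ t, (1 - y i) - 1 + ∑ i ∈ t, y i) - y a * (∏ i ∈ t, (1 - y i) - 1) := by ring
    rw [this]
    refine (norm_sub_le _ _).trans ?_
    rw [norm_mul, pow_succ]
    have := mul_le_mul h3 h2 (norm_nonneg _) hρ0
    nlinarith

/-- The Euler factor at `p` of the part of the diagonal series prime to `M`. -/
noncomputable def diagFactor (M : ℕ) {k : ℕ} (p : ℕ) (s : Fin k → ℂ) : ℂ :=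
  ∑' e : ℕ, coprimeCoeff M s (p ^ e)

/-- The index pairs `i ≤ j`. -/
def orderedPairs (k : ℕ) : Finset (Fin k × Fin k) := Finset.univ.filter fun q => q.1 ≤ q.2

theorem prod_orderedPairs {β : Type*} [CommMonoid β] {k : ℕ} (f : Fin k → Fin k → β) :
    ∏ q ∈ orderedPairs k, f q.1 q.2 = ∏ i, ∏ j ∈ Finset.Ici i, f i j := by
  rw [orderedPairs, Finset.prod_filter, ← Finset.univ_product_univ, Finset.prod_product]
  refine Finset.prod_congr rfl fun i _ => ?_
  rw [← Finset.prod_filter]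
  refine Finset.prod_congr ?_ fun _ _ => rfl
  ext j; simp

theorem sum_orderedPairs {k : ℕ} (f : Fin k → Fin k → ℂ) :
    ∑ q ∈ orderedPairs k, f q.1 q.2 = ∑ i, ∑ j ∈ Finset.Ici i, f i j := by
  rw [orderedPairs, Finset.sum_filter, ← Finset.univ_product_univ, Finset.sum_product]
  refine Finset.sum_congr rfl fun i _ => ?_
  rw [← Finset.sum_filter]
  refine Finset.sum_congr ?_ fun _ _ => rfl
  ext j; simp

/-- `∏_{i ≤ j} (1 - p^{-s_i-s_j})`. -/
noncomputable def zetaFactor {k : ℕ} (p : ℕ) (s : Fin k → ℂ) : ℂ :=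
  ∏ q ∈ orderedPairs k, (1 - (p : ℂ) ^ (-(s q.1 + s q.2)))

theorem norm_tupleFun_prime_pow_le {k : ℕ} {s : Fin k → ℂ} (hs : s ∈ diagRegion k) {p : ℕ}
    (hp : p.Prime) (e : ℕ) :
    ‖tupleFun s (p ^ e)‖ ≤ ((e : ℝ) + 1) ^ k * ((p : ℝ) ^ (-(3 / 8) : ℝ)) ^ e :=
  (norm_tupleFun_le (fun j => (hs j).le) _).trans (rpowFun_pow_prime_pow_le _ k hp e)

theorem summable_norm_coprimeCoeff_prime_pow (M : ℕ) {k : ℕ} {s : Fin k → ℂ}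
    (hs : s ∈ diagRegion k) {p : ℕ} (hp : p.Prime) :
    Summable fun e : ℕ => ‖coprimeCoeff M s (p ^ e)‖ :=
  Summable.of_nonneg_of_le (fun _ => norm_nonneg _)
    (fun e => (norm_coprimeCoeff_le M s _).trans (norm_tupleFun_prime_pow_le hs hp e))
    (summable_succ_pow_mul_geometric k (by positivity) (rpow_neg_lt_one hp (by norm_num)))

theorem differentiableOn_diagFactor (k M : ℕ) {p : ℕ} (hp : p.Prime) :
    DifferentiableOn ℂ (fun s : Fin k → ℂ => diagFactor M p s) (diagRegion k) := by
  refine differentiableOn_tsum_of_locally_dominated (isOpen_diagRegion k) (fun e => ?_)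
    fun z₀ _ => ⟨1, one_pos, fun e => ((e : ℝ) + 1) ^ k * ((p : ℝ) ^ (-(3 / 8) : ℝ)) ^ e,
      summable_succ_pow_mul_geometric k (by positivity) (rpow_neg_lt_one hp (by norm_num)),
      fun z _ hz e => (norm_coprimeCoeff_le M z _).trans (norm_tupleFun_prime_pow_le hz hp e)⟩
  unfold coprimeCoeff
  split_ifs
  · exact ((differentiable_tupleFun k _).const_mul _).differentiableOn
  · exact differentiableOn_const _

theorem differentiable_zetaFactor (k : ℕ) {p : ℕ} (hp : p.Prime) :
    Differentiable ℂ fun s : Fin k → ℂ => zetaFactor p s := by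
  intro s
  refine differentiableAt_prod _ fun q _ => ?_
  refine DifferentiableAt.const_sub ?_ _
  exact DifferentiableAt.const_cpow (by fun_prop) (Or.inl (by exact_mod_cast hp.ne_zero))

theorem coprimeCoeff_one (M : ℕ) {k : ℕ} (s : Fin k → ℂ) : coprimeCoeff M s 1 = 1 := by
  have h1 : tupleFun s 1 = 1 := (isMultiplicative_tupleFun s).1
  simp [coprimeCoeff, aCoeff, h1]

theorem coprimeCoeff_mul (M : ℕ) {k : ℕ} (s : Fin k → ℂ) {m n : ℕ} (h : m.Coprime n) :
    coprimeCoeff M s (m * n) = coprimeCoeff M s m * coprimeCoeff M s n := by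
  unfold coprimeCoeff
  have hiff : ((m * n).Coprime M ∧ IsSquare (m * n)) ↔
      (m.Coprime M ∧ IsSquare m) ∧ (n.Coprime M ∧ IsSquare n) := by
    rw [isSquare_mul_iff_of_coprime h, Nat.coprime_mul_iff_left]
    tauto
  rw [aCoeff_mul_of_coprime h, (isMultiplicative_tupleFun s).2 h]
  by_cases h1 : m.Coprime M ∧ IsSquare m
  · by_cases h2 : n.Coprime M ∧ IsSquare n
    · rw [if_pos (hiff.2 ⟨h1, h2⟩), if_pos h1, if_pos h2]
      ring
    · rw [if_neg fun h' => h2 (hiff.1 h').2, if_neg h2, mul_zero]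
  · rw [if_neg fun h' => h1 (hiff.1 h').1, if_neg h1, zero_mul]

theorem not_isSquare_prime_mul_sq {p : ℕ} (hp : p.Prime) (m : ℕ) (hm : m ≠ 0) :
    ¬ IsSquare (p * m ^ 2) := by
  rintro ⟨c, hc⟩
  have hc0 : c ≠ 0 := by
    rintro rfl
    simp [hp.ne_zero, hm] at hc
  have := (eq_of_sq_mul_squarefree hm hc0 hp.squarefree squarefree_one
    (by rw [mul_comm, hc]; ring)).2
  exact hp.ne_one this

theorem isSquare_prime_pow_iff {p : ℕ} (hp : p.Prime) (e : ℕ) : IsSquare (p ^ e) ↔ Even e := by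
  constructor
  · intro h
    by_contra ho
    obtain ⟨f, rfl⟩ := Nat.not_even_iff_odd.1 ho
    refine not_isSquare_prime_mul_sq hp (p ^ f) (pow_ne_zero _ hp.ne_zero) ?_
    convert h using 1
    ring
  · rintro ⟨f, rfl⟩
    exact ⟨p ^ f, pow_add _ _ _⟩

theorem coprimeCoeff_prime_pow {M : ℕ} {k : ℕ} (s : Fin k → ℂ) {p : ℕ} (hp : p.Prime)
    (hpM : ¬ p ∣ M) {e : ℕ} (he : e ≠ 0) :
    coprimeCoeff M s (p ^ e) =
      if Even e then (p : ℂ) / ((p : ℂ) + 1) * tupleFun s (p ^ e) else 0 := by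
  have h1 : (p ^ e).Coprime M := Nat.Coprime.pow_left _ ((Nat.Prime.coprime_iff_not_dvd hp).2 hpM)
  unfold coprimeCoeff
  by_cases h : Even e
  · rw [if_pos ⟨h1, (isSquare_prime_pow_iff hp e).2 h⟩, if_pos h, aCoeff,
      Nat.primeFactors_prime_pow he hp, Finset.prod_singleton]
  · rw [if_neg fun h' => h ((isSquare_prime_pow_iff hp e).1 h'.2), if_neg h]

theorem diagFactor_of_dvd {M : ℕ} {k : ℕ} (s : Fin k → ℂ) {p : ℕ} (hp : p.Prime)
    (hpM : p ∣ M) : diagFactor M p s = 1 := by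
  rw [diagFactor, tsum_eq_single 0 fun e he => ?_]
  · rw [pow_zero, coprimeCoeff_one]
  · rw [coprimeCoeff, if_neg]
    rintro ⟨h, -⟩
    exact Nat.not_coprime_of_dvd_of_dvd hp.one_lt (dvd_pow_self p he) hpM h

theorem norm_cpow_neg_add_le {k : ℕ} {s : Fin k → ℂ} (hs : s ∈ diagRegion k) {p : ℕ}
    (hp : p.Prime) (i j : Fin k) :
    ‖(p : ℂ) ^ (-(s i + s j))‖ ≤ ((p : ℝ) ^ (-(3 / 8) : ℝ)) ^ 2 := by
  have h1 : (1 : ℝ) ≤ p := by exact_mod_cast hp.one_lt.le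
  rw [Complex.norm_natCast_cpow_of_pos hp.pos, ← Real.rpow_natCast, ← Real.rpow_mul (by positivity)]
  refine Real.rpow_le_rpow_of_exponent_le h1 ?_
  have := hs i
  have := hs j
  simp only [Complex.neg_re, Complex.add_re]
  push_cast
  linarith

theorem tupleFun_prime_sq_eq_sum_orderedPairs {k : ℕ} (s : Fin k → ℂ) {p : ℕ} (hp : p.Prime) :
    tupleFun s (p ^ 2) = ∑ q ∈ orderedPairs k, (p : ℂ) ^ (-(s q.1 + s q.2)) := by
  rw [tupleFun_prime_sq s hp, sum_orderedPairs fun i j => (p : ℂ) ^ (-(s i + s j)),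
    ← sum_Ici_mul_self fun j => (p : ℂ) ^ (-s j)]
  refine Finset.sum_congr rfl fun i _ => Finset.sum_congr rfl fun j _ => ?_
  rw [neg_add, Complex.cpow_add _ _ (by exact_mod_cast hp.ne_zero)]

/-- Odd exponents do not occur, since `p^e` must be a square, so after `e = 0` and `e = 2` the
expansion resumes at `e = 4`. With `Re s_j > 3/8` the remainder is `O(p^{-3/2})`, which is summable
over primes. -/
theorem exists_norm_diagFactor_sub_le (k : ℕ) : ∃ C : ℝ, 0 ≤ C ∧ ∀ (M p : ℕ), p.Prime → ¬ p ∣ M →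
    ∀ s ∈ diagRegion k, ‖diagFactor M p s - 1 - (p : ℂ) / ((p : ℂ) + 1) * tupleFun s (p ^ 2)‖ ≤
      C * ((p : ℝ) ^ (-(3 / 8) : ℝ)) ^ 4 := by
  have hr0 : (0 : ℝ) < (2 : ℝ) ^ (-(3 / 8) : ℝ) := by positivity
  have hr1 : (2 : ℝ) ^ (-(3 / 8) : ℝ) < 1 := by
    have := rpow_neg_lt_one Nat.prime_two (a := 3 / 8) (by norm_num)
    exact_mod_cast this
  -- `p = 2` is the worst prime; comparison with `2^{-3/8}` makes the constant independent of `p`.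
  obtain ⟨r₀, hr₀⟩ : ∃ r₀ : ℝ, r₀ = (2 : ℝ) ^ (-(3 / 8) : ℝ) := ⟨_, rfl⟩
  rw [← hr₀] at hr0 hr1
  have hsum : Summable fun e : ℕ => ((e : ℝ) + 5) ^ k * r₀ ^ e := by
    have h := ((summable_nat_add_iff 4).2
      (summable_succ_pow_mul_geometric k hr0.le hr1)).mul_right (r₀ ^ 4)⁻¹
    refine h.congr fun e => ?_
    push_cast
    rw [pow_add]
    field_simp
    ring
  refine ⟨∑' e : ℕ, ((e : ℝ) + 5) ^ k * r₀ ^ e, tsum_nonneg fun e => by positivity, ?_⟩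
  intro M p hp hpM s hs
  obtain ⟨r, hr⟩ : ∃ r : ℝ, r = (p : ℝ) ^ (-(3 / 8) : ℝ) := ⟨_, rfl⟩
  have hrpos : 0 ≤ r := by rw [hr]; positivity
  have hrr₀ : r ≤ r₀ := by
    rw [hr, hr₀]
    refine Real.rpow_le_rpow_of_nonpos (by norm_num) ?_ (by norm_num)
    exact_mod_cast hp.two_le
  have hS := (summable_norm_coprimeCoeff_prime_pow M hs hp).of_norm
  have h0 := coprimeCoeff_one M s
  have h1 := coprimeCoeff_prime_pow s hp hpM (e := 1) one_ne_zero
  have h2 := coprimeCoeff_prime_pow s hp hpM (e := 2) two_ne_zero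
  have h3 := coprimeCoeff_prime_pow s hp hpM (e := 3) three_ne_zero
  rw [if_neg (by decide)] at h1 h3
  rw [if_pos (by decide)] at h2
  rw [diagFactor, ← hS.sum_add_tsum_nat_add 4]
  simp only [Finset.sum_range_succ, Finset.range_zero, Finset.sum_empty, pow_zero, h0, h1, h2, h3]
  rw [show ∀ x y : ℂ, 0 + 1 + 0 + x + 0 + y - 1 - x = y by intros; ring, ← hr]
  rw [← tsum_mul_right]
  refine tsum_of_norm_bounded (hsum.mul_right (r ^ 4)).hasSum fun e => ?_
  refine ((norm_coprimeCoeff_le M s _).trans (norm_tupleFun_prime_pow_le hs hp _)).trans ?_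
  rw [← hr, pow_add]
  push_cast
  have h5 : r ^ e ≤ r₀ ^ e := pow_le_pow_left₀ hrpos hrr₀ e
  rw [show (e : ℝ) + 4 + 1 = e + 5 by ring, ← mul_assoc]
  gcongr

/-- With `S = ∑_{i ≤ j} p^{-s_i - s_j}`, the Euler factor is `1 + p/(p+1) S` and `zetaFactor` is `1
- S`, both up to `O(p^{-3/2})`. The terms of first order cancel up to `S/(p + 1)`, which is as small
as the errors. -/
theorem exists_norm_euler_error_le (k : ℕ) : ∃ C : ℝ, 0 ≤ C ∧ ∀ (M p : ℕ), p.Prime → ¬ p ∣ M →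
    ∀ s ∈ diagRegion k, ‖diagFactor M p s * zetaFactor p s - 1‖ ≤ C * (1 / (p : ℝ) ^ (3 / 2 : ℝ)) := by
  obtain ⟨C₁, hC₁, hle⟩ := exists_norm_diagFactor_sub_le k
  obtain ⟨n, hn⟩ : ∃ n : ℕ, n = (orderedPairs k).card := ⟨_, rfl⟩
  refine ⟨2 ^ n + n * 2 ^ n + n + C₁ * 2 ^ n, by positivity, ?_⟩
  intro M p hp hpM s hs
  obtain ⟨r, hr⟩ : ∃ r : ℝ, r = (p : ℝ) ^ (-(3 / 8) : ℝ) := ⟨_, rfl⟩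
  have hp1 : (1 : ℝ) ≤ p := by exact_mod_cast hp.one_lt.le
  have hp0 : (0 : ℝ) < p := by linarith
  have hr0 : 0 ≤ r := by rw [hr]; positivity
  have hr1 : r ≤ 1 := by rw [hr]; exact (rpow_neg_lt_one hp (by norm_num)).le
  have hr21 : r ^ 2 ≤ 1 := pow_le_one₀ hr0 hr1
  have hr4 : r ^ 4 = 1 / (p : ℝ) ^ (3 / 2 : ℝ) := by
    rw [hr, ← Real.rpow_natCast, ← Real.rpow_mul hp0.le, one_div, ← Real.rpow_neg hp0.le]
    norm_num
  have hpr : 1 / (p : ℝ) ≤ r ^ 2 := by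
    rw [hr, ← Real.rpow_natCast, ← Real.rpow_mul hp0.le, one_div, ← Real.rpow_neg_one]
    refine Real.rpow_le_rpow_of_exponent_le hp1 ?_
    norm_num
  have hy : ∀ q ∈ orderedPairs k, ‖(p : ℂ) ^ (-(s q.1 + s q.2))‖ ≤ r ^ 2 := fun q _ => by
    rw [hr]; exact norm_cpow_neg_add_le hs hp _ _
  obtain ⟨S, hS⟩ : ∃ S, S = tupleFun s (p ^ 2) := ⟨_, rfl⟩
  obtain ⟨z, hz⟩ : ∃ z, z = zetaFactor p s := ⟨_, rfl⟩
  obtain ⟨κ, hκ⟩ : ∃ κ, κ = (p : ℂ) / ((p : ℂ) + 1) := ⟨_, rfl⟩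
  have e1 : ‖z - 1 + S‖ ≤ 2 ^ n * r ^ 4 := by
    rw [hz, hS, tupleFun_prime_sq_eq_sum_orderedPairs s hp, hn]
    have := norm_prod_one_sub_sub_one_add_sum_le (orderedPairs k) (sq_nonneg r) hr21 hy
    rwa [← pow_mul] at this
  have e2 : ‖z - 1‖ ≤ 2 ^ n * r ^ 2 := by
    rw [hz, hn]
    exact norm_prod_one_sub_sub_one_le (orderedPairs k) (sq_nonneg r) hr21 hy
  have e3 : ‖z‖ ≤ 2 ^ n := by
    rw [hz, hn]
    exact norm_prod_one_sub_le (orderedPairs k) hr21 hy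
  have e4 : ‖S‖ ≤ n * r ^ 2 := by
    rw [hS, tupleFun_prime_sq_eq_sum_orderedPairs s hp, hn]
    refine (norm_sum_le _ _).trans ((Finset.sum_le_sum hy).trans_eq ?_)
    rw [Finset.sum_const, nsmul_eq_mul]
  have e5 : ‖diagFactor M p s - 1 - κ * S‖ ≤ C₁ * r ^ 4 := by
    rw [hκ, hS, hr]; exact hle M p hp hpM s hs
  have hpc : ‖(p : ℂ) + 1‖ = (p : ℝ) + 1 := by
    rw [← Nat.cast_add_one, Complex.norm_natCast]; push_cast; rfl
  have hp1c : (p : ℂ) + 1 ≠ 0 := by exact_mod_cast Nat.succ_ne_zero p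
  have e6 : ‖κ‖ ≤ 1 := by
    rw [hκ, norm_div, hpc, Complex.norm_natCast]
    exact div_le_one_of_le₀ (by linarith) (by positivity)
  have e7 : ‖κ - 1‖ ≤ r ^ 2 := by
    have : κ - 1 = -(1 / ((p : ℂ) + 1)) := by rw [hκ]; field_simp; ring
    rw [this, norm_neg, norm_div, hpc, norm_one]
    exact (one_div_le_one_div_of_le hp0 (by linarith)).trans hpr
  have hid : diagFactor M p s * z - 1 = (z - 1 + S) + κ * S * (z - 1) + (κ - 1) * S +
      (diagFactor M p s - 1 - κ * S) * z := by ring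
  rw [← hz, hid, ← hr4]
  have f2 : ‖κ * S * (z - 1)‖ ≤ n * 2 ^ n * r ^ 4 := by
    rw [norm_mul, norm_mul]
    calc ‖κ‖ * ‖S‖ * ‖z - 1‖ ≤ 1 * (n * r ^ 2) * (2 ^ n * r ^ 2) := by gcongr
      _ = _ := by ring
  have f3 : ‖(κ - 1) * S‖ ≤ n * r ^ 4 := by
    rw [norm_mul]
    calc ‖κ - 1‖ * ‖S‖ ≤ r ^ 2 * (n * r ^ 2) := by gcongr
      _ = _ := by ring
  have f4 : ‖(diagFactor M p s - 1 - κ * S) * z‖ ≤ C₁ * 2 ^ n * r ^ 4 := by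
    rw [norm_mul]
    calc ‖diagFactor M p s - 1 - κ * S‖ * ‖z‖ ≤ (C₁ * r ^ 4) * 2 ^ n := by gcongr
      _ = _ := by ring
  have g1 := norm_add_le ((z - 1 + S) + κ * S * (z - 1) + (κ - 1) * S)
    ((diagFactor M p s - 1 - κ * S) * z)
  have g2 := norm_add_le ((z - 1 + S) + κ * S * (z - 1)) ((κ - 1) * S)
  have g3 := norm_add_le (z - 1 + S) (κ * S * (z - 1))
  linarith

end EulerFactors

/-! ### Analytic continuation of `T_M` by an absolutely convergent Euler product. -/

section Continuation

/-- Telescoping turns the infinite product into a series, to which the lemma on dominated series of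
holomorphic functions applies. -/
theorem prod_range_one_add {u : ℕ → ℂ} (N : ℕ) : ∏ m ∈ Finset.range N, (1 + u m) =
    1 + ∑ n ∈ Finset.range N, u n * ∏ m ∈ Finset.range n, (1 + u m) := by
  induction N with
  | zero => simp
  | succ N ih =>
    rw [Finset.sum_range_succ, Finset.prod_range_succ, mul_one_add, ← add_assoc, ← ih, mul_comm (u N)]

/-- An infinite product of holomorphic functions `1 + u_n`, with `u_n` dominated by a summable
sequence, converges to a holomorphic function. -/
theorem exists_holomorphic_prod {E : Type*} [NormedAddCommGroup E] [NormedSpace ℂ E] {U : Set E}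
    (hU : IsOpen U) {u : ℕ → E → ℂ} (hu : ∀ n, DifferentiableOn ℂ (u n) U) {b : ℕ → ℝ}
    (hb : Summable b) (hle : ∀ n, ∀ s ∈ U, ‖u n s‖ ≤ b n) :
    ∃ F : E → ℂ, DifferentiableOn ℂ F U ∧ ∀ s ∈ U,
      Tendsto (fun N => ∏ m ∈ Finset.range N, (1 + u m s)) atTop (𝓝 (F s)) := by
  rcases U.eq_empty_or_nonempty with rfl | ⟨s₀, hs₀⟩
  · exact ⟨0, by simp, by simp⟩
  have hb0 : ∀ n, 0 ≤ b n := fun n => (norm_nonneg _).trans (hle n s₀ hs₀)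
  have hprod : ∀ n, ∀ s ∈ U, ‖∏ m ∈ Finset.range n, (1 + u m s)‖ ≤ Real.exp (∑' m, b m) := by
    intro n s hs
    rw [norm_prod]
    calc ∏ m ∈ Finset.range n, ‖1 + u m s‖ ≤ ∏ m ∈ Finset.range n, Real.exp (b m) := by
          refine Finset.prod_le_prod (fun _ _ => norm_nonneg _) fun m _ => ?_
          refine (norm_add_le _ _).trans ?_
          rw [norm_one]
          linarith [hle m s hs, Real.add_one_le_exp (b m)]
      _ = Real.exp (∑ m ∈ Finset.range n, b m) := (Real.exp_sum _ _).symm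
      _ ≤ _ := Real.exp_le_exp.2 (hb.sum_le_tsum _ fun m _ => hb0 m)
  have hterm : ∀ n, ∀ s ∈ U, ‖u n s * ∏ m ∈ Finset.range n, (1 + u m s)‖ ≤
      b n * Real.exp (∑' m, b m) := by
    intro n s hs
    rw [norm_mul]
    exact mul_le_mul (hle n s hs) (hprod n s hs) (norm_nonneg _) (hb0 n)
  refine ⟨fun s => 1 + ∑' n, u n s * ∏ m ∈ Finset.range n, (1 + u m s), ?_, ?_⟩
  · have hd : DifferentiableOn ℂ
        (fun s => ∑' n, u n s * ∏ m ∈ Finset.range n, (1 + u m s)) U := by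
      refine differentiableOn_tsum_of_locally_dominated hU (fun n => ?_) fun z₀ _ =>
        ⟨1, one_pos, fun n => b n * Real.exp (∑' m, b m), hb.mul_right _,
          fun z _ hz n => hterm n z hz⟩
      refine (hu n).mul fun s hs => ?_
      refine (differentiableAt_prod _ fun m _ => ?_).differentiableWithinAt
      exact ((hu m).differentiableAt (hU.mem_nhds hs)).const_add _
    exact hd.const_add 1
  · intro s hs
    have hsum : Summable fun n => u n s * ∏ m ∈ Finset.range n, (1 + u m s) :=
      Summable.of_norm_bounded (hb.mul_right _) fun n => hterm n s hs
    refine Tendsto.congr (fun N => (prod_range_one_add (u := fun m => u m s) N).symm) ?_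
    exact hsum.hasSum.tendsto_sum_nat.const_add 1

open Classical in
/-- The deviation of the normalized Euler factor from `1`. -/
noncomputable def eulerError (M : ℕ) {k : ℕ} (n : ℕ) (s : Fin k → ℂ) : ℂ :=
  if n.Prime ∧ ¬ n ∣ M then diagFactor M n s * zetaFactor n s - 1 else 0

theorem exists_euler_limit (k M : ℕ) : ∃ F : (Fin k → ℂ) → ℂ,
    DifferentiableOn ℂ F (diagRegion k) ∧ ∀ s ∈ diagRegion k,
      Tendsto (fun N => ∏ m ∈ Finset.range N, (1 + eulerError M m s)) atTop (𝓝 (F s)) := by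
  obtain ⟨C, hC, hle⟩ := exists_norm_euler_error_le k
  refine exists_holomorphic_prod (isOpen_diagRegion k) (fun n => ?_)
    ((Real.summable_one_div_nat_rpow.2 (by norm_num : (1 : ℝ) < 3 / 2)).mul_left C) fun n s hs => ?_
  · by_cases h : n.Prime ∧ ¬ n ∣ M
    · have : eulerError M n = fun s : Fin k → ℂ => diagFactor M n s * zetaFactor n s - 1 := by
        funext s; exact if_pos h
      rw [this]
      exact ((differentiableOn_diagFactor k M h.1).mul
        (differentiable_zetaFactor k h.1).differentiableOn).sub_const _
    · have : eulerError M n = fun _ : Fin k → ℂ => 0 := by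
        funext s; exact if_neg h
      rw [this]
      exact differentiableOn_const _
  · unfold eulerError
    split_ifs with h
    · exact hle M n h.1 h.2 s hs
    · rw [norm_zero]; positivity

theorem mem_diagRegion_of_one_lt {k : ℕ} {s : Fin k → ℂ} (hs : ∀ j, 1 < (s j).re) :
    s ∈ diagRegion k := fun j => by linarith [hs j]

theorem riemannZeta_add_ne_zero {k : ℕ} {s : Fin k → ℂ} (hs : ∀ j, 1 < (s j).re) (i j : Fin k) :
    riemannZeta (s i + s j) ≠ 0 :=
  riemannZeta_ne_zero_of_one_le_re (by rw [Complex.add_re]; linarith [hs i, hs j])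

/-- Partial Euler products are compared over the primes below `n > M`. At primes dividing `M` the
diagonal factor is `1`, so their zeta factors survive as a finite correction. -/
theorem tsum_coprimeCoeff {k M : ℕ} (hM : M ≠ 0) {F : (Fin k → ℂ) → ℂ} {s : Fin k → ℂ}
    (hs : ∀ j, 1 < (s j).re)
    (hF : Tendsto (fun N => ∏ m ∈ Finset.range N, (1 + eulerError M m s)) atTop (𝓝 (F s))) :
    ∑' v, coprimeCoeff M s v = F s * (∏ p ∈ M.primeFactors, zetaFactor p s) *
      ∏ q ∈ orderedPairs k, riemannZeta (s q.1 + s q.2) := by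
  have h1 : Tendsto (fun n : ℕ => ∏ p ∈ Nat.primesBelow n, diagFactor M p s) atTop
      (𝓝 (∑' v, coprimeCoeff M s v)) :=
    EulerProduct.eulerProduct (coprimeCoeff_one M s) (fun h => coprimeCoeff_mul M s h)
      (Summable.of_nonneg_of_le (fun _ => norm_nonneg _) (fun v => norm_coprimeCoeff_le M s v)
        (summable_norm_tupleFun hs)) (by simp [coprimeCoeff])
  have h2 : Tendsto (fun n : ℕ => ∏ p ∈ Nat.primesBelow n, zetaFactor p s) atTop
      (𝓝 (∏ q ∈ orderedPairs k, (riemannZeta (s q.1 + s q.2))⁻¹)) := by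
    have h : ∀ q ∈ orderedPairs k, Tendsto
        (fun n : ℕ => ∏ p ∈ Nat.primesBelow n, (1 - (p : ℂ) ^ (-(s q.1 + s q.2)))) atTop
        (𝓝 (riemannZeta (s q.1 + s q.2))⁻¹) := by
      intro q _
      have := (riemannZeta_eulerProduct (s := s q.1 + s q.2)
        (by rw [Complex.add_re]; linarith [hs q.1, hs q.2])).inv₀
        (riemannZeta_add_ne_zero hs _ _)
      refine this.congr fun n => ?_
      rw [← Finset.prod_inv_distrib]
      simp
    refine (tendsto_finsetProd _ h).congr fun n => ?_
    exact Finset.prod_comm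
  have h3 : ∀ᶠ n : ℕ in atTop, (∏ p ∈ Nat.primesBelow n, diagFactor M p s) *
      (∏ p ∈ Nat.primesBelow n, zetaFactor p s) =
      (∏ m ∈ Finset.range n, (1 + eulerError M m s)) * ∏ p ∈ M.primeFactors, zetaFactor p s := by
    filter_upwards [eventually_gt_atTop M] with n hn
    have hsub : M.primeFactors = (Nat.primesBelow n).filter (· ∣ M) := by
      ext p
      simp only [Nat.mem_primeFactors, Finset.mem_filter, Nat.mem_primesBelow]
      constructor
      · rintro ⟨hp, hd, -⟩
        exact ⟨⟨(Nat.le_of_dvd (Nat.pos_of_ne_zero hM) hd).trans_lt hn, hp⟩, hd⟩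
      · rintro ⟨⟨-, hp⟩, hd⟩
        exact ⟨hp, hd, hM⟩
    have hE : ∏ m ∈ Finset.range n, (1 + eulerError M m s) =
        ∏ p ∈ (Nat.primesBelow n).filter (¬ · ∣ M), (diagFactor M p s * zetaFactor p s) := by
      rw [Nat.primesBelow, Finset.filter_filter, Finset.prod_filter]
      refine Finset.prod_congr rfl fun m _ => ?_
      unfold eulerError
      split_ifs <;> ring
    have hL : ∏ p ∈ (Nat.primesBelow n).filter (· ∣ M), diagFactor M p s = 1 := by
      refine Finset.prod_eq_one fun p hp => ?_
      rw [Finset.mem_filter] at hp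
      exact diagFactor_of_dvd s (Nat.prime_of_mem_primesBelow hp.1) hp.2
    rw [hE, hsub, ← Finset.prod_filter_mul_prod_filter_not (Nat.primesBelow n) (· ∣ M)
      (fun p => diagFactor M p s), ← Finset.prod_filter_mul_prod_filter_not (Nat.primesBelow n)
      (· ∣ M) (fun p => zetaFactor p s), hL, Finset.prod_mul_distrib]
    ring
  have h4 := tendsto_nhds_unique ((h1.mul h2).congr' h3) (hF.mul_const _)
  rw [Finset.prod_inv_distrib] at h4
  have hz : ∏ q ∈ orderedPairs k, riemannZeta (s q.1 + s q.2) ≠ 0 :=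
    Finset.prod_ne_zero_iff.2 fun q _ => riemannZeta_add_ne_zero hs _ _
  rw [← h4]
  field_simp

/-- The continuation of the diagonal series, with its poles cleared. -/
theorem exists_diag_continuation (k : ℕ) {M : ℕ} (hM : M ≠ 0) : ∃ G : (Fin k → ℂ) → ℂ,
    DifferentiableOn ℂ G (diagRegion k) ∧
      ∀ s : Fin k → ℂ, (∀ j, 1 < (s j).re) → diagSeries M s * polarFactor s = G s := by
  obtain ⟨F, hFd, hF⟩ := exists_euler_limit k M
  -- `Z` is `(z - 1) ζ(z)` with its singularity removed; at `z = s_i + s_j` it absorbs the factors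
  -- of `polarFactor`.
  obtain ⟨Z, hZd, hZ⟩ : ∃ Z : ℂ → ℂ, Differentiable ℂ Z ∧
      ∀ z, z ≠ 1 → Z z = (z - 1) * riemannZeta z := by
    refine ⟨DirichletCharacter.LFunctionTrivChar₁ 1,
      DirichletCharacter.differentiable_LFunctionTrivChar₁ 1, fun z hz => ?_⟩
    rw [DirichletCharacter.LFunctionTrivChar₁, Function.update_of_ne hz]
    congr 1
    exact congrFun (DirichletCharacter.LFunction_modOne_eq (χ := 1)) z
  refine ⟨fun s => 1 / (2 * riemannZeta 2) *
    ((∑' u : Nat.factoredNumbers M.primeFactors, diagCoeff M s u) *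
      (F s * (∏ p ∈ M.primeFactors, zetaFactor p s) * ∏ q ∈ orderedPairs k, Z (s q.1 + s q.2))),
    ?_, ?_⟩
  · refine DifferentiableOn.const_mul ?_ _
    refine (differentiableOn_tsum_factored k M).mul ((hFd.mul ?_).mul ?_)
    · intro s _
      exact (differentiableAt_prod _ fun p hp => differentiable_zetaFactor k
        (Nat.prime_of_mem_primeFactors hp) s).differentiableWithinAt
    · intro s _
      refine (differentiableAt_prod _ fun q _ => ?_).differentiableWithinAt
      exact (hZd _).comp s (by fun_prop)
  · intro s hs
    have h1 : diagSeries M s = 1 / (2 * riemannZeta 2) * ∑' N, diagCoeff M s N := diagSeries_eq M hs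
    have h2 : polarFactor s = ∏ q ∈ orderedPairs k, (s q.1 + s q.2 - 1) :=
      (prod_orderedPairs fun i j => s i + s j - 1).symm
    have h3 : ∏ q ∈ orderedPairs k, Z (s q.1 + s q.2) =
        polarFactor s * ∏ q ∈ orderedPairs k, riemannZeta (s q.1 + s q.2) := by
      rw [h2, ← Finset.prod_mul_distrib]
      refine Finset.prod_congr rfl fun q _ => hZ _ fun h => ?_
      have := congrArg Complex.re h
      rw [Complex.add_re, Complex.one_re] at this
      linarith [hs q.1, hs q.2]
    rw [h1, tsum_diagCoeff hM hs, tsum_coprimeCoeff hM hs (hF s (mem_diagRegion_of_one_lt hs))]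
    simp only [h3]
    ring

end Continuation

end QuadraticMoments

namespace QuadraticMoments

open MeasureTheory Filter Topology

/-! ### Decay of the Mellin transform of a test function. -/

section MellinDecay

/-- The support of `g` may contain `0`, so convergence there requires `Re w > 0`; every line used
below satisfies this. -/
theorem mellinConvergent_of_hasCompactSupport {g : ℝ → ℂ} (hg : Continuous g)
    (hc : HasCompactSupport g) {w : ℂ} (hw : 0 < w.re) : MellinConvergent g w := by
  refine mellinConvergent_of_isBigO_rpow (a := w.re + 1) (b := 0)
    (hg.locallyIntegrable.locallyIntegrableOn _) ?_ (by linarith) ?_ hw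
  · refine (EventuallyEq.isBigO (f₂ := fun _ => (0 : ℂ)) ?_).trans (Asymptotics.isBigO_zero _ _)
    have h2 := (hasCompactSupport_iff_eventuallyEq.1 hc)
    rw [Filter.coclosedCompact_eq_cocompact] at h2
    exact h2.filter_mono atTop_le_cocompact
  · simp only [neg_zero, Real.rpow_zero]
    exact (hg.tendsto 0).isBigO_one ℝ |>.mono nhdsWithin_le_nhds

theorem differentiableAt_mellin_of_hasCompactSupport {g : ℝ → ℂ} (hg : Continuous g)
    (hc : HasCompactSupport g) {w : ℂ} (hw : 0 < w.re) : DifferentiableAt ℂ (mellin g) w := by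
  refine mellin_differentiableAt_of_isBigO_rpow (a := w.re + 1) (b := 0)
    (hg.locallyIntegrable.locallyIntegrableOn _) ?_ (by linarith) ?_ hw
  · refine (EventuallyEq.isBigO (f₂ := fun _ => (0 : ℂ)) ?_).trans (Asymptotics.isBigO_zero _ _)
    have h2 := (hasCompactSupport_iff_eventuallyEq.1 hc)
    rw [Filter.coclosedCompact_eq_cocompact] at h2
    exact h2.filter_mono atTop_le_cocompact
  · simp only [neg_zero, Real.rpow_zero]
    exact (hg.tendsto 0).isBigO_one ℝ |>.mono nhdsWithin_le_nhds

theorem exists_norm_mellin_le {g : ℝ → ℂ} (hg : Continuous g) (hc : HasCompactSupport g)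
    {a : ℝ} (ha : 0 < a) (b : ℝ) :
    ∃ C : ℝ, ∀ w : ℂ, a ≤ w.re → w.re ≤ b → ‖mellin g w‖ ≤ C := by
  by_cases hab : a ≤ b
  swap
  · exact ⟨0, fun w h1 h2 => absurd (h1.trans h2) hab⟩
  have hInt : ∀ x : ℝ, 0 < x →
      IntegrableOn (fun t : ℝ => ‖(t : ℂ) ^ ((x : ℂ) - 1) • g t‖) (Set.Ioi 0) := fun x hx =>
    (mellinConvergent_of_hasCompactSupport hg hc (w := (x : ℂ)) (by simpa using hx)).norm
  refine ⟨∫ t in Set.Ioi (0 : ℝ), (‖(t : ℂ) ^ ((a : ℂ) - 1) • g t‖ +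
    ‖(t : ℂ) ^ ((b : ℂ) - 1) • g t‖), fun w h1 h2 => ?_⟩
  refine norm_integral_le_of_norm_le ((hInt a ha).add (hInt b (ha.trans_le hab))) ?_
  filter_upwards [ae_restrict_mem measurableSet_Ioi] with t ht
  have ht : 0 < t := ht
  rw [norm_smul, norm_smul, norm_smul, ← add_mul]
  refine mul_le_mul_of_nonneg_right ?_ (norm_nonneg _)
  rw [Complex.norm_cpow_eq_rpow_re_of_pos ht, Complex.norm_cpow_eq_rpow_re_of_pos ht,
    Complex.norm_cpow_eq_rpow_re_of_pos ht]
  simp only [Complex.sub_re, Complex.one_re, Complex.ofReal_re]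
  rcases le_total 1 t with h | h
  · have := Real.rpow_le_rpow_of_exponent_le h (show w.re - 1 ≤ b - 1 by linarith)
    have := Real.rpow_nonneg ht.le (a - 1)
    linarith
  · have := Real.rpow_le_rpow_of_exponent_ge ht h (show a - 1 ≤ w.re - 1 by linarith)
    have := Real.rpow_nonneg ht.le (b - 1)
    linarith

/-- Integration by parts in the Mellin transform. -/
theorem mul_mellin_eq_neg_mellin_deriv {g : ℝ → ℂ} (hg : ContDiff ℝ ∞ g)
    (hc : HasCompactSupport g) {w : ℂ} (hw : 0 < w.re) :
    w * mellin g w = -mellin (deriv g) (w + 1) := by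
  have hg1 : Continuous (deriv g) := hg.continuous_deriv (by simp)
  have hw0 : w ≠ 0 := fun h => by simp [h] at hw
  have hi1 : IntegrableOn (fun t : ℝ => w * ((t : ℂ) ^ (w - 1) * g t)) (Set.Ioi 0) :=
    (mellinConvergent_of_hasCompactSupport hg.continuous hc hw).const_mul w
  have hi2 : IntegrableOn (fun t : ℝ => (t : ℂ) ^ w * deriv g t) (Set.Ioi 0) := by
    have := mellinConvergent_of_hasCompactSupport hg1 hc.deriv (w := w + 1) (by simp; linarith)
    simpa [MellinConvergent] using this
  have key : ∫ t in Set.Ioi (0 : ℝ), (w * ((t : ℂ) ^ (w - 1) * g t) + (t : ℂ) ^ w * deriv g t)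
      = 0 - ((0 : ℝ) : ℂ) ^ w * g 0 := by
    refine integral_Ioi_of_hasDerivAt_of_tendsto (f := fun t : ℝ => (t : ℂ) ^ w * g t)
      ?_ ?_ (hi1.add hi2) ?_
    · refine ContinuousAt.continuousWithinAt (ContinuousAt.mul ?_ hg.continuous.continuousAt)
      exact (Complex.continuousAt_ofReal_cpow_const 0 w (Or.inl hw))
    · intro t ht
      have ht : 0 < t := ht
      have h1' := hasDerivAt_ofReal_cpow_const (x := t) ht.ne' (r := w) hw0
      have h2 := ((hg.differentiable (by simp)) t).hasDerivAt
      exact (h1'.mul h2).congr_deriv (by ring)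
    · refine (tendsto_const_nhds (x := (0 : ℂ))).congr' ?_
      have h2 := (hasCompactSupport_iff_eventuallyEq.1 hc)
      rw [Filter.coclosedCompact_eq_cocompact] at h2
      filter_upwards [h2.filter_mono atTop_le_cocompact] with t ht
      simp [ht]
  rw [integral_add hi1 hi2, integral_const_mul] at key
  simp only [Complex.ofReal_zero, Complex.zero_cpow hw0, zero_mul, sub_zero] at key
  simp only [mellin, smul_eq_mul, add_sub_cancel_right]
  linear_combination key

/-- The Mellin transform of a test function decays rapidly in vertical strips. -/
theorem exists_norm_mellin_mul_pow_le (N : ℕ) {g : ℝ → ℂ} (hg : ContDiff ℝ ∞ g)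
    (hc : HasCompactSupport g) {a : ℝ} (ha : 0 < a) (b : ℝ) :
    ∃ C : ℝ, ∀ w : ℂ, a ≤ w.re → w.re ≤ b → ‖mellin g w‖ * (1 + |w.im|) ^ N ≤ C := by
  induction N generalizing g a b with
  | zero =>
    obtain ⟨C, hC⟩ := exists_norm_mellin_le hg.continuous hc ha b
    exact ⟨C, fun w h1 h2 => by simpa using hC w h1 h2⟩
  | succ N ih =>
    obtain ⟨C₁, hC₁⟩ := ih hg hc ha b
    have hg' : ContDiff ℝ ∞ (deriv g) := (contDiff_infty_iff_deriv.1 hg).2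
    obtain ⟨C₂, hC₂⟩ := ih hg' hc.deriv (show 0 < a + 1 by linarith) (b + 1)
    refine ⟨C₁ + C₂, fun w h1 h2 => ?_⟩
    have e1 := hC₁ w h1 h2
    have e2 := hC₂ (w + 1) (by simpa using h1) (by simpa using h2)
    have e3 := congrArg norm (mul_mellin_eq_neg_mellin_deriv hg hc (ha.trans_le h1))
    rw [norm_mul, norm_neg] at e3
    rw [← e3] at e2
    simp only [Complex.add_im, Complex.one_im, add_zero] at e2
    have e4 := Complex.abs_im_le_norm w
    have e5 : |w.im| * (‖mellin g w‖ * (1 + |w.im|) ^ N) ≤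
        ‖w‖ * (‖mellin g w‖ * (1 + |w.im|) ^ N) := by gcongr
    calc ‖mellin g w‖ * (1 + |w.im|) ^ (N + 1)
        = ‖mellin g w‖ * (1 + |w.im|) ^ N + |w.im| * (‖mellin g w‖ * (1 + |w.im|) ^ N) := by ring
      _ ≤ C₁ + C₂ := by
        refine add_le_add e1 (e5.trans ?_)
        rwa [← mul_assoc]

end MellinDecay

/-! ### Contour shifts and residues in vertical strips. -/

section StripCauchy

/-- Cauchy's theorem in a vertical strip. -/
theorem integral_vertical_eq_of_decay {β γ : ℝ} {f : ℂ → ℂ}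
    (hf : DifferentiableOn ℂ f {w | β < w.re ∧ w.re < γ})
    (hb : ∀ b c : ℝ, β < b → c < γ → ∃ C : ℝ, ∀ w : ℂ, b ≤ w.re → w.re ≤ c →
      ‖f w‖ ≤ C * (1 + w.im ^ 2)⁻¹)
    {x y : ℝ} (hx : x ∈ Set.Ioo β γ) (hy : y ∈ Set.Ioo β γ) :
    ∫ t : ℝ, f (x + t * Complex.I) = ∫ t : ℝ, f (y + t * Complex.I) := by
  have hV : IsOpen {σ : Fin 1 → ℝ | σ 0 ∈ Set.Ioo β γ} :=
    isOpen_Ioo.preimage (continuous_apply 0)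
  have hVc : Convex ℝ {σ : Fin 1 → ℝ | σ 0 ∈ Set.Ioo β γ} :=
    (convex_Ioo β γ).linear_preimage (LinearMap.proj (R := ℝ) (φ := fun _ : Fin 1 => ℝ) 0)
  have key := integral_vert_eq_of_decay (Φ := fun z => f (z 0)) hV hVc.isPreconnected ?_ ?_
    (σ₁ := fun _ => x) (σ₂ := fun _ => y) hx hy
  · have e : ∀ u : ℝ, ∫ t : Fin 1 → ℝ, f (vert (fun _ => u) t 0)
        = ∫ t : ℝ, f (u + t * Complex.I) := fun u =>
      (volume_preserving_funUnique (Fin 1) ℝ).integral_comp'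
        (fun t : ℝ => f (u + t * Complex.I))
    rw [← e, ← e]
    exact key
  · exact hf.comp (differentiable_apply (𝕜 := ℂ) (0 : Fin 1)).differentiableOn fun z hz => hz
  · intro σ₀ hσ₀
    obtain ⟨h1, h2⟩ : β < σ₀ 0 ∧ σ₀ 0 < γ := hσ₀
    obtain ⟨C, hC⟩ := hb ((β + σ₀ 0) / 2) ((σ₀ 0 + γ) / 2) (by linarith) (by linarith)
    refine ⟨min ((σ₀ 0 - β) / 2) ((γ - σ₀ 0) / 2), lt_min (by linarith) (by linarith), C,
      fun σ hσ _ t => ?_⟩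
    have h3 : |σ 0 - σ₀ 0| < min ((σ₀ 0 - β) / 2) ((γ - σ₀ 0) / 2) := by
      refine lt_of_le_of_lt ?_ (mem_ball_iff_norm.1 hσ)
      simpa using norm_le_pi_norm (σ - σ₀) 0
    have h4 := abs_lt.1 (h3.trans_le (min_le_left _ _))
    have h5 := abs_lt.1 (h3.trans_le (min_le_right _ _))
    have := hC (vert σ t 0) (by simp [vert]; linarith) (by simp [vert]; linarith)
    simpa [vert] using this

theorem integrable_div_sq_add_sq {ξ : ℝ} (hξ : ξ ≠ 0) :
    Integrable fun t : ℝ => ξ / (ξ ^ 2 + t ^ 2) := by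
  have h := (integrable_inv_one_add_sq.comp_div hξ).const_mul ξ⁻¹
  refine h.congr (Eventually.of_forall fun t => ?_)
  beta_reduce
  have : ξ ^ 2 + t ^ 2 ≠ 0 := by positivity
  field_simp

theorem integral_div_sq_add_sq {ξ : ℝ} (hξ : ξ ≠ 0) :
    ∫ t : ℝ, ξ / (ξ ^ 2 + t ^ 2) = |ξ| / ξ * Real.pi := by
  have h : ∀ t : ℝ, ξ / (ξ ^ 2 + t ^ 2) = ξ⁻¹ * (1 + (t / ξ) ^ 2)⁻¹ := fun t => by
    have : ξ ^ 2 + t ^ 2 ≠ 0 := by positivity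
    field_simp
  simp_rw [h]
  rw [integral_const_mul, Measure.integral_comp_div (fun t : ℝ => (1 + t ^ 2)⁻¹),
    integral_univ_inv_one_add_sq, smul_eq_mul]
  ring

/-- The kernel `1/u - 1/(u + B)` integrated over a vertical line. -/
theorem integral_kernel_vertical {ξ B : ℝ} (h1 : ξ ≠ 0) (h2 : ξ + B ≠ 0) :
    Integrable (fun t : ℝ => (B : ℂ) / ((ξ + t * Complex.I) * (ξ + t * Complex.I + B))) ∧
    ∫ t : ℝ, (B : ℂ) / ((ξ + t * Complex.I) * (ξ + t * Complex.I + B)) =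
      ((|ξ| / ξ - |ξ + B| / (ξ + B)) * Real.pi : ℝ) := by
  have n1 : ∀ t : ℝ, (ξ : ℂ) + t * Complex.I ≠ 0 := fun t h => h1 (by simpa using congrArg Complex.re h)
  have n2 : ∀ t : ℝ, (ξ : ℂ) + t * Complex.I + B ≠ 0 := fun t h =>
    h2 (by simpa using congrArg Complex.re h)
  obtain ⟨f, hf⟩ : ∃ f : ℝ → ℂ, f = fun t : ℝ =>
      (B : ℂ) / ((ξ + t * Complex.I) * (ξ + t * Complex.I + B)) := ⟨_, rfl⟩
  have hcont : Continuous f := by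
    rw [hf]
    exact continuous_const.div (by fun_prop) fun t => mul_ne_zero (n1 t) (n2 t)
  have hsplit : ∀ t, f t = ((ξ + t * Complex.I) : ℂ)⁻¹ - ((ξ + t * Complex.I + B) : ℂ)⁻¹ := by
    intro t
    have := n1 t
    have := n2 t
    rw [hf]
    field_simp
    ring
  have hns : ∀ x t : ℝ, ‖(x : ℂ) + t * Complex.I‖ ^ 2 = x ^ 2 + t ^ 2 := fun x t => by
    rw [← Complex.normSq_eq_norm_sq, Complex.normSq_add_mul_I]
  have hInt : Integrable f := by
    have hb := (((integrable_div_sq_add_sq h1).const_mul ξ⁻¹).add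
      ((integrable_div_sq_add_sq h2).const_mul (ξ + B)⁻¹)).const_mul |B|
    refine hb.mono' hcont.aestronglyMeasurable (Eventually.of_forall fun t => ?_)
    rw [hf]
    simp only [Pi.add_apply]
    have e1 : ξ⁻¹ * (ξ / (ξ ^ 2 + t ^ 2)) = (‖(ξ : ℂ) + t * Complex.I‖⁻¹) ^ 2 := by
      rw [inv_pow, hns]; field_simp
    have e2 : (ξ + B)⁻¹ * ((ξ + B) / ((ξ + B) ^ 2 + t ^ 2)) =
        (‖(ξ : ℂ) + t * Complex.I + B‖⁻¹) ^ 2 := by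
      rw [inv_pow, show (ξ : ℂ) + t * Complex.I + B = ((ξ + B : ℝ) : ℂ) + t * Complex.I by
        push_cast; ring, hns]; field_simp
    rw [e1, e2, norm_div, norm_mul, Complex.norm_real, Real.norm_eq_abs, div_eq_mul_inv, mul_inv]
    refine mul_le_mul_of_nonneg_left ?_ (abs_nonneg _)
    nlinarith [sq_nonneg (‖(ξ : ℂ) + t * Complex.I‖⁻¹ - ‖(ξ : ℂ) + t * Complex.I + B‖⁻¹),
      sq_nonneg (‖(ξ : ℂ) + t * Complex.I‖⁻¹), sq_nonneg (‖(ξ : ℂ) + t * Complex.I + B‖⁻¹)]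
  refine ⟨hf ▸ hInt, ?_⟩
  -- Conjugate symmetry under `t ↦ -t` makes the integral real; the real part of the kernel is a
  -- difference of two Poisson kernels.
  have hconj : ∀ t, f (-t) = (starRingEnd ℂ) (f t) := by
    intro t
    rw [hf]
    simp only [map_div₀, map_mul, map_add, Complex.conj_ofReal, Complex.conj_I, Complex.ofReal_neg]
    ring_nf
  have hre : ∀ t, (f t).re = ξ / (ξ ^ 2 + t ^ 2) - (ξ + B) / ((ξ + B) ^ 2 + t ^ 2) := by
    intro t
    rw [hsplit, Complex.sub_re, Complex.inv_re, Complex.inv_re,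
      show (ξ : ℂ) + t * Complex.I + B = ((ξ + B : ℝ) : ℂ) + t * Complex.I by push_cast; ring,
      Complex.normSq_add_mul_I, Complex.normSq_add_mul_I]
    simp
  have hself : (starRingEnd ℂ) (∫ t, f t) = ∫ t, f t := by
    rw [← integral_conj, ← integral_neg_eq_self f]
    simp_rw [hconj]
  have him : (∫ t, f t) = ((∫ t, (f t).re : ℝ) : ℂ) := by
    have h3 := Complex.conj_eq_iff_re.1 hself
    rw [← h3]
    congr 1
    exact (integral_re hInt).symm
  have goal : (∫ t, f t) = (((|ξ| / ξ - |ξ + B| / (ξ + B)) * Real.pi : ℝ) : ℂ) := by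
    rw [him]
    congr 1
    simp_rw [hre]
    rw [integral_sub (integrable_div_sq_add_sq h1) (integrable_div_sq_add_sq h2),
      integral_div_sq_add_sq h1, integral_div_sq_add_sq h2]
    ring
  rw [hf] at goal
  exact goal

/-- Cauchy's formula in a vertical strip at the origin. -/
theorem integral_vertical_sub_div_self {β γ : ℝ} {Q : ℂ → ℂ}
    (hQ : DifferentiableOn ℂ Q {w | β < w.re ∧ w.re < γ})
    (hb : ∀ b c : ℝ, β < b → c < γ → ∃ C : ℝ, ∀ w : ℂ, b ≤ w.re → w.re ≤ c →
      ‖Q w‖ ≤ C * (1 + w.im ^ 2)⁻¹)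
    {b c : ℝ} (h1 : β < b) (h2 : b < 0) (h3 : 0 < c) (h4 : c < γ) :
    (∫ t : ℝ, Q (c + t * Complex.I) / (c + t * Complex.I)) -
      ∫ t : ℝ, Q (b + t * Complex.I) / (b + t * Complex.I) = 2 * Real.pi * Q 0 := by
  have hopen : IsOpen {w : ℂ | β < w.re ∧ w.re < γ} :=
    (isOpen_lt continuous_const Complex.continuous_re).inter
      (isOpen_lt Complex.continuous_re continuous_const)
  have h0mem : (0 : ℂ) ∈ {w : ℂ | β < w.re ∧ w.re < γ} := ⟨by simp; linarith, by simp; linarith⟩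
  -- Subtracting `Q(0) B/(w + B)` kills the value at `0` and keeps quadratic decay after division by
  -- `w`; `B = 1 - β` puts the new pole `-B` to the left of the strip. The remaining kernel `B/(w (w
  -- + B))` then carries the whole jump `2π Q(0)`.
  obtain ⟨B, hB⟩ : ∃ B : ℝ, B = 1 - β := ⟨_, rfl⟩
  have hBpos : 0 < B := by linarith
  have hne : ∀ w : ℂ, β < w.re → w + B ≠ 0 := fun w hw h => by
    have := congrArg Complex.re h
    simp at this
    linarith
  obtain ⟨q, hq⟩ : ∃ q : ℂ → ℂ, q = fun w => Q w - Q 0 * (B / (w + B)) := ⟨_, rfl⟩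
  have hqd : DifferentiableOn ℂ q {w | β < w.re ∧ w.re < γ} := by
    rw [hq]
    refine hQ.sub ((differentiableOn_const _).mul ((differentiableOn_const _).div
      (differentiableOn_id.add_const _) fun w hw => hne w hw.1))
  have hq0 : q 0 = 0 := by
    rw [hq]
    have : (B : ℂ) ≠ 0 := by exact_mod_cast hBpos.ne'
    simp [this]
  have hhd : DifferentiableOn ℂ (dslope q 0) {w | β < w.re ∧ w.re < γ} :=
    (Complex.differentiableOn_dslope (hopen.mem_nhds h0mem)).2 hqd
  have hval : ∀ w : ℂ, w ≠ 0 → dslope q 0 w = Q w / w - Q 0 * (B / (w * (w + B))) := by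
    intro w hw
    rw [dslope_of_ne _ hw, slope_def_field, hq0, hq]
    by_cases h : w + B = 0
    · simp [h]
    · field_simp
      ring
  have hdec : ∀ b c : ℝ, β < b → c < γ → ∃ C : ℝ, ∀ w : ℂ, b ≤ w.re → w.re ≤ c →
      ‖dslope q 0 w‖ ≤ C * (1 + w.im ^ 2)⁻¹ := by
    intro b c hb1 hc1
    obtain ⟨C, hC⟩ := hb b c hb1 hc1
    -- Near the real axis the divided difference is bounded by compactness of a rectangle; for `|Im
    -- w| ≥ 1` the explicit formula gives the decay.
    obtain ⟨D, hD⟩ := ((isCompact_Icc (a := b) (b := c)).reProdIm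
      (isCompact_Icc (a := (-1 : ℝ)) (b := 1))).exists_bound_of_continuousOn
      (hhd.continuousOn.mono fun w hw => ⟨hb1.trans_le hw.1.1, hw.1.2.trans_lt hc1⟩)
    refine ⟨|D| * 2 + (|C| + ‖Q 0‖ * B * 2), fun w hw1 hw2 => ?_⟩
    have hpos : 0 < (1 + w.im ^ 2)⁻¹ := by positivity
    rcases le_total |w.im| 1 with h | h
    · have e1 := hD w ⟨⟨hw1, hw2⟩, abs_le.1 h⟩
      have e2 : (1 : ℝ) ≤ 2 * (1 + w.im ^ 2)⁻¹ := by
        rw [← div_eq_mul_inv, le_div_iff₀ (by positivity)]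
        have := (sq_le_one_iff_abs_le_one w.im).2 h
        linarith
      calc ‖dslope q 0 w‖ ≤ |D| * 1 := by rw [mul_one]; exact e1.trans (le_abs_self D)
        _ ≤ |D| * (2 * (1 + w.im ^ 2)⁻¹) := by gcongr
        _ = (|D| * 2 + 0) * (1 + w.im ^ 2)⁻¹ := by ring
        _ ≤ _ := by gcongr; positivity
    · have him : w.im ≠ 0 := fun h0 => by rw [h0] at h; norm_num at h
      have hw0 : w ≠ 0 := fun h0 => him (by simp [h0])
      have hsq : 1 ≤ w.im ^ 2 := by rw [← sq_abs]; nlinarith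
      have n1 : 1 ≤ ‖w‖ := h.trans (Complex.abs_im_le_norm w)
      have n2 : |w.im| ≤ ‖w + B‖ := by simpa using Complex.abs_im_le_norm (w + B)
      rw [hval w hw0]
      have e1 : ‖Q w / w‖ ≤ |C| * (1 + w.im ^ 2)⁻¹ := by
        rw [norm_div]
        refine (div_le_self (norm_nonneg _) n1).trans ((hC w hw1 hw2).trans ?_)
        gcongr
        exact le_abs_self C
      have e2 : ‖Q 0 * (B / (w * (w + B)))‖ ≤ ‖Q 0‖ * B * 2 * (1 + w.im ^ 2)⁻¹ := by
        rw [norm_mul, norm_div, norm_mul, Complex.norm_real, Real.norm_of_nonneg hBpos.le,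
          mul_assoc, mul_assoc]
        gcongr
        rw [div_eq_mul_inv]
        gcongr
        have n3 : 0 < ‖w + B‖ := (zero_lt_one.trans_le h).trans_le n2
        rw [← div_eq_mul_inv, ← one_div, div_le_div_iff₀ (by positivity) (by positivity)]
        have : |w.im| * |w.im| ≤ ‖w‖ * ‖w + B‖ := by
          gcongr
          exact Complex.abs_im_le_norm w
        rw [abs_mul_abs_self] at this
        nlinarith
      calc _ ≤ _ := norm_sub_le _ _
        _ ≤ _ := add_le_add e1 e2
        _ = (0 + (|C| + ‖Q 0‖ * B * 2)) * (1 + w.im ^ 2)⁻¹ := by ring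
        _ ≤ _ := by gcongr; positivity
  have hmain := integral_vertical_eq_of_decay hhd hdec (x := c) (y := b)
    ⟨by linarith, h4⟩ ⟨h1, by linarith⟩
  have hline : ∀ x : ℝ, x ≠ 0 → β < x → x < γ →
      ∫ t : ℝ, Q (x + t * Complex.I) / (x + t * Complex.I) =
        (∫ t : ℝ, dslope q 0 (x + t * Complex.I)) +
          Q 0 * (((|x| / x - |x + B| / (x + B)) * Real.pi : ℝ) : ℂ) := by
    intro x hx hx1 hx2
    obtain ⟨i1, i2⟩ := integral_kernel_vertical (B := B) hx (by linarith : x + B > 0).ne'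
    have i3 : Integrable fun t : ℝ => dslope q 0 (x + t * Complex.I) := by
      obtain ⟨C, hC⟩ := hdec x x hx1 hx2
      refine (integrable_inv_one_add_sq.const_mul C).mono' ?_ (Eventually.of_forall fun t => ?_)
      · refine Continuous.aestronglyMeasurable ?_
        refine hhd.continuousOn.comp_continuous (by fun_prop) fun t => ?_
        simpa using ⟨hx1, hx2⟩
      · simpa using hC (x + t * Complex.I) (by simp) (by simp)
    rw [← i2, ← integral_const_mul, ← integral_add i3 (i1.const_mul _)]
    congr 1
    ext t
    rw [hval _ fun h => hx (by simpa using congrArg Complex.re h)]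
    ring
  rw [hline c h3.ne' (by linarith) h4, hline b h2.ne h1 (by linarith), hmain,
    abs_of_pos h3, abs_of_neg h2, abs_of_pos (show 0 < c + B by linarith),
    abs_of_pos (show 0 < b + B by linarith), div_self h3.ne', neg_div, div_self h2.ne,
    div_self (show c + B ≠ 0 by linarith), div_self (show b + B ≠ 0 by linarith)]
  push_cast
  ring

/-- Cauchy's formula in a vertical strip. -/
theorem integral_vertical_sub_div {β γ : ℝ} {Q : ℂ → ℂ}
    (hQ : DifferentiableOn ℂ Q {w | β < w.re ∧ w.re < γ})
    (hb : ∀ b c : ℝ, β < b → c < γ → ∃ C : ℝ, ∀ w : ℂ, b ≤ w.re → w.re ≤ c →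
      ‖Q w‖ ≤ C * (1 + w.im ^ 2)⁻¹)
    {b c : ℝ} {a : ℂ} (h1 : β < b) (h2 : b < a.re) (h3 : a.re < c) (h4 : c < γ) :
    (∫ t : ℝ, Q (c + t * Complex.I) / (c + t * Complex.I - a)) -
      ∫ t : ℝ, Q (b + t * Complex.I) / (b + t * Complex.I - a) = 2 * Real.pi * Q a := by
  have key := integral_vertical_sub_div_self (Q := fun w => Q (w + a)) (β := β - a.re)
    (γ := γ - a.re) (b := b - a.re) (c := c - a.re) ?_ ?_ (by linarith) (by linarith)
    (by linarith) (by linarith)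
  · have e : ∀ x : ℝ, ∫ t : ℝ, Q (x + t * Complex.I) / (x + t * Complex.I - a) =
        ∫ t : ℝ, Q (((x - a.re : ℝ) : ℂ) + t * Complex.I + a) /
          (((x - a.re : ℝ) : ℂ) + t * Complex.I) := by
      intro x
      rw [← integral_add_right_eq_self (fun t : ℝ => Q (x + t * Complex.I) /
        (x + t * Complex.I - a)) a.im]
      congr 1
      ext t
      have : ((x - a.re : ℝ) : ℂ) + t * Complex.I + a = x + ((t + a.im : ℝ) : ℂ) * Complex.I := by
        apply Complex.ext <;> simp
      rw [← this]
      congr 1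
      ring
    rw [e, e]
    simpa using key
  · refine hQ.comp (by fun_prop) fun w hw => ?_
    have hw : β - a.re < w.re ∧ w.re < γ - a.re := hw
    exact ⟨by simp; linarith, by simp; linarith⟩
  · intro b c hb1 hc1
    obtain ⟨C, hC⟩ := hb (b + a.re) (c + a.re) (by linarith) (by linarith)
    refine ⟨|C| * (2 * (1 + |a.im| ^ 2)), fun w hw1 hw2 => ?_⟩
    refine (hC (w + a) (by simp; linarith) (by simp; linarith)).trans ?_
    rw [mul_assoc]
    have := inv_one_add_sq_add_le (t := w.im) (y := a.im) le_rfl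
    gcongr
    · exact le_abs_self C
    · simpa using this

/-- The residue formula for `Q / ∏ (w - a i)` in a vertical strip, for distinct `a i`. -/
theorem integral_vertical_sub_div_prod {ι : Type*} [Fintype ι] [DecidableEq ι] {β γ : ℝ}
    {Q : ℂ → ℂ} (hQ : DifferentiableOn ℂ Q {w | β < w.re ∧ w.re < γ})
    (hb : ∀ b c : ℝ, β < b → c < γ → ∃ C : ℝ, ∀ w : ℂ, b ≤ w.re → w.re ≤ c →
      ‖Q w‖ ≤ C * (1 + w.im ^ 2)⁻¹)
    {b c : ℝ} {a : ι → ℂ} (ha : Function.Injective a) [Nonempty ι]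
    (h1 : β < b) (h2 : ∀ i, b < (a i).re) (h3 : ∀ i, (a i).re < c) (h4 : c < γ) :
    (∫ t : ℝ, Q (c + t * Complex.I) / ∏ i, (c + t * Complex.I - a i)) -
      ∫ t : ℝ, Q (b + t * Complex.I) / ∏ i, (b + t * Complex.I - a i) =
      2 * Real.pi * ∑ i, Q (a i) / ∏ j ∈ Finset.univ.erase i, (a i - a j) := by
  -- Partial fractions, obtained from Lagrange interpolation of the constant `1` at the nodes `a i`.
  have hpf : ∀ w : ℂ, (∀ i, w ≠ a i) → Q w / ∏ i, (w - a i) =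
      ∑ i, (∏ j ∈ Finset.univ.erase i, (a i - a j))⁻¹ * (Q w / (w - a i)) := by
    intro w hw
    have hs := congrArg (Polynomial.eval w) (Lagrange.sum_basis (s := Finset.univ) (v := a)
      ha.injOn Finset.univ_nonempty)
    rw [Polynomial.eval_finsetSum, Polynomial.eval_one] at hs
    simp_rw [Lagrange.eval_basis_not_at_node (Finset.mem_univ _) (hw _)] at hs
    rw [← Finset.mul_sum, Lagrange.eval_nodal] at hs
    have hP : ∏ i, (w - a i) ≠ 0 := Finset.prod_ne_zero_iff.2 fun i _ => sub_ne_zero.2 (hw i)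
    rw [div_eq_iff hP, Finset.sum_mul]
    calc Q w = Q w * ((∏ i, (w - a i)) *
          ∑ i, Lagrange.nodalWeight Finset.univ a i * (w - a i)⁻¹) := by rw [hs, mul_one]
      _ = _ := by
        rw [Finset.mul_sum, Finset.mul_sum]
        refine Finset.sum_congr rfl fun i _ => ?_
        rw [Lagrange.nodalWeight, Finset.prod_inv_distrib]
        ring
  have hlen : ∀ x : ℝ, β < x → x < γ → (∀ i, x ≠ (a i).re) →
      ∫ t : ℝ, Q (x + t * Complex.I) / ∏ i, (x + t * Complex.I - a i) =
      ∑ i, (∏ j ∈ Finset.univ.erase i, (a i - a j))⁻¹ *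
        ∫ t : ℝ, Q (x + t * Complex.I) / (x + t * Complex.I - a i) := by
    intro x hx1 hx2 hx
    have hne : ∀ (t : ℝ) i, (x : ℂ) + t * Complex.I ≠ a i := fun t i h =>
      hx i (by simpa using congrArg Complex.re h)
    simp_rw [← integral_const_mul]
    rw [← integral_finsetSum]
    · congr 1
      ext t
      exact hpf _ (hne t)
    · intro i _
      refine Integrable.const_mul ?_ _
      obtain ⟨C, hC⟩ := hb x x hx1 hx2
      have hd : 0 < |x - (a i).re| := abs_pos.2 (sub_ne_zero.2 (hx i))
      refine ((integrable_inv_one_add_sq.const_mul C).mul_const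
        |x - (a i).re|⁻¹).mono' ?_ (Eventually.of_forall fun t => ?_)
      · refine Continuous.aestronglyMeasurable (Continuous.div ?_ (by fun_prop)
          fun t => sub_ne_zero.2 (hne t i))
        refine hQ.continuousOn.comp_continuous (by fun_prop) fun t => ?_
        simpa using ⟨hx1, hx2⟩
      · rw [norm_div, div_eq_mul_inv]
        have e1 := hC (x + t * Complex.I) (by simp) (by simp)
        have e2 : |x - (a i).re| ≤ ‖(x : ℂ) + t * Complex.I - a i‖ := by
          simpa using Complex.abs_re_le_norm ((x : ℂ) + t * Complex.I - a i)
        have e3 : (0 : ℝ) ≤ ‖Q (x + t * Complex.I)‖ := norm_nonneg _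
        simp only [Complex.add_im, Complex.ofReal_im, Complex.mul_im, Complex.I_im,
          Complex.ofReal_re, Complex.I_re, mul_one, mul_zero, add_zero, zero_add] at e1
        gcongr
        exact e3.trans e1
  obtain ⟨i₀⟩ := ‹Nonempty ι›
  have hbc : b < c := (h2 i₀).trans (h3 i₀)
  rw [hlen c (by linarith) h4 fun i => (h3 i).ne', hlen b h1 (by linarith) fun i => (h2 i).ne,
    ← Finset.sum_sub_distrib, Finset.mul_sum]
  refine Finset.sum_congr rfl fun i _ => ?_
  rw [← mul_sub, integral_vertical_sub_div hQ hb h1 (h2 i) (h3 i) h4]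
  ring

end StripCauchy

end QuadraticMoments

namespace QuadraticMoments

open MeasureTheory Filter Topology

/-! ### From the hypothesis to a continuation on a full wedge. -/

section TubeContinuation

theorem exists_abs_eval_le_pow {n : ℕ} (P : MvPolynomial (Fin n) ℝ) :
    ∃ C : ℝ, 0 ≤ C ∧ ∃ A : ℕ, ∀ t : Fin n → ℝ, |MvPolynomial.eval t P| ≤ C * (1 + ‖t‖) ^ A := by
  induction P using MvPolynomial.induction_on with
  | C a => exact ⟨|a|, abs_nonneg a, 0, fun t => by simp⟩
  | add p q hp hq =>
    obtain ⟨C₁, hC₁, A₁, h₁⟩ := hp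
    obtain ⟨C₂, hC₂, A₂, h₂⟩ := hq
    refine ⟨C₁ + C₂, by positivity, max A₁ A₂, fun t => ?_⟩
    have h1t : 1 ≤ 1 + ‖t‖ := by linarith [norm_nonneg t]
    rw [map_add, add_mul]
    refine (abs_add_le _ _).trans (add_le_add ((h₁ t).trans ?_) ((h₂ t).trans ?_))
    · gcongr
      exact le_max_left _ _
    · gcongr
      exact le_max_right _ _
  | mul_X p i hp =>
    obtain ⟨C, hC, A, h⟩ := hp
    refine ⟨C, hC, A + 1, fun t => ?_⟩
    rw [map_mul, MvPolynomial.eval_X, abs_mul, pow_succ, ← mul_assoc]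
    have h1 : |t i| ≤ 1 + ‖t‖ := by
      have := norm_le_pi_norm t i
      rw [Real.norm_eq_abs] at this
      linarith
    exact mul_le_mul (h t) h1 (abs_nonneg _) (by positivity)

theorem PolyBoundedOnTube.tubeGrowth {n : ℕ} {V : Set (Fin n → ℝ)} {F : (Fin n → ℂ) → ℂ}
    (h : PolyBoundedOnTube V F) : TubeGrowth V F := by
  intro σ₀ _
  obtain ⟨P, hP⟩ := h (fun j => σ₀ j - 1) (fun j => σ₀ j + 1)
  obtain ⟨C, _, A, hCA⟩ := exists_abs_eval_le_pow P
  refine ⟨1, one_pos, C, A, fun σ hσ hσV t => ?_⟩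
  have := hP (vert σ t) (vert_mem_tube.2 hσV) fun j => ?_
  · refine this.trans ?_
    simpa [vert] using hCA t
  · have h1 : |σ j - σ₀ j| < 1 := by
      refine lt_of_le_of_lt ?_ (mem_ball_iff_norm.1 hσ)
      simpa using norm_le_pi_norm (σ - σ₀) j
    have h2 := abs_lt.1 h1
    constructor <;> simp [vert] <;> linarith

variable {k : ℕ}

/-- `∏_J (σ_J(w) - 1)` as a function of `z = (s_1, …, s_k, w)`. -/
noncomputable def clearFactor (k : ℕ) (z : Fin (k + 1) → ℂ) : ℂ :=
  ∏ J : Finset (Fin k), (sigmaJ (fun j => z j.castSucc) J (z (Fin.last k)) - 1)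

/-- `A_M` without the term of `d = 1` as a function of `z = (s_1, …, s_k, w)`. -/
noncomputable def starFun (k M : ℕ) (z : Fin (k + 1) → ℂ) : ℂ :=
  starSeries M (fun j => z j.castSucc) (z (Fin.last k))

theorem differentiable_clearFactor (k : ℕ) : Differentiable ℂ (clearFactor k) := by
  intro z
  refine differentiableAt_prod _ fun J _ => ?_
  unfold sigmaJ
  fun_prop

theorem norm_sigmaJ_sub_one_le (z : Fin (k + 1) → ℂ) (J : Finset (Fin k)) :
    ‖sigmaJ (fun j => z j.castSucc) J (z (Fin.last k)) - 1‖ ≤ (k + 2) * (1 + ‖z‖) := by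
  rw [sigmaJ_eq]
  have h1 : ‖∑ j ∈ J, (z j.castSucc - 1 / 2)‖ ≤ k * (‖z‖ + 1) := by
    refine (norm_sum_le _ _).trans ?_
    calc _ ≤ ∑ _j ∈ J, (‖z‖ + 1) := Finset.sum_le_sum fun j _ => by
          refine (norm_sub_le _ _).trans (add_le_add (norm_le_pi_norm z _) ?_)
          norm_num
      _ = J.card * (‖z‖ + 1) := by rw [Finset.sum_const, nsmul_eq_mul]
      _ ≤ k * (‖z‖ + 1) := by
        gcongr
        simpa using J.card_le_univ
  calc _ ≤ ‖z (Fin.last k)‖ + ‖∑ j ∈ J, (z j.castSucc - 1 / 2)‖ + ‖(1 : ℂ)‖ :=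
        (norm_sub_le _ _).trans (add_le_add_left (norm_add_le _ _) _)
    _ ≤ ‖z‖ + k * (‖z‖ + 1) + 1 := by
      rw [norm_one]
      gcongr
      exact norm_le_pi_norm z _
    _ ≤ _ := by nlinarith [norm_nonneg z]

theorem norm_clearFactor_le (z : Fin (k + 1) → ℂ) :
    ‖clearFactor k z‖ ≤ ((k + 2) * (1 + ‖z‖)) ^ 2 ^ k := by
  rw [clearFactor, norm_prod]
  calc _ ≤ ∏ _J : Finset (Fin k), ((k + 2) * (1 + ‖z‖) : ℝ) :=
        Finset.prod_le_prod (fun _ _ => norm_nonneg _) fun J _ => norm_sigmaJ_sub_one_le z J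
    _ = _ := by simp

theorem norm_vert_le {n : ℕ} (σ t : Fin n → ℝ) : ‖vert σ t‖ ≤ ‖σ‖ + ‖t‖ := by
  refine (pi_norm_le_iff_of_nonneg (by positivity)).2 fun j => ?_
  have h1 := norm_le_pi_norm σ j
  have h2 := norm_le_pi_norm t j
  calc ‖vert σ t j‖ ≤ ‖(σ j : ℂ)‖ + ‖(t j : ℂ) * Complex.I‖ := norm_add_le _ _
    _ = ‖σ j‖ + ‖t j‖ := by simp
    _ ≤ _ := add_le_add h1 h2

theorem clearedSeries_eq_of_mem_convRegion (M : ℕ) {z : Fin (k + 1) → ℂ} (hz : z ∈ convRegion k) :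
    clearedSeries k M z = clearFactor k z * starFun k M z := by
  rw [clearedSeries, multiSeries_sub_eq_starSeries M (fun j => hz _) (hz _)]
  rfl

theorem convRegion_eq_tube (k : ℕ) : convRegion k = tube {σ : Fin (k + 1) → ℝ | ∀ i, 1 < σ i} := rfl

theorem isOpen_forall_one_lt (n : ℕ) : IsOpen {σ : Fin n → ℝ | ∀ i, 1 < σ i} := by
  simp only [Set.ofPred_forall]
  exact isOpen_iInter_of_finite fun i => isOpen_lt continuous_const (continuous_apply i)

/-- The series is bounded where it converges absolutely with room to spare, and the clearing factor
is a polynomial. The hypothesis bounds the function over `V` only, so the orthant needs this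
separate argument. -/
theorem tubeGrowth_clearFactor_mul_starFun (k M : ℕ) :
    TubeGrowth {σ : Fin (k + 1) → ℝ | ∀ i, 1 < σ i} fun z => clearFactor k z * starFun k M z := by
  intro σ₀ hσ₀
  obtain ⟨i₀, hi₀⟩ := Finite.exists_min fun i => σ₀ i
  have h1 : 1 < σ₀ i₀ := hσ₀ i₀
  obtain ⟨C, hC⟩ := norm_starSeries_le_conv (k := k) M (a := (1 + σ₀ i₀) / 2)
    (b := (1 + σ₀ i₀) / 2) (by linarith) (by linarith)
  refine ⟨(σ₀ i₀ - 1) / 2, by linarith,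
    ((k + 2) * (1 + ‖σ₀‖ + (σ₀ i₀ - 1) / 2)) ^ 2 ^ k * |C|, 2 ^ k, fun σ hσ _ t => ?_⟩
  have hre : ∀ i, (1 + σ₀ i₀) / 2 ≤ (vert σ t i).re := by
    intro i
    have h2 : |σ i - σ₀ i| < (σ₀ i₀ - 1) / 2 := by
      refine lt_of_le_of_lt ?_ (mem_ball_iff_norm.1 hσ)
      simpa using norm_le_pi_norm (σ - σ₀) i
    have h3 := abs_lt.1 h2
    have h4 := hi₀ i
    simp only [vert_re]
    linarith
  have hσn : ‖σ‖ ≤ ‖σ₀‖ + (σ₀ i₀ - 1) / 2 := by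
    have h4 : ‖σ‖ ≤ ‖σ₀‖ + ‖σ - σ₀‖ := norm_le_norm_add_norm_sub' _ _
    have := mem_ball_iff_norm.1 hσ
    linarith
  have e1 : (1 : ℝ) + ‖vert σ t‖ ≤ (1 + ‖σ₀‖ + (σ₀ i₀ - 1) / 2) * (1 + ‖t‖) := by
    have := norm_vert_le σ t
    nlinarith [norm_nonneg t, mul_nonneg (norm_nonneg t) (norm_nonneg σ₀)]
  rw [norm_mul]
  calc _ ≤ ((k + 2) * ((1 + ‖σ₀‖ + (σ₀ i₀ - 1) / 2) * (1 + ‖t‖))) ^ 2 ^ k * |C| := by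
        gcongr
        · refine (norm_clearFactor_le _).trans ?_
          gcongr
        · exact (hC _ _ (fun j => hre _) (hre _)).trans (le_abs_self C)
    _ = _ := by
      rw [← mul_assoc, mul_pow _ (1 + ‖t‖)]
      ring

/-- The points with `Re s_j > 1/2 - η` and `Re w > 1 - η`. -/
def wedge (k : ℕ) (η : ℝ) : Set (Fin (k + 1) → ℝ) :=
  {σ | (∀ j : Fin k, 1 / 2 - η < σ j.castSucc) ∧ 1 - η < σ (Fin.last k)}

theorem isOpen_wedge (k : ℕ) (η : ℝ) : IsOpen (wedge k η) := by
  have : wedge k η = (⋂ j : Fin k, {σ : Fin (k + 1) → ℝ | 1 / 2 - η < σ j.castSucc}) ∩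
      {σ | 1 - η < σ (Fin.last k)} := by
    ext σ
    simp [wedge]
  rw [this]
  exact (isOpen_iInter_of_finite fun i => isOpen_lt continuous_const (continuous_apply _)).inter
    (isOpen_lt continuous_const (continuous_apply _))

theorem convex_wedge (k : ℕ) (η : ℝ) : Convex ℝ (wedge k η) := by
  have : wedge k η = (⋂ j : Fin k, {σ : Fin (k + 1) → ℝ | 1 / 2 - η < σ j.castSucc}) ∩
      {σ | 1 - η < σ (Fin.last k)} := by
    ext σ
    simp [wedge]
  rw [this]
  exact (convex_iInter fun j : Fin k => convex_halfSpace_gt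
    (LinearMap.proj (R := ℝ) (φ := fun _ : Fin (k + 1) => ℝ) j.castSucc).isLinear _).inter
    (convex_halfSpace_gt (LinearMap.proj (R := ℝ) (φ := fun _ : Fin (k + 1) => ℝ)
      (Fin.last k)).isLinear _)

/-- A point beyond the centre `c` up to `ε/4` in each coordinate lies on a segment from `c - ε/2`,
which is in `V`, to a point of the orthant; `l = ε/(4(1 + ε))` is small enough to send the far end
past `1` everywhere. The cap `1/8` keeps `1/2 - η ≥ 3/8`, inside `diagRegion`. -/
theorem exists_wedge_subset_convexHull {V : Set (Fin (k + 1) → ℝ)} (hV : IsOpen V)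
    (h1 : Fin.snoc (α := fun _ => ℝ) (fun _ : Fin k => (1 / 2 : ℝ)) 1 ∈ V)
    (h2 : {σ : Fin (k + 1) → ℝ | ∀ i, 1 < σ i} ⊆ V) :
    ∃ η > 0, η ≤ 1 / 8 ∧ wedge k η ⊆ convexHull ℝ V := by
  obtain ⟨c, hc⟩ : ∃ c : Fin (k + 1) → ℝ,
    c = Fin.snoc (α := fun _ => ℝ) (fun _ : Fin k => (1 / 2 : ℝ)) 1 := ⟨_, rfl⟩
  rw [← hc] at h1
  have hc2 : ∀ i, 1 / 2 ≤ c i := by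
    intro i
    rw [hc]
    refine Fin.lastCases ?_ (fun j => ?_) i
    · simp; norm_num
    · simp
  obtain ⟨ε, hε, hball⟩ := Metric.isOpen_iff.1 hV c h1
  refine ⟨min (ε / 4) (1 / 8), lt_min (by linarith) (by norm_num), min_le_right _ _, ?_⟩
  intro σ hσ
  have hσi : ∀ i, c i - ε / 4 < σ i := by
    have hm := min_le_left (ε / 4) (1 / 8)
    intro i
    rw [hc]
    refine Fin.lastCases ?_ (fun j => ?_) i
    · have := hσ.2
      simp
      linarith
    · have := hσ.1 j
      simp at this ⊢
      linarith
  obtain ⟨l, hl⟩ : ∃ l : ℝ, l = ε / (4 * (1 + ε)) := ⟨_, rfl⟩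
  have hl0 : 0 < l := by rw [hl]; positivity
  have hl1 : l ≤ 1 / 4 := by
    rw [hl, div_le_div_iff₀ (by positivity) (by positivity)]; linarith
  have hl2 : l ≤ ε / 4 := by
    rw [hl]
    gcongr
    linarith
  have ha : (fun i => c i - ε / 2) ∈ V := by
    apply hball
    rw [mem_ball_iff_norm]
    refine lt_of_le_of_lt ((pi_norm_le_iff_of_nonneg (by linarith : 0 ≤ ε / 2)).2 fun i => ?_)
      (half_lt_self hε)
    simp [abs_of_pos hε]
  have hb : (fun i => (σ i - (1 - l) * (c i - ε / 2)) / l) ∈ V := by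
    apply h2
    intro i
    rw [lt_div_iff₀ hl0]
    have := hσi i
    have := hc2 i
    nlinarith
  have := convex_convexHull ℝ V (subset_convexHull ℝ V ha) (subset_convexHull ℝ V hb)
    (by linarith : 0 ≤ 1 - l) hl0.le (by ring)
  convert this using 1
  funext i
  simp only [Pi.add_apply, Pi.smul_apply, smul_eq_mul]
  field_simp
  ring

theorem TubeGrowth.mono {n : ℕ} {V W : Set (Fin n → ℝ)} {F : (Fin n → ℂ) → ℂ}
    (h : TubeGrowth V F) (hWV : W ⊆ V) : TubeGrowth W F := by
  intro σ₀ hσ₀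
  obtain ⟨r, hr, C, A, hC⟩ := h σ₀ (hWV hσ₀)
  exact ⟨r, hr, C, A, fun σ hσ hσW t => hC σ hσ (hWV hσW) t⟩

/-- The continuation of the cleared series to a full wedge around `(1/2, …, 1/2, 1)`. -/
theorem MDSConjecture.exists_continuation {M : ℕ} (h : MDSConjecture k M) :
    ∃ η > 0, η ≤ 1 / 8 ∧ ∃ G : (Fin (k + 1) → ℂ) → ℂ,
      DifferentiableOn ℂ G (tube (wedge k η)) ∧ TubeGrowth (wedge k η) G ∧
      (∀ z ∈ convRegion k, G z = clearFactor k z * starFun k M z) ∧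
      ∀ z ∈ tube (wedge k η), (k : ℝ) + 1 < (z (Fin.last k)).re →
        G z = clearFactor k z * starFun k M z := by
  classical
  obtain ⟨V, hV, hVc, hcen, hne, F, hF, hFeq, hFb⟩ := h
  obtain ⟨O, hO⟩ : ∃ O : Set (Fin (k + 1) → ℝ), O = {σ | ∀ i, 1 < σ i} := ⟨_, rfl⟩
  have hOo : IsOpen O := hO ▸ isOpen_forall_one_lt _
  have hOconv : Convex ℝ O := by
    rw [hO]
    simp only [Set.ofPred_forall]
    exact convex_iInter fun i => convex_halfSpace_gt
      (LinearMap.proj (R := ℝ) (φ := fun _ : Fin (k + 1) => ℝ) i).isLinear _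
  have htO : tube O = convRegion k := by rw [hO]; rfl
  obtain ⟨z₁, hz₁V, hz₁O⟩ := hne
  -- `V` meets the orthant, so the union is connected; `F` and the series agree on the overlap and
  -- glue to one function on its tube.
  have hUc : IsConnected (V ∪ O) := hVc.union ⟨fun j => (z₁ j).re, hz₁V, by rw [hO]; exact hz₁O⟩
    ⟨⟨fun j => (z₁ j).re, by rw [hO]; exact hz₁O⟩, hOconv.isPreconnected⟩
  obtain ⟨S, hS⟩ : ∃ S : (Fin (k + 1) → ℂ) → ℂ, S = fun z => clearFactor k z * starFun k M z :=
    ⟨_, rfl⟩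
  have hSd : DifferentiableOn ℂ S (convRegion k) := by
    rw [hS]
    exact (differentiable_clearFactor k).differentiableOn.mul (differentiableOn_starSeries_conv k M)
  obtain ⟨F₂, hF₂⟩ : ∃ F₂ : (Fin (k + 1) → ℂ) → ℂ, F₂ = fun z => if z ∈ tube V then F z else S z :=
    ⟨_, rfl⟩
  have hF₂V : ∀ z ∈ tube V, F₂ z = F z := fun z hz => by rw [hF₂]; exact if_pos hz
  have hF₂O : ∀ z ∈ convRegion k, F₂ z = S z := fun z hz => by
    by_cases hzV : z ∈ tube V
    · rw [hF₂V z hzV, hFeq z ⟨hzV, hz⟩, clearedSeries_eq_of_mem_convRegion M hz, hS]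
    · rw [hF₂]; exact if_neg hzV
  have hF₂d : DifferentiableOn ℂ F₂ (tube (V ∪ O)) := by
    rintro z (hz | hz)
    · have hn := (isOpen_tube hV).mem_nhds hz
      refine DifferentiableAt.differentiableWithinAt ?_
      refine (hF.differentiableAt hn).congr_of_eventuallyEq ?_
      filter_upwards [hn] with y hy using hF₂V y hy
    · have hz' : z ∈ convRegion k := by rw [← htO]; exact hz
      have hn := (isOpen_convRegion k).mem_nhds hz'
      refine DifferentiableAt.differentiableWithinAt ?_
      refine (hSd.differentiableAt hn).congr_of_eventuallyEq ?_
      filter_upwards [hn] with y hy using hF₂O y hy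
  have hF₂g : TubeGrowth (V ∪ O) F₂ := by
    rintro σ₀ (hσ₀ | hσ₀)
    · obtain ⟨r, hr, C, A, hC⟩ := hFb.tubeGrowth σ₀ hσ₀
      obtain ⟨ε, hε, hball⟩ := Metric.isOpen_iff.1 hV σ₀ hσ₀
      refine ⟨min r ε, lt_min hr hε, C, A, fun σ hσ _ t => ?_⟩
      have hσV : σ ∈ V := hball (Metric.ball_subset_ball (min_le_right _ _) hσ)
      rw [hF₂V _ (vert_mem_tube.2 hσV)]
      exact hC σ (Metric.ball_subset_ball (min_le_left _ _) hσ) hσV t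
    · have hg := tubeGrowth_clearFactor_mul_starFun k M
      rw [← hO, ← hS] at hg
      obtain ⟨r, hr, C, A, hC⟩ := hg σ₀ hσ₀
      obtain ⟨ε, hε, hball⟩ := Metric.isOpen_iff.1 hOo σ₀ hσ₀
      refine ⟨min r ε, lt_min hr hε, C, A, fun σ hσ _ t => ?_⟩
      have hσO : σ ∈ O := hball (Metric.ball_subset_ball (min_le_right _ _) hσ)
      rw [hF₂O _ (by rw [← htO]; exact vert_mem_tube.2 hσO)]
      exact hC σ (Metric.ball_subset_ball (min_le_left _ _) hσ) hσO t
  obtain ⟨G, hGd, hGe, hGg⟩ := exists_extension_convexHull_tube (hV.union hOo) hUc hF₂d hF₂g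
  obtain ⟨η, hη0, hη8, hsub⟩ := exists_wedge_subset_convexHull (hV.union hOo) (Or.inl hcen)
    (by rw [← hO]; exact Set.subset_union_right)
  have hGO : ∀ z ∈ convRegion k, G z = clearFactor k z * starFun k M z := fun z hz => by
    rw [hGe (show z ∈ tube (V ∪ O) from Or.inr (by rw [← htO] at hz; exact hz)), hF₂O z hz, hS]
  have hGd' : DifferentiableOn ℂ G (tube (wedge k η)) := hGd.mono fun z hz => hsub hz
  refine ⟨η, hη0, hη8, G, hGd', hGg.mono hsub, hGO, fun z hz hzw => ?_⟩
  -- For `Re w > k + 1` the series converges on the whole wedge. The tube over `U` is convex and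
  -- contains the point with all coordinates `k + 2`, near which the equality is known.
  obtain ⟨U, hU⟩ : ∃ U : Set (Fin (k + 1) → ℝ),
    U = wedge k η ∩ {σ | (k : ℝ) + 1 < σ (Fin.last k)} := ⟨_, rfl⟩
  have hUo : IsOpen U := by
    rw [hU]
    exact (isOpen_wedge k η).inter (isOpen_lt continuous_const (continuous_apply _))
  have hUconv : Convex ℝ U := by
    rw [hU]
    exact (convex_wedge k η).inter (convex_halfSpace_gt (LinearMap.proj (R := ℝ)
      (φ := fun _ : Fin (k + 1) => ℝ) (Fin.last k)).isLinear _)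
  have hUw : tube U ⊆ tube (wedge k η) := fun z hz => by
    have : (fun j => (z j).re) ∈ U := hz
    rw [hU] at this
    exact this.1
  have hUs : tube U ⊆ stripRegion k := fun z hz => by
    have h3 : (fun j => (z j).re) ∈ U := hz
    rw [hU] at h3
    refine ⟨fun j => ?_, h3.2⟩
    have := h3.1.1 j
    linarith
  have hp : vert (fun _ : Fin (k + 1) => (k : ℝ) + 2) 0 ∈ tube U := by
    rw [vert_mem_tube, hU]
    have : (0 : ℝ) ≤ k := Nat.cast_nonneg k
    refine ⟨⟨fun j => ?_, ?_⟩, ?_⟩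
    · linarith
    · linarith
    · show (k : ℝ) + 1 < k + 2
      linarith
  refine eqOn_of_convex_of_eventuallyEq (isOpen_tube hUo) (convex_tube hUconv)
    (hGd'.mono hUw) (((differentiable_clearFactor k).differentiableOn).mul
      ((differentiableOn_starSeries_strip k M).mono hUs)) hp ?_
    (show z ∈ tube U by
      show (fun j => (z j).re) ∈ U
      rw [hU]; exact ⟨hz, hzw⟩)
  have hpc : vert (fun _ : Fin (k + 1) => (k : ℝ) + 2) 0 ∈ convRegion k := by
    rw [convRegion_eq_tube, vert_mem_tube]
    intro i
    have : (0 : ℝ) ≤ k := Nat.cast_nonneg k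
    linarith
  filter_upwards [(isOpen_convRegion k).mem_nhds hpc] with y hy using hGO y hy

end TubeContinuation

end QuadraticMoments

namespace QuadraticMoments

open MeasureTheory Filter Topology

/-! ### The cleared series: functional equation and value at `w = 1`. -/

section Continuation

variable {k : ℕ}

/-- The point `(s_1, …, s_k, w)`. -/
def pt (s : Fin k → ℂ) (w : ℂ) : Fin (k + 1) → ℂ := Fin.snoc (α := fun _ => ℂ) s w

@[simp] theorem pt_castSucc (s : Fin k → ℂ) (w : ℂ) (j : Fin k) : pt s w j.castSucc = s j := by
  simp [pt]

@[simp] theorem pt_last (s : Fin k → ℂ) (w : ℂ) : pt s w (Fin.last k) = w := by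
  simp [pt]

theorem differentiable_pt : Differentiable ℂ fun p : (Fin k → ℂ) × ℂ => pt p.1 p.2 := by
  refine differentiable_pi.2 fun i => ?_
  refine Fin.lastCases ?_ (fun j => ?_) i
  · simp only [pt_last]
    fun_prop
  · simp only [pt_castSucc]
    fun_prop

theorem pt_mem_tube_wedge {η : ℝ} {s : Fin k → ℂ} {w : ℂ} :
    pt s w ∈ tube (wedge k η) ↔ (∀ j, 1 / 2 - η < (s j).re) ∧ 1 - η < w.re := by
  simp [tube, wedge]

theorem clearFactor_pt (s : Fin k → ℂ) (w : ℂ) :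
    clearFactor k (pt s w) = ∏ J : Finset (Fin k), (sigmaJ s J w - 1) := by
  simp [clearFactor]

theorem starFun_pt (M : ℕ) (s : Fin k → ℂ) (w : ℂ) : starFun k M (pt s w) = starSeries M s w := by
  simp [starFun]

/-- `G` continues `∏_J (σ_J(w) - 1) ∑_{d ≠ 1} χ_d(M) L(s_1, χ_d) ⋯ L(s_k, χ_d) d^{-w}` to
`Re s_j > 1/2 - η`, `Re w > 1 - η`, with polynomial growth. -/
structure IsClearedContinuation (k M : ℕ) (η : ℝ) (G : (Fin (k + 1) → ℂ) → ℂ) : Prop where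
  pos : 0 < η
  le : η ≤ 1 / 8
  differentiableOn : DifferentiableOn ℂ G (tube (wedge k η))
  growth : TubeGrowth (wedge k η) G
  eq_conv : ∀ (s : Fin k → ℂ) (w : ℂ), (∀ j, 1 < (s j).re) → 1 < w.re →
    G (pt s w) = (∏ J : Finset (Fin k), (sigmaJ s J w - 1)) * starSeries M s w
  eq_strip : ∀ (s : Fin k → ℂ) (w : ℂ), (∀ j, 1 / 2 - η < (s j).re) → (k : ℝ) + 1 < w.re →
    G (pt s w) = (∏ J : Finset (Fin k), (sigmaJ s J w - 1)) * starSeries M s w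

theorem MDSConjecture.exists_isClearedContinuation {M : ℕ} (h : MDSConjecture k M) :
    ∃ η G, IsClearedContinuation k M η G := by
  obtain ⟨η, h0, h8, G, hd, hg, hc, hs⟩ := h.exists_continuation
  refine ⟨η, G, h0, h8, hd, hg, fun s w h1 h2 => ?_, fun s w h1 h2 => ?_⟩
  · rw [hc _ fun i => Fin.lastCases (by simpa using h2) (fun j => by simpa using h1 j) i,
      clearFactor_pt, starFun_pt]
  · have : (0 : ℝ) ≤ k := Nat.cast_nonneg k
    rw [hs _ (pt_mem_tube_wedge.2 ⟨h1, by linarith⟩) (by simpa using h2), clearFactor_pt, starFun_pt]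

theorem reflect_sub_half (s : Fin k → ℂ) (J : Finset (Fin k)) (j : Fin k) :
    reflect s J j - 1 / 2 = if j ∈ J then -(s j - 1 / 2) else s j - 1 / 2 := by
  unfold reflect
  split_ifs <;> ring

/-- Reflection in `J` changes the sign of `s_j - 1/2` for `j ∈ J`. Terms over `J ∩ J'` cancel, so
the reflections act on the indices of the polar hyperplanes by symmetric difference. -/
theorem sigmaJ_reflect (s : Fin k → ℂ) (J J' : Finset (Fin k)) (w : ℂ) :
    sigmaJ (reflect s J) J' (sigmaJ s J w) = sigmaJ s (symmDiff J J') w := by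
  simp only [sigmaJ_eq, reflect_sub_half]
  rw [add_assoc]
  congr 1
  rw [← Finset.sum_ite_mem_eq J, ← Finset.sum_ite_mem_eq J', ← Finset.sum_ite_mem_eq (symmDiff J J'),
    ← Finset.sum_add_distrib]
  refine Finset.sum_congr rfl fun j _ => ?_
  by_cases h1 : j ∈ J <;> by_cases h2 : j ∈ J' <;> simp [h1, h2, Finset.mem_symmDiff]

/-- The reflection permutes the polar factors, so clearing the poles does not disturb the functional
equation. -/
theorem prod_sigmaJ_reflect (s : Fin k → ℂ) (J : Finset (Fin k)) (w : ℂ) :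
    ∏ J' : Finset (Fin k), (sigmaJ (reflect s J) J' (sigmaJ s J w) - 1) =
      ∏ J' : Finset (Fin k), (sigmaJ s J' w - 1) := by
  refine Fintype.prod_equiv (Function.Involutive.toPerm (fun J' => symmDiff J J')
    fun J' => symmDiff_symmDiff_cancel_left J J') _ _ fun J' => ?_
  rw [sigmaJ_reflect]
  rfl

theorem IsClearedContinuation.differentiableAt_pt {M : ℕ} {η : ℝ} {G : (Fin (k + 1) → ℂ) → ℂ}
    (hG : IsClearedContinuation k M η G) {s : Fin k → ℂ} {w : ℂ} (hs : ∀ j, 1 / 2 - η < (s j).re)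
    (hw : 1 - η < w.re) :
    DifferentiableAt ℂ (fun p : (Fin k → ℂ) × ℂ => G (pt p.1 p.2)) (s, w) :=
  DifferentiableAt.comp (s, w) (hG.differentiableOn.differentiableAt
    ((isOpen_tube (isOpen_wedge k η)).mem_nhds (pt_mem_tube_wedge.2 ⟨hs, hw⟩)))
    (differentiable_pt (s, w))

theorem sigmaJ_re (s : Fin k → ℂ) (J : Finset (Fin k)) (w : ℂ) :
    (sigmaJ s J w).re = w.re + ∑ j ∈ J, ((s j).re - 1 / 2) := by
  rw [sigmaJ_eq, Complex.add_re, Complex.re_sum]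
  congr 1
  refine Finset.sum_congr rfl fun j _ => ?_
  norm_num

/-- The functional equation of the continued series. -/
theorem IsClearedContinuation.reflect {M : ℕ} {η : ℝ} {G : (Fin (k + 1) → ℂ) → ℂ}
    (hG : IsClearedContinuation k M η G) {s : Fin k → ℂ} (hs : ∀ j, |(s j).re - 1 / 2| < η)
    (J : Finset (Fin k)) {w : ℂ} (hw : 1 - η < w.re) (hw' : 1 - η < (sigmaJ s J w).re) :
    G (pt s w) = (∏ j ∈ J, gammaRatio (s j)) *
      G (pt (QuadraticMoments.reflect s J) (sigmaJ s J w)) := by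
  have hη := hG.le
  have hs1 : ∀ j, 1 / 2 - η < (s j).re := fun j => by linarith [(abs_lt.1 (hs j)).1]
  have hs2 : ∀ j, 1 / 2 - η < (QuadraticMoments.reflect s J j).re := fun j => by
    unfold QuadraticMoments.reflect
    split_ifs
    · simp only [Complex.sub_re, Complex.one_re]
      linarith [(abs_lt.1 (hs j)).2]
    · exact hs1 j
  obtain ⟨c, hc⟩ : ∃ c : ℝ, c = ∑ j ∈ J, ((s j).re - 1 / 2) := ⟨_, rfl⟩
  have hre : ∀ u, (sigmaJ s J u).re = u.re + c := fun u => by rw [sigmaJ_re, hc]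
  -- `U` is the half-plane of `u` for which both sides are defined. Far to the right both are given
  -- by the series, where the functional equation holds term by term; the identity theorem carries
  -- it to `w`.
  obtain ⟨U, hU⟩ : ∃ U : Set ℂ, U = {u : ℂ | 1 - η < u.re} ∩ {u : ℂ | 1 - η - c < u.re} := ⟨_, rfl⟩
  have hUo : IsOpen U := by
    rw [hU]
    exact (isOpen_lt continuous_const Complex.continuous_re).inter
      (isOpen_lt continuous_const Complex.continuous_re)
  have hUc : Convex ℝ U := by
    rw [hU]
    exact (convex_halfSpace_re_gt _).inter (convex_halfSpace_re_gt _)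
  have hsd : Differentiable ℂ fun u => sigmaJ s J u := by
    unfold sigmaJ
    fun_prop
  have hU1 : ∀ u ∈ U, 1 - η < u.re ∧ 1 - η < (sigmaJ s J u).re := fun u hu => by
    rw [hU] at hu
    refine ⟨hu.1, ?_⟩
    rw [hre]
    have : 1 - η - c < u.re := hu.2
    linarith
  have hx : (((k : ℝ) + 2 + |c| : ℝ) : ℂ) ∈ U := by
    have : (0 : ℝ) ≤ k := Nat.cast_nonneg k
    have := neg_abs_le c
    have := hG.pos
    rw [hU]
    constructor
    · show 1 - η < (((k : ℝ) + 2 + |c| : ℝ) : ℂ).re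
      rw [Complex.ofReal_re]; linarith [abs_nonneg c]
    · show 1 - η - c < (((k : ℝ) + 2 + |c| : ℝ) : ℂ).re
      rw [Complex.ofReal_re]; linarith
  refine eqOn_of_convex_of_eventuallyEq (f := fun u => G (pt s u))
    (g := fun u => (∏ j ∈ J, gammaRatio (s j)) *
      G (pt (QuadraticMoments.reflect s J) (sigmaJ s J u))) hUo hUc ?_ ?_ hx ?_ (x := w) ?_
  · intro u hu
    refine DifferentiableAt.differentiableWithinAt ?_
    exact DifferentiableAt.comp (f := fun u : ℂ => (s, u))
      (g := fun p : (Fin k → ℂ) × ℂ => G (pt p.1 p.2)) u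
      (hG.differentiableAt_pt hs1 (hU1 u hu).1) (by fun_prop)
  · intro u hu
    refine DifferentiableAt.differentiableWithinAt (DifferentiableAt.const_mul ?_ _)
    exact DifferentiableAt.comp (f := fun u : ℂ => (QuadraticMoments.reflect s J, sigmaJ s J u))
      (g := fun p : (Fin k → ℂ) × ℂ => G (pt p.1 p.2)) u
      (hG.differentiableAt_pt hs2 (hU1 u hu).2) ((differentiableAt_const _).prodMk (hsd u))
  · have ho : IsOpen {u : ℂ | (k : ℝ) + 1 + |c| < u.re} :=
      isOpen_lt continuous_const Complex.continuous_re
    filter_upwards [ho.mem_nhds (show (((k : ℝ) + 2 + |c| : ℝ) : ℂ) ∈ _ by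
      show (k : ℝ) + 1 + |c| < (((k : ℝ) + 2 + |c| : ℝ) : ℂ).re
      rw [Complex.ofReal_re]; linarith)] with u hu
    have hu : (k : ℝ) + 1 + |c| < u.re := hu
    have := neg_abs_le c
    rw [hG.eq_strip s u hs1 (by linarith [abs_nonneg c]), hG.eq_strip _ _ hs2 (by rw [hre]; linarith),
      prod_sigmaJ_reflect, starSeries_reflect M (fun j => ?_) J u]
    · ring
    · have := abs_lt.1 (hs j)
      constructor <;> linarith
  · rw [hU]
    refine ⟨hw, ?_⟩
    rw [hre] at hw'
    show 1 - η - c < w.re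
    linarith

/-- `1 + |J|/2 - ∑_J s_j`, the solution of `σ_J(w) = 1`. -/
noncomputable def poleAt (s : Fin k → ℂ) (J : Finset (Fin k)) : ℂ :=
  1 + (J.card : ℂ) / 2 - ∑ j ∈ J, s j

theorem sigmaJ_poleAt (s : Fin k → ℂ) (J : Finset (Fin k)) : sigmaJ s J (poleAt s J) = 1 := by
  unfold sigmaJ poleAt
  ring

theorem sigmaJ_sub_one (s : Fin k → ℂ) (J : Finset (Fin k)) (w : ℂ) :
    sigmaJ s J w - 1 = w - poleAt s J := by
  unfold sigmaJ poleAt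
  ring

theorem poleAt_re (s : Fin k → ℂ) (J : Finset (Fin k)) :
    (poleAt s J).re = 1 - ∑ j ∈ J, ((s j).re - 1 / 2) := by
  have h := sigmaJ_re s J (poleAt s J)
  rw [sigmaJ_poleAt, Complex.one_re] at h
  linarith

theorem abs_poleAt_re_sub_one_le {ε : ℝ} {s : Fin k → ℂ} (hs : ∀ j, |(s j).re - 1 / 2| ≤ ε)
    (hε : 0 ≤ ε) (J : Finset (Fin k)) : |(poleAt s J).re - 1| ≤ k * ε := by
  rw [poleAt_re, sub_sub_cancel_left, abs_neg]
  refine (Finset.abs_sum_le_sum_abs _ _).trans ((Finset.sum_le_sum fun j _ => hs j).trans ?_)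
  rw [Finset.sum_const, nsmul_eq_mul]
  gcongr
  simpa using J.card_le_univ

/-- `∏_{J ≠ ∅} ∑_{j ∈ J} (s_j - 1/2)`. -/
noncomputable def subsetSumProd (s : Fin k → ℂ) : ℂ :=
  ∏ J ∈ (Finset.univ : Finset (Finset (Fin k))).erase ∅, (sigmaJ s J 1 - 1)

/-- `w_J - w_{J'}` is `σ_{J'}(w_J) - 1`, which after reflection in `J` becomes a factor at `w = 1`
indexed by the symmetric difference of `J` and `J'`. The denominator of the residue at `w_J` is thus
that of the residue at `1`, taken at the reflected point. -/
theorem prod_erase_poleAt_sub (s : Fin k → ℂ) (J : Finset (Fin k)) :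
    ∏ J' ∈ Finset.univ.erase J, (poleAt s J - poleAt s J') = subsetSumProd (reflect s J) := by
  refine Finset.prod_bij (fun J' _ => symmDiff J J') (fun J' h => ?_) (fun J₁ _ J₂ _ h => ?_)
    (fun J' h => ⟨symmDiff J J', ?_, symmDiff_symmDiff_cancel_left J J'⟩) fun J' h => ?_
  · simp only [Finset.mem_erase, Finset.mem_univ, and_true] at h ⊢
    exact fun h0 => h (symmDiff_eq_bot.1 h0).symm
  · have := congrArg (symmDiff J) h
    simpa only [symmDiff_symmDiff_cancel_left] using this
  · simp only [Finset.mem_erase, Finset.mem_univ, and_true] at h ⊢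
    exact fun h0 => h (symmDiff_eq_left.1 h0)
  · have := sigmaJ_reflect s J (symmDiff J J') (poleAt s J)
    rw [sigmaJ_poleAt, symmDiff_symmDiff_cancel_left] at this
    rw [this, sigmaJ_sub_one]

theorem differentiable_subsetSumProd : Differentiable ℂ (subsetSumProd (k := k)) := by
  intro s
  refine differentiableAt_prod _ fun J _ => ?_
  unfold sigmaJ
  fun_prop

theorem differentiable_polarFactor : Differentiable ℂ (polarFactor (k := k)) := by
  intro s
  refine differentiableAt_prod _ fun i _ => differentiableAt_prod _ fun j _ => ?_
  fun_prop

/-- The polar part of the continued series at `w = 1`. -/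
theorem IsClearedContinuation.apply_one {M : ℕ} (hM : M ≠ 0) {η : ℝ} {G : (Fin (k + 1) → ℂ) → ℂ}
    (hG : IsClearedContinuation k M η G) {s : Fin k → ℂ} (hs : ∀ j, 1 < (s j).re) :
    G (pt s 1) = subsetSumProd s * diagSeries M s := by
  have hη := hG.le
  have hη0 := hG.pos
  have hc : ContinuousAt (fun w : ℝ => G (pt s w)) 1 := by
    have h1 : ContinuousAt (fun p : (Fin k → ℂ) × ℂ => G (pt p.1 p.2)) (s, ((1 : ℝ) : ℂ)) :=
      (hG.differentiableAt_pt (s := s) (w := ((1 : ℝ) : ℂ)) (fun j => by linarith [hs j])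
        (by simpa using hη0)).continuousAt
    exact ContinuousAt.comp (f := fun w : ℝ => (s, (w : ℂ))) h1 (by fun_prop)
  have h1 : Tendsto (fun w : ℝ => G (pt s w)) (𝓝[>] 1) (𝓝 (G (pt s 1))) := by
    have := hc.tendsto.mono_left (nhdsWithin_le_nhds (s := Set.Ioi 1))
    simpa using this
  -- The factor of `J = ∅` is `w - 1`; it is paired with the series to form the residue, and the
  -- other factors are continuous.
  have h2 : Tendsto (fun w : ℝ => (∏ J ∈ (Finset.univ : Finset (Finset (Fin k))).erase ∅,
      (sigmaJ s J w - 1)) * (((w : ℂ) - 1) * starSeries M s w)) (𝓝[>] 1)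
      (𝓝 (subsetSumProd s * diagSeries M s)) := by
    refine Tendsto.mul ?_ (tendsto_sub_mul_starSeries hM hs)
    refine tendsto_finsetProd _ fun J _ => ?_
    have : Continuous fun w : ℝ => sigmaJ s J w - 1 := by
      unfold sigmaJ
      fun_prop
    have h3 := (this.tendsto 1).mono_left (nhdsWithin_le_nhds (s := Set.Ioi 1))
    simpa using h3
  refine tendsto_nhds_unique h1 (h2.congr' ?_)
  filter_upwards [self_mem_nhdsWithin] with w hw
  have hw : 1 < w := hw
  rw [hG.eq_conv s w hs (by simpa using hw), ← Finset.mul_prod_erase _ _ (Finset.mem_univ ∅)]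
  have : sigmaJ s ∅ (w : ℂ) = w := by simp [sigmaJ]
  rw [this]
  ring

/-- Both sides are holomorphic for `Re s_j > 1/2 - η` and agree for `Re s_j > 1`, where the residue
is the diagonal series. Multiplying by `polarFactor` avoids poles in the region of comparison. -/
theorem IsClearedContinuation.apply_one_mul_polarFactor {M : ℕ} (hM : M ≠ 0) {η : ℝ}
    {G : (Fin (k + 1) → ℂ) → ℂ} (hG : IsClearedContinuation k M η G) {D : (Fin k → ℂ) → ℂ}
    (hD : DifferentiableOn ℂ D (diagRegion k))
    (hDe : ∀ s, (∀ j, 1 < (s j).re) → diagSeries M s * polarFactor s = D s)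
    {s : Fin k → ℂ} (hs : ∀ j, 1 / 2 - η < (s j).re) :
    G (pt s 1) * polarFactor s = subsetSumProd s * D s := by
  have hη := hG.le
  have hη0 := hG.pos
  obtain ⟨U, hU⟩ : ∃ U : Set (Fin k → ℂ), U = {s | ∀ j, 1 / 2 - η < (s j).re} := ⟨_, rfl⟩
  have hUt : U = tube {σ : Fin k → ℝ | ∀ j, 1 / 2 - η < σ j} := hU
  have hUo : IsOpen U := by
    rw [hUt]
    refine isOpen_tube ?_
    simp only [Set.ofPred_forall]
    exact isOpen_iInter_of_finite fun i => isOpen_lt continuous_const (continuous_apply i)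
  have hUc : Convex ℝ U := by
    rw [hUt]
    refine convex_tube ?_
    simp only [Set.ofPred_forall]
    exact convex_iInter fun i => convex_halfSpace_gt
      (LinearMap.proj (R := ℝ) (φ := fun _ : Fin k => ℝ) i).isLinear _
  have hmem : ∀ y ∈ U, ∀ j, 1 / 2 - η < (y j).re := fun y hy => by rw [hU] at hy; exact hy
  have hx : (fun _ : Fin k => (2 : ℂ)) ∈ U := by
    rw [hU]
    intro j
    simp only [Complex.re_ofNat]
    linarith
  have ho : IsOpen {s : Fin k → ℂ | ∀ j, 1 < (s j).re} := by
    refine isOpen_tube (V := {σ : Fin k → ℝ | ∀ j, 1 < σ j}) (isOpen_forall_one_lt k)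
  refine eqOn_of_convex_of_eventuallyEq (f := fun s => G (pt s 1) * polarFactor s)
    (g := fun s => subsetSumProd s * D s) hUo hUc ?_ ?_ hx ?_ (x := s) (by rw [hU]; exact hs)
  · intro y hy
    refine DifferentiableAt.differentiableWithinAt (DifferentiableAt.mul ?_
      (differentiable_polarFactor y))
    exact DifferentiableAt.comp (f := fun y : Fin k → ℂ => (y, (1 : ℂ)))
      (g := fun p : (Fin k → ℂ) × ℂ => G (pt p.1 p.2)) y
      (hG.differentiableAt_pt (hmem y hy) (by simpa using hη0)) (by fun_prop)
  · refine differentiable_subsetSumProd.differentiableOn.mul (hD.mono fun y hy j => ?_)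
    have := hmem y hy j
    linarith
  · filter_upwards [ho.mem_nhds (fun j => by norm_num : (fun _ : Fin k => (2 : ℂ)) ∈ _)] with y hy
    rw [hG.apply_one hM hy, mul_assoc, hDe y hy]

end Continuation

end QuadraticMoments

namespace QuadraticMoments

open MeasureTheory Filter Topology

/-! ### The line integrals as holomorphic functions of the shifts. -/

section RecipeFunction

theorem TubeGrowth.exists_bound_of_isCompact {n : ℕ} {V : Set (Fin n → ℝ)} {F : (Fin n → ℂ) → ℂ}
    (h : TubeGrowth V F) {K : Set (Fin n → ℝ)} (hK : IsCompact K) (hKV : K ⊆ V) :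
    ∃ C : ℝ, 0 ≤ C ∧ ∃ A : ℕ, ∀ σ ∈ K, ∀ t : Fin n → ℝ, ‖F (vert σ t)‖ ≤ C * (1 + ‖t‖) ^ A := by
  refine hK.induction_on (p := fun S => ∃ C : ℝ, 0 ≤ C ∧ ∃ A : ℕ, ∀ σ ∈ S, ∀ t : Fin n → ℝ,
    ‖F (vert σ t)‖ ≤ C * (1 + ‖t‖) ^ A) ⟨0, le_rfl, 0, fun σ hσ => absurd hσ (Set.notMem_empty σ)⟩
    ?_ ?_ ?_
  · rintro S T hST ⟨C, hC, A, hb⟩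
    exact ⟨C, hC, A, fun σ hσ => hb σ (hST hσ)⟩
  · rintro S T ⟨C, hC, A, hb⟩ ⟨C', hC', A', hb'⟩
    refine ⟨C + C', by positivity, max A A', fun σ hσ t => ?_⟩
    have h1t : 1 ≤ 1 + ‖t‖ := by linarith [norm_nonneg t]
    rcases hσ with hσ | hσ
    · refine (hb σ hσ t).trans ?_
      gcongr
      · linarith
      · exact le_max_left _ _
    · refine (hb' σ hσ t).trans ?_
      gcongr
      · linarith
      · exact le_max_right _ _
  · intro σ₀ hσ₀
    obtain ⟨r, hr, C, A, hb⟩ := h σ₀ (hKV hσ₀)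
    refine ⟨Metric.ball σ₀ r ∩ K, Filter.inter_mem
      (mem_nhdsWithin_of_mem_nhds (Metric.ball_mem_nhds σ₀ hr)) self_mem_nhdsWithin,
      |C|, abs_nonneg C, A, fun σ hσ t => (hb σ hσ.1 (hKV hσ.2) t).trans ?_⟩
    gcongr
    exact le_abs_self C

variable {k M : ℕ} {η : ℝ} {G : (Fin (k + 1) → ℂ) → ℂ}

theorem IsClearedContinuation.exists_norm_le (hG : IsClearedContinuation k M η G) {ε b c : ℝ}
    (hε : ε < η) (hb : 1 - η < b) : ∃ C : ℝ, 0 ≤ C ∧ ∃ A : ℕ, ∀ (s : Fin k → ℂ) (w : ℂ),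
      (∀ j, |(s j).re - 1 / 2| ≤ ε) → b ≤ w.re → w.re ≤ c →
      ‖G (pt s w)‖ ≤ C * (1 + ‖s‖) ^ A * (1 + |w.im|) ^ A := by
  obtain ⟨lo, hlo⟩ : ∃ lo : Fin (k + 1) → ℝ,
    lo = Fin.snoc (α := fun _ => ℝ) (fun _ : Fin k => (1 / 2 - ε : ℝ)) b := ⟨_, rfl⟩
  obtain ⟨hi, hhi⟩ : ∃ hi : Fin (k + 1) → ℝ,
    hi = Fin.snoc (α := fun _ => ℝ) (fun _ : Fin k => (1 / 2 + ε : ℝ)) c := ⟨_, rfl⟩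
  obtain ⟨C, hC, A, hCA⟩ := hG.growth.exists_bound_of_isCompact (isCompact_Icc (a := lo) (b := hi))
    (fun σ hσ => by
      constructor
      · intro j
        have := hσ.1 j.castSucc
        rw [hlo] at this
        simp only [Fin.snoc_castSucc] at this
        linarith
      · have := hσ.1 (Fin.last k)
        rw [hlo] at this
        simp only [Fin.snoc_last] at this
        linarith)
  refine ⟨C, hC, A, fun s w hs hw1 hw2 => ?_⟩
  have h1 := hCA (fun i => (pt s w i).re) ⟨fun i => ?_, fun i => ?_⟩ fun i => (pt s w i).im
  · rw [vert_re_im] at h1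
    refine h1.trans ?_
    rw [mul_assoc, ← mul_pow]
    gcongr
    have h2 : ‖fun i => (pt s w i).im‖ ≤ ‖s‖ + |w.im| := by
      refine (pi_norm_le_iff_of_nonneg (by positivity)).2 fun i => ?_
      refine Fin.lastCases ?_ (fun j => ?_) i
      · simp
      · simp only [pt_castSucc, Real.norm_eq_abs]
        have h3 := Complex.abs_im_le_norm (s j)
        have h4 := norm_le_pi_norm s j
        have := abs_nonneg w.im
        linarith
    nlinarith [norm_nonneg s, abs_nonneg w.im, mul_nonneg (norm_nonneg s) (abs_nonneg w.im)]
  · rw [hlo]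
    refine Fin.lastCases ?_ (fun j => ?_) i
    · simpa using hw1
    · have := (abs_le.1 (hs j)).1
      simp only [Fin.snoc_castSucc, pt_castSucc]
      linarith
  · rw [hhi]
    refine Fin.lastCases ?_ (fun j => ?_) i
    · simpa using hw2
    · have := (abs_le.1 (hs j)).2
      simp only [Fin.snoc_castSucc, pt_castSucc]
      linarith

theorem IsClearedContinuation.exists_norm_mul_mellin_le (hG : IsClearedContinuation k M η G)
    {g : ℝ → ℂ} (hg : ContDiff ℝ ∞ g) (hc : HasCompactSupport g) {ε b c : ℝ} (hε : ε < η)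
    (hb : 1 - η < b) : ∃ C : ℝ, 0 ≤ C ∧ ∃ A : ℕ, ∀ (s : Fin k → ℂ) (w : ℂ),
      (∀ j, |(s j).re - 1 / 2| ≤ ε) → b ≤ w.re → w.re ≤ c →
      ‖G (pt s w) * mellin g w‖ ≤ C * (1 + ‖s‖) ^ A * (1 + w.im ^ 2)⁻¹ := by
  obtain ⟨C, hC, A, hCA⟩ := hG.exists_norm_le (c := c) hε hb
  -- `A` powers compensate the growth of `G`, and two more leave the integrable decay.
  obtain ⟨D, hD⟩ := exists_norm_mellin_mul_pow_le (A + 2) hg hc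
    (show 0 < b by linarith [hG.le]) c
  refine ⟨C * |D|, by positivity, A, fun s w hs h1 h2 => ?_⟩
  have e1 := hCA s w hs h1 h2
  have e2 := (hD w h1 h2).trans (le_abs_self D)
  rw [norm_mul]
  have e3 : 1 + w.im ^ 2 ≤ (1 + |w.im|) ^ 2 := by
    nlinarith [sq_abs w.im, abs_nonneg w.im]
  rw [← div_eq_mul_inv, le_div_iff₀ (by positivity)]
  calc ‖G (pt s w)‖ * ‖mellin g w‖ * (1 + w.im ^ 2)
      ≤ (C * (1 + ‖s‖) ^ A * (1 + |w.im|) ^ A) * ‖mellin g w‖ * (1 + |w.im|) ^ 2 := by gcongr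
    _ = C * (1 + ‖s‖) ^ A * (‖mellin g w‖ * (1 + |w.im|) ^ (A + 2)) := by ring
    _ ≤ C * (1 + ‖s‖) ^ A * |D| := by gcongr
    _ = _ := by ring

/-- The integrand `G(s, w) g̃(w) X^w / ∏_J (w - w_J)` of the contour integrals. -/
noncomputable def contourTerm (G : (Fin (k + 1) → ℂ) → ℂ) (g : ℝ → ℂ) (X : ℝ) (s : Fin k → ℂ)
    (w : ℂ) : ℂ :=
  G (pt s w) * mellin g w * (X : ℂ) ^ w / ∏ J : Finset (Fin k), (w - poleAt s J)

/-- The integral of `contourTerm` over the line `Re w = x`. -/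
noncomputable def contourIntegral (G : (Fin (k + 1) → ℂ) → ℂ) (g : ℝ → ℂ) (X : ℝ) (x : ℝ)
    (s : Fin k → ℂ) : ℂ :=
  ∫ t : ℝ, contourTerm G g X s (x + t * Complex.I)

theorem pow_le_norm_prod_sub_poleAt {ρ : ℝ} (hρ : 0 ≤ ρ) {s : Fin k → ℂ} {w : ℂ}
    (h : ∀ J, ρ ≤ |w.re - (poleAt s J).re|) :
    ρ ^ 2 ^ k ≤ ‖∏ J : Finset (Fin k), (w - poleAt s J)‖ := by
  rw [norm_prod]
  calc ρ ^ 2 ^ k = ∏ _J : Finset (Fin k), ρ := by simp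
    _ ≤ _ := Finset.prod_le_prod (fun _ _ => hρ) fun J _ => (h J).trans (by
      simpa using Complex.abs_re_le_norm (w - poleAt s J))

/-- `ρ` is the distance of the line from the poles. The bound is uniform in `s` apart from an
explicit power, and explicit in `X`, so it serves both the holomorphy of the integral and the final
error term. -/
theorem IsClearedContinuation.exists_norm_contourTerm_le (hG : IsClearedContinuation k M η G)
    {g : ℝ → ℂ} (hg : ContDiff ℝ ∞ g) (hc : HasCompactSupport g) {ε x ρ : ℝ} (hε : ε < η)
    (hx : 1 - η < x) (hρ : 0 < ρ) : ∃ C : ℝ, 0 ≤ C ∧ ∃ A : ℕ, ∀ (X : ℝ), 0 < X →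
      ∀ s : Fin k → ℂ, (∀ j, |(s j).re - 1 / 2| ≤ ε) → (∀ J, ρ ≤ |x - (poleAt s J).re|) →
      ∀ t : ℝ, ‖contourTerm G g X s (x + t * Complex.I)‖ ≤
        C * (1 + ‖s‖) ^ A * X ^ x * (1 + t ^ 2)⁻¹ := by
  obtain ⟨C, hC, A, hCA⟩ := hG.exists_norm_mul_mellin_le (c := x) hg hc hε hx
  refine ⟨C * (ρ ^ 2 ^ k)⁻¹, by positivity, A, fun X hX s hs hJ t => ?_⟩
  have e1 := hCA s (x + t * Complex.I) hs (by simp) (by simp)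
  have e2 := pow_le_norm_prod_sub_poleAt hρ.le (s := s) (w := x + t * Complex.I)
    (fun J => by simpa using hJ J)
  have hρk : 0 < ρ ^ 2 ^ k := by positivity
  have him : ((x : ℂ) + t * Complex.I).im = t := by simp
  rw [him] at e1
  rw [contourTerm, norm_div, norm_mul, Complex.norm_cpow_eq_rpow_re_of_pos hX, div_eq_mul_inv]
  have hre : ((x : ℂ) + t * Complex.I).re = x := by simp
  rw [hre]
  calc _ ≤ (C * (1 + ‖s‖) ^ A * (1 + t ^ 2)⁻¹) * X ^ x * (ρ ^ 2 ^ k)⁻¹ := by gcongr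
    _ = _ := by ring

theorem continuous_contourTerm (hG : IsClearedContinuation k M η G)
    {g : ℝ → ℂ} (hg : ContDiff ℝ ∞ g) (hc : HasCompactSupport g) {x X : ℝ} (hX : 0 < X)
    (hx : 1 - η < x) {s : Fin k → ℂ} (hs : ∀ j, 1 / 2 - η < (s j).re)
    (hJ : ∀ J, x ≠ (poleAt s J).re) :
    Continuous fun t : ℝ => contourTerm G g X s (x + t * Complex.I) := by
  have hη := hG.le
  have hline : Continuous fun t : ℝ => (x : ℂ) + t * Complex.I := by fun_prop
  unfold contourTerm
  refine Continuous.div (Continuous.mul (Continuous.mul ?_ ?_) ?_) ?_ fun t => ?_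
  · rw [continuous_iff_continuousAt]
    intro t
    have h1 : ContinuousAt (fun p : (Fin k → ℂ) × ℂ => G (pt p.1 p.2)) (s, x + t * Complex.I) :=
      (hG.differentiableAt_pt hs (by simpa using hx)).continuousAt
    exact ContinuousAt.comp (f := fun t : ℝ => (s, (x : ℂ) + t * Complex.I)) h1 (by fun_prop)
  · rw [continuous_iff_continuousAt]
    intro t
    exact ContinuousAt.comp (g := mellin g) (f := fun t : ℝ => (x : ℂ) + t * Complex.I)
      (differentiableAt_mellin_of_hasCompactSupport hg.continuous hc (by
        simp; linarith)).continuousAt hline.continuousAt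
  · exact hline.const_cpow (Or.inl (by exact_mod_cast hX.ne'))
  · fun_prop
  · refine Finset.prod_ne_zero_iff.2 fun J _ h => hJ J ?_
    simpa using congrArg Complex.re (sub_eq_zero.1 h)

theorem isOpen_halfStrip (k : ℕ) (ε : ℝ) : IsOpen {s : Fin k → ℂ | ∀ j, |(s j).re - 1 / 2| < ε} := by
  simp only [Set.ofPred_forall]
  exact isOpen_iInter_of_finite fun j => isOpen_lt (by fun_prop) continuous_const

theorem differentiableOn_contourIntegral (hG : IsClearedContinuation k M η G)
    {g : ℝ → ℂ} (hg : ContDiff ℝ ∞ g) (hc : HasCompactSupport g) {ε x X ρ : ℝ} (hX : 0 < X)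
    (hε : ε < η) (hx : 1 - η < x) (hρ : 0 < ρ)
    (hJ : ∀ s : Fin k → ℂ, (∀ j, |(s j).re - 1 / 2| < ε) → ∀ J, ρ ≤ |x - (poleAt s J).re|) :
    DifferentiableOn ℂ (contourIntegral G g X x) {s | ∀ j, |(s j).re - 1 / 2| < ε} := by
  have hJne : ∀ s : Fin k → ℂ, (∀ j, |(s j).re - 1 / 2| < ε) → ∀ J, x ≠ (poleAt s J).re :=
    fun s hs J h => by
      have := hJ s hs J
      rw [h] at this
      simp at this
      linarith
  have hs' : ∀ s : Fin k → ℂ, (∀ j, |(s j).re - 1 / 2| < ε) → ∀ j, 1 / 2 - η < (s j).re :=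
    fun s hs j => by linarith [(abs_lt.1 (hs j)).1]
  obtain ⟨C, hC, A, hCA⟩ := hG.exists_norm_contourTerm_le hg hc hε hx hρ
  refine differentiableOn_integral_of_locally_dominated (isOpen_halfStrip k ε)
    (fun s hs => (continuous_contourTerm hG hg hc hX hx (hs' s hs)
      (hJne s hs)).aestronglyMeasurable) (fun t => ?_) fun s₀ _ => ?_
  · intro s hs
    refine DifferentiableAt.differentiableWithinAt ?_
    unfold contourTerm
    simp only [div_eq_mul_inv]
    have hne : (∏ J : Finset (Fin k), ((x : ℂ) + t * Complex.I - poleAt s J)) ≠ 0 := by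
      refine Finset.prod_ne_zero_iff.2 fun J _ h => hJne s hs J ?_
      simpa using congrArg Complex.re (sub_eq_zero.1 h)
    refine DifferentiableAt.mul (DifferentiableAt.mul (DifferentiableAt.mul ?_
      (differentiableAt_const _)) (differentiableAt_const _)) ?_
    · exact DifferentiableAt.comp (f := fun y : Fin k → ℂ => (y, (x : ℂ) + t * Complex.I))
        (g := fun p : (Fin k → ℂ) × ℂ => G (pt p.1 p.2)) s
        (hG.differentiableAt_pt (hs' s hs) (by simpa using hx)) (by fun_prop)
    · refine DifferentiableAt.comp (g := fun u : ℂ => u⁻¹) s (differentiableAt_inv hne) ?_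
      refine differentiableAt_prod _ fun J _ => ?_
      unfold poleAt
      fun_prop
  · refine ⟨1, one_pos, fun t => C * (1 + (‖s₀‖ + 1)) ^ A * X ^ x * (1 + t ^ 2)⁻¹,
      integrable_inv_one_add_sq.const_mul _, fun s hs hsU t => ?_⟩
    refine (hCA X hX s (fun j => (hsU j).le) (hJ s hsU) t).trans ?_
    have h4 : ‖s‖ ≤ ‖s₀‖ + ‖s - s₀‖ := norm_le_norm_add_norm_sub' _ _
    have h5 := mem_ball_iff_norm.1 hs
    have h6 : ‖s‖ ≤ ‖s₀‖ + 1 := by linarith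
    beta_reduce
    gcongr

end RecipeFunction

/-! ### The smoothed moment as a Mellin integral of the series. -/

section MomentMellin

variable {k M : ℕ}

theorem integrable_mellin_vertical {g : ℝ → ℂ} (hg : ContDiff ℝ ∞ g) (hc : HasCompactSupport g)
    {x : ℝ} (hx : 0 < x) : Integrable fun t : ℝ => mellin g (x + t * Complex.I) := by
  obtain ⟨D, hD⟩ := exists_norm_mellin_mul_pow_le 2 hg hc hx x
  refine (integrable_inv_one_add_sq.const_mul D).mono' ?_ (Eventually.of_forall fun t => ?_)
  · refine Continuous.aestronglyMeasurable (continuous_iff_continuousAt.2 fun t => ?_)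
    exact ContinuousAt.comp (g := mellin g) (f := fun t : ℝ => (x : ℂ) + t * Complex.I)
      (differentiableAt_mellin_of_hasCompactSupport hg.continuous hc (by
        simpa using hx)).continuousAt (by fun_prop)
  · have := hD (x + t * Complex.I) (by simp) (by simp)
    rw [← div_eq_mul_inv, le_div_iff₀ (by positivity)]
    refine le_trans ?_ this
    have him : ((x : ℂ) + t * Complex.I).im = t := by simp
    rw [him]
    gcongr
    nlinarith [sq_abs t, abs_nonneg t]

theorem integral_cpow_neg_mul_mellin {g : ℝ → ℂ} (hg : ContDiff ℝ ∞ g) (hc : HasCompactSupport g)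
    {x y : ℝ} (hx : 0 < x) (hy : 0 < y) :
    ∫ t : ℝ, (y : ℂ) ^ (-((x : ℂ) + t * Complex.I)) * mellin g (x + t * Complex.I) =
      2 * Real.pi * g y := by
  have h := mellinInv_mellin_eq x g hy (mellinConvergent_of_hasCompactSupport hg.continuous hc
    (by simpa using hx)) (integrable_mellin_vertical hg hc hx) hg.continuous.continuousAt
  rw [mellinInv] at h
  simp only [smul_eq_mul, Complex.real_smul] at h
  rw [← h, ← mul_assoc]
  push_cast
  rw [mul_one_div_cancel (by simp), one_mul]

/-- The moment as a contour integral of the multiple Dirichlet series. -/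
theorem moment_eq_integral {g : ℝ → ℂ} (hg : ContDiff ℝ ∞ g) (hc : HasCompactSupport g)
    {s : Fin k → ℂ} (hs : ∀ j, 1 / 4 ≤ (s j).re) {c X : ℝ} (hcc : (k : ℝ) + 1 < c) (hX : 0 < X) :
    2 * Real.pi * (moment M g X s - g (1 / X) * ∏ j, riemannZeta (s j)) =
      ∫ t : ℝ, starSeries M s (c + t * Complex.I) * mellin g (c + t * Complex.I) *
        (X : ℂ) ^ ((c : ℂ) + t * Complex.I) := by
  classical
  have hk : (0 : ℝ) ≤ k := Nat.cast_nonneg k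
  have hc0 : 0 < c := by linarith
  have hX0 : (X : ℂ) ≠ 0 := by exact_mod_cast hX.ne'
  obtain ⟨F, hF⟩ : ∃ F : fundDisc → ℝ → ℂ, F = fun d (t : ℝ) => starTerm M s (c + t * Complex.I) d *
    mellin g (c + t * Complex.I) * (X : ℂ) ^ ((c : ℂ) + t * Complex.I) := ⟨_, rfl⟩
  have hbound : ∀ d t, ‖F d t‖ ≤ (∏ j, 4 * ‖s j‖) * (1 / (((d : ℕ+) : ℕ) : ℝ) ^ (c - k)) *
      (‖mellin g (c + t * Complex.I)‖ * X ^ c) := by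
    intro d t
    rw [hF]
    simp only
    rw [norm_mul, norm_mul, Complex.norm_cpow_eq_rpow_re_of_pos hX, mul_assoc]
    have hre : ((c : ℂ) + t * Complex.I).re = c := by simp
    rw [hre]
    gcongr
    exact norm_starTerm_le_strip M hs (by simp) d
  have hInt : ∀ d, Integrable (F d) := by
    intro d
    refine (((integrable_mellin_vertical hg hc hc0).norm.mul_const (X ^ c)).const_mul
      ((∏ j, 4 * ‖s j‖) * (1 / (((d : ℕ+) : ℕ) : ℝ) ^ (c - k)))).mono' ?_
      (Eventually.of_forall (hbound d))
    rw [hF]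
    refine Continuous.aestronglyMeasurable (Continuous.mul (Continuous.mul ?_ ?_) ?_)
    · have h1 : Continuous fun t : ℝ => pt s ((c : ℂ) + t * Complex.I) :=
        differentiable_pt.continuous.comp
          (by fun_prop : Continuous fun t : ℝ => (s, (c : ℂ) + t * Complex.I))
      have h2 := (differentiable_starTerm (k := k) M d).continuous.comp h1
      simpa [Function.comp_def] using h2
    · refine continuous_iff_continuousAt.2 fun t => ?_
      exact ContinuousAt.comp (g := mellin g) (f := fun t : ℝ => (c : ℂ) + t * Complex.I)
        (differentiableAt_mellin_of_hasCompactSupport hg.continuous hc (by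
          simpa using hc0)).continuousAt (by fun_prop)
    · exact (by fun_prop : Continuous fun t : ℝ => (c : ℂ) + t * Complex.I).const_cpow (Or.inl hX0)
  have hsum : Summable fun d => ∫ t, ‖F d t‖ := by
    refine Summable.of_nonneg_of_le (fun d => integral_nonneg fun t => norm_nonneg _) (fun d => ?_)
      (((summable_fundDisc_rpow (b := c - k) (by linarith)).mul_left (∏ j, 4 * ‖s j‖)).mul_right
        (∫ t : ℝ, ‖mellin g (c + t * Complex.I)‖ * X ^ c))
    rw [← integral_const_mul]
    exact integral_mono (hInt d).norm (((integrable_mellin_vertical hg hc hc0).norm.mul_const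
      (X ^ c)).const_mul _) (hbound d)
  have hval : ∀ d, ∫ t, F d t = 2 * Real.pi * (if (d : ℕ+) = 1 then 0 else
      g (((d : ℕ+) : ℝ) / X) * ((kronecker (d : ℕ+) M : ℤ) : ℂ) * ∏ j, Lquad d (s j)) := by
    intro d
    rw [hF]
    by_cases hd : (d : ℕ+) = 1
    · simp [starTerm, hd]
    · have hdpos : (0 : ℝ) < ((d : ℕ+) : ℕ) := by exact_mod_cast (d : ℕ+).pos
      have h1 := integral_cpow_neg_mul_mellin hg hc hc0 (div_pos hdpos hX)
      rw [if_neg hd, mul_assoc (g _), ← mul_assoc (2 * (Real.pi : ℂ)), ← h1, ← integral_mul_const]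
      congr 1
      funext t
      simp only [starTerm, if_neg hd]
      rw [Complex.ofReal_div, Complex.ofReal_natCast,
        show (((d : ℕ+) : ℕ) : ℂ) / (X : ℂ) = ((((d : ℕ+) : ℕ) : ℝ) : ℂ) * ((X⁻¹ : ℝ) : ℂ) by
          push_cast; ring,
        Complex.mul_cpow_ofReal_nonneg hdpos.le (inv_nonneg.2 hX.le), Complex.cpow_neg,
        Complex.ofReal_inv, Complex.inv_cpow _ _ (by
          rw [Complex.arg_ofReal_of_nonneg hX.le]; exact Real.pi_pos.ne), Complex.cpow_neg, inv_inv,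
        Complex.ofReal_natCast]
      ring
  have hS := hasSum_integral_of_summable_integral_norm hInt hsum
  simp_rw [hval] at hS
  have hpi : (2 * (Real.pi : ℂ)) ≠ 0 := by
    simp [Real.pi_ne_zero]
  have hS2 := hS.div_const (2 * (Real.pi : ℂ))
  -- Restores the term of `d = 1`, which `starSeries` omits.
  have hS3 := hS2.add (hasSum_ite_eq (⟨1, one_mem_fundDisc⟩ : fundDisc)
    (g (1 / X) * ∏ j, riemannZeta (s j)))
  have hm : moment M g X s = (∫ t, ∑' d, F d t) / (2 * Real.pi) +
      g (1 / X) * ∏ j, riemannZeta (s j) := by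
    rw [moment, ← hS3.tsum_eq]
    congr 1
    funext d
    by_cases hd : (d : ℕ+) = 1
    · have hd' : d = ⟨1, one_mem_fundDisc⟩ := Subtype.ext hd
      rw [if_pos hd, if_pos hd', hd']
      simp [Lquad_one, kronecker_one_left]
    · have hd' : d ≠ ⟨1, one_mem_fundDisc⟩ := fun h => hd (congrArg Subtype.val h)
      rw [if_neg hd, if_neg hd']
      field_simp
      simp
  rw [hm, add_sub_cancel_right, mul_div_cancel₀ _ hpi]
  congr 1
  funext t
  rw [hF]
  simp only
  rw [tsum_mul_right, tsum_mul_right, starSeries]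

end MomentMellin

end QuadraticMoments

namespace QuadraticMoments

open MeasureTheory Filter Topology

/-! ### The recipe as a sum of residues, and the error term. -/

section Recipe

variable {k M : ℕ} {η : ℝ} {G : (Fin (k + 1) → ℂ) → ℂ} {D : (Fin k → ℂ) → ℂ}

/-- The contribution of the poles between the lines `Re w = b` and `Re w = c`. -/
noncomputable def recipeFun (G : (Fin (k + 1) → ℂ) → ℂ) (g : ℝ → ℂ) (b c X : ℝ)
    (s : Fin k → ℂ) : ℂ :=
  (2 * (Real.pi : ℂ))⁻¹ * (contourIntegral G g X c s - contourIntegral G g X b s)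

theorem recipeSum_eq (T : (Fin k → ℂ) → ℂ) (g : ℝ → ℂ) (X : ℝ) (s : Fin k → ℂ) :
    recipeSum T g X s = ∑ J : Finset (Fin k), (∏ j ∈ J, gammaRatio (s j)) *
      (X : ℂ) ^ poleAt s J * mellin g (poleAt s J) * T (reflect s J) := rfl

theorem reflect_re_gt {s : Fin k → ℂ} (hs : ∀ j, |(s j).re - 1 / 2| < η) (J : Finset (Fin k))
    (j : Fin k) : 1 / 2 - η < (reflect s J j).re := by
  have := abs_lt.1 (hs j)
  unfold reflect
  split_ifs
  · simp only [Complex.sub_re, Complex.one_re]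
    linarith
  · linarith

/-- For distinct `w_J` all poles are simple. At `w_J` the functional equation turns `G(s, w_J)` into
`∏_J 𝒳(s_j) G(s^J, 1)`, and `G(s^J, 1)` is `subsetSumProd (reflect s J)` times the continued
`T_M(s^J)`. The first of these factors is the denominator of the residue, so the `J`-th term of the
recipe remains. -/
theorem recipeFun_eq_of_injective (hM : M ≠ 0) (hG : IsClearedContinuation k M η G)
    (hD : DifferentiableOn ℂ D (diagRegion k))
    (hDe : ∀ s, (∀ j, 1 < (s j).re) → diagSeries M s * polarFactor s = D s)
    {g : ℝ → ℂ} (hg : ContDiff ℝ ∞ g) (hc : HasCompactSupport g) {ε b c X : ℝ} (hX : 0 < X)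
    {s : Fin k → ℂ} (hε : ε < η) (hs : ∀ j, |(s j).re - 1 / 2| ≤ ε) (hb : 1 - η < b)
    (hbJ : ∀ J, b < (poleAt s J).re) (hcJ : ∀ J, (poleAt s J).re < c)
    (hinj : Function.Injective (poleAt s))
    (hpol : ∀ J : Finset (Fin k), polarFactor (reflect s J) ≠ 0) :
    recipeFun G g b c X s = recipeSum (fun s => D s / polarFactor s) g X s := by
  have hη := hG.le
  have hs' : ∀ j, |(s j).re - 1 / 2| < η := fun j => (hs j).trans_lt hε
  have hs1 : ∀ j, 1 / 2 - η < (s j).re := fun j => by linarith [(abs_lt.1 (hs' j)).1]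
  have hX0 : (X : ℂ) ≠ 0 := by exact_mod_cast hX.ne'
  have key := integral_vertical_sub_div_prod (β := 1 - η) (γ := c + 1) (b := b) (c := c)
    (Q := fun w => G (pt s w) * mellin g w * (X : ℂ) ^ w) ?_ ?_ hinj hb hbJ hcJ (by linarith)
  · have hpi : (2 * (Real.pi : ℂ)) ≠ 0 := by simp [Real.pi_ne_zero]
    unfold recipeFun contourIntegral contourTerm
    rw [key, inv_mul_cancel_left₀ hpi, recipeSum_eq]
    refine Finset.sum_congr rfl fun J _ => ?_
    have hFE := hG.reflect hs' J (w := poleAt s J) (hb.trans (hbJ J)) (by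
      rw [sigmaJ_poleAt, Complex.one_re]
      linarith [hG.pos])
    rw [sigmaJ_poleAt] at hFE
    have h1 := hG.apply_one_mul_polarFactor hM hD hDe (reflect_re_gt hs' J)
    have hne : subsetSumProd (reflect s J) ≠ 0 := by
      rw [← prod_erase_poleAt_sub]
      refine Finset.prod_ne_zero_iff.2 fun J' hJ' => sub_ne_zero.2 fun h => ?_
      exact (Finset.ne_of_mem_erase hJ') (hinj h).symm
    have h2 : G (pt (reflect s J) 1) =
        subsetSumProd (reflect s J) * (D (reflect s J) / polarFactor (reflect s J)) := by
      rw [← mul_div_assoc, eq_div_iff (hpol J), h1]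
    rw [prod_erase_poleAt_sub, hFE, h2]
    field_simp
  · intro w hw
    have hw : 1 - η < w.re ∧ w.re < c + 1 := hw
    refine DifferentiableAt.differentiableWithinAt (DifferentiableAt.mul (DifferentiableAt.mul ?_ ?_)
      ?_)
    · exact DifferentiableAt.comp (f := fun u : ℂ => (s, u))
        (g := fun p : (Fin k → ℂ) × ℂ => G (pt p.1 p.2)) w
        (hG.differentiableAt_pt hs1 hw.1) (by fun_prop)
    · exact differentiableAt_mellin_of_hasCompactSupport hg.continuous hc (by linarith)
    · exact differentiableAt_id.const_cpow (Or.inl hX0)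
  · intro b' c' hb' _
    obtain ⟨C, hC, A, hCA⟩ := hG.exists_norm_mul_mellin_le (c := c') hg hc hε hb'
    refine ⟨C * (1 + ‖s‖) ^ A * (X ^ b' + X ^ c'), fun w h1 h2 => ?_⟩
    rw [norm_mul, Complex.norm_cpow_eq_rpow_re_of_pos hX]
    have h3 : X ^ w.re ≤ X ^ b' + X ^ c' := by
      have p1 := Real.rpow_nonneg hX.le b'
      have p2 := Real.rpow_nonneg hX.le c'
      rcases le_total 1 X with h | h
      · have := Real.rpow_le_rpow_of_exponent_le h h2
        linarith
      · have := Real.rpow_le_rpow_of_exponent_ge hX h h1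
        linarith
    calc _ ≤ (C * (1 + ‖s‖) ^ A * (1 + w.im ^ 2)⁻¹) * (X ^ b' + X ^ c') := by
          gcongr
          exact hCA s w hs h1 h2
      _ = _ := by ring

theorem continuousAt_gammaRatio {s : ℂ} (h0 : 0 < s.re) (h1 : s.re < 1) :
    ContinuousAt gammaRatio s := by
  have hG : ∀ z : ℂ, 0 < z.re → ContinuousAt Complex.Gamma z := fun z hz =>
    Complex.continuousAt_Gamma z fun m h => by
      have := congrArg Complex.re h
      simp at this
      have : (0 : ℝ) ≤ m := Nat.cast_nonneg m
      linarith
  have h2 : 0 < ((1 - s) / 2).re := by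
    rw [show (1 - s) / 2 = (1 - s) * ((1 / 2 : ℝ) : ℂ) by push_cast; ring, Complex.re_mul_ofReal]
    simp
    linarith
  have h3 : 0 < (s / 2).re := by
    rw [show s / 2 = s * ((1 / 2 : ℝ) : ℂ) by push_cast; ring, Complex.re_mul_ofReal]
    linarith
  have hpi : (Real.pi : ℂ) ≠ 0 := by simp [Real.pi_ne_zero]
  unfold gammaRatio
  refine ContinuousAt.div (ContinuousAt.mul ?_ ?_) ?_ (Complex.Gamma_ne_zero_of_re_pos h3)
  · exact ContinuousAt.const_cpow (by fun_prop) (Or.inl hpi)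
  · exact ContinuousAt.comp (f := fun s : ℂ => (1 - s) / 2) (hG _ h2) (by fun_prop)
  · exact ContinuousAt.comp (f := fun s : ℂ => s / 2) (hG _ h3) (by fun_prop)

theorem continuous_reflect (J : Finset (Fin k)) : Continuous fun s : Fin k → ℂ => reflect s J := by
  unfold reflect
  refine continuous_pi fun j => ?_
  split_ifs <;> fun_prop

theorem continuous_poleAt (J : Finset (Fin k)) : Continuous fun s : Fin k → ℂ => poleAt s J := by
  unfold poleAt
  fun_prop

theorem continuousAt_recipeSum (hη : η ≤ 1 / 8) (hD : DifferentiableOn ℂ D (diagRegion k))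
    {g : ℝ → ℂ} (hg : ContDiff ℝ ∞ g) (hc : HasCompactSupport g) {X : ℝ} (hX : 0 < X)
    {s : Fin k → ℂ} (hs : ∀ j, |(s j).re - 1 / 2| < η) (hJ : ∀ J, 0 < (poleAt s J).re)
    (hpol : ∀ J : Finset (Fin k), polarFactor (reflect s J) ≠ 0) :
    ContinuousAt (recipeSum (fun s => D s / polarFactor s) g X) s := by
  have hX0 : (X : ℂ) ≠ 0 := by exact_mod_cast hX.ne'
  rw [funext (recipeSum_eq (fun s => D s / polarFactor s) g X)]
  refine tendsto_finsetSum _ fun J _ => ?_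
  refine Tendsto.mul (Tendsto.mul (Tendsto.mul ?_ ?_) ?_) ?_
  · refine tendsto_finsetProd _ fun j _ => ?_
    have := abs_lt.1 (hs j)
    exact ContinuousAt.comp (f := fun s : Fin k → ℂ => s j)
      (continuousAt_gammaRatio (by linarith) (by linarith)) (continuous_apply j).continuousAt
  · exact ContinuousAt.const_cpow (continuous_poleAt J).continuousAt (Or.inl hX0)
  · exact ContinuousAt.comp (g := mellin g) (f := fun s : Fin k → ℂ => poleAt s J)
      (differentiableAt_mellin_of_hasCompactSupport hg.continuous hc (hJ J)).continuousAt
      (continuous_poleAt J).continuousAt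
  · refine ContinuousAt.div ?_ ?_ (hpol J)
    · have hmem : reflect s J ∈ diagRegion k := fun j => by
        have := reflect_re_gt hs J j
        linarith
      exact ContinuousAt.comp (f := fun s : Fin k → ℂ => reflect s J)
        (hD.differentiableAt ((isOpen_diagRegion k).mem_nhds hmem)).continuousAt
        (continuous_reflect J).continuousAt
    · exact (differentiable_polarFactor.continuous.comp (continuous_reflect J)).continuousAt

/-- Uniqueness of binary expansions: moving `s_j` with speed `2^j` gives every subset its own speed.
-/
theorem sum_two_pow_injective :
    Function.Injective fun J : Finset (Fin k) => ∑ j ∈ J, (2 : ℂ) ^ (j : ℕ) := by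
  intro J J' h
  have h1 : ∀ J : Finset (Fin k), ∑ j ∈ J, (2 : ℂ) ^ (j : ℕ) =
      ((∑ i ∈ J.map Fin.valEmbedding, 2 ^ i : ℕ) : ℂ) := fun J => by simp
  simp only [h1] at h
  exact Finset.map_injective _ (Finset.geomSum_injective le_rfl (by exact_mod_cast h))

/-- On a generic line through `s` the points `w_J` are distinct near `s`. -/
theorem eventually_injective_poleAt (s : Fin k → ℂ) :
    ∀ᶠ x : ℂ in 𝓝[≠] 0, Function.Injective (poleAt fun j => s j + x * 2 ^ (j : ℕ)) := by
  have hdiff : ∀ (x : ℂ) (J : Finset (Fin k)), poleAt (fun j => s j + x * 2 ^ (j : ℕ)) J =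
      poleAt s J - x * ∑ j ∈ J, (2 : ℂ) ^ (j : ℕ) := by
    intro x J
    unfold poleAt
    rw [Finset.sum_add_distrib, Finset.mul_sum]
    ring
  have hpair : ∀ p : Finset (Fin k) × Finset (Fin k), ∀ᶠ x : ℂ in 𝓝[≠] 0,
      poleAt (fun j => s j + x * 2 ^ (j : ℕ)) p.1 = poleAt (fun j => s j + x * 2 ^ (j : ℕ)) p.2 →
      p.1 = p.2 := by
    rintro ⟨J, J'⟩
    simp only [hdiff]
    -- Points that coincide at `x = 0` separate because their speeds differ; points that are
    -- distinct there stay distinct nearby.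
    by_cases h : poleAt s J = poleAt s J'
    · filter_upwards [self_mem_nhdsWithin] with x hx hxe
      rw [h] at hxe
      have hx : x ≠ 0 := hx
      exact sum_two_pow_injective (mul_left_cancel₀ hx (sub_right_injective hxe))
    · have hc : ContinuousAt (fun x : ℂ => (poleAt s J - x * ∑ j ∈ J, (2 : ℂ) ^ (j : ℕ)) -
          (poleAt s J' - x * ∑ j ∈ J', (2 : ℂ) ^ (j : ℕ))) 0 := by fun_prop
      have hne := hc.eventually_ne (y := 0) (by simpa using sub_ne_zero.2 h)
      filter_upwards [hne.filter_mono nhdsWithin_le_nhds] with x hx hxe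
      exact absurd (sub_eq_zero.2 hxe) hx
  filter_upwards [eventually_all.2 hpair] with x hx J J' h
  exact hx (J, J') h

/-- Parameters for the shift of contour: for `|Re s_j - 1/2| ≤ η/(4(k+1))` the points `w_J` lie
well between the lines `Re w = 1 - η/2` and `Re w = k + 2`. -/
theorem poleAt_re_bounds (hη0 : 0 < η) (hη : η ≤ 1 / 8) {s : Fin k → ℂ}
    (hs : ∀ j, |(s j).re - 1 / 2| ≤ η / (4 * (k + 1))) (J : Finset (Fin k)) :
    1 - η / 2 + η / 4 ≤ (poleAt s J).re ∧ (poleAt s J).re + η / 4 ≤ k + 2 := by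
  have hk : (0 : ℝ) ≤ k := Nat.cast_nonneg k
  have h1 := abs_poleAt_re_sub_one_le hs (by positivity) J
  have h2 : k * (η / (4 * (k + 1))) ≤ η / 4 := by
    rw [← mul_div_assoc, div_le_div_iff₀ (by positivity) (by positivity)]
    nlinarith
  have h3 := abs_le.1 (h1.trans h2)
  constructor <;> linarith

/-- All `w_J` keep distance at least `η/4` from both lines, so the integrals are holomorphic even
where the `w_J` collide. The cancellation of the poles in the recipe needs no separate argument. -/
theorem differentiableOn_recipeFun (hG : IsClearedContinuation k M η G)
    {g : ℝ → ℂ} (hg : ContDiff ℝ ∞ g) (hc : HasCompactSupport g) {X : ℝ} (hX : 0 < X) :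
    DifferentiableOn ℂ (recipeFun G g (1 - η / 2) (k + 2) X)
      {s | ∀ j, |(s j).re - 1 / 2| < η / (4 * (k + 1))} := by
  have hη0 := hG.pos
  have hη := hG.le
  have hk : (0 : ℝ) ≤ k := Nat.cast_nonneg k
  have hε : η / (4 * (k + 1)) < η := div_lt_self hη0 (by linarith)
  have hb := fun (s : Fin k → ℂ) (hs : ∀ j, |(s j).re - 1 / 2| < η / (4 * (k + 1))) =>
    poleAt_re_bounds hη0 hη fun j => (hs j).le
  refine ((differentiableOn_contourIntegral hG hg hc hX hε (by linarith) (ρ := η / 4)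
    (by linarith) fun s hs J => ?_).sub (differentiableOn_contourIntegral hG hg hc hX hε
    (by linarith) (ρ := η / 4) (by linarith) fun s hs J => ?_)).const_mul _
  · rw [le_abs]
    left
    linarith [(hb s hs J).2]
  · rw [le_abs]
    right
    linarith [(hb s hs J).1]

/-- Off the polar hyperplanes both sides are continuous at `s`. If some `w_J` coincide, `s` is
approached along a generic line on which they are distinct. -/
theorem recipeFun_eq_recipeSum (hM : M ≠ 0) (hG : IsClearedContinuation k M η G)
    (hD : DifferentiableOn ℂ D (diagRegion k))
    (hDe : ∀ s, (∀ j, 1 < (s j).re) → diagSeries M s * polarFactor s = D s)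
    {g : ℝ → ℂ} (hg : ContDiff ℝ ∞ g) (hc : HasCompactSupport g) {X : ℝ} (hX : 0 < X)
    {s : Fin k → ℂ} (hs : ∀ j, |(s j).re - 1 / 2| < η / (4 * (k + 1)))
    (hpol : ∀ J : Finset (Fin k), polarFactor (reflect s J) ≠ 0) :
    recipeFun G g (1 - η / 2) (k + 2) X s = recipeSum (fun s => D s / polarFactor s) g X s := by
  have hη0 := hG.pos
  have hη := hG.le
  have hk : (0 : ℝ) ≤ k := Nat.cast_nonneg k
  have hε : η / (4 * (k + 1)) < η := div_lt_self hη0 (by linarith)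
  obtain ⟨γ, hγ⟩ : ∃ γ : ℂ → Fin k → ℂ, γ = fun x j => s j + x * 2 ^ (j : ℕ) := ⟨_, rfl⟩
  have hγ0 : γ 0 = s := by rw [hγ]; simp
  have hγc : Continuous γ := by rw [hγ]; fun_prop
  have hopen := isOpen_halfStrip k (η / (4 * (k + 1)))
  have hmem : ∀ᶠ x in 𝓝 (0 : ℂ), γ x ∈ {s : Fin k → ℂ | ∀ j, |(s j).re - 1 / 2| < η / (4 * (k + 1))} :=
    hγc.continuousAt.eventually_mem (hopen.mem_nhds (by rw [hγ0]; exact hs))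
  have hpol' : ∀ᶠ x in 𝓝 (0 : ℂ), ∀ J : Finset (Fin k), polarFactor (reflect (γ x) J) ≠ 0 := by
    refine eventually_all.2 fun J => ?_
    have : Continuous fun x => polarFactor (reflect (γ x) J) :=
      differentiable_polarFactor.continuous.comp ((continuous_reflect J).comp hγc)
    exact this.continuousAt.eventually_ne (by rw [hγ0]; exact hpol J)
  have h1 : Tendsto (fun x => recipeFun G g (1 - η / 2) (k + 2) X (γ x)) (𝓝[≠] 0)
      (𝓝 (recipeFun G g (1 - η / 2) (k + 2) X s)) := by
    have h2 : ContinuousAt (recipeFun G g (1 - η / 2) (k + 2) X) (γ 0) := by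
      rw [hγ0]
      exact ((differentiableOn_recipeFun hG hg hc hX).differentiableAt
        (hopen.mem_nhds hs)).continuousAt
    have h3 := (h2.comp hγc.continuousAt).tendsto.mono_left
      (nhdsWithin_le_nhds (s := ({0}ᶜ : Set ℂ)))
    simpa only [Function.comp_def, hγ0] using h3
  have h2 : Tendsto (fun x => recipeSum (fun s => D s / polarFactor s) g X (γ x)) (𝓝[≠] 0)
      (𝓝 (recipeSum (fun s => D s / polarFactor s) g X s)) := by
    have h2 : ContinuousAt (recipeSum (fun s => D s / polarFactor s) g X) (γ 0) := by
      rw [hγ0]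
      refine continuousAt_recipeSum hη hD hg hc hX (fun j => (hs j).trans hε) (fun J => ?_) hpol
      linarith [(poleAt_re_bounds hη0 hη (fun j => (hs j).le) J).1]
    have h3 := (h2.comp hγc.continuousAt).tendsto.mono_left
      (nhdsWithin_le_nhds (s := ({0}ᶜ : Set ℂ)))
    simpa only [Function.comp_def, hγ0] using h3
  refine tendsto_nhds_unique h1 (h2.congr' ?_)
  filter_upwards [eventually_injective_poleAt s, hmem.filter_mono nhdsWithin_le_nhds,
    hpol'.filter_mono nhdsWithin_le_nhds] with x hx1 hx2 hx3
  have hJ := poleAt_re_bounds hη0 hη fun j => (hx2 j).le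
  refine (recipeFun_eq_of_injective hM hG hD hDe hg hc hX hε (fun j => (hx2 j).le) (by linarith)
    (fun J => by linarith [(hJ J).1]) (fun J => by linarith [(hJ J).2]) ?_ hx3).symm
  rw [hγ]
  exact hx1

/-- On `Re w = k + 2` the integrand is the series itself, so that line cancels; what remains is the
left line and the term of `d = 1`. -/
theorem moment_sub_recipeFun (hG : IsClearedContinuation k M η G)
    {g : ℝ → ℂ} (hg : ContDiff ℝ ∞ g) (hc : HasCompactSupport g) {X : ℝ} (hX : 0 < X)
    {s : Fin k → ℂ} (hs : ∀ j, |(s j).re - 1 / 2| < η / (4 * (k + 1))) :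
    moment M g X s - recipeFun G g (1 - η / 2) (k + 2) X s =
      g (1 / X) * ∏ j, riemannZeta (s j) +
        (2 * (Real.pi : ℂ))⁻¹ * contourIntegral G g X (1 - η / 2) s := by
  have hη0 := hG.pos
  have hη := hG.le
  have hk : (0 : ℝ) ≤ k := Nat.cast_nonneg k
  have hε : η / (4 * (k + 1)) < η := div_lt_self hη0 (by linarith)
  have hs1 : ∀ j, 1 / 2 - η < (s j).re := fun j => by linarith [(abs_lt.1 (hs j)).1]
  have hm := moment_eq_integral (M := M) hg hc (fun j => by linarith [hs1 j])
    (show (k : ℝ) + 1 < k + 2 by linarith) hX (s := s)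
  have hcI : contourIntegral G g X (k + 2) s = ∫ t : ℝ, starSeries M s ((k + 2 : ℝ) + t * Complex.I) *
      mellin g ((k + 2 : ℝ) + t * Complex.I) * (X : ℂ) ^ (((k + 2 : ℝ) : ℂ) + t * Complex.I) := by
    unfold contourIntegral
    congr 1
    funext t
    have hne : (∏ J : Finset (Fin k), (((k + 2 : ℝ) : ℂ) + t * Complex.I - poleAt s J)) ≠ 0 := by
      refine Finset.prod_ne_zero_iff.2 fun J _ h => ?_
      have h1 := congrArg Complex.re (sub_eq_zero.1 h)
      have h2 := (poleAt_re_bounds hη0 hη (fun j => (hs j).le) J).2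
      rw [← h1] at h2
      simp at h2
      linarith
    rw [contourTerm, hG.eq_strip s _ hs1 (by simp)]
    simp only [sigmaJ_sub_one]
    rw [div_eq_iff hne]
    ring
  rw [← hcI] at hm
  have hpi : (2 * (Real.pi : ℂ)) ≠ 0 := by simp [Real.pi_ne_zero]
  rw [recipeFun, ← hm, mul_sub, inv_mul_cancel_left₀ hpi]
  ring

theorem exists_norm_moment_sub_recipeFun_le (hG : IsClearedContinuation k M η G)
    {g : ℝ → ℂ} (hg : ContDiff ℝ ∞ g) (hc : HasCompactSupport g) (C B : ℝ) :
    ∃ K X₀ : ℝ, ∀ X : ℝ, X₀ ≤ X → ∀ s : Fin k → ℂ,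
      (∀ j, |(s j).re - 1 / 2| ≤ C / Real.log X ∧ |(s j).im| ≤ B) →
      ‖moment M g X s - recipeFun G g (1 - η / 2) (k + 2) X s‖ ≤ K * X ^ (1 - η / 2) := by
  have hη0 := hG.pos
  have hη := hG.le
  have hk : (0 : ℝ) ≤ k := Nat.cast_nonneg k
  have hε : η / (4 * (k + 1)) < η := div_lt_self hη0 (by linarith)
  have hε0 : 0 < η / (4 * (k + 1)) := by positivity
  -- For large `X` the window `C / log X` fits inside the strip of fixed width on which `recipeFun`
  -- is controlled. There `Re s_j` is bounded away from `1`, so the product of zeta values is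
  -- bounded.
  have hlim : Tendsto (fun X : ℝ => C / Real.log X) atTop (𝓝 0) :=
    tendsto_const_nhds.div_atTop Real.tendsto_log_atTop
  obtain ⟨X₁, hX₁⟩ := eventually_atTop.1 (hlim.eventually (gt_mem_nhds hε0))
  obtain ⟨Cg, hCg⟩ := hc.exists_bound_of_continuous hg.continuous
  have hcpt : IsCompact ((Set.Icc (1 / 2 - η) (1 / 2 + η)) ×ℂ (Set.Icc (-B) B)) :=
    isCompact_Icc.reProdIm isCompact_Icc
  obtain ⟨Z, hZ⟩ := hcpt.exists_bound_of_continuousOn (f := riemannZeta) (fun z hz => by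
    refine (differentiableAt_riemannZeta fun h => ?_).continuousAt.continuousWithinAt
    have := hz.1.2
    rw [h, Complex.one_re] at this
    linarith)
  obtain ⟨Cc, hCc, A, hCA⟩ := hG.exists_norm_contourTerm_le hg hc hε
    (show 1 - η < 1 - η / 2 by linarith) (show 0 < η / 4 by linarith)
  refine ⟨|Cg| * |Z| ^ k + (2 * Real.pi)⁻¹ * (Cc * (1 + (1 + |B|)) ^ A * Real.pi), max X₁ 1,
    fun X hX s hs => ?_⟩
  have hX1 : 1 ≤ X := (le_max_right _ _).trans hX
  have hX0 : 0 < X := by linarith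
  have hsmall := hX₁ X ((le_max_left _ _).trans hX)
  have hs' : ∀ j, |(s j).re - 1 / 2| < η / (4 * (k + 1)) := fun j => (hs j).1.trans_lt hsmall
  rw [moment_sub_recipeFun hG hg hc hX0 hs', add_mul]
  have hXp : 1 ≤ X ^ (1 - η / 2) := Real.one_le_rpow hX1 (by linarith)
  refine (norm_add_le _ _).trans (add_le_add ?_ ?_)
  · rw [norm_mul, norm_prod]
    have e1 : ∏ j, ‖riemannZeta (s j)‖ ≤ |Z| ^ k := by
      calc _ ≤ ∏ _j : Fin k, |Z| := Finset.prod_le_prod (fun _ _ => norm_nonneg _) fun j _ => by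
            have h1 := abs_lt.1 ((hs' j).trans hε)
            refine (hZ (s j) ⟨⟨?_, ?_⟩, abs_le.1 (hs j).2⟩).trans (le_abs_self Z)
            · linarith
            · linarith
        _ = _ := by simp
    have e2 : ‖g (1 / X)‖ ≤ |Cg| := (hCg _).trans (le_abs_self Cg)
    calc _ ≤ |Cg| * |Z| ^ k * 1 := by
          rw [mul_one]
          gcongr
      _ ≤ _ := by gcongr
  · rw [norm_mul, norm_inv, mul_assoc]
    have hn : ‖2 * (Real.pi : ℂ)‖ = 2 * Real.pi := by
      rw [norm_mul, Complex.norm_real, Real.norm_of_nonneg Real.pi_pos.le]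
      simp
    rw [hn]
    have hsn : ‖s‖ ≤ 1 + |B| := by
      refine (pi_norm_le_iff_of_nonneg (by positivity)).2 fun j => ?_
      have h1 := abs_lt.1 ((hs' j).trans hε)
      have h2 : |(s j).re| ≤ 1 := abs_le.2 ⟨by linarith, by linarith⟩
      have h3 := ((hs j).2).trans (le_abs_self B)
      linarith [Complex.norm_le_abs_re_add_abs_im (s j)]
    have hJ := poleAt_re_bounds hη0 hη fun j => (hs' j).le
    have hbd : ∀ t : ℝ, ‖contourTerm G g X s (((1 - η / 2 : ℝ) : ℂ) + t * Complex.I)‖ ≤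
        Cc * (1 + (1 + |B|)) ^ A * X ^ (1 - η / 2) * (1 + t ^ 2)⁻¹ := by
      intro t
      refine (hCA X hX0 s (fun j => (hs' j).le) (fun J => ?_) t).trans ?_
      · rw [le_abs]
        right
        linarith [(hJ J).1]
      · gcongr
    gcongr
    refine (norm_integral_le_of_norm_le (integrable_inv_one_add_sq.const_mul _)
      (Eventually.of_forall hbd)).trans (le_of_eq ?_)
    rw [integral_const_mul, integral_univ_inv_one_add_sq]
    ring

theorem polarFactor_ne_zero_of_one_lt {s : Fin k → ℂ} (hs : ∀ j, 1 < (s j).re) :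
    polarFactor s ≠ 0 := by
  refine Finset.prod_ne_zero_iff.2 fun i _ => Finset.prod_ne_zero_iff.2 fun j _ h => ?_
  have h1 := congrArg Complex.re h
  simp at h1
  linarith [hs i, hs j]

theorem IsClearedContinuation.recipeWithPowerSaving (hM : M ≠ 0)
    (hG : IsClearedContinuation k M η G) : RecipeWithPowerSaving k M := by
  have hη0 := hG.pos
  have hη := hG.le
  have hk : (0 : ℝ) ≤ k := Nat.cast_nonneg k
  have hε : η / (4 * (k + 1)) < η := div_lt_self hη0 (by linarith)
  obtain ⟨D, hD, hDe⟩ := exists_diag_continuation k hM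
  -- The saving `η/2` is the abscissa of the left line. The width `η/(4(k+1))` lets the `k` shifts
  -- move a point `w_J` by at most `η/4`, half of the distance from `1` to that line.
  refine ⟨η / 2, by linarith, η / (4 * (k + 1)), by positivity, fun s => D s / polarFactor s,
    ⟨fun s hs => ?_, D, hD.mono fun s hs j => ?_, fun s _ _ => rfl⟩, fun g hg hc =>
    ⟨recipeFun G g (1 - η / 2) (k + 2), fun X hX => ⟨differentiableOn_recipeFun hG hg hc hX,
      fun s hs hpol => recipeFun_eq_recipeSum hM hG hD hDe hg hc hX hs hpol⟩,
      exists_norm_moment_sub_recipeFun_le hG hg hc⟩⟩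
  · beta_reduce
    rw [← hDe s hs, mul_div_cancel_right₀ _ (polarFactor_ne_zero_of_one_lt hs)]
  · have := hs j
    linarith

end Recipe

end QuadraticMoments

theorem mainTheorem1 (k M : ℕ) (hk : 0 < k) (hM : 0 < M)
    (hMDS : QuadraticMoments.MDSConjecture k M) :
    QuadraticMoments.RecipeWithPowerSaving k M := by
  obtain ⟨η, G, hG⟩ := hMDS.exists_isClearedContinuation
  exact hG.recipeWithPowerSaving hM.ne'
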